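/- \textbf{Setting.} Let $M$ be a compact oriented smooth $3$-manifold with boundary $\partial_1M=\partial M$ (and $\partial_2M=\emptyset$), let $\partial_1 M$ be oriented, and write $\iota\colon\partial_1M\to M$ for the inclusion. Let $C_{m,n}(M,\partial_1M)$ be the configuration space of $m$ points in $M$ and $n$ points in $\partial_1M$, and put $C_n(\partial_1M)=C_{0,n}(M,\partial_1M)$. Integrals over configuration spaces are taken over pairwise distinct points (the remaining strata have measure zero). Let $X$ be a smooth vector field on $M$ that is tangent to $\partial M$, and let $X^\partial$ be its restriction to $\partial_1M$. We also write $X$ and $X^\partial$ for the induced vector fields $(X,\dots,X)$, $(X^\partial,\dots,X^\partial)$ and $(X,\dots,X,X^\partial,\dots,X^\partial)$ on products of copies of $M$ and $\partial_1M$. \textbf{Data.} Let $t$ run through an open set $J\subseteq\mathbb R$. Let $\chi_b(t)\in\Omega^{d_b}(M)$, $b\in B$, be families of differential forms, smooth in $t$ and in the point (for instance representatives $\chi_i$, $\chi^i$ of bases of $H^\bullet(M,\partial_1M)$ and $H^\bullet(M)$). Let $\eta(t)$ be a $2$-form on $\{(x,y)\in M\times M: x\neq y\}$, smooth in $t$ and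 $(x,y)$ (for instance a propagator), such that in charts, and locally uniformly in $t$, the coefficients of $\eta(t)$, and of $L_Y\eta(t)$ for every smooth vector field $Y$ on $M$ tangent to $\partial M$, are $O(|x-y|^{-2})$ near the diagonal. (Smooth families of forms that extend smoothly to the compactified configuration space of two points have this property.) Suppose that for all $t\in J$ $$\dot\chi_b=L_X\chi_b\quad(b\in B),\qquad \dot\eta=L_X\eta .$$ \textbf{Effective action.} A \emph{Feynman tree} is a connected tree with $m$ bulk vertices, each with three half-edges, and $n$ boundary vertices, each with one half-edge. Each half-edge is either a leaf, labelled by some $b\in B$, or one end of an arrow; an arrow starts at a bulk vertex and ends at a bulk or boundary vertex. To such a tree belongs the form $\widehat\gamma$ on $C_{m,n}(M,\partial_1M)$ that is the product, in a chosen order, of the pullback of $\chi_b$ to vertex $v$ for each leaf at $v$ labelled $b$, and of the pullback of $\eta$ to the pair $(u,v)$ for each arrow from $u$ to $v$. Assume $\deg\widehat\gamma\ge 3m$ and put $$\gamma=\int_{\text{bulk vertices}}\widehat\gamma ,$$ the integral over $M^m$, a form of degree $\deg\widehat\gamma-3m$ on $C_n(\partial_1M)$. A term of the effective action consists of a Feynman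 tree, smooth forms $\mathbb A_1,\dots,\mathbb A_n$ on $\partial_1M$ (homogeneous components of the boundary fields, independent of $t$) such that $\deg\gamma+\sum_j\deg\mathbb A_j=2n$, and a coefficient $F$ in a real normed space $W$ that does not depend on $t$ (it stands for structure constants, coordinates of residual fields, signs and symmetry factors). The effective action of a finite family of terms is $$S^{\mathrm{eff}}(t)=\sum F\int_{C_{m,n}(M,\partial_1M)}\widehat\gamma(t)\,\pi_1^*\mathbb A_1\cdots\pi_n^*\mathbb A_n\in W .$$ \textbf{Proposition.} For all $t\in J$: \begin{enumerate} \item For each term, $\gamma(t)$ is a well-defined differential form of class $C^1$ on $C_n(\partial_1M)$. Moreover, pointwise on $C_n(\partial_1M)$ and with absolutely convergent integrals over the bulk vertices, $$\frac{d}{dt}\gamma=L_{X^\partial}\gamma=\int_{\text{bulk vertices}}L_X\widehat\gamma .$$ That is, the Lie derivative passes through integration over the bulk vertices. \item The integrals in the definition of $S^{\mathrm{eff}}$ converge absolutely, and $$S^{\mathrm{eff}}=\sum F\int_{C_n(\partial_1M)}\gamma\,\pi_1^*\mathbb A_1\cdots\pi_n^*\mathbb A_n ,$$ also with absolutely convergent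 integrals. \item For each term, with an absolutely convergent integral on the right, $$\frac{d}{dt}\int_{C_n(\partial_1M)}\gamma\,\pi_1^*\mathbb A_1\cdots\pi_n^*\mathbb A_n=\int_{C_n(\partial_1M)}(L_{X^\partial}\gamma)\,\pi_1^*\mathbb A_1\cdots\pi_n^*\mathbb A_n .$$ Hence $$\frac{d}{dt}S^{\mathrm{eff}}=\sum F\int_{C_n(\partial_1M)}(L_{X^\partial}\gamma)\,\pi_1^*\mathbb A_1\cdots\pi_n^*\mathbb A_n .$$ \end{enumerate} -/

import Mathlib

open scoped Manifold ContDiff Topology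
open MeasureTheory

noncomputable section

namespace ChangeOfData

/-! ### Differential forms on manifolds (possibly with boundary or corners) -/

section Forms

variable {E : Type*} [NormedAddCommGroup E] [NormedSpace ℝ E] {H : Type*} [TopologicalSpace H]
  (I : ModelWithCorners ℝ E H) (P : Type*) [TopologicalSpace P] [ChartedSpace H P]

/-- Not necessarily continuous families of scalar functions of `k` tangent vectors.  The predicates
`IsFormOn` and `IsSmoothFamilyOn` below single out the differential forms. -/
abbrev PreForm (k : ℕ) : Type _ := ∀ x : P, (Fin k → TangentSpace I x) → ℝ

variable {I P}

/-- The coordinate expression of `θ` in the chart at `c`, i.e. the pullback of `θ` under the inverse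
chart, evaluated at the point `y` of the model space on the (constant) vectors `v`. -/
def formInChart {k : ℕ} (θ : PreForm I P k) (c : P) (y : E) (v : Fin k → E) : ℝ :=
  θ ((extChartAt I c).symm y) fun i =>
    mfderivWithin 𝓘(ℝ, E) I (extChartAt I c).symm (Set.range I) y (v i)

/-- The coordinate expression of the vector field `X` in the chart at `c`. -/
def vectorInChart (X : ∀ x : P, TangentSpace I x) (c : P) (y : E) : E :=
  mfderiv I 𝓘(ℝ, E) (extChartAt I c) ((extChartAt I c).symm y) (X ((extChartAt I c).symm y))

/-- The Lie derivative `L_X θ`, by its local formula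
`(L_X θ)(v₁, …, v_k) = D_X (θ(v₁, …, v_k)) + ∑ᵢ θ(v₁, …, D_{vᵢ} X, …, v_k)`
in the chart at the point in question, for vectors `vᵢ` that are constant in this chart. -/
def lieDeriv {k : ℕ} (X : ∀ x : P, TangentSpace I x) (θ : PreForm I P k) : PreForm I P k :=
  fun x v =>
    let y₀ : E := extChartAt I x x
    fderivWithin ℝ (fun y => formInChart θ x y v) (Set.range I) y₀ (vectorInChart X x y₀) +
      ∑ i : Fin k, formInChart θ x y₀
        (Function.update (fun j => (v j : E)) i
          (fderivWithin ℝ (vectorInChart X x) (Set.range I) y₀ (v i)))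

/-- `θ` is alternating multilinear at each point of `U`. -/
def IsAlternatingOn {k : ℕ} (θ : PreForm I P k) (U : Set P) : Prop :=
  ∀ x ∈ U, ∃ a : (TangentSpace I x) [⋀^Fin k]→ₗ[ℝ] ℝ, ∀ v, θ x v = a v

/-- `θ` restricts to a differential `k`-form of class `C^r` on the open set `U`. -/
structure IsFormOn (r : ℕ∞ω) {k : ℕ} (θ : PreForm I P k) (U : Set P) : Prop where
  alternating : IsAlternatingOn θ U
  contDiffOn : ∀ (c : P) (v : Fin k → E), ContDiffOn ℝ r (fun y => formInChart θ c y v)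
    ((extChartAt I c).target ∩ (extChartAt I c).symm ⁻¹' U)

/-- `(θ t)`, `t ∈ J`, is a family of differential `k`-forms on the open set `U` that is smooth in
`t` and the point jointly. -/
structure IsSmoothFamilyOn (J : Set ℝ) {k : ℕ} (θ : ℝ → PreForm I P k) (U : Set P) : Prop where
  alternating : ∀ t ∈ J, IsAlternatingOn (θ t) U
  contDiffOn : ∀ (c : P) (v : Fin k → E),
    ContDiffOn ℝ ∞ (fun z : ℝ × E => formInChart (θ z.1) c z.2 v)
      (J ×ˢ ((extChartAt I c).target ∩ (extChartAt I c).symm ⁻¹' U))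

variable (I) in
/-- Smooth vector fields. -/
def IsSmoothVectorField [IsManifold I 1 P] (X : ∀ x : P, TangentSpace I x) : Prop :=
  ContMDiff I I.tangent ∞ fun x => (⟨x, X x⟩ : TangentBundle I P)

end Forms

/-! ### Wedge products -/

section Wedge

variable {V : Type*}

/-- Wedge product of alternating functions of `p` and `q` vectors. -/
def wedge {p q K : ℕ} (h : p + q = K) (α : (Fin p → V) → ℝ) (β : (Fin q → V) → ℝ)
    (v : Fin K → V) : ℝ :=
  ((p.factorial * q.factorial : ℕ) : ℝ)⁻¹ * ∑ σ : Equiv.Perm (Fin K),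
    ((Equiv.Perm.sign σ : ℤ) : ℝ) *
      (α (fun a => v (σ (Fin.cast h (Fin.castAdd q a)))) *
        β (fun b => v (σ (Fin.cast h (Fin.natAdd p b)))))

/-- The wedge product `α₁ ∧ … ∧ α_s` of a finite sequence of alternating functions. -/
def wedgeFam {s K : ℕ} {d : Fin s → ℕ} (h : ∑ i, d i = K) (α : ∀ i, (Fin (d i) → V) → ℝ)
    (v : Fin K → V) : ℝ :=
  ((∏ i, (d i).factorial : ℕ) : ℝ)⁻¹ * ∑ σ : Equiv.Perm (Fin K),
    ((Equiv.Perm.sign σ : ℤ) : ℝ) *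
      ∏ i, α i (fun a => v (σ (Fin.cast h (finSigmaFinEquiv ⟨i, a⟩))))

end Wedge

/-! ### Integration -/

section Integration

variable {d : ℕ} {H : Type*} [TopologicalSpace H]
  {I : ModelWithCorners ℝ (EuclideanSpace ℝ (Fin d)) H}
  {P : Type*} [TopologicalSpace P] [ChartedSpace H P]

variable (I) in
/-- The frame of the tangent space at `x` given by the chart at `x`. -/
def frame (x : P) (a : Fin d) : TangentSpace I x :=
  (EuclideanSpace.single a (1 : ℝ) : EuclideanSpace ℝ (Fin d))

/-- A volume form: a smooth form of top degree without zeros.  It determines an orientation. -/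
structure IsVolumeForm (vol : PreForm I P d) : Prop where
  isFormOn : IsFormOn ∞ vol Set.univ
  ne_zero : ∀ x, vol x (frame I x) ≠ 0

variable (H P) in
theorem exists_chartCover [CompactSpace P] :
    ∃ s : Finset P, ⋃ c ∈ s, (chartAt H c).source = Set.univ := by
  obtain ⟨s, -, hs⟩ := isCompact_univ.elim_nhds_subcover (fun c : P => (chartAt H c).source)
    (fun c _ => chart_source_mem_nhds H c)
  exact ⟨s, Set.eq_univ_of_univ_subset hs⟩

variable (H P) in
/-- A finite set of points whose chart domains cover the compact manifold `P`. -/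
def chartCover [CompactSpace P] : Finset P := Classical.choose (exists_chartCover H P)

open Classical in
/-- The measure `|vol|` of a volume form `vol`: in each chart, its density is the absolute value of
the coefficient of `vol`.  It is put together from finitely many charts; the contribution of each
point is divided by the number of the chart domains in the cover that contain this point. -/
def volumeMeasure [CompactSpace P] [MeasurableSpace P] (vol : PreForm I P d) : Measure P :=
  ∑ c ∈ chartCover H P, Measure.map (extChartAt I c).symm
    ((volume.restrict (extChartAt I c).target).withDensity fun y =>
      ENNReal.ofReal (|formInChart vol c y fun a => EuclideanSpace.single a (1 : ℝ)| /
        ((chartCover H P).filter fun c' =>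
          (extChartAt I c).symm y ∈ (chartAt H c').source).card))

end Integration

/-! ### Configurations of `m` points of `M` and `n` points of `N = ∂M` -/

/-- Model of `M × ⋯ × M` (`m` factors). -/
abbrev bulkModel (m : ℕ) := ModelWithCorners.pi fun _ : Fin m => 𝓡∂ 3

/-- Model of `N × ⋯ × N` (`n` factors). -/
abbrev bdryModel (n : ℕ) := ModelWithCorners.pi fun _ : Fin n => 𝓡 2

/-- Model of `M^m × N^n`. -/
abbrev confModel (m n : ℕ) := (bulkModel m).prod (bdryModel n)

/-- Model of `M × M`. -/
abbrev pairModel := (𝓡∂ 3).prod (𝓡∂ 3)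

section Configurations

variable {M : Type*} [TopologicalSpace M] [ChartedSpace (EuclideanHalfSpace 3) M]
  {N : Type*} [TopologicalSpace N] [ChartedSpace (EuclideanSpace ℝ (Fin 2)) N]

variable (N) in
/-- The open configuration space of `n` distinct points of `N`, inside `N^n`. -/
def confSpace (n : ℕ) : Set (Fin n → N) := {y | Function.Injective y}

variable (M) in
/-- The open configuration space of two distinct points of `M`, inside `M × M`. -/
def pairSpace : Set (M × M) := {p | p.1 ≠ p.2}

/-- `ι : N → M` exhibits the surface `N` as the boundary of `M`. -/
structure IsBoundaryInclusion (ι : N → M) : Prop where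
  contMDiff : ContMDiff (𝓡 2) (𝓡∂ 3) ∞ ι
  isEmbedding : Topology.IsEmbedding ι
  immersive : ∀ y, Function.Injective (mfderiv (𝓡 2) (𝓡∂ 3) ι y)
  range_eq : Set.range ι = (𝓡∂ 3).boundary M

/-- `X` is tangent to the boundary and its restriction to the boundary is the vector field `X'`. -/
def RestrictsTo (ι : N → M) (X : ∀ x : M, TangentSpace (𝓡∂ 3) x)
    (X' : ∀ y : N, TangentSpace (𝓡 2) y) : Prop :=
  ∀ y, mfderiv (𝓡 2) (𝓡∂ 3) ι y (X' y) = X (ι y)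

/-- The vector field `(X, X)` on `M × M`. -/
def pairField (X : ∀ x : M, TangentSpace (𝓡∂ 3) x) : ∀ p : M × M, TangentSpace pairModel p :=
  fun p => ((X p.1 : EuclideanSpace ℝ (Fin 3)), (X p.2 : EuclideanSpace ℝ (Fin 3)))

/-- The vector field `(X', …, X')` on `N^n`. -/
def bdryField (X' : ∀ y : N, TangentSpace (𝓡 2) y) (n : ℕ) :
    ∀ y : Fin n → N, TangentSpace (bdryModel n) y :=
  fun y j => (X' (y j) : EuclideanSpace ℝ (Fin 2))

/-- The vector field `(X, …, X, X', …, X')` on `M^m × N^n`. -/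
def confField (X : ∀ x : M, TangentSpace (𝓡∂ 3) x) (X' : ∀ y : N, TangentSpace (𝓡 2) y)
    (m n : ℕ) : ∀ p : (Fin m → M) × (Fin n → N), TangentSpace (confModel m n) p :=
  fun p => ((fun i => (X (p.1 i) : EuclideanSpace ℝ (Fin 3))),
    (fun j => (X' (p.2 j) : EuclideanSpace ℝ (Fin 2))))

/-! ### Regularity of propagators -/

/-- In every chart of `M`, and locally uniformly in `t ∈ J`, the coefficients of the forms `θ t` are
`O(|x - y|⁻²)` near the diagonal. -/
def HasDiagonalBound (J : Set ℝ) (θ : ℝ → PreForm pairModel (M × M) 2) : Prop :=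
  ∀ (c : M) (T : Set ℝ) (K : Set (EuclideanSpace ℝ (Fin 3))), IsCompact T → T ⊆ J →
    IsCompact K → K ⊆ (extChartAt (𝓡∂ 3) c).target →
    ∃ C : ℝ, ∀ t ∈ T, ∀ y ∈ K, ∀ y' ∈ K, y ≠ y' →
      ∀ v : Fin 2 → EuclideanSpace ℝ (Fin 3) × EuclideanSpace ℝ (Fin 3),
        |formInChart (θ t) (c, c) (y, y') v| ≤ C * (‖y - y'‖ ^ 2)⁻¹ * (‖v 0‖ * ‖v 1‖)

/-- The regularity of a smooth family `(η t)`, `t ∈ J`, of propagators: a family of `2`-forms on the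
configuration space of two points of `M`, smooth up to the boundary of `M`, whose singularity at the
diagonal is as mild as that of a form on the compactified configuration space: `η` and its Lie
derivatives `L_Y η` along the vector fields `Y` on `M` that are tangent to `∂M` are `O(|x - y|⁻²)`.
(If `η` extends smoothly to the compactification, then so does `L_Y η`, because the fields `(Y, Y)`
lift; and the coefficients of a `2`-form that extends are `O(|x - y|⁻²)`.)  The differential, the
normalisation and the boundary values of a propagator are not restricted. -/
structure HasPropagatorRegularity [IsManifold (𝓡∂ 3) ∞ M] (ι : N → M) (J : Set ℝ) (η : ℝ → PreForm pairModel (M × M) 2) :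
    Prop where
  smooth : IsSmoothFamilyOn J η (pairSpace M)
  bound : HasDiagonalBound J η
  bound_lieDeriv : ∀ (Y : ∀ x : M, TangentSpace (𝓡∂ 3) x) (Y' : ∀ y : N, TangentSpace (𝓡 2) y),
    IsSmoothVectorField (𝓡∂ 3) Y → RestrictsTo ι Y Y' →
      HasDiagonalBound J fun t => lieDeriv (pairField Y) (η t)

/-! ### Integrals over configurations -/

/-- The frame of `M^m`, in the order of the points. -/
def bulkFrame {m : ℕ} (x : Fin m → M) (a : Fin (m * 3)) : TangentSpace (bulkModel m) x :=
  (Pi.single (finProdFinEquiv.symm a).1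
    (EuclideanSpace.single (finProdFinEquiv.symm a).2 (1 : ℝ)) :
      Fin m → EuclideanSpace ℝ (Fin 3))

/-- The frame of `N^n`, in the order of the points. -/
def bdryFrame {n : ℕ} (y : Fin n → N) (a : Fin (n * 2)) : TangentSpace (bdryModel n) y :=
  (Pi.single (finProdFinEquiv.symm a).1
    (EuclideanSpace.single (finProdFinEquiv.symm a).2 (1 : ℝ)) :
      Fin n → EuclideanSpace ℝ (Fin 2))

/-- `3m + k` vectors along `M^m × N^n`: first the frame of `M^m`, then the `k` vectors `w` along
`N^n`. -/
def bulkFrameAppend {m n k : ℕ} (x : Fin m → M) (y : Fin n → N)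
    (w : Fin k → TangentSpace (bdryModel n) y) :
    Fin (m * 3 + k) → TangentSpace (confModel m n) (x, y) :=
  Fin.append
    (fun a => ((bulkFrame x a : Fin m → EuclideanSpace ℝ (Fin 3)),
      (0 : Fin n → EuclideanSpace ℝ (Fin 2))))
    (fun a => ((0 : Fin m → EuclideanSpace ℝ (Fin 3)),
      (w a : Fin n → EuclideanSpace ℝ (Fin 2))))

variable (volM : PreForm (𝓡∂ 3) M 3) (volN : PreForm (𝓡 2) N 2)

/-- The value of `vol_M ∧ ⋯ ∧ vol_M` on the frame of `M^m`. -/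
def bulkVol {m : ℕ} (x : Fin m → M) : ℝ := ∏ i, volM (x i) (frame (𝓡∂ 3) (x i))

/-- The value of `vol_N ∧ ⋯ ∧ vol_N` on the frame of `N^n`. -/
def bdryVol {n : ℕ} (y : Fin n → N) : ℝ := ∏ j, volN (y j) (frame (𝓡 2) (y j))

variable [CompactSpace M] [MeasurableSpace M] [CompactSpace N] [MeasurableSpace N]

/-- The measure `|vol_M ∧ ⋯ ∧ vol_M|` on `M^m`. -/
def bulkMeasure (m : ℕ) : Measure (Fin m → M) := Measure.pi fun _ => volumeMeasure volM

/-- The measure `|vol_N ∧ ⋯ ∧ vol_N|` on `N^n`. -/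
def bdryMeasure (n : ℕ) : Measure (Fin n → N) := Measure.pi fun _ => volumeMeasure volN

/-- The density of a form `θ` of degree `3m + k` on `M^m × N^n` along the fibre `M^m`, evaluated on
the vectors `w` in the base. -/
def fibreDensity {m n k : ℕ} (θ : PreForm (confModel m n) ((Fin m → M) × (Fin n → N)) (m * 3 + k))
    (y : Fin n → N) (w : Fin k → TangentSpace (bdryModel n) y) (x : Fin m → M) : ℝ :=
  θ (x, y) (bulkFrameAppend x y w) / bulkVol volM x

/-- Integration of a form of degree `3m + k` on `C_{m,n}(M, N)` over the `m` bulk points, with the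
orientation given by `volM`; the result is a form of degree `k` on `C_n(N)`.  (Collisions of points
form a null set.) -/
def fibreIntegral {m n k : ℕ}
    (θ : PreForm (confModel m n) ((Fin m → M) × (Fin n → N)) (m * 3 + k)) :
    PreForm (bdryModel n) (Fin n → N) k :=
  fun y w => ∫ x, fibreDensity volM θ y w x ∂bulkMeasure volM m

/-- The density of a form of top degree on `C_n(N)`. -/
def bdryDensity {n : ℕ} (θ : PreForm (bdryModel n) (Fin n → N) (n * 2)) (y : Fin n → N) : ℝ :=
  θ y (bdryFrame y) / bdryVol volN y

/-- The integral of a form of top degree over `C_n(N)`, with the orientation given by `volN`. -/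
def bdryIntegral {n : ℕ} (θ : PreForm (bdryModel n) (Fin n → N) (n * 2)) : ℝ :=
  ∫ y, bdryDensity volN θ y ∂bdryMeasure volN n

/-- The density of a form of top degree on `C_{m,n}(M, N)`. -/
def confDensity {m n : ℕ}
    (θ : PreForm (confModel m n) ((Fin m → M) × (Fin n → N)) (m * 3 + n * 2))
    (p : (Fin m → M) × (Fin n → N)) : ℝ :=
  θ p (bulkFrameAppend p.1 p.2 (bdryFrame p.2)) / (bulkVol volM p.1 * bdryVol volN p.2)

/-- The measure `|vol|` on `M^m × N^n`. -/
def confMeasure (m n : ℕ) : Measure ((Fin m → M) × (Fin n → N)) :=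
  (bulkMeasure volM m).prod (bdryMeasure volN n)

/-- The integral of a form of top degree over `C_{m,n}(M, N)`, with the orientation given by `volM`
and `volN`. -/
def confIntegral {m n : ℕ}
    (θ : PreForm (confModel m n) ((Fin m → M) × (Fin n → N)) (m * 3 + n * 2)) : ℝ :=
  ∫ p, confDensity volM volN θ p ∂confMeasure volM volN m n

end Configurations

/-! ### Feynman trees and their integrands -/

/-- The factors of a Feynman integrand with `m` bulk and `n` boundary vertices: a leaf at the vertex
`w`, labelled by a cohomology representative `b`, or an arrow (propagator) from a bulk vertex `i` to a
vertex `w`. -/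
inductive Factor (B : Type*) (m n : ℕ)
  | leaf (w : Fin m ⊕ Fin n) (b : B)
  | arrow (i : Fin m) (w : Fin m ⊕ Fin n)

namespace Factor

variable {B : Type*} {m n : ℕ}

/-- The number of half-edges of the factor at the vertex `u`. -/
def halfEdges (u : Fin m ⊕ Fin n) : Factor B m n → ℕ
  | leaf w _ => if w = u then 1 else 0
  | arrow i w => (if Sum.inl i = u then 1 else 0) + (if w = u then 1 else 0)

/-- `1` for an arrow, `0` for a leaf. -/
def arrowCount : Factor B m n → ℕ
  | leaf _ _ => 0
  | arrow _ _ => 1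

/-- The factor is an arrow from `u` to `u'`. -/
def Joins (u u' : Fin m ⊕ Fin n) : Factor B m n → Prop
  | leaf _ _ => False
  | arrow i w => Sum.inl i = u ∧ w = u'

/-- The degree of the factor as a differential form. -/
def deg (dχ : B → ℕ) : Factor B m n → ℕ
  | leaf _ b => dχ b
  | arrow _ _ => 2

end Factor

/-- A connected tree diagram with its half-edges decorated: every bulk vertex (interaction vertex) has
three half-edges, each of which is a leaf or belongs to an arrow; every boundary vertex carries one
boundary field `𝔸` and one further half-edge, namely an arrowhead or a leaf.  The leaves and arrows
are listed in the order in which their forms are multiplied. -/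
structure FeynmanTree (B : Type*) where
  /-- number of bulk vertices -/
  m : ℕ
  /-- number of boundary vertices -/
  n : ℕ
  /-- number of leaves and arrows -/
  s : ℕ
  /-- the leaves and arrows -/
  factor : Fin s → Factor B m n
  bulk_valence : ∀ i : Fin m, ∑ f, (factor f).halfEdges (Sum.inl i) = 3
  bdry_valence : ∀ j : Fin n, ∑ f, (factor f).halfEdges (Sum.inr j) = 1
  connected : (SimpleGraph.fromRel fun u u' => ∃ f, (factor f).Joins u u').Connected
  tree : ∑ f, (factor f).arrowCount + 1 = m + n

section Integrands

variable {M : Type*} [TopologicalSpace M] [ChartedSpace (EuclideanHalfSpace 3) M]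
  {N : Type*} [TopologicalSpace N] [ChartedSpace (EuclideanSpace ℝ (Fin 2)) N]

/-- The position in `M` of the vertex `w`. -/
def pos {m n : ℕ} (ι : N → M) (p : (Fin m → M) × (Fin n → N)) : Fin m ⊕ Fin n → M
  | Sum.inl i => p.1 i
  | Sum.inr j => ι (p.2 j)

/-- The differential of the position of the vertex `w`. -/
def vel {m n : ℕ} (ι : N → M) (p : (Fin m → M) × (Fin n → N)) (w : Fin m ⊕ Fin n)
    (v : TangentSpace (confModel m n) p) : TangentSpace (𝓡∂ 3) (pos ι p w) :=
  match w with
  | Sum.inl i => (v : (Fin m → EuclideanSpace ℝ (Fin 3)) × (Fin n → EuclideanSpace ℝ (Fin 2))).1 i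
  | Sum.inr j => mfderiv (𝓡 2) (𝓡∂ 3) ι (p.2 j)
      ((v : (Fin m → EuclideanSpace ℝ (Fin 3)) × (Fin n → EuclideanSpace ℝ (Fin 2))).2 j)

variable {B : Type*} {dχ : B → ℕ}

/-- The form on `M^m × N^n` that belongs to a factor: the pullback of a cohomology representative
under the projection to a vertex, or of the propagator under the projection to a pair of vertices. -/
def factorForm (ι : N → M) (χ : ∀ b, PreForm (𝓡∂ 3) M (dχ b)) (η : PreForm pairModel (M × M) 2)
    {m n : ℕ} : (f : Factor B m n) →
      PreForm (confModel m n) ((Fin m → M) × (Fin n → N)) (f.deg dχ)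
  | .leaf w b => fun p v => χ b (pos ι p w) fun a => vel ι p w (v a)
  | .arrow i w => fun p v => η (pos ι p (Sum.inl i), pos ι p w) fun a =>
      ((vel ι p (Sum.inl i) (v a) : EuclideanSpace ℝ (Fin 3)),
        (vel ι p w (v a) : EuclideanSpace ℝ (Fin 3)))

/-- The integrand `γ̂` of a Feynman tree: the product of its background fields and propagators, a form
of degree `K` on `C_{m,n}(M, N)`. -/
def gammaHat (ι : N → M) (χ : ∀ b, PreForm (𝓡∂ 3) M (dχ b)) (η : PreForm pairModel (M × M) 2)
    (Γ : FeynmanTree B) {K : ℕ} (hK : ∑ f, (Γ.factor f).deg dχ = K) :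
    PreForm (confModel Γ.m Γ.n) ((Fin Γ.m → M) × (Fin Γ.n → N)) K :=
  fun p v => wedgeFam hK (fun f => factorForm ι χ η (Γ.factor f) p) v

/-- The form `π₁^*𝔸₁ ∧ … ∧ π_n^*𝔸_n` on `N^n`. -/
def bdryFields {n : ℕ} {p : Fin n → ℕ} (A : ∀ j, PreForm (𝓡 2) N (p j)) :
    PreForm (bdryModel n) (Fin n → N) (∑ j, p j) :=
  fun y v => wedgeFam rfl
    (fun j (u : Fin (p j) → TangentSpace (bdryModel n) y) => A j (y j) fun a =>
      (u a : Fin n → EuclideanSpace ℝ (Fin 2)) j) v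

/-- The form `γ ∧ π₁^*𝔸₁ ∧ … ∧ π_n^*𝔸_n` of top degree on `C_n(N)`. -/
def bdryIntegrand {n k : ℕ} {p : Fin n → ℕ} (h : k + ∑ j, p j = n * 2)
    (γ : PreForm (bdryModel n) (Fin n → N) k) (A : ∀ j, PreForm (𝓡 2) N (p j)) :
    PreForm (bdryModel n) (Fin n → N) (n * 2) :=
  fun y v => wedge h (γ y) (bdryFields A y) v

/-- The form `θ ∧ π₁^*𝔸₁ ∧ … ∧ π_n^*𝔸_n` of top degree on `C_{m,n}(M, N)`. -/
def confIntegrand {m n k : ℕ} {p : Fin n → ℕ} (h : k + ∑ j, p j = n * 2)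
    (θ : PreForm (confModel m n) ((Fin m → M) × (Fin n → N)) (m * 3 + k))
    (A : ∀ j, PreForm (𝓡 2) N (p j)) :
    PreForm (confModel m n) ((Fin m → M) × (Fin n → N)) (m * 3 + n * 2) :=
  fun x v => wedge (show m * 3 + k + ∑ j, p j = m * 3 + n * 2 by omega) (θ x)
    (fun u => bdryFields A x.2 fun a =>
      (u a : (Fin m → EuclideanSpace ℝ (Fin 3)) × (Fin n → EuclideanSpace ℝ (Fin 2))).2) v

/-- A term of the effective action: a decorated tree, homogeneous components `𝔸_j` of the boundary
fields at its boundary vertices, and a coefficient (a polynomial in the structure constants and in the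
coordinates of the residual fields, in general) in the vector space `W`.  Only terms whose
integrand has top degree are listed, the integrals of all others being zero by convention. -/
structure ActionTerm (B : Type*) (dχ : B → ℕ) (N : Type*) [TopologicalSpace N]
    [ChartedSpace (EuclideanSpace ℝ (Fin 2)) N] (W : Type*) extends FeynmanTree B where
  /-- the degree of `γ` -/
  k : ℕ
  deg_eq : ∑ f, (factor f).deg dχ = m * 3 + k
  /-- the degrees of the boundary fields -/
  p : Fin n → ℕ
  top_degree : k + ∑ j, p j = n * 2
  /-- the boundary fields -/
  A : ∀ j, PreForm (𝓡 2) N (p j)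
  smooth : ∀ j, IsFormOn ∞ (A j) Set.univ
  /-- the coefficient -/
  coeff : W

namespace ActionTerm

variable {W : Type*} (τ : ActionTerm B dχ N W) (ι : N → M) (χ : ∀ b, PreForm (𝓡∂ 3) M (dχ b))
  (η : PreForm pairModel (M × M) 2)

/-- The form `γ̂` on `C_{m,n}(M, ∂M)`. -/
def hatForm : PreForm (confModel τ.m τ.n) ((Fin τ.m → M) × (Fin τ.n → N)) (τ.m * 3 + τ.k) :=
  gammaHat ι χ η τ.toFeynmanTree τ.deg_eq

/-- The form `γ` on `C_n(∂M)`: the integral of `γ̂` over the bulk vertices. -/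
def form [CompactSpace M] [MeasurableSpace M] (volM : PreForm (𝓡∂ 3) M 3) :
    PreForm (bdryModel τ.n) (Fin τ.n → N) τ.k :=
  fibreIntegral volM (τ.hatForm ι χ η)

end ActionTerm

/-- The effective action with the terms `τ i`, according to the Feynman rules: the sum of the
integrals of `γ̂ ∧ π₁^*𝔸₁ ∧ … ∧ π_n^*𝔸_n` over all vertices, with coefficients. -/
def effectiveAction [CompactSpace M] [MeasurableSpace M] [CompactSpace N] [MeasurableSpace N]
    {W : Type*} [AddCommGroup W] [Module ℝ W]
    (volM : PreForm (𝓡∂ 3) M 3) (volN : PreForm (𝓡 2) N 2) {T : Type*} [Fintype T]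
    (τ : T → ActionTerm B dχ N W) (ι : N → M) (χ : ∀ b, PreForm (𝓡∂ 3) M (dχ b))
    (η : PreForm pairModel (M × M) 2) : W :=
  ∑ i, confIntegral volM volN
    (confIntegrand (τ i).top_degree ((τ i).hatForm ι χ η) (τ i).A) • (τ i).coeff

end Integrands

end ChangeOfData

end

open scoped Manifold ContDiff Topology
open MeasureTheory

noncomputable section

set_option linter.unusedSectionVars false

namespace ChangeOfData

open Set Filter Function

/-- The charts of a manifold. -/
notation "Φ" => extChartAt

/-- The model of a `3`-manifold with boundary. -/
notation "ℍ" => modelWithCornersEuclideanHalfSpace 3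

/-- The model of a surface. -/
notation "𝔹" => modelWithCornersSelf ℝ (EuclideanSpace ℝ (Fin 2))

/-- The models of `M^m`, `N^n` and `M^m × N^n`. -/
notation "ℳ" => bulkModel
notation "ℬ" => bdryModel
notation "ℭ" => confModel

abbrev VField {E : Type*} [NormedAddCommGroup E] [NormedSpace ℝ E] {H : Type*} [TopologicalSpace H]
    (I : ModelWithCorners ℝ E H) (P : Type*) [TopologicalSpace P] [ChartedSpace H P] :=
  ∀ x : P, TangentSpace I x

variable {E : Type*} [NormedAddCommGroup E] [NormedSpace ℝ E] {H : Type*} [TopologicalSpace H]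
  {I : ModelWithCorners ℝ E H} {P : Type*} [TopologicalSpace P] [ChartedSpace H P]
  {E' : Type*} [NormedAddCommGroup E'] [NormedSpace ℝ E'] {H' : Type*} [TopologicalSpace H']
  {I' : ModelWithCorners ℝ E' H'} {Q : Type*} [TopologicalSpace Q] [ChartedSpace H' Q]
  {F : Type*} [NormedAddCommGroup F] [NormedSpace ℝ F] {V : Type*} [AddCommGroup V] [Module ℝ V]
  {M : Type*} [TopologicalSpace M] [T2Space M] [CompactSpace M]
  [ChartedSpace (EuclideanHalfSpace 3) M] [IsManifold ℍ ∞ M]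
  {N : Type*} [TopologicalSpace N] [ChartedSpace (EuclideanSpace ℝ (Fin 2)) N] [IsManifold 𝔹 ∞ N]
  {k m n : ℕ} {ι : N → M} {f : P → Q} {c x : P} {y : E} {U : Set P} {a : (Fin k → V) → ℝ}
  {B : Type*} {J : Set ℝ}
variable {θ : PreForm I P k} {X : VField I P} {X' : VField I' Q}

/-! ### Alternating functions on finite-dimensional spaces -/

section Alternating

variable [FiniteDimensional ℝ E]

/-- A function of `k` vectors is alternating multilinear. -/
def IsAlt (a : (Fin k → V) → ℝ) : Prop := ∃ A : V [⋀^Fin k]→ₗ[ℝ] ℝ, ∀ v, a v = A v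

open Classical in
/-- The continuous alternating map given by an alternating function. -/
def bundleAlt (a : (Fin k → E) → ℝ) : E [⋀^Fin k]→L[ℝ] ℝ :=
  if h : ∃ A : E [⋀^Fin k]→L[ℝ] ℝ, ∀ v, a v = A v then h.choose else 0

theorem MultilinearMap.apply_eq_sum_basis {ι : Type*} [Fintype ι] (b : Module.Basis ι ℝ V)
    (A : MultilinearMap ℝ (fun _ : Fin k => V) ℝ) (v : Fin k → V) :
    A v = ∑ r : Fin k → ι, (∏ i, b.repr (v i) (r i)) * A fun i => b (r i) := by
  classical
  have h : v = fun i => ∑ j, b.repr (v i) j • b j := by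
    ext i; exact (b.sum_repr (v i)).symm
  conv_lhs => rw [h, MultilinearMap.map_sum]
  exact Finset.sum_congr rfl fun r _ => by rw [MultilinearMap.map_smul_univ]; rfl

theorem IsAlt.exists_continuous {a : (Fin k → E) → ℝ} (h : IsAlt a) :
    ∃ A : E [⋀^Fin k]→L[ℝ] ℝ, ∀ v, a v = A v := by
  obtain ⟨A, hA⟩ := h
  have hc : Continuous A := by
    let b := Module.finBasis ℝ E
    have : ⇑A = fun v : Fin k → E => ∑ r : Fin k → Fin (Module.finrank ℝ E),
        (∏ i, b.coord (r i) (v i)) * A fun i => b (r i) := by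
      ext v
      exact MultilinearMap.apply_eq_sum_basis b A.toMultilinearMap v
    rw [this]
    refine continuous_finsetSum _ fun r _ => (continuous_finsetProd _ fun i _ => ?_).mul
      continuous_const
    exact (b.coord (r i)).continuous_of_finiteDimensional.comp (continuous_apply i)
  exact ⟨{ A with cont := hc }, hA⟩

theorem IsAlt.bundleAlt_apply {a : (Fin k → E) → ℝ} (h : IsAlt a) (v : Fin k → E) :
    bundleAlt a v = a v := by
  have h' := h.exists_continuous
  rw [bundleAlt, dif_pos h']
  exact (h'.choose_spec v).symm

variable (E k) in
theorem exists_alt_coords : ∃ (r : ℕ) (u : Fin r → Fin k → E)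
    (L : (Fin r → ℝ) →L[ℝ] E [⋀^Fin k]→L[ℝ] ℝ),
    ∀ A : E [⋀^Fin k]→L[ℝ] ℝ, L (fun i => A (u i)) = A := by
  classical
  let b := Module.finBasis ℝ E
  let T := Fin k → Fin (Module.finrank ℝ E)
  let e : Fin (Fintype.card T) ≃ T := (Fintype.equivFin T).symm
  let ev : (E [⋀^Fin k]→L[ℝ] ℝ) →ₗ[ℝ] (Fin (Fintype.card T) → ℝ) :=
    { toFun := fun A i => A fun j => b (e i j)
      map_add' := fun _ _ => rfl
      map_smul' := fun _ _ => rfl }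
  have hinj : LinearMap.ker ev = ⊥ := by
    rw [LinearMap.ker_eq_bot']
    intro A hA
    apply ContinuousAlternatingMap.toAlternatingMap_injective
    apply AlternatingMap.coe_multilinearMap_injective
    refine Module.Basis.ext_multilinear (fun _ => b) fun v => ?_
    have := congrFun hA (e.symm v)
    simpa [ev] using this
  obtain ⟨L, hL⟩ := LinearMap.exists_leftInverse_of_injective ev hinj
  exact ⟨_, fun i j => b (e i j), L.toContinuousLinearMap, fun A => LinearMap.congr_fun hL A⟩

theorem differentiableWithinAt_bundleAlt {s : Set F} {x : F} {a : F → (Fin k → E) → ℝ} (hxs : x ∈ s)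
    (halt : ∀ᶠ y in 𝓝[s] x, IsAlt (a y)) (hd : ∀ v, DifferentiableWithinAt ℝ (fun y => a y v) s x) :
    DifferentiableWithinAt ℝ (fun y => bundleAlt (a y)) s x := by
  obtain ⟨r, u, L, hL⟩ := exists_alt_coords E k
  have h1 : DifferentiableWithinAt ℝ (fun y => L (fun i => a y (u i))) s x :=
    L.differentiableAt.comp_differentiableWithinAt x (differentiableWithinAt_pi.2 fun i => hd (u i))
  have h2 : ∀ᶠ y in 𝓝[s] x, bundleAlt (a y) = L (fun i => a y (u i)) := by
    filter_upwards [halt] with y hy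
    rw [← hL (bundleAlt (a y))]
    congr 1
    ext i
    exact hy.bundleAlt_apply _
  exact h1.congr_of_eventuallyEq h2 (h2.self_of_nhdsWithin hxs)

theorem IsAlt.comp_linearMap {W : Type*} [AddCommGroup W] [Module ℝ W] (h : IsAlt a)
    (L : W →ₗ[ℝ] V) : IsAlt fun w : Fin k → W => a fun i => L (w i) := by
  obtain ⟨A, hA⟩ := h
  exact ⟨A.compLinearMap L, fun v => by simp [hA]⟩

end Alternating

/-! ### The local formula for the Lie derivative -/

section LocLie

/-- The local formula for the Lie derivative of the family `Θ` of functions of `k` vectors along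
the vector field `Z`. -/
def locLie (s : Set E) (Z : E → E) (Θ : E → (Fin k → E) → ℝ) (y : E) (v : Fin k → E) : ℝ :=
  fderivWithin ℝ (fun y => Θ y v) s y (Z y) + ∑ i, Θ y (update v i (fderivWithin ℝ Z s y (v i)))

theorem locLie_congr {s : Set E} {Z Z₁ : E → E} {Θ Θ₁ : E → (Fin k → E) → ℝ} (hy : y ∈ s)
    (hZ : Z =ᶠ[𝓝[s] y] Z₁) (hΘ : ∀ᶠ y' in 𝓝[s] y, ∀ v, Θ y' v = Θ₁ y' v) (v : Fin k → E) :
    locLie s Z Θ y v = locLie s Z₁ Θ₁ y v := by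
  have h0 : (fun y' => Θ y' v) =ᶠ[𝓝[s] y] fun y' => Θ₁ y' v := by
    filter_upwards [hΘ] with y' h using h v
  have h1 := hΘ.self_of_nhdsWithin hy
  simp only [locLie]
  rw [h0.fderivWithin_eq (h1 v), hZ.fderivWithin_eq (hZ.self_of_nhdsWithin hy),
    hZ.self_of_nhdsWithin hy]
  simp only [h1]

variable [FiniteDimensional ℝ E']

theorem locLie_pullback {φ : E → E'} {s : Set E} {s' : Set E'} {Z : E → E} {Z' : E' → E'}
    {Θ : E → (Fin k → E) → ℝ} {Θ' : E' → (Fin k → E') → ℝ} (hs : UniqueDiffOn ℝ s) (hy : y ∈ s)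
    (hyc : y ∈ closure (interior s)) (hs' : UniqueDiffOn ℝ s') (hφ : ContDiffWithinAt ℝ 2 φ s y)
    (hmaps : ∀ᶠ y' in 𝓝[s] y, φ y' ∈ s') (halt : ∀ᶠ z in 𝓝[s'] (φ y), IsAlt (Θ' z))
    (hd : ∀ v, DifferentiableWithinAt ℝ (fun z => Θ' z v) s' (φ y))
    (hZ : DifferentiableWithinAt ℝ Z s y) (hZ' : DifferentiableWithinAt ℝ Z' s' (φ y))
    (hrel : ∀ᶠ y' in 𝓝[s] y, Z' (φ y') = fderivWithin ℝ φ s y' (Z y'))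
    (hΘ : ∀ᶠ y' in 𝓝[s] y, ∀ v, Θ y' v = Θ' (φ y') fun i => fderivWithin ℝ φ s y' (v i))
    (v : Fin k → E) :
    locLie s Z Θ y v = locLie s' Z' Θ' (φ y) fun i => fderivWithin ℝ φ s y (v i) := by
  have hφy : φ y ∈ s' := hmaps.self_of_nhdsWithin hy
  have hdφ : DifferentiableWithinAt ℝ φ s y := hφ.differentiableWithinAt (by norm_num)
  have hd2 : DifferentiableWithinAt ℝ (fderivWithin ℝ φ s) s y :=
    (hφ.fderivWithin_right (m := 1) hs (by norm_num) hy).differentiableWithinAt (by norm_num)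
  have htend : Tendsto φ (𝓝[s] y) (𝓝[s'] (φ y)) :=
    tendsto_nhdsWithin_iff.2 ⟨hdφ.continuousWithinAt, hmaps⟩
  have hsym : ∀ u w, fderivWithin ℝ (fderivWithin ℝ φ s) s y u w =
      fderivWithin ℝ (fderivWithin ℝ φ s) s y w u := by
    have := hφ.isSymmSndFDerivWithinAt (by simp) hs hyc hy
    exact fun u w => this.eq u w
  have hω := differentiableWithinAt_bundleAlt hφy halt hd
  have haltφ : ∀ᶠ y' in 𝓝[s] y, IsAlt (Θ' (φ y')) := htend.eventually halt
  have halty := halt.self_of_nhdsWithin hφy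
  set D := fderivWithin ℝ φ s y with hD
  -- the derivative of the coefficients of the pullback
  have key : fderivWithin ℝ (fun y' => Θ y' v) s y =
      fderivWithin ℝ (fun y' => bundleAlt (Θ' (φ y')) fun i => fderivWithin ℝ φ s y' (v i)) s y := by
    have : (fun y' => Θ y' v) =ᶠ[𝓝[s] y]
        fun y' => bundleAlt (Θ' (φ y')) fun i => fderivWithin ℝ φ s y' (v i) := by
      filter_upwards [hΘ, haltφ] with y' h h'
      rw [h v, h'.bundleAlt_apply]
    exact this.fderivWithin_eq (this.self_of_nhdsWithin hy)
  have hcomp : HasFDerivWithinAt (fun y' => bundleAlt (Θ' (φ y')))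
      ((fderivWithin ℝ (fun z => bundleAlt (Θ' z)) s' (φ y)).comp D) s y :=
    hω.hasFDerivWithinAt.comp_of_tendsto y hdφ.hasFDerivWithinAt htend
  rw [locLie, key, fderivWithin_continuousAlternatingMap_apply_apply
    (g := fun i y' => fderivWithin ℝ φ s y' (v i)) hcomp.differentiableWithinAt
    (fun i => hd2.clm_apply (differentiableWithinAt_const _)) (hs y hy), hcomp.fderivWithin (hs y hy),
    locLie]
  have h2 : ∀ w, fderivWithin ℝ (fun z => bundleAlt (Θ' z)) s' (φ y) w (fun i => D (v i)) =
      fderivWithin ℝ (fun z => Θ' z fun i => D (v i)) s' (φ y) w := by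
    intro w
    have h3 : (fun z => Θ' z fun i => D (v i)) =ᶠ[𝓝[s'] (φ y)]
        fun z => bundleAlt (Θ' z) fun i => D (v i) := by
      filter_upwards [halt] with z hz
      rw [hz.bundleAlt_apply]
    rw [h3.fderivWithin_eq (h3.self_of_nhdsWithin hφy)]
    have := hω.hasFDerivWithinAt.continuousAlternatingMap_apply_const (fun i => D (v i))
    rw [this.fderivWithin (hs' _ hφy)]
    rfl
  have hrely := hrel.self_of_nhdsWithin hy
  have hDZ : ∀ u, fderivWithin ℝ Z' s' (φ y) (D u) =
      fderivWithin ℝ (fderivWithin ℝ φ s) s y u (Z y) + D (fderivWithin ℝ Z s y u) := by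
    intro u
    have e1 : HasFDerivWithinAt (fun y' => Z' (φ y')) ((fderivWithin ℝ Z' s' (φ y)).comp D) s y :=
      hZ'.hasFDerivWithinAt.comp_of_tendsto y hdφ.hasFDerivWithinAt htend
    have e2 : HasFDerivWithinAt (fun y' => fderivWithin ℝ φ s y' (Z y')) _ s y :=
      hd2.hasFDerivWithinAt.clm_apply hZ.hasFDerivWithinAt
    have e3 : (fun y' => Z' (φ y')) =ᶠ[𝓝[s] y] fun y' => fderivWithin ℝ φ s y' (Z y') := hrel
    have e4 := (e2.congr_of_eventuallyEq e3 (e3.self_of_nhdsWithin hy)).fderivWithin (hs y hy)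
    rw [e1.fderivWithin (hs y hy)] at e4
    have := congrArg (fun T => T u) e4
    simp only [ContinuousLinearMap.comp_apply, add_apply, ContinuousLinearMap.flip_apply] at this
    rw [this, add_comm]
  rw [ContinuousLinearMap.comp_apply, h2, hrely, add_assoc, ← Finset.sum_add_distrib]
  congr 1
  refine Finset.sum_congr rfl fun i _ => ?_
  have e5 : fderivWithin ℝ (fun y' => fderivWithin ℝ φ s y' (v i)) s y (Z y) =
      fderivWithin ℝ (fderivWithin ℝ φ s) s y (Z y) (v i) := by
    have := hd2.hasFDerivWithinAt.clm_apply (hasFDerivWithinAt_const (v i) y s)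
    rw [this.fderivWithin (hs y hy)]
    simp
  rw [e5, hDZ, hsym (Z y), hΘ.self_of_nhdsWithin hy, halty.bundleAlt_apply]
  obtain ⟨A, hA⟩ := halty
  rw [hA, hA, hA, A.map_update_add]
  congr 2
  ext j
  by_cases h : j = i
  · subst h; simp [hD]
  · simp [h, hD]

end LocLie

/-! ### Coordinate expressions of forms and vector fields -/

section Charts

theorem target_subset (c : P) : (Φ I c).target ⊆ range I := extChartAt_target_subset_range c

/-- The value of a form, on vectors of the model space. -/
def PreForm.val (θ : PreForm I P k) (x : P) (v : Fin k → E) : ℝ := θ x v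

/-- The value of a vector field, in the model space. -/
def fieldVal (X : VField I P) (x : P) : E := X x

variable (I I') in
/-- The differential of a map, as a map of model spaces. -/
def mfd (f : P → Q) (x : P) : E →L[ℝ] E' := mfderiv I I' f x

variable (I) in
/-- The differential of the inverse chart at `c`. -/
def chartD (c : P) (y : E) : E →L[ℝ] E := mfderivWithin 𝓘(ℝ, E) I (Φ I c).symm (range I) y

variable (I I') in
/-- The coordinate expression of the map `f` in the charts at `c` and `c'`. -/
def coordRep (f : P → Q) (c : P) (c' : Q) (y : E) : E' := Φ I' c' (f ((Φ I c).symm y))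

theorem formInChart_eq (θ : PreForm I P k) (c : P) (y : E) (v : Fin k → E) :
    formInChart θ c y v = θ.val ((Φ I c).symm y) fun i => chartD I c y (v i) := rfl

theorem lieDeriv_eq_locLie (X : VField I P) (θ : PreForm I P k) (x : P) (v : Fin k → E) :
    (lieDeriv X θ).val x v =
      locLie (range I) (vectorInChart X x) (formInChart θ x) (Φ I x x) v := rfl

theorem isAlt_formInChart (h : IsAlternatingOn θ U) (hy : (Φ I c).symm y ∈ U) :
    IsAlt (formInChart θ c y) := by
  obtain ⟨A, hA⟩ := h _ hy
  let A' : E [⋀^Fin k]→ₗ[ℝ] ℝ := A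
  exact ⟨A'.compLinearMap (chartD I c y).toLinearMap, fun v => hA _⟩

variable [IsManifold I 1 P] [IsManifold I' 1 Q]

theorem chartD_self (c : P) : chartD I c (Φ I c c) = ContinuousLinearMap.id ℝ E :=
  mfderivWithin_range_extChartAt_symm

theorem formInChart_self (θ : PreForm I P k) (x : P) (v : Fin k → E) :
    formInChart θ x (Φ I x x) v = θ.val x v := by
  rw [formInChart_eq, chartD_self, extChartAt_to_inv]
  rfl

theorem chartD_mfderiv (hy : y ∈ (Φ I c).target) (v : E) :
    chartD I c y (mfd I 𝓘(ℝ, E) (Φ I c) ((Φ I c).symm y) v) = v := by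
  have := mfderivWithin_extChartAt_symm_comp_mfderiv_extChartAt (I := I) hy
  exact congrArg (fun T : E →L[ℝ] E => T v) this

theorem mfderiv_chartD (hy : y ∈ (Φ I c).target) (v : E) :
    mfd I 𝓘(ℝ, E) (Φ I c) ((Φ I c).symm y) (chartD I c y v) = v := by
  have := mfderiv_extChartAt_comp_mfderivWithin_extChartAt_symm (I := I) hy
  exact congrArg (fun T : E →L[ℝ] E => T v) this

theorem chartD_vectorInChart (X : VField I P) (hy : y ∈ (Φ I c).target) :
    chartD I c y (vectorInChart X c y) = fieldVal X ((Φ I c).symm y) :=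
  chartD_mfderiv hy _

theorem vectorInChart_self (X : VField I P) (x : P) :
    vectorInChart X x (Φ I x x) = fieldVal X x := by
  have h := chartD_vectorInChart X (mem_extChartAt_target (I := I) x)
  rwa [chartD_self, extChartAt_to_inv] at h

theorem uniqueDiffWithinAt_range (hy : y ∈ (Φ I c).target) : UniqueDiffWithinAt ℝ (range I) y :=
  I.uniqueDiffOn y (target_subset c hy)

theorem hasFDerivWithinAt_coordRep {c' : Q} (hf : MDifferentiableAt I I' f ((Φ I c).symm y))
    (hy : y ∈ (Φ I c).target) (hfy : f ((Φ I c).symm y) ∈ (Φ I' c').source) :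
    HasFDerivWithinAt (coordRep I I' f c c') ((mfd I' 𝓘(ℝ, E') (Φ I' c') (f ((Φ I c).symm y))).comp
        ((mfd I I' f ((Φ I c).symm y)).comp (chartD I c y)))
      (range I) y := by
  have h1 := (mdifferentiableWithinAt_extChartAt_symm hy).hasMFDerivWithinAt
  have h2 := hf.hasMFDerivAt
  have h3 := (mdifferentiableAt_extChartAt (I := I')
    (by rwa [extChartAt_source] at hfy)).hasMFDerivAt
  have h4 := HasMFDerivAt.comp_hasMFDerivWithinAt (f := f ∘ (Φ I c).symm) y h3
    (h2.comp_hasMFDerivWithinAt y h1)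
  exact h4.hasFDerivWithinAt

theorem fderivWithin_coordRep {c' : Q} (hf : MDifferentiableAt I I' f ((Φ I c).symm y))
    (hy : y ∈ (Φ I c).target) (hfy : f ((Φ I c).symm y) ∈ (Φ I' c').source) (v : E) :
    fderivWithin ℝ (coordRep I I' f c c') (range I) y v =
      mfd I' 𝓘(ℝ, E') (Φ I' c') (f ((Φ I c).symm y))
        (mfd I I' f ((Φ I c).symm y) (chartD I c y v)) := by
  rw [(hasFDerivWithinAt_coordRep hf hy hfy).fderivWithin (uniqueDiffWithinAt_range hy)]
  rfl

theorem chartD_fderivWithin_coordRep {c' : Q} (hf : MDifferentiableAt I I' f ((Φ I c).symm y))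
    (hy : y ∈ (Φ I c).target) (hfy : f ((Φ I c).symm y) ∈ (Φ I' c').source) (v : E) :
    chartD I' c' (coordRep I I' f c c' y) (fderivWithin ℝ (coordRep I I' f c c') (range I) y v) =
      mfd I I' f ((Φ I c).symm y) (chartD I c y v) := by
  rw [fderivWithin_coordRep hf hy hfy]
  have hy' : coordRep I I' f c c' y ∈ (Φ I' c').target := (Φ I' c').map_source hfy
  have := chartD_mfderiv hy' (mfd I I' f ((Φ I c).symm y) (chartD I c y v))
  rw [coordRep, (Φ I' c').left_inv hfy] at this
  exact this

theorem fderivWithin_coordRep_vector {c' : Q}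
    (hrel : ∀ x, mfd I I' f x (fieldVal X x) = fieldVal X' (f x))
    (hf : MDifferentiableAt I I' f ((Φ I c).symm y)) (hy : y ∈ (Φ I c).target)
    (hfy : f ((Φ I c).symm y) ∈ (Φ I' c').source) : vectorInChart X' c' (coordRep I I' f c c' y) =
      fderivWithin ℝ (coordRep I I' f c c') (range I) y (vectorInChart X c y) := by
  rw [fderivWithin_coordRep hf hy hfy, chartD_vectorInChart X hy, hrel]
  have : vectorInChart X' c' (coordRep I I' f c c' y) =
    mfd I' 𝓘(ℝ, E') (Φ I' c') ((Φ I' c').symm (coordRep I I' f c c' y))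
      (fieldVal X' ((Φ I' c').symm (coordRep I I' f c c' y))) := rfl
  rw [this, coordRep, (Φ I' c').left_inv hfy]

variable (I I') in
def pullForm (f : P → Q) (θ : PreForm I' Q k) : PreForm I P k :=
  fun x v => θ.val (f x) fun i => mfd I I' f x (v i)

theorem pullForm_val (f : P → Q) (θ : PreForm I' Q k) (x : P) (v : Fin k → E) :
    (pullForm I I' f θ).val x v = θ.val (f x) fun i => mfd I I' f x (v i) := rfl

variable (I) in
theorem mfd_id (x : P) : mfd I I (id : P → P) x = ContinuousLinearMap.id ℝ E := mfderiv_id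

theorem formInChart_pullForm {θ : PreForm I' Q k} {c' : Q}
    (hf : MDifferentiableAt I I' f ((Φ I c).symm y)) (hy : y ∈ (Φ I c).target)
    (hfy : f ((Φ I c).symm y) ∈ (Φ I' c').source) (v : Fin k → E) :
    formInChart (pullForm I I' f θ) c y v = formInChart θ c' (coordRep I I' f c c' y)
        fun i => fderivWithin ℝ (coordRep I I' f c c') (range I) y (v i) := by
  rw [formInChart_eq, formInChart_eq]
  simp only [chartD_fderivWithin_coordRep hf hy hfy]
  rw [coordRep, (Φ I' c').left_inv hfy]
  rfl

theorem pullForm_id (θ : PreForm I P k) : pullForm I I id θ = θ := by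
  funext x v
  change θ.val x (fun i => mfd I I id x (v i)) = θ.val x v
  rw [mfd_id]
  rfl

theorem eventually_mem_chart (hf : Continuous f) (hU : IsOpen U) {c' : Q} (hy : y ∈ (Φ I c).target)
    (hyU : (Φ I c).symm y ∈ U) (hfy : f ((Φ I c).symm y) ∈ (Φ I' c').source) :
    ∀ᶠ z in 𝓝[range I] y, z ∈ (Φ I c).target ∧ (Φ I c).symm z ∈ U ∧
      f ((Φ I c).symm z) ∈ (Φ I' c').source := by
  have h1 := extChartAt_target_mem_nhdsWithin_of_mem hy
  have h2 : ContinuousWithinAt (Φ I c).symm (range I) y :=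
    ((continuousOn_extChartAt_symm c) y hy).mono_of_mem_nhdsWithin h1
  have h3 : U ∩ f ⁻¹' (Φ I' c').source ∈ 𝓝 ((Φ I c).symm y) :=
    (hU.inter ((isOpen_extChartAt_source c').preimage hf)).mem_nhds ⟨hyU, hfy⟩
  filter_upwards [h1, h2 h3] with z hz hz'
  exact ⟨hz, hz'⟩

theorem eventually_mem_target (hU : IsOpen U) (hy : y ∈ (Φ I c).target) (hyU : (Φ I c).symm y ∈ U) :
    (Φ I c).target ∩ (Φ I c).symm ⁻¹' U ∈ 𝓝[range I] y := by
  filter_upwards [eventually_mem_chart continuous_id hU hy hyU ((Φ I c).map_target hy)]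
    with z hz using ⟨hz.1, hz.2.1⟩

theorem contDiffWithinAt_coordRep {n : ℕ∞ω} [IsManifold I n P] [IsManifold I' n Q]
    (hf : ContMDiff I I' n f) {c' : Q} (hy : y ∈ (Φ I c).target)
    (hfy : f ((Φ I c).symm y) ∈ (Φ I' c').source) :
    ContDiffWithinAt ℝ n (coordRep I I' f c c') (range I) y := by
  have h := (contMDiffAt_iff_of_mem_source (I := I) (I' := I') (x := c) (y := c')
    (x' := (Φ I c).symm y) (f := f) (n := n)
    (by have := (Φ I c).map_target hy; rwa [extChartAt_source] at this)
    (by rwa [extChartAt_source] at hfy)).1 (hf _)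
  have h2 := h.2
  rw [(Φ I c).right_inv hy] at h2
  exact h2

end Charts

section LieCharts

variable [IsManifold I ∞ P] [IsManifold I' ∞ Q]

/-- The vector field has coordinate expressions of class `C^∞`. -/
def IsChartSmooth (X : VField I P) : Prop :=
  ∀ c : P, ContDiffOn ℝ ∞ (vectorInChart X c) (Φ I c).target

theorem IsChartSmooth.contDiffWithinAt (hX : IsChartSmooth X) (hy : y ∈ (Φ I c).target) :
    ContDiffWithinAt ℝ ∞ (vectorInChart X c) (range I) y :=
  (hX c y hy).mono_of_mem_nhdsWithin (extChartAt_target_mem_nhdsWithin_of_mem hy)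

theorem IsFormOn.contDiffWithinAt {r : ℕ∞ω} (h : IsFormOn r θ U) (hU : IsOpen U)
    (hy : y ∈ (Φ I c).target) (hyU : (Φ I c).symm y ∈ U) (v : Fin k → E) :
    ContDiffWithinAt ℝ r (fun y => formInChart θ c y v) (range I) y := by
  exact (h.contDiffOn c v y ⟨hy, hyU⟩).mono_of_mem_nhdsWithin (eventually_mem_target hU hy hyU)

theorem mem_closure_interior_range (hy : y ∈ (Φ I c).target) : y ∈ closure (interior (range I)) :=
  I.range_subset_closure_interior (target_subset c hy)

variable [FiniteDimensional ℝ E'] in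
theorem locLie_formInChart_pullForm (hf : ContMDiff I I' ∞ f) {U : Set Q} (hU : IsOpen U)
    {θ : PreForm I' Q k} (hθ : IsFormOn 1 θ U) (hX : IsChartSmooth X) (hX' : IsChartSmooth X')
    (hrel : ∀ x, mfd I I' f x (fieldVal X x) = fieldVal X' (f x)) {c' : Q} (hy : y ∈ (Φ I c).target)
    (hyU : f ((Φ I c).symm y) ∈ U) (hfy : f ((Φ I c).symm y) ∈ (Φ I' c').source) (v : Fin k → E) :
    locLie (range I) (vectorInChart X c) (formInChart (pullForm I I' f θ) c) y v =
      locLie (range I') (vectorInChart X' c') (formInChart θ c') (coordRep I I' f c c' y)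
        fun i => fderivWithin ℝ (coordRep I I' f c c') (range I) y (v i) := by
  have hmd : ∀ x, MDifferentiableAt I I' f x := fun x => (hf x).mdifferentiableAt (by simp)
  have hev := eventually_mem_chart hf.continuous isOpen_univ hy (mem_univ _) hfy
  have hy' : coordRep I I' f c c' y ∈ (Φ I' c').target := (Φ I' c').map_source hfy
  have hyU' : (Φ I' c').symm (coordRep I I' f c c' y) ∈ U := by
    rwa [coordRep, (Φ I' c').left_inv hfy]
  apply locLie_pullback I.uniqueDiffOn (target_subset c hy)
    (mem_closure_interior_range hy) I'.uniqueDiffOn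
    ((contDiffWithinAt_coordRep hf hy hfy).of_le (WithTop.coe_le_coe.2 le_top))
  · filter_upwards [hev] with z hz
    exact target_subset c' ((Φ I' c').map_source hz.2.2)
  · filter_upwards [eventually_mem_target hU hy' hyU'] with z hz
    exact isAlt_formInChart hθ.alternating hz.2
  · exact fun w => (hθ.contDiffWithinAt hU hy' hyU' w).differentiableWithinAt (by simp)
  · exact (hX.contDiffWithinAt hy).differentiableWithinAt (by simp)
  · exact (hX'.contDiffWithinAt hy').differentiableWithinAt (by simp)
  · filter_upwards [hev] with z hz
    exact fderivWithin_coordRep_vector hrel (hmd _) hz.1 hz.2.2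
  · filter_upwards [hev] with z hz w
    exact formInChart_pullForm (hmd _) hz.1 hz.2.2 w

theorem lieDeriv_pullForm [FiniteDimensional ℝ E'] (hf : ContMDiff I I' ∞ f) {U : Set Q}
    (hU : IsOpen U) {θ : PreForm I' Q k} (hθ : IsFormOn 1 θ U) (hX : IsChartSmooth X)
    (hX' : IsChartSmooth X') (hrel : ∀ x, mfd I I' f x (fieldVal X x) = fieldVal X' (f x))
    (hx : f x ∈ U) (v : Fin k → E) :
    (lieDeriv X (pullForm I I' f θ)).val x v = (pullForm I I' f (lieDeriv X' θ)).val x v := by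
  have hx0 : (Φ I x).symm (Φ I x x) = x := extChartAt_to_inv x
  have hs : f ((Φ I x).symm (Φ I x x)) ∈ (Φ I' (f x)).source := by
    rw [hx0]; exact mem_extChartAt_source (f x)
  rw [lieDeriv_eq_locLie, locLie_formInChart_pullForm hf hU hθ hX hX' hrel
    (mem_extChartAt_target x) (by rwa [hx0]) hs, pullForm_val, lieDeriv_eq_locLie]
  have hc : coordRep I I' f x (f x) (Φ I x x) = Φ I' (f x) (f x) := by
    rw [coordRep, hx0]
  rw [hc]
  congr 1
  funext i
  have hmd : MDifferentiableAt I I' f x := (hf x).mdifferentiableAt (by simp)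
  rw [mfd, hmd.mfderiv]
  rfl

theorem formInChart_lieDeriv [FiniteDimensional ℝ E] (hU : IsOpen U) (hθ : IsFormOn 1 θ U)
    (hX : IsChartSmooth X) (hy : y ∈ (Φ I c).target) (hyU : (Φ I c).symm y ∈ U) (v : Fin k → E) :
    formInChart (lieDeriv X θ) c y v =
      locLie (range I) (vectorInChart X c) (formInChart θ c) y v := by
  set p := (Φ I c).symm y with hp
  have hps : p ∈ (Φ I p).source := mem_extChartAt_source p
  have h := locLie_formInChart_pullForm (f := id) (I := I) (I' := I) contMDiff_id hU hθ hX hX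
    (fun x => by rw [mfd_id]; rfl) (c' := p) hy hyU hps v
  rw [pullForm_id] at h
  rw [h, formInChart_eq, lieDeriv_eq_locLie]
  have hc : coordRep I I id c p y = Φ I p p := rfl
  rw [hc]
  congr 1
  funext i
  rw [fderivWithin_coordRep mdifferentiableAt_id hy hps, mfd_id]
  have : mfd I 𝓘(ℝ, E) (Φ I p) p = ContinuousLinearMap.id ℝ _ := mfderiv_extChartAt_self
  exact (congrArg (fun T : E →L[ℝ] E => T (chartD I c y (v i))) this).symm

theorem IsSmoothVectorField.isChartSmooth [IsManifold I 1 P] (hX : IsSmoothVectorField I X) :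
    IsChartSmooth X := by
  intro c
  have h1 : ContMDiffOn I 𝓘(ℝ, E) ∞ (fun x => mfderiv I 𝓘(ℝ, E) (Φ I c) x (X x))
      (chartAt H c).source := by
    intro x hx
    have h2 := (Bundle.Trivialization.contMDiffAt_iff (IB := I) (n := ∞) (IM := I)
      (e := trivializationAt E (TangentSpace I) c)
      (f := fun x => (⟨x, X x⟩ : TangentBundle I P)) (x₀ := x) (by simpa using hx)).1 (hX x)
    refine (h2.2.congr_of_eventuallyEq ?_).contMDiffWithinAt
    filter_upwards [(chartAt H c).open_source.mem_nhds hx] with z hz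
    have h4 := TangentBundle.continuousLinearMapAt_trivializationAt (I := I) hz
    have h5 := Bundle.Trivialization.coe_linearMapAt_of_mem (R := ℝ)
      (trivializationAt E (TangentSpace I) c) (b := z) (by simpa using hz)
    exact (congrArg (fun T : E →L[ℝ] E => T (fieldVal X z)) h4).symm.trans (congrFun h5 (X z))
  have h3 := h1.comp (contMDiffOn_extChartAt_symm (n := ∞) c) fun y hy => by
    have := (Φ I c).map_target hy
    rwa [extChartAt_source] at this
  exact h3.contDiffOn

end LieCharts

/-! ### Finite powers of manifolds -/

section Powers

variable (I : ModelWithCorners ℝ E H)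

abbrev powModel (m : ℕ) := ModelWithCorners.pi fun _ : Fin m => I

theorem extChartAt_pow_symm_apply (c : Fin m → P) (y : Fin m → E) (i : Fin m) :
    (Φ (powModel I m) c).symm y i = (Φ I (c i)).symm (y i) := rfl

theorem range_powModel : range (powModel I m) = {y | ∀ i, y i ∈ range I} := by
  ext y
  constructor
  · rintro ⟨x, rfl⟩ i
    exact ⟨x i, rfl⟩
  · intro h
    choose x hx using h
    exact ⟨x, funext hx⟩

theorem powChart_source (c : Fin m → P) :
    (Φ (powModel I m) c).source = {x | ∀ i, x i ∈ (Φ I (c i)).source} := by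
  rw [extChartAt_source]
  ext x
  simp only [extChartAt_source, mem_ofPred_eq]
  change x ∈ Set.pi univ (fun i => (chartAt H (c i)).source) ↔ _
  simp

theorem powChart_target (c : Fin m → P) :
    (Φ (powModel I m) c).target = {y | ∀ i, y i ∈ (Φ I (c i)).target} := by
  ext y
  rw [extChartAt_target]
  simp only [extChartAt_target, mem_ofPred_eq]
  rw [range_powModel]
  change ((fun i => I.symm (y i)) ∈ Set.pi univ (fun i => (chartAt H (c i)).target) ∧ _) ↔ _
  simp [forall_and]

instance isManifold_pow {n : ℕ∞ω} [IsManifold I n P] : IsManifold (powModel I m) n (Fin m → P) := by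
  apply isManifold_of_contDiffOn
  rintro _ _ ⟨e, he, rfl⟩ ⟨e', he', rfl⟩
  have he1 : ∀ i, e i ∈ atlas H P := fun i => he i (mem_univ i)
  have he1' : ∀ i, e' i ∈ atlas H P := fun i => he' i (mem_univ i)
  rw [contDiffOn_pi]
  intro i
  have h := (contDiffGroupoid n I).compatible (he1 i) (he1' i)
  rw [contDiffGroupoid, mem_groupoid_of_pregroupoid] at h
  have h2 : ContDiffOn ℝ n (I ∘ ((e i).symm ≫ₕ e' i) ∘ I.symm)
    (I.symm ⁻¹' ((e i).symm ≫ₕ e' i).source ∩ range I) := h.1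
  refine h2.comp (t := I.symm ⁻¹' ((e i).symm ≫ₕ e' i).source ∩ range I)
    (g := I ∘ ((e i).symm ≫ₕ e' i) ∘ I.symm) (f := fun y : Fin m → E => y i)
    (contDiff_apply ℝ E i).contDiffOn ?_
  rintro y ⟨hy1, hy2⟩
  rw [range_powModel] at hy2
  refine ⟨?_, hy2 i⟩
  rw [mem_preimage, OpenPartialHomeomorph.trans_source] at hy1 ⊢
  exact ⟨hy1.1 i (mem_univ i), hy1.2 i (mem_univ i)⟩

theorem contMDiff_eval {n : ℕ∞ω} [IsManifold I n P] (i : Fin m) :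
    ContMDiff (powModel I m) I n (fun x : Fin m → P => x i) := by
  intro x
  rw [contMDiffAt_iff]
  refine ⟨(continuous_apply i).continuousAt, ?_⟩
  have h1 : ContDiffWithinAt ℝ n (fun y : Fin m → E => y i) (range (powModel I m))
    (Φ (powModel I m) x x) := (contDiff_apply ℝ E i).contDiffWithinAt
  refine h1.congr_of_eventuallyEq ?_ ?_
  · filter_upwards [extChartAt_target_mem_nhdsWithin (I := powModel I m) x] with y hy
    rw [powChart_target] at hy
    exact (Φ I (x i)).right_inv (hy i)
  · exact (Φ I (x i)).right_inv (mem_extChartAt_target (x i))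

theorem mfd_eval [IsManifold I 1 P] (i : Fin m) (x : Fin m → P) :
    mfd (powModel I m) I (fun x : Fin m → P => x i) x = ContinuousLinearMap.proj i := by
  have h : MDifferentiableAt (powModel I m) I (fun x : Fin m → P => x i) x :=
    (contMDiff_eval I (n := 1) i x).mdifferentiableAt (by simp)
  have h1 : HasFDerivWithinAt (fun y : Fin m → E => y i) (ContinuousLinearMap.proj i)
    (range (powModel I m)) (Φ (powModel I m) x x) :=
    (ContinuousLinearMap.proj (R := ℝ) (φ := fun _ : Fin m => E) i).hasFDerivWithinAt
  rw [mfd, h.mfderiv]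
  refine (h1.congr_of_eventuallyEq ?_ ?_).fderivWithin
    (uniqueDiffWithinAt_range (I := powModel I m) (mem_extChartAt_target x))
  · filter_upwards [extChartAt_target_mem_nhdsWithin (I := powModel I m) x] with y hy
    rw [powChart_target] at hy
    exact (Φ I (x i)).right_inv (hy i)
  · exact (Φ I (x i)).right_inv (mem_extChartAt_target (x i))

theorem fderivWithin_coordRep_eval [IsManifold I 1 P] (i : Fin m) {c : Fin m → P} {y : Fin m → E}
    (hy : y ∈ (Φ (powModel I m) c).target) :
    fderivWithin ℝ (coordRep (powModel I m) I (fun x : Fin m → P => x i) c (c i))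
      (range (powModel I m)) y = ContinuousLinearMap.proj i := by
  have h1 : HasFDerivWithinAt (fun y : Fin m → E => y i) (ContinuousLinearMap.proj i)
    (range (powModel I m)) y :=
    (ContinuousLinearMap.proj (R := ℝ) (φ := fun _ : Fin m => E) i).hasFDerivWithinAt
  refine (h1.congr_of_eventuallyEq ?_ ?_).fderivWithin
    (uniqueDiffWithinAt_range (I := powModel I m) hy)
  · filter_upwards [extChartAt_target_mem_nhdsWithin_of_mem (I := powModel I m) hy] with y hy
    rw [powChart_target] at hy
    exact (Φ I (c i)).right_inv (hy i)
  · rw [powChart_target] at hy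
    exact (Φ I (c i)).right_inv (hy i)

theorem vectorInChart_pow [IsManifold I 1 P] {X : VField I P}
    {Z : ∀ x : Fin m → P, TangentSpace (powModel I m) x} (i : Fin m)
    (hZ : ∀ x, (fieldVal Z x : Fin m → E) i = fieldVal X (x i)) {c : Fin m → P} {y : Fin m → E}
    (hy : y ∈ (Φ (powModel I m) c).target) :
    (vectorInChart Z c y : Fin m → E) i = vectorInChart X (c i) (y i) := by
  have hy' := hy
  rw [powChart_target] at hy'
  have h2 := fderivWithin_coordRep_vector (f := fun x : Fin m → P => x i) (X := Z) (X' := X)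
    (I := powModel I m) (I' := I)
    (fun x => by rw [mfd_eval]; exact hZ x) (c := c) (c' := c i) (y := y)
    ((contMDiff_eval I (n := 1) i _).mdifferentiableAt (by simp)) hy
    ((Φ I (c i)).map_target (hy' i))
  rw [fderivWithin_coordRep_eval I i hy] at h2
  have h3 : coordRep (powModel I m) I (fun x : Fin m → P => x i) c (c i) y = y i :=
    (Φ I (c i)).right_inv (hy' i)
  rw [h3] at h2
  exact h2.symm

theorem chartD_pow [IsManifold I 1 P] (i : Fin m) {c : Fin m → P} {y : Fin m → E}
    (hy : y ∈ (Φ (powModel I m) c).target) (v : Fin m → E) :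
    (chartD (powModel I m) c y v) i = chartD I (c i) (y i) (v i) := by
  have hy' := hy
  rw [powChart_target] at hy'
  have h2 := chartD_fderivWithin_coordRep (f := fun x : Fin m → P => x i)
    (I := powModel I m) (I' := I) (c := c) (c' := c i) (y := y)
    ((contMDiff_eval I (n := 1) i _).mdifferentiableAt (by simp)) hy
    ((Φ I (c i)).map_target (hy' i)) v
  rw [fderivWithin_coordRep_eval I i hy, mfd_eval] at h2
  have h3 : coordRep (powModel I m) I (fun x : Fin m → P => x i) c (c i) y = y i :=
    (Φ I (c i)).right_inv (hy' i)
  rw [h3] at h2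
  exact h2.symm

theorem isChartSmooth_pow [IsManifold I ∞ P] {X : Fin m → VField I P}
    (hX : ∀ i, IsChartSmooth (X i)) {Z : ∀ x : Fin m → P, TangentSpace (powModel I m) x}
    (hZ : ∀ x i, (fieldVal Z x : Fin m → E) i = fieldVal (X i) (x i)) : IsChartSmooth Z := by
  intro c
  refine contDiffOn_pi.2 fun i => ?_
  have h := (hX i (c i)).comp (t := (Φ I (c i)).target) (f := fun y : Fin m → E => y i)
    (s := (Φ (powModel I m) c).target) (contDiff_apply ℝ E i).contDiffOn fun y hy => by
      rw [powChart_target] at hy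
      exact hy i
  exact h.congr fun y hy => vectorInChart_pow I i (fun x => hZ x i) hy

end Powers

/-! ### Products of two manifolds -/

section Products

variable (I I') in
/-- The differential of a map within a set, as a map of model spaces. -/
def mfdWithin (f : P → Q) (s : Set P) (x : P) : E →L[ℝ] E' := mfderivWithin I I' f s x

theorem mem_extChartAt_prod_target {c : P × Q} {y : E × E'} : y ∈ (Φ (I.prod I') c).target ↔
      y.1 ∈ (Φ I c.1).target ∧ y.2 ∈ (Φ I' c.2).target := by
  rw [extChartAt_prod]; rfl

theorem prodChart_symm (c : P × Q) (y : E × E') : (Φ (I.prod I') c).symm y =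
      ((Φ I c.1).symm y.1, (Φ I' c.2).symm y.2) := by
  rw [extChartAt_prod]; rfl

theorem extChartAt_prod_apply (c : P × Q) (y : P × Q) :
    Φ (I.prod I') c y = (Φ I c.1 y.1, Φ I' c.2 y.2) := by
  rw [extChartAt_prod]; rfl

variable [IsManifold I 1 P] [IsManifold I' 1 Q]

theorem chartD_prod {c : P × Q} {y : E × E'} (hy : y ∈ (Φ (I.prod I') c).target) (v : E × E') :
    chartD (I.prod I') c y v = (chartD I c.1 y.1 v.1, chartD I' c.2 y.2 v.2) := by
  obtain ⟨h1, h2⟩ := mem_extChartAt_prod_target.1 hy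
  have a1 := mdifferentiableWithinAt_extChartAt_symm h1
  have a2 := mdifferentiableWithinAt_extChartAt_symm h2
  have b1 := (mdifferentiableWithinAt_extChartAt_symm (I := I.prod I') hy)
  have e1 : (fun z : E × E' => (Φ I c.1).symm z.1) = fun z => ((Φ (I.prod I') c).symm z).1 := by
    funext z; rw [prodChart_symm]
  have e2 : (fun z : E × E' => (Φ I' c.2).symm z.2) = fun z => ((Φ (I.prod I') c).symm z).2 := by
    funext z; rw [prodChart_symm]
  have hu : UniqueMDiffWithinAt 𝓘(ℝ, E × E') (range (I.prod I')) y :=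
    (uniqueDiffWithinAt_range (I := I.prod I') hy).uniqueMDiffWithinAt
  have m1 : MapsTo Prod.fst (range (I.prod I')) (range I) := by
    rintro _ ⟨x, rfl⟩; exact ⟨x.1, rfl⟩
  have m2 : MapsTo Prod.snd (range (I.prod I')) (range I') := by
    rintro _ ⟨x, rfl⟩; exact ⟨x.2, rfl⟩
  have f1 : HasMFDerivWithinAt 𝓘(ℝ, E × E') 𝓘(ℝ, E) (Prod.fst : E × E' → E) (range (I.prod I')) y
      (ContinuousLinearMap.fst ℝ E E') := hasFDerivWithinAt_fst.hasMFDerivWithinAt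
  have f2 : HasMFDerivWithinAt 𝓘(ℝ, E × E') 𝓘(ℝ, E') (Prod.snd : E × E' → E') (range (I.prod I')) y
      (ContinuousLinearMap.snd ℝ E E') := hasFDerivWithinAt_snd.hasMFDerivWithinAt
  have g1 := (a1.hasMFDerivWithinAt.comp (f := Prod.fst) y f1 m1).mfderivWithin hu
  have g2 := (a2.hasMFDerivWithinAt.comp (f := Prod.snd) y f2 m2).mfderivWithin hu
  have k1 := (mdifferentiableAt_fst (I := I) (I' := I')
    (x := (Φ (I.prod I') c).symm y)).hasMFDerivAt.comp_hasMFDerivWithinAt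
    (f := (Φ (I.prod I') c).symm) y b1.hasMFDerivWithinAt |>.mfderivWithin hu
  have k2 := (mdifferentiableAt_snd (I := I) (I' := I')
    (x := (Φ (I.prod I') c).symm y)).hasMFDerivAt.comp_hasMFDerivWithinAt
    (f := (Φ (I.prod I') c).symm) y b1.hasMFDerivWithinAt |>.mfderivWithin hu
  have q1 : ((ContinuousLinearMap.fst ℝ E E').comp (chartD (I.prod I') c y) : E × E' →L[ℝ] E) =
      (chartD I c.1 y.1).comp (ContinuousLinearMap.fst ℝ E E') := by
    rw [mfderiv_fst] at k1
    refine k1.symm.trans (Eq.trans ?_ g1)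
    exact congrArg (fun f => mfdWithin 𝓘(ℝ, E × E') I f (range (I.prod I')) y) e1.symm
  have q2 : ((ContinuousLinearMap.snd ℝ E E').comp (chartD (I.prod I') c y) : E × E' →L[ℝ] E') =
      (chartD I' c.2 y.2).comp (ContinuousLinearMap.snd ℝ E E') := by
    rw [mfderiv_snd] at k2
    refine k2.symm.trans (Eq.trans ?_ g2)
    exact congrArg (fun f => mfdWithin 𝓘(ℝ, E × E') I' f (range (I.prod I')) y) e2.symm
  exact Prod.ext (congrArg (fun T : E × E' →L[ℝ] E => T v) q1)
    (congrArg (fun T : E × E' →L[ℝ] E' => T v) q2)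

theorem vectorInChart_prod {Z : ∀ x : P × Q, TangentSpace (I.prod I') x}
    (hZ : ∀ x, (fieldVal Z x : E × E') = (fieldVal X x.1, fieldVal X' x.2)) {c : P × Q} {y : E × E'}
    (hy : y ∈ (Φ (I.prod I') c).target) :
    vectorInChart Z c y = (vectorInChart X c.1 y.1, vectorInChart X' c.2 y.2) := by
  obtain ⟨h1, h2⟩ := mem_extChartAt_prod_target.1 hy
  have e := chartD_vectorInChart (I := I.prod I') Z hy
  rw [chartD_prod hy, hZ, prodChart_symm] at e
  have i1 := congrArg (fun v => mfd I 𝓘(ℝ, E) (Φ I c.1) ((Φ I c.1).symm y.1) v)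
    (congrArg Prod.fst e)
  have i2 := congrArg (fun v => mfd I' 𝓘(ℝ, E') (Φ I' c.2) ((Φ I' c.2).symm y.2) v)
    (congrArg Prod.snd e)
  simp only [mfderiv_chartD h1, mfderiv_chartD h2] at i1 i2
  exact Prod.ext i1 i2

end Products

theorem isChartSmooth_prod [IsManifold I ∞ P] [IsManifold I' ∞ Q] (hX : IsChartSmooth X)
    (hX' : IsChartSmooth X') {Z : ∀ x : P × Q, TangentSpace (I.prod I') x}
    (hZ : ∀ x, (fieldVal Z x : E × E') = (fieldVal X x.1, fieldVal X' x.2)) :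
    IsChartSmooth Z := by
  intro c
  have h1 := (hX c.1).comp (t := (Φ I c.1).target) (f := fun y : E × E' => y.1)
    (s := (Φ (I.prod I') c).target) contDiff_fst.contDiffOn
    fun y hy => (mem_extChartAt_prod_target.1 hy).1
  have h2 := (hX' c.2).comp (t := (Φ I' c.2).target) (f := fun y : E × E' => y.2)
    (s := (Φ (I.prod I') c).target) contDiff_snd.contDiffOn
    fun y hy => (mem_extChartAt_prod_target.1 hy).2
  exact (h1.prodMk h2).congr fun y hy => vectorInChart_prod hZ hy

section MfdRules

variable {E'' : Type*} [NormedAddCommGroup E''] [NormedSpace ℝ E''] {H'' : Type*}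
  [TopologicalSpace H''] {I'' : ModelWithCorners ℝ E'' H''} {R : Type*} [TopologicalSpace R]
  [ChartedSpace H'' R]

theorem mfd_comp {g : Q → R} (hg : MDifferentiableAt I' I'' g (f x))
    (hf : MDifferentiableAt I I' f x) :
    mfd I I'' (fun x => g (f x)) x = (mfd I' I'' g (f x)).comp (mfd I I' f x) :=
  mfderiv_comp x hg hf

theorem mfd_prodMk {g : P → R} (hf : MDifferentiableAt I I' f x)
    (hg : MDifferentiableAt I I'' g x) :
    mfd I (I'.prod I'') (fun x => (f x, g x)) x = (mfd I I' f x).prod (mfd I I'' g x) :=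
  mfderiv_prodMk hf hg

theorem mfd_fst (x : P × Q) :
    mfd (I.prod I') I Prod.fst x = ContinuousLinearMap.fst ℝ E E' := mfderiv_fst

theorem mfd_snd (x : P × Q) :
    mfd (I.prod I') I' Prod.snd x = ContinuousLinearMap.snd ℝ E E' := mfderiv_snd

end MfdRules

/-! ### Configuration spaces -/

section Config

/-- The model space of `M`. -/
abbrev E3 := EuclideanSpace ℝ (Fin 3)

/-- The model space of `N`. -/
abbrev E2 := EuclideanSpace ℝ (Fin 2)

/-- The model space of `M^m × N^n`. -/
abbrev EConf (m n : ℕ) := (Fin m → E3) × (Fin n → E2)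

abbrev Conf (M N : Type*) (m n : ℕ) := (Fin m → M) × (Fin n → N)

abbrev ConfForm (M N : Type*) [TopologicalSpace M] [ChartedSpace (EuclideanHalfSpace 3) M]
    [TopologicalSpace N] [ChartedSpace (EuclideanSpace ℝ (Fin 2)) N] (m n k : ℕ) :=
  PreForm (ℭ m n) (Conf M N m n) k

theorem contMDiff_pos (hι : ContMDiff 𝔹 ℍ ∞ ι) (w : Fin m ⊕ Fin n) :
    ContMDiff (ℭ m n) ℍ ∞ (fun p : Conf M N m n => pos ι p w) := by
  rcases w with i | j
  · exact (contMDiff_eval ℍ i).comp contMDiff_fst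
  · exact hι.comp ((contMDiff_eval 𝔹 j).comp contMDiff_snd)

theorem mfd_pos (hι : ContMDiff 𝔹 ℍ ∞ ι) (w : Fin m ⊕ Fin n) (p : Conf M N m n) (v : EConf m n) :
    mfd (ℭ m n) ℍ (fun p : Conf M N m n => pos ι p w) p v = vel ι p w v := by
  rcases w with i | j
  · change mfd (ℭ m n) ℍ (fun p : Conf M N m n => (fun x : Fin m → M => x i) p.1) p v = _
    rw [mfd_comp (I := ℭ m n) (I' := ℳ m) (I'' := ℍ) (g := fun x : Fin m → M => x i) (f := Prod.fst)
      ((contMDiff_eval ℍ (n := ∞) i _).mdifferentiableAt (by simp))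
      mdifferentiableAt_fst, mfd_fst, mfd_eval]
    rfl
  · change mfd (ℭ m n) ℍ (fun p : Conf M N m n => (fun y : Fin n → N => ι (y j)) p.2) p v = _
    have h1 : MDifferentiableAt (ℬ n) 𝔹 (fun x : Fin n → N => x j) p.2 :=
      (contMDiff_eval 𝔹 (n := ∞) j _).mdifferentiableAt (by simp)
    have h2 : MDifferentiableAt 𝔹 ℍ ι (p.2 j) := (hι _).mdifferentiableAt (by simp)
    rw [mfd_comp (I := ℭ m n) (I' := ℬ n) (I'' := ℍ)
      (g := fun x : Fin n → N => ι (x j)) (f := Prod.snd)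
      (MDifferentiableAt.comp (g := ι) p.2 h2 h1) mdifferentiableAt_snd, mfd_snd,
      mfd_comp (I := ℬ n) (I' := 𝔹) (I'' := ℍ) (g := ι) (f := fun x : Fin n → N => x j) h2 h1,
      mfd_eval]
    rfl

/-- The projection to the pair of positions of an arrow. -/
def posPair (ι : N → M) (i : Fin m) (w : Fin m ⊕ Fin n) (p : Conf M N m n) : M × M :=
  (p.1 i, pos ι p w)

theorem contMDiff_posPair (hι : ContMDiff 𝔹 ℍ ∞ ι) (i : Fin m) (w : Fin m ⊕ Fin n) :
    ContMDiff (ℭ m n) pairModel ∞ (posPair ι i w : Conf M N m n → M × M) :=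
  (contMDiff_pos hι (Sum.inl i)).prodMk (contMDiff_pos hι w)

theorem mfd_posPair (hι : ContMDiff 𝔹 ℍ ∞ ι) (i : Fin m) (w : Fin m ⊕ Fin n)
    (p : Conf M N m n) (v : EConf m n) : mfd (ℭ m n) pairModel (posPair ι i w) p v =
      ((v.1 i, (vel ι p w v : E3)) : E3 × E3) := by
  have h1 := contMDiff_pos (M := M) (m := m) (n := n) hι (Sum.inl i)
  have h2 := contMDiff_pos (M := M) (m := m) (n := n) hι w
  have := mfd_prodMk (I := ℭ m n) (I' := ℍ) (I'' := ℍ) (x := p)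
    ((h1 p).mdifferentiableAt (by simp)) ((h2 p).mdifferentiableAt (by simp))
  have h3 : mfd (ℭ m n) pairModel (posPair ι i w) p v =
    (mfd (ℭ m n) ℍ (fun p : Conf M N m n => pos ι p (Sum.inl i)) p v,
      mfd (ℭ m n) ℍ (fun p : Conf M N m n => pos ι p w) p v) :=
    congrArg (fun T : EConf m n →L[ℝ] E3 × E3 => T v) this
  rw [h3, mfd_pos hι, mfd_pos hι]
  rfl

end Config

/-! ### Wedge products of families -/

section WedgeFam

variable {V : Type*} {s K : ℕ} {d : Fin s → ℕ}

/-- The enumeration of the slots of a product of forms. -/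
def slotEquiv (h : ∑ i, d i = K) : (Σ f, Fin (d f)) ≃ Fin K := finSigmaFinEquiv.trans (finCongr h)

theorem wedgeFam_eq (h : ∑ i, d i = K) (α : ∀ i, (Fin (d i) → V) → ℝ) (v : Fin K → V) :
    wedgeFam h α v = ((∏ i, (d i).factorial : ℕ) : ℝ)⁻¹ * ∑ σ : Equiv.Perm (Fin K),
      ((Equiv.Perm.sign σ : ℤ) : ℝ) * ∏ i, α i (fun a => v (σ (slotEquiv h ⟨i, a⟩))) := rfl

theorem prod_update_slot (h : ∑ i, d i = K) (α : ∀ i, (Fin (d i) → V) → ℝ) (v : Fin K → V)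
    (f₀ : Fin s) (a₀ : Fin (d f₀)) (x : V) :
    ∏ f, α f (fun a => update v (slotEquiv h ⟨f₀, a₀⟩) x (slotEquiv h ⟨f, a⟩)) =
      α f₀ (update (fun a => v (slotEquiv h ⟨f₀, a⟩)) a₀ x) *
        ∏ f ∈ Finset.univ.erase f₀, α f (fun a => v (slotEquiv h ⟨f, a⟩)) := by
  rw [← Finset.mul_prod_erase _ _ (Finset.mem_univ f₀)]
  congr 1
  · congr 1
    funext a
    by_cases ha : a = a₀
    · subst ha; simp
    · rw [update_of_ne ha, update_of_ne]
      intro h'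
      have := (slotEquiv h).injective h'
      simp only [Sigma.mk.injEq, heq_eq_eq, true_and] at this
      exact ha this
  · refine Finset.prod_congr rfl fun f hf => ?_
    congr 1
    funext a
    rw [update_of_ne]
    intro h'
    have := (slotEquiv h).injective h'
    simp only [Sigma.mk.injEq] at this
    exact (Finset.ne_of_mem_erase hf) this.1

theorem isAlt_wedgeFam [AddCommGroup V] [Module ℝ V] (h : ∑ i, d i = K)
    {α : ∀ i, (Fin (d i) → V) → ℝ} (hα : ∀ i, IsAlt (α i)) : IsAlt (wedgeFam h α) := by
  choose A hA using hα
  have hupd : ∀ (v : Fin K → V) (i : Fin K) (x : V), ∃ f₀ a₀, ∀ x,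
      ∏ f, α f (fun a => update v i x (slotEquiv h ⟨f, a⟩)) =
      A f₀ (update (fun a => v (slotEquiv h ⟨f₀, a⟩)) a₀ x) *
        ∏ f ∈ Finset.univ.erase f₀, α f (fun a => v (slotEquiv h ⟨f, a⟩)) := by
    intro v i x
    obtain ⟨⟨f₀, a₀⟩, rfl⟩ := (slotEquiv h).surjective i
    exact ⟨f₀, a₀, fun x => by rw [prod_update_slot, hA]⟩
  let B : MultilinearMap ℝ (fun _ : Fin K => V) ℝ :=
    { toFun := fun v => ∏ f, α f (fun a => v (slotEquiv h ⟨f, a⟩))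
      map_update_add' := by
        intro inst v i x y
        rw [Subsingleton.elim inst (instDecidableEqFin K)]
        obtain ⟨f₀, a₀, H⟩ := hupd v i x
        simp only [H, AlternatingMap.map_update_add, add_mul]
      map_update_smul' := by
        intro inst v i c x
        rw [Subsingleton.elim inst (instDecidableEqFin K)]
        obtain ⟨f₀, a₀, H⟩ := hupd v i x
        simp only [H, AlternatingMap.map_update_smul, smul_eq_mul, mul_assoc] }
  refine ⟨((∏ i, (d i).factorial : ℕ) : ℝ)⁻¹ • MultilinearMap.alternatization B, fun v => ?_⟩
  rw [wedgeFam_eq, AlternatingMap.smul_apply, MultilinearMap.alternatization_apply, smul_eq_mul]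
  congr 1
  refine Finset.sum_congr rfl fun σ _ => ?_
  rw [MultilinearMap.domDomCongr_apply, Units.smul_def, zsmul_eq_mul]
  rfl

theorem abs_wedgeFam_le (h : ∑ i, d i = K) {α : ∀ i, (Fin (d i) → V) → ℝ} {C : Fin s → ℝ}
    {ν : V → ℝ} (hα : ∀ i v, |α i v| ≤ C i * ∏ a, ν (v a)) (v : Fin K → V) :
    |wedgeFam h α v| ≤ K.factorial * ((∏ i, C i) * ∏ a, ν (v a)) := by
  have hterm : ∀ σ : Equiv.Perm (Fin K),
      |((Equiv.Perm.sign σ : ℤ) : ℝ) * ∏ i, α i (fun a => v (σ (slotEquiv h ⟨i, a⟩)))| ≤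
        (∏ i, C i) * ∏ a, ν (v a) := by
    intro σ
    rw [abs_mul, Finset.abs_prod]
    have h1 : |((Equiv.Perm.sign σ : ℤ) : ℝ)| = 1 := by
      rcases Int.units_eq_one_or (Equiv.Perm.sign σ) with h | h <;> simp [h]
    rw [h1, one_mul]
    refine (Finset.prod_le_prod (fun _ _ => abs_nonneg _) fun i _ => hα i _).trans (le_of_eq ?_)
    rw [Finset.prod_mul_distrib]
    congr 1
    rw [← Equiv.prod_comp (σ) (fun a => ν (v a)), ← Equiv.prod_comp (slotEquiv h),
      Fintype.prod_sigma]
  have hle1 : ((∏ i, (d i).factorial : ℕ) : ℝ)⁻¹ ≤ 1 := by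
    apply inv_le_one_of_one_le₀
    exact_mod_cast Nat.succ_le_of_lt (Finset.prod_pos fun i _ => Nat.factorial_pos _)
  rw [wedgeFam_eq, abs_mul, abs_of_nonneg (inv_nonneg.2 (Nat.cast_nonneg _))]
  refine (mul_le_of_le_one_left (abs_nonneg _) hle1).trans ?_
  refine (Finset.abs_sum_le_sum_abs _ _).trans ((Finset.sum_le_sum fun σ _ => hterm σ).trans ?_)
  simp [Fintype.card_perm]

theorem wedgeFam_update (h : ∑ i, d i = K) (α : ∀ i, (Fin (d i) → V) → ℝ) (f₀ : Fin s)
    (β : (Fin (d f₀) → V) → ℝ) (v : Fin K → V) :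
    wedgeFam h (update α f₀ β) v = ((∏ i, (d i).factorial : ℕ) : ℝ)⁻¹ *
      ∑ σ : Equiv.Perm (Fin K), ((Equiv.Perm.sign σ : ℤ) : ℝ) *
        (β (fun a => v (σ (slotEquiv h ⟨f₀, a⟩))) *
          ∏ f ∈ Finset.univ.erase f₀, α f (fun a => v (σ (slotEquiv h ⟨f, a⟩)))) := by
  rw [wedgeFam_eq]
  congr 1
  refine Finset.sum_congr rfl fun σ _ => ?_
  rw [← Finset.mul_prod_erase _ _ (Finset.mem_univ f₀), update_self]
  congr 2
  exact Finset.prod_congr rfl fun f hf => by rw [update_of_ne (Finset.ne_of_mem_erase hf)]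

theorem locLie_wedgeFam (h : ∑ i, d i = K) {S : Set E} {Z : E → E}
    {α : ∀ i, E → (Fin (d i) → E) → ℝ} (hS : UniqueDiffWithinAt ℝ S y)
    (hα : ∀ i v, DifferentiableWithinAt ℝ (fun y => α i y v) S y) (v : Fin K → E) :
    locLie S Z (fun y => wedgeFam h fun i => α i y) y v =
      ∑ f₀, wedgeFam h (update (fun i => α i y) f₀ (locLie S Z (α f₀) y)) v := by
  have hprod : ∀ σ : Equiv.Perm (Fin K), HasFDerivWithinAt
      (fun y => ∏ i, α i y (fun a => v (σ (slotEquiv h ⟨i, a⟩))))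
      (∑ f ∈ Finset.univ, (∏ f' ∈ Finset.univ.erase f, α f' y
        (fun a => v (σ (slotEquiv h ⟨f', a⟩)))) •
          fderivWithin ℝ (fun y => α f y (fun a => v (σ (slotEquiv h ⟨f, a⟩)))) S y) S y :=
    fun σ => HasFDerivWithinAt.finsetProd fun f _ => (hα f _).hasFDerivWithinAt
  have hsum : HasFDerivWithinAt (fun y => wedgeFam h (fun i => α i y) v)
      (((∏ i, (d i).factorial : ℕ) : ℝ)⁻¹ • ∑ σ : Equiv.Perm (Fin K),
        ((Equiv.Perm.sign σ : ℤ) : ℝ) •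
      (∑ f ∈ Finset.univ, (∏ f' ∈ Finset.univ.erase f, α f' y
        (fun a => v (σ (slotEquiv h ⟨f', a⟩)))) •
          fderivWithin ℝ (fun y => α f y (fun a => v (σ (slotEquiv h ⟨f, a⟩)))) S y)) S y := by
    simp only [wedgeFam_eq]
    exact (HasFDerivWithinAt.fun_sum fun σ _ => (hprod σ).const_mul _).const_mul _
  rw [locLie, hsum.fderivWithin hS]
  simp only [wedgeFam_update]
  simp only [wedgeFam_eq, smul_apply, sum_apply, smul_eq_mul]
  rw [← Finset.mul_sum, ← Finset.mul_sum, ← mul_add]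
  congr 1
  rw [Finset.sum_comm (γ := Fin K), Finset.sum_comm (γ := Fin s), ← Finset.sum_add_distrib]
  refine Finset.sum_congr rfl fun σ _ => ?_
  simp only [← Finset.mul_sum]
  rw [← mul_add]
  congr 1
  have hre : ∑ i : Fin K, ∏ f, α f y (fun a =>
      update v i (fderivWithin ℝ Z S y (v i)) (σ (slotEquiv h ⟨f, a⟩))) =
      ∑ f₀, ∑ a₀ : Fin (d f₀), α f₀ y (update (fun a => v (σ (slotEquiv h ⟨f₀, a⟩))) a₀
        (fderivWithin ℝ Z S y (v (σ (slotEquiv h ⟨f₀, a₀⟩))))) *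
          ∏ f ∈ Finset.univ.erase f₀, α f y (fun a => v (σ (slotEquiv h ⟨f, a⟩))) := by
    rw [← Equiv.sum_comp σ, ← Equiv.sum_comp (slotEquiv h), Fintype.sum_sigma]
    refine Finset.sum_congr rfl fun f₀ _ => Finset.sum_congr rfl fun a₀ _ => ?_
    rw [← prod_update_slot h (fun i => α i y) (fun j => v (σ j)) f₀ a₀]
    refine Finset.prod_congr rfl fun f _ => ?_
    congr 1
    funext a
    by_cases hj : slotEquiv h ⟨f, a⟩ = slotEquiv h ⟨f₀, a₀⟩
    · rw [hj]; simp
    · rw [update_of_ne hj, update_of_ne (fun h' => hj (σ.injective h'))]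
  rw [hre, ← Finset.sum_add_distrib]
  refine Finset.sum_congr rfl fun f₀ _ => ?_
  rw [locLie, add_mul, Finset.sum_mul, mul_comm]

end WedgeFam

/-! ### Smoothness of forms -/

section Smoothness

variable [FiniteDimensional ℝ E] [FiniteDimensional ℝ E']

theorem IsFormOn.of_le {r r' : ℕ∞ω} (h : IsFormOn r θ U) (hr : r' ≤ r) : IsFormOn r' θ U :=
  ⟨h.alternating, fun c v => (h.contDiffOn c v).of_le hr⟩

theorem IsFormOn.mono {r : ℕ∞ω} {U' : Set P} (h : IsFormOn r θ U) (hU : U' ⊆ U) : IsFormOn r θ U' :=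
  ⟨fun x hx => h.alternating x (hU hx),
    fun c v => (h.contDiffOn c v).mono (inter_subset_inter_right _ (preimage_mono hU))⟩

theorem IsSmoothFamilyOn.isFormOn {θ : ℝ → PreForm I P k} (h : IsSmoothFamilyOn J θ U) {t : ℝ}
    (ht : t ∈ J) : IsFormOn ∞ (θ t) U :=
  ⟨h.alternating t ht, fun c v => (h.contDiffOn c v).comp
    (contDiff_const.prodMk contDiff_id).contDiffOn fun _ hy => ⟨ht, hy⟩⟩

theorem IsAlt.add {b : (Fin k → V) → ℝ} (ha : IsAlt a) (hb : IsAlt b) :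
    IsAlt fun v => a v + b v := by
  obtain ⟨A, hA⟩ := ha
  obtain ⟨B, hB⟩ := hb
  exact ⟨A + B, fun v => by simp [hA, hB]⟩

theorem IsAlt.smul (ha : IsAlt a) (c : ℝ) : IsAlt fun v => c * a v := by
  obtain ⟨A, hA⟩ := ha
  exact ⟨c • A, fun v => by simp [hA]⟩

theorem isAlt_locLie {S : Set E} {Z : E → E} {Θ : E → (Fin k → E) → ℝ} (hy : y ∈ S)
    (hS : UniqueDiffWithinAt ℝ S y) (halt : ∀ᶠ y' in 𝓝[S] y, IsAlt (Θ y'))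
    (hd : ∀ v, DifferentiableWithinAt ℝ (fun y' => Θ y' v) S y) : IsAlt (locLie S Z Θ y) := by
  have hω := differentiableWithinAt_bundleAlt hy halt hd
  have h1 : IsAlt fun v => fderivWithin ℝ (fun y => Θ y v) S y (Z y) := by
    refine ⟨(fderivWithin ℝ (fun y => bundleAlt (Θ y)) S y (Z y)).toAlternatingMap, fun v => ?_⟩
    have h3 : (fun z => Θ z v) =ᶠ[𝓝[S] y] fun z => bundleAlt (Θ z) v := by
      filter_upwards [halt] with z hz
      rw [hz.bundleAlt_apply]
    change fderivWithin ℝ (fun z => Θ z v) S y (Z y) = _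
    rw [h3.fderivWithin_eq (h3.self_of_nhdsWithin hy)]
    rw [(hω.hasFDerivWithinAt.continuousAlternatingMap_apply_const v).fderivWithin hS]
    rfl
  refine h1.add ⟨((ContinuousAlternatingMap.fderivCompContinuousLinearMap (bundleAlt (Θ y))
    (ContinuousLinearMap.id ℝ E)) (fderivWithin ℝ Z S y)).toAlternatingMap, fun v => ?_⟩
  have h := halt.self_of_nhdsWithin hy
  simp only [← h.bundleAlt_apply]
  change _ = ContinuousAlternatingMap.fderivCompContinuousLinearMap (bundleAlt (Θ y))
    (ContinuousLinearMap.id ℝ E) (fderivWithin ℝ Z S y) v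
  rw [ContinuousAlternatingMap.fderivCompContinuousLinearMap_apply]
  refine Finset.sum_congr rfl fun i _ => congrArg _ ?_
  funext j
  by_cases hj : j = i
  · subst hj; simp
  · simp [hj]

variable [IsManifold I ∞ P] [IsManifold I' ∞ Q]

theorem IsFormOn.isAlternatingOn_lieDeriv (hU : IsOpen U) (h : IsFormOn 1 θ U) (X : VField I P) :
    IsAlternatingOn (lieDeriv X θ) U := by
  intro x hx
  have hx' : (Φ I x).symm (Φ I x x) ∈ U := by rwa [extChartAt_to_inv]
  have := isAlt_locLie (Z := vectorInChart X x) (mem_range_self _)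
    (uniqueDiffWithinAt_range (I := I) (mem_extChartAt_target x))
    (by filter_upwards [eventually_mem_target hU (mem_extChartAt_target x) hx'] with z hz
        exact isAlt_formInChart h.alternating hz.2)
    (fun v => (h.contDiffWithinAt hU (mem_extChartAt_target x) hx' v).differentiableWithinAt
      (by simp))
  exact this

theorem IsAlt.apply_eq_sum {a : (Fin k → E) → ℝ} (h : IsAlt a) (v : Fin k → E) :
    a v = ∑ r : Fin k → Fin (Module.finrank ℝ E),
      (∏ i, (Module.finBasis ℝ E).repr (v i) (r i)) * a fun i => Module.finBasis ℝ E (r i) := by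
  obtain ⟨A, hA⟩ := h
  rw [hA]
  refine (MultilinearMap.apply_eq_sum_basis (Module.finBasis ℝ E) A.toMultilinearMap v).trans ?_
  exact Finset.sum_congr rfl fun r _ => by rw [hA]; rfl

theorem contDiffWithinAt_alt_apply {n : ℕ∞ω} {S : Set F} {x : F} {a : F → (Fin k → E) → ℝ}
    {u : F → Fin k → E} (hx : x ∈ S) (halt : ∀ᶠ y in 𝓝[S] x, IsAlt (a y))
    (ha : ∀ v, ContDiffWithinAt ℝ n (fun y => a y v) S x)
    (hu : ∀ i, ContDiffWithinAt ℝ n (fun y => u y i) S x) :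
    ContDiffWithinAt ℝ n (fun y => a y (u y)) S x := by
  have h1 : ContDiffWithinAt ℝ n (fun y => ∑ r : Fin k → Fin (Module.finrank ℝ E),
      (∏ i, (Module.finBasis ℝ E).repr (u y i) (r i)) * a y fun i => Module.finBasis ℝ E (r i))
      S x := by
    refine ContDiffWithinAt.sum fun r _ => (contDiffWithinAt_prod fun i _ => ?_).mul (ha _)
    exact ((Module.finBasis ℝ E).coord (r i)).toContinuousLinearMap.contDiff.contDiffAt.comp_contDiffWithinAt x (hu i)
  have h2 : (fun y => a y (u y)) =ᶠ[𝓝[S] x] _ := halt.mono fun y hy => hy.apply_eq_sum (u y)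
  exact h1.congr_of_eventuallyEq h2 (h2.self_of_nhdsWithin hx)

theorem IsFormOn.pullForm {r : ℕ∞ω} (hr : r ≤ ∞) (hf : ContMDiff I I' ∞ f) {θ : PreForm I' Q k}
    {U : Set Q} (hU : IsOpen U) (h : IsFormOn r θ U) :
    IsFormOn r (pullForm I I' f θ) (f ⁻¹' U) := by
  have hmd : ∀ x, MDifferentiableAt I I' f x := fun x => (hf x).mdifferentiableAt (by simp)
  refine ⟨fun x hx => ?_, fun c v y hy => ?_⟩
  · have h1 : IsAlt (θ.val (f x)) := h.alternating (f x) hx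
    exact h1.comp_linearMap (mfd I I' f x).toLinearMap
  · have hs : f ((Φ I c).symm y) ∈ (Φ I' (f ((Φ I c).symm y))).source := mem_extChartAt_source _
    set c' := f ((Φ I c).symm y) with hc'
    have hev := eventually_mem_chart hf.continuous isOpen_univ hy.1 (mem_univ _) hs
    have hyr := target_subset c hy.1
    have hy' : coordRep I I' f c c' y ∈ (Φ I' c').target := (Φ I' c').map_source hs
    have hyU' : (Φ I' c').symm (coordRep I I' f c c' y) ∈ U := by
      rw [coordRep, (Φ I' c').left_inv hs]; exact hy.2
    have hφ := contDiffWithinAt_coordRep hf hy.1 hs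
    have hmaps : Tendsto (coordRep I I' f c c') (𝓝[range I] y)
        (𝓝[range I'] (coordRep I I' f c c' y)) := by
      refine tendsto_nhdsWithin_iff.2 ⟨hφ.continuousWithinAt, ?_⟩
      filter_upwards [hev] with z hz
      exact target_subset c' ((Φ I' c').map_source hz.2.2)
    have key : ContDiffWithinAt ℝ r (fun z => formInChart θ c' (coordRep I I' f c c' z)
        fun i => fderivWithin ℝ (coordRep I I' f c c') (range I) z (v i)) (range I) y := by
      apply contDiffWithinAt_alt_apply hyr
      · exact hmaps.eventually (by
          filter_upwards [eventually_mem_target hU hy' hyU'] with z hz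
          exact isAlt_formInChart h.alternating hz.2)
      · intro w
        exact (h.contDiffWithinAt hU hy' hyU' w).comp_of_preimage_mem_nhdsWithin y (hφ.of_le hr)
          (hmaps self_mem_nhdsWithin)
      · intro i
        have h3 := hφ.fderivWithin_right (m := ∞) I.uniqueDiffOn (by rfl) hyr
        exact (h3.clm_apply contDiffWithinAt_const).of_le hr
    have heq : (fun z => formInChart (ChangeOfData.pullForm I I' f θ) c z v) =ᶠ[𝓝[range I] y]
        fun z => formInChart θ c' (coordRep I I' f c c' z)
          fun i => fderivWithin ℝ (coordRep I I' f c c') (range I) z (v i) := by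
      filter_upwards [hev] with z hz
      exact formInChart_pullForm (hmd _) hz.1 hz.2.2 v
    exact (key.congr_of_eventuallyEq heq (heq.self_of_nhdsWithin hyr)).mono
      (inter_subset_left.trans (target_subset c))

theorem IsSmoothFamilyOn.lieDeriv (hJ : IsOpen J) {θ : ℝ → PreForm I P k} (hU : IsOpen U)
    (h : IsSmoothFamilyOn J θ U) (hX : IsChartSmooth X) :
    IsSmoothFamilyOn J (fun t => lieDeriv X (θ t)) U := by
  have h1 : ∀ t ∈ J, IsFormOn 1 (θ t) U := fun t ht => (h.isFormOn ht).of_le (by simp)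
  refine ⟨fun t ht => (h1 t ht).isAlternatingOn_lieDeriv hU X, fun c v => ?_⟩
  set D := (Φ I c).target ∩ (Φ I c).symm ⁻¹' U with hD
  have hDn : ∀ y ∈ D, D ∈ 𝓝[range I] y := fun y hy => eventually_mem_target hU hy.1 hy.2
  have hDr : D ⊆ range I := inter_subset_left.trans (target_subset c)
  have hDu : UniqueDiffOn ℝ D := fun y hy => by
    have := (I.uniqueDiffOn y (hDr hy)).inter' (hDn y hy)
    rwa [inter_eq_right.2 hDr] at this
  have hprod : UniqueDiffOn ℝ (J ×ˢ D) := hJ.uniqueDiffOn.prod hDu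
  have hXD : ContDiffOn ℝ ∞ (vectorInChart X c) D := (hX c).mono inter_subset_left
  have hDX : ContDiffOn ℝ ∞ (fderivWithin ℝ (vectorInChart X c) (range I)) D := by
    refine (hXD.fderivWithin hDu (m := ∞) (by rfl)).congr fun y hy => ?_
    exact fderivWithin_of_mem_nhdsWithin (hDn y hy) (I.uniqueDiffOn y (hDr hy))
      ((hXD y hy).differentiableWithinAt (by simp))
  have hG := h.contDiffOn c v
  have hdG := hG.fderivWithin hprod (m := ∞) (by rfl)
  have hsnd : ContDiffOn ℝ ∞ (Prod.snd : ℝ × E → E) (J ×ˢ D) := contDiff_snd.contDiffOn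
  have m2 : MapsTo (Prod.snd : ℝ × E → E) (J ×ˢ D) D := fun z hz => hz.2
  have key : ContDiffOn ℝ ∞ (fun z : ℝ × E =>
      fderivWithin ℝ (fun z : ℝ × E => formInChart (θ z.1) c z.2 v) (J ×ˢ D) z
        ((0 : ℝ), vectorInChart X c z.2) +
      ∑ i, formInChart (θ z.1) c z.2 (update v i
        (fderivWithin ℝ (vectorInChart X c) (range I) z.2 (v i)))) (J ×ˢ D) := by
    refine (hdG.clm_apply (contDiffOn_const.prodMk (hXD.comp hsnd m2))).add
      (ContDiffOn.sum fun i _ => fun z hz => ?_)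
    apply contDiffWithinAt_alt_apply hz
    · filter_upwards [self_mem_nhdsWithin] with z hz
      exact isAlt_formInChart (h.alternating z.1 hz.1) hz.2.2
    · exact fun w => h.contDiffOn c w z hz
    · intro j
      by_cases hj : j = i
      · subst hj
        simp only [update_self]
        exact ((hDX.comp hsnd m2).clm_apply contDiffOn_const) z hz
      · simp only [update_of_ne hj]
        exact contDiffWithinAt_const
  refine key.congr fun z hz => ?_
  obtain ⟨t, y⟩ := z
  obtain ⟨ht, hy⟩ : t ∈ J ∧ y ∈ D := hz
  simp only
  rw [formInChart_lieDeriv hU (h1 t ht) hX hy.1 hy.2, locLie]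
  congr 1
  have e1 : HasFDerivWithinAt (fun y' => formInChart (θ t) c y' v)
      ((fderivWithin ℝ (fun z : ℝ × E => formInChart (θ z.1) c z.2 v) (J ×ˢ D) (t, y)).comp
        (ContinuousLinearMap.inr ℝ ℝ E)) D y := by
    have e2 : HasFDerivWithinAt (fun y' : E => (t, y')) (ContinuousLinearMap.inr ℝ ℝ E) D y :=
      (hasFDerivAt_prodMk_right t y).hasFDerivWithinAt
    exact HasFDerivWithinAt.comp (t := J ×ˢ D) (g := fun z : ℝ × E => formInChart (θ z.1) c z.2 v) y
      ((hG (t, y) ⟨ht, hy⟩).differentiableWithinAt (by simp)).hasFDerivWithinAt e2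
      fun y' hy' => ⟨ht, hy'⟩
  rw [(e1.mono_of_mem_nhdsWithin (hDn y hy)).fderivWithin (I.uniqueDiffOn y (hDr hy))]
  rfl

end Smoothness

/-! ### Products of forms on a manifold -/

section FormProducts

variable [FiniteDimensional ℝ E] [IsManifold I ∞ P]

/-- The wedge product of a finite sequence of forms. -/
def wedgeForm {s K : ℕ} {d : Fin s → ℕ} (h : ∑ i, d i = K) (φ : ∀ i, PreForm I P (d i)) :
    PreForm I P K :=
  fun x v => wedgeFam h (fun f => φ f x) v

theorem IsFormOn.wedgeForm {r : ℕ∞ω} {s K : ℕ} {d : Fin s → ℕ} (h : ∑ i, d i = K)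
    {φ : ∀ i, PreForm I P (d i)} (hφ : ∀ i, IsFormOn r (φ i) U) : IsFormOn r (wedgeForm h φ) U := by
  refine ⟨fun x hx => ?_, fun c v => ?_⟩
  · exact isAlt_wedgeFam (V := E) (α := fun f => (φ f).val x) h fun i => (hφ i).alternating x hx
  · have : (fun y => formInChart (ChangeOfData.wedgeForm h φ) c y v) = fun y =>
        ((∏ i, (d i).factorial : ℕ) : ℝ)⁻¹ * ∑ σ : Equiv.Perm (Fin K),
          ((Equiv.Perm.sign σ : ℤ) : ℝ) *
            ∏ i, formInChart (φ i) c y (fun a => v (σ (slotEquiv h ⟨i, a⟩))) := rfl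
    rw [this]
    refine contDiffOn_const.mul (ContDiffOn.sum fun σ _ => contDiffOn_const.mul ?_)
    exact contDiffOn_prod fun i _ => (hφ i).contDiffOn c _

theorem lieDeriv_wedgeForm {s K : ℕ} {d : Fin s → ℕ} (h : ∑ i, d i = K) {φ : ∀ i, PreForm I P (d i)}
    (hU : IsOpen U) (hφ : ∀ i, IsFormOn 1 (φ i) U) (X : VField I P) (hx : x ∈ U) (v : Fin K → E) :
    (lieDeriv X (wedgeForm h φ)).val x v =
      ∑ f₀, (wedgeForm h (update φ f₀ (lieDeriv X (φ f₀)))).val x v := by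
  have hy := mem_extChartAt_target (I := I) x
  have hd : ∀ i v, DifferentiableWithinAt ℝ (fun y => formInChart (φ i) x y v) (range I)
      (Φ I x x) := fun i v =>
    ((hφ i).contDiffWithinAt hU hy (by rwa [extChartAt_to_inv]) v).differentiableWithinAt
      one_ne_zero
  rw [lieDeriv_eq_locLie]
  have h1 := locLie_wedgeFam h (uniqueDiffWithinAt_range hy)
    (Z := vectorInChart X x) (α := fun i => formInChart (φ i) x) hd v
  refine h1.trans (Finset.sum_congr rfl fun f₀ _ => ?_)
  have h2 : (update (fun i => formInChart (φ i) x (Φ I x x)) f₀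
      (locLie (range I) (vectorInChart X x) (formInChart (φ f₀) x) (Φ I x x))) =
      fun i => (update φ f₀ (lieDeriv X (φ f₀)) i).val x := by
    funext i v
    by_cases hi : i = f₀
    · subst hi
      simp only [update_self]
      rfl
    · simp only [update_of_ne hi]
      exact formInChart_self _ _ _
  rw [h2]
  rfl

/-- The product of a function and a form. -/
def smulForm (ψ : P → ℝ) (θ : PreForm I P k) : PreForm I P k := fun x v => ψ x * θ x v

theorem formInChart_smulForm (ψ : P → ℝ) (θ : PreForm I P k) (c : P) (y : E) (v : Fin k → E) :
    formInChart (smulForm ψ θ) c y v = ψ ((Φ I c).symm y) * formInChart θ c y v := rfl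

theorem contDiffWithinAt_comp_symm {ψ : P → ℝ} (hψ : ContMDiff I 𝓘(ℝ, ℝ) ∞ ψ)
    (hy : y ∈ (Φ I c).target) : ContDiffWithinAt ℝ ∞ (fun y => ψ ((Φ I c).symm y)) (range I) y :=
  contDiffWithinAt_coordRep (c' := ψ ((Φ I c).symm y)) hψ hy (by simp)

theorem IsFormOn.smulForm {r : ℕ∞ω} (hr : r ≤ ∞) {ψ : P → ℝ} (hψ : ContMDiff I 𝓘(ℝ, ℝ) ∞ ψ)
    (hU : IsOpen U) (h : IsFormOn r θ U) (hsupp : ∀ x ∉ U, ∀ᶠ x' in 𝓝 x, ψ x' = 0) :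
    IsFormOn r (smulForm ψ θ) univ := by
  refine ⟨fun x _ => ?_, fun c v y hy => ?_⟩
  · by_cases hx : x ∈ U
    · exact IsAlt.smul (V := E) (a := θ.val x) (h.alternating x hx) (ψ x)
    · refine ⟨0, fun v => ?_⟩
      change ψ x * θ x v = 0
      rw [(hsupp x hx).self_of_nhds, zero_mul]
  · have hy1 : y ∈ (Φ I c).target := hy.1
    refine ContDiffWithinAt.mono (s := range I) ?_ (inter_subset_left.trans (target_subset c))
    by_cases hx : (Φ I c).symm y ∈ U
    · exact ((contDiffWithinAt_comp_symm hψ hy1).of_le hr).mul (h.contDiffWithinAt hU hy1 hx v)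
    · have h0 : ∀ᶠ z in 𝓝[range I] y, formInChart (ChangeOfData.smulForm ψ θ) c z v = 0 := by
        have := ((continuousOn_extChartAt_symm c y hy1).mono_of_mem_nhdsWithin
          (extChartAt_target_mem_nhdsWithin_of_mem hy1)).eventually (hsupp _ hx)
        filter_upwards [this] with z hz
        rw [formInChart_smulForm, hz, zero_mul]
      exact contDiffWithinAt_const.congr_of_eventuallyEq h0
        (h0.self_of_nhdsWithin (target_subset c hy1))

theorem lieDeriv_smulForm {ψ : P → ℝ} (hψ : ContMDiff I 𝓘(ℝ, ℝ) ∞ ψ) (hU : IsOpen U)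
    (h : IsFormOn 1 θ U) (X : VField I P) (hx : x ∈ U) (v : Fin k → E) :
    (lieDeriv X (smulForm ψ θ)).val x v =
      mfd I 𝓘(ℝ, ℝ) ψ x (fieldVal X x) * θ.val x v + ψ x * (lieDeriv X θ).val x v := by
  have hy := mem_extChartAt_target (I := I) x
  have hu := uniqueDiffWithinAt_range hy
  have h1 := (contDiffWithinAt_comp_symm hψ hy).differentiableWithinAt (by simp)
  have h2 := (h.contDiffWithinAt hU hy (by rwa [extChartAt_to_inv]) v).differentiableWithinAt
      one_ne_zero
  have h3 : fderivWithin ℝ (fun y => ψ ((Φ I x).symm y)) (range I) (Φ I x x) =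
      mfd I 𝓘(ℝ, ℝ) ψ x := by
    have := ((hψ x).mdifferentiableAt (by simp)).mfderiv
    exact this.symm
  rw [lieDeriv_eq_locLie, lieDeriv_eq_locLie]
  unfold locLie
  have h4 : fderivWithin ℝ (fun y => formInChart (smulForm ψ θ) x y v) (range I)
      (Φ I x x) = fderivWithin ℝ (fun y => ψ ((Φ I x).symm y) *
        formInChart θ x y v) (range I) (Φ I x x) := rfl
  rw [h4, fderivWithin_fun_mul hu h1 h2, h3]
  simp only [add_apply, smul_apply, smul_eq_mul, extChartAt_to_inv,
    vectorInChart_self, formInChart_self, mul_add, Finset.mul_sum]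
  have h5 (w : Fin k → E) : (smulForm ψ θ).val x w = ψ x * θ.val x w := rfl
  simp only [h5]
  ring

end FormProducts

/-! ### The factors of Feynman integrands -/

section Factors

variable {dχ : B → ℕ}

variable (ι) in
/-- The configurations at which the form of a factor is regular. -/
def facSet : Factor B m n → Set (Conf M N m n)
  | .leaf _ _ => univ
  | .arrow i w => posPair ι i w ⁻¹' pairSpace M

theorem isOpen_pairSpace : IsOpen (pairSpace M) := isOpen_ne_fun continuous_fst continuous_snd

theorem isOpen_facSet (hι : ContMDiff 𝔹 ℍ ∞ ι) (f : Factor B m n) : IsOpen (facSet ι f) := by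
  cases f with
  | leaf w b => exact isOpen_univ
  | arrow i w => exact isOpen_pairSpace.preimage (contMDiff_posPair hι i w).continuous

theorem factorForm_leaf (hι : ContMDiff 𝔹 ℍ ∞ ι) (χ : ∀ b, PreForm ℍ M (dχ b))
    (η : PreForm pairModel (M × M) 2) (w : Fin m ⊕ Fin n) (b : B) : factorForm ι χ η (.leaf w b) =
      pullForm (ℭ m n) ℍ (fun p : Conf M N m n => pos ι p w) (χ b) := by
  funext p v
  change (χ b).val _ _ = (χ b).val _ _
  congr 1
  funext a
  exact (mfd_pos hι w p (v a)).symm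

theorem factorForm_arrow (hι : ContMDiff 𝔹 ℍ ∞ ι) (χ : ∀ b, PreForm ℍ M (dχ b))
    (η : PreForm pairModel (M × M) 2) (i : Fin m) (w : Fin m ⊕ Fin n) :
    factorForm ι χ η (.arrow i w) =
      pullForm (ℭ m n) pairModel (posPair ι i w : Conf M N m n → M × M) η := by
  funext p v
  change η.val _ _ = η.val _ _
  congr 1
  funext a
  exact (mfd_posPair hι i w p (v a)).symm

theorem isFormOn_factorForm {r : ℕ∞ω} (hr : r ≤ ∞) (hι : ContMDiff 𝔹 ℍ ∞ ι)
    {χ : ∀ b, PreForm ℍ M (dχ b)} {η : PreForm pairModel (M × M) 2}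
    (hχ : ∀ b, IsFormOn r (χ b) univ) (hη : IsFormOn r η (pairSpace M)) (f : Factor B m n) :
    IsFormOn r (factorForm ι χ η f) (facSet ι f) := by
  cases f with
  | leaf w b =>
    rw [factorForm_leaf hι]
    exact (hχ b).pullForm hr (contMDiff_pos hι w) isOpen_univ
  | arrow i w =>
    rw [factorForm_arrow hι]
    exact hη.pullForm hr (contMDiff_posPair hι i w) isOpen_pairSpace

theorem vel_confField {X : VField ℍ M} {X' : VField 𝔹 N}
    (hX' : RestrictsTo ι X X') (p : Conf M N m n) (w : Fin m ⊕ Fin n) :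
    (vel ι p w (confField X X' m n p) : E3) = fieldVal X (pos ι p w) := by
  cases w with
  | inl i => rfl
  | inr j => exact hX' (p.2 j)

theorem isChartSmooth_pairField {X : VField ℍ M} (hX : IsChartSmooth X) :
    IsChartSmooth (pairField X) :=
  isChartSmooth_prod hX hX fun _ => rfl

theorem isChartSmooth_bdryField {X' : VField 𝔹 N} (hX' : IsChartSmooth X') :
    IsChartSmooth (bdryField X' n) :=
  isChartSmooth_pow 𝔹 (fun _ => hX') fun _ _ => rfl

theorem isChartSmooth_confField {X : VField ℍ M}
    {X' : VField 𝔹 N} (hX : IsChartSmooth X) (hX' : IsChartSmooth X') :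
    IsChartSmooth (confField X X' m n) :=
  isChartSmooth_prod (X := (fun x i => (X (x i) : E3) : ∀ x : Fin m → M, TangentSpace (ℳ m) x))
    (isChartSmooth_pow ℍ (fun _ => hX) fun _ _ => rfl) (isChartSmooth_bdryField hX') fun _ => rfl

theorem lieDeriv_factorForm (hι : ContMDiff 𝔹 ℍ ∞ ι) {χ : ∀ b, PreForm ℍ M (dχ b)}
    {η : PreForm pairModel (M × M) 2} (hχ : ∀ b, IsFormOn 1 (χ b) univ)
    (hη : IsFormOn 1 η (pairSpace M)) {X : VField ℍ M} {X' : VField 𝔹 N} (hX : IsChartSmooth X)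
    (hX' : IsChartSmooth X') (hXX : RestrictsTo ι X X') (f : Factor B m n) {p : Conf M N m n}
    (hp : p ∈ facSet ι f) (v : Fin (f.deg dχ) → EConf m n) :
    (lieDeriv (confField X X' m n) (factorForm ι χ η f)).val p v =
      (factorForm ι (fun b => lieDeriv X (χ b)) (lieDeriv (pairField X) η) f).val p v := by
  cases f with
  | leaf w b =>
    rw [factorForm_leaf hι, factorForm_leaf hι]
    exact lieDeriv_pullForm (contMDiff_pos hι w) isOpen_univ (hχ b)
      (isChartSmooth_confField hX hX') hX
      (fun q => (mfd_pos hι w q _).trans (vel_confField hXX q w)) (mem_univ _) v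
  | arrow i w =>
    rw [factorForm_arrow hι, factorForm_arrow hι]
    refine lieDeriv_pullForm (contMDiff_posPair hι i w) isOpen_pairSpace hη
      (isChartSmooth_confField hX hX') (isChartSmooth_pairField hX) (fun q => ?_) hp v
    refine (mfd_posPair hι i w q _).trans ?_
    exact Prod.ext rfl (vel_confField hXX q w)

end Factors

/-! ### Vector fields along the boundary -/

section Boundary

theorem mfd_extChartAt_injective [IsManifold I 1 P] (hx : x ∈ (Φ I c).source) :
    Injective (mfd I 𝓘(ℝ, E) (Φ I c) x) := by
  intro v w h
  have h1 := chartD_mfderiv ((Φ I c).map_source hx) v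
  have h2 := chartD_mfderiv ((Φ I c).map_source hx) w
  rw [(Φ I c).left_inv hx] at h1 h2
  rw [← h1, ← h2, h]

theorem chartD_injective [IsManifold I 1 P] (hy : y ∈ (Φ I c).target) :
    Injective (chartD I c y) := by
  intro v w h
  rw [← mfderiv_chartD hy v, ← mfderiv_chartD hy w, h]

theorem IsBoundaryInclusion.injective_fderivWithin_coordRep (hι : IsBoundaryInclusion ι) {b : N}
    {c : M} {y : E2} (hy : y ∈ (Φ 𝔹 b).target) (hc : ι ((Φ 𝔹 b).symm y) ∈ (Φ ℍ c).source) :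
    Injective (fderivWithin ℝ (coordRep 𝔹 ℍ ι b c) (range 𝔹) y) := by
  intro v w h
  rw [fderivWithin_coordRep ((hι.contMDiff _).mdifferentiableAt (by simp)) hy hc,
    fderivWithin_coordRep ((hι.contMDiff _).mdifferentiableAt (by simp)) hy hc] at h
  exact chartD_injective hy (hι.immersive _ (mfd_extChartAt_injective hc h))

theorem RestrictsTo.isChartSmooth (hι : IsBoundaryInclusion ι) {X : VField ℍ M} {X' : VField 𝔹 N}
    (hX : IsChartSmooth X) (hX' : RestrictsTo ι X X') : IsChartSmooth X' := by
  intro b y hy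
  set c := ι ((Φ 𝔹 b).symm y) with hc
  have hcs : ι ((Φ 𝔹 b).symm y) ∈ (Φ ℍ c).source := mem_extChartAt_source _
  set φ := coordRep 𝔹 ℍ ι b c with hφ
  have hφs : ContDiffWithinAt ℝ ∞ φ (range 𝔹) y := contDiffWithinAt_coordRep hι.contMDiff hy hcs
  obtain ⟨L, hL⟩ := LinearMap.exists_leftInverse_of_injective
    (fderivWithin ℝ φ (range 𝔹) y).toLinearMap
    (LinearMap.ker_eq_bot.2 (hι.injective_fderivWithin_coordRep hy hcs))
  let L' : E3 →L[ℝ] E2 := LinearMap.toContinuousLinearMap L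
  let A : E2 → E2 →L[ℝ] E2 := fun z => L'.comp (fderivWithin ℝ φ (range 𝔹) z)
  have hA : A y = ((ContinuousLinearEquiv.refl ℝ E2 : E2 ≃L[ℝ] E2) : E2 →L[ℝ] E2) := by
    ext1 v
    exact congrArg (fun T : E2 →ₗ[ℝ] E2 => T v) hL
  have hyr : y ∈ range 𝔹 := target_subset b hy
  have hAs : ContDiffWithinAt ℝ ∞ A (range 𝔹) y := contDiffWithinAt_const.clm_comp
      (hφs.fderivWithin_right (𝔹).uniqueDiffOn (by rfl) hyr)
  have hinv : ContDiffWithinAt ℝ ∞ (fun z => (A z).inverse (L' (vectorInChart X c (φ z))))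
      (range 𝔹) y := by
    have h1 : ContDiffAt ℝ ∞ ContinuousLinearMap.inverse (A y) := by
      rw [hA]
      exact contDiffAt_map_inverse _
    have h2 := h1.comp_contDiffWithinAt y hAs
    have h3 : ContDiffWithinAt ℝ ∞ (fun z => vectorInChart X c (φ z)) (range 𝔹) y := by
      have h4 : ContDiffWithinAt ℝ ∞ (vectorInChart X c) (range ℍ) (φ y) :=
        hX.contDiffWithinAt ((Φ ℍ c).map_source hcs)
      exact h4.comp y hφs fun z _ => mem_range_self _
    exact h2.clm_apply (contDiffWithinAt_const.clm_apply h3)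
  have hev : ∀ᶠ z in 𝓝[range 𝔹] y, (A z).inverse (L' (vectorInChart X c (φ z))) =
      vectorInChart X' b z := by
    have h1 : ∀ᶠ z in 𝓝[range 𝔹] y, A z ∈ range ((↑) : (E2 ≃L[ℝ] E2) → E2 →L[ℝ] E2) := by
      refine hAs.continuousWithinAt.eventually ?_
      rw [hA]
      exact ContinuousLinearEquiv.nhds _
    filter_upwards [h1, eventually_mem_chart hι.contMDiff.continuous isOpen_univ hy (mem_univ _)
      hcs] with z hz hz'
    have h2 : vectorInChart X c (φ z) = _ :=
      fderivWithin_coordRep_vector (I := 𝔹) (I' := ℍ) (X := X') (X' := X) hX'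
        ((hι.contMDiff _).mdifferentiableAt (by simp)) hz'.1 hz'.2.2
    rw [h2]
    change (A z).inverse (A z (vectorInChart X' b z)) = _
    obtain ⟨e, he⟩ := hz
    rw [← he, ContinuousLinearMap.inverse_equiv]
    exact e.symm_apply_apply _
  have := hinv.congr_of_eventuallyEq (hev.mono fun z hz => hz.symm)
    (hev.self_of_nhdsWithin hyr).symm
  exact this.mono (target_subset b)

theorem extChartAt_apply_zero_nonneg (c : M) {y : E3} (hy : y ∈ (Φ ℍ c).target) :
    0 ≤ y 0 := by
  have := target_subset c hy
  rw [range_modelWithCornersEuclideanHalfSpace] at this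
  exact this

theorem mem_boundary_iff {c x : M} (hx : x ∈ (Φ ℍ c).source) :
    x ∈ (ℍ).boundary M ↔ (Φ ℍ c x) 0 = 0 := by
  have h1 := (Φ ℍ c).map_source hx
  have hn : (1 : ℕ∞ω) ≠ 0 := one_ne_zero
  rw [extChartAt_source] at hx
  have h2 := (ℍ).isInteriorPoint_iff_of_mem_atlas hn (chart_mem_atlas (EuclideanHalfSpace 3) c) hx
  have h4 : (ℍ).IsInteriorPoint x ↔ Φ ℍ c x ∈ interior (range ℍ) :=
    h2.trans ⟨fun h => interior_mono (target_subset c) h, fun h =>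
      OpenPartialHomeomorph.mem_interior_extend_target _
        ((chartAt (EuclideanHalfSpace 3) c).map_source hx) h⟩
  rw [interior_range_modelWithCornersEuclideanHalfSpace] at h4
  change (ℍ).IsBoundaryPoint x ↔ _
  rw [← not_iff_not, ← (ℍ).isInteriorPoint_iff_not_isBoundaryPoint, h4]
  have h3 := extChartAt_apply_zero_nonneg c h1
  exact ⟨fun h => ne_of_gt h, fun h => lt_of_le_of_ne h3 (Ne.symm h)⟩

theorem RestrictsTo.vectorInChart_zero (hι : IsBoundaryInclusion ι)
    {X : VField ℍ M} {X' : VField 𝔹 N} (hX' : RestrictsTo ι X X') {c : M} {y : E3}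
    (hy : y ∈ (Φ ℍ c).target) (hy0 : y 0 = 0) : vectorInChart X c y 0 = 0 := by
  have hx := (Φ ℍ c).map_target hy
  have h1 : (Φ ℍ c).symm y ∈ (ℍ).boundary M := by
    rw [mem_boundary_iff hx, (Φ ℍ c).right_inv hy, hy0]
  rw [← hι.range_eq] at h1
  obtain ⟨b, hb⟩ := h1
  have hbt := mem_extChartAt_target (I := 𝔹) b
  have hbs : ι ((Φ 𝔹 b).symm (Φ 𝔹 b b)) ∈ (Φ ℍ c).source := by rwa [extChartAt_to_inv, hb]
  have h2 := fderivWithin_coordRep_vector (I := 𝔹) (I' := ℍ) (X := X') (X' := X) hX'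
    ((hι.contMDiff _).mdifferentiableAt (by simp)) hbt hbs
  have h3 : coordRep 𝔹 ℍ ι b c (Φ 𝔹 b b) = y := by
    rw [coordRep, extChartAt_to_inv, hb, (Φ ℍ c).right_inv hy]
  rw [h3] at h2
  have hd := (hasFDerivWithinAt_coordRep (I := 𝔹) (I' := ℍ)
    ((hι.contMDiff _).mdifferentiableAt (by simp)) hbt hbs).differentiableWithinAt
  have h5 := ((EuclideanSpace.proj (𝕜 := ℝ) (0 : Fin 3)).hasFDerivAt.comp_hasFDerivWithinAt
    (Φ 𝔹 b b) hd.hasFDerivWithinAt)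
  have h6 : HasFDerivWithinAt (fun z => (coordRep 𝔹 ℍ ι b c z) 0)
      (0 : E2 →L[ℝ] ℝ) (range 𝔹) (Φ 𝔹 b b) := by
    refine (hasFDerivWithinAt_const (0 : ℝ) _ _).congr_of_eventuallyEq ?_ ?_
    · filter_upwards [eventually_mem_chart hι.contMDiff.continuous isOpen_univ hbt (mem_univ _)
        hbs] with z hz
      refine (mem_boundary_iff hz.2.2).1 ?_
      rw [← hι.range_eq]
      exact mem_range_self _
    · rw [h3, hy0]
  have h7 := (uniqueDiffWithinAt_range hbt).eq h5 h6
  rw [h2]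
  exact congrArg (fun T : E2 →L[ℝ] ℝ => T (vectorInChart X' b (Φ 𝔹 b b))) h7

end Boundary

/-! ### Immersions in charts -/

section Immersions

variable [FiniteDimensional ℝ E] [IsManifold I ∞ P]

theorem fderivWithin_comp_symm {G : P → F} (hG : ContMDiff I 𝓘(ℝ, F) ∞ G) (hy : y ∈ (Φ I c).target)
    (v : E) : fderivWithin ℝ (fun y => G ((Φ I c).symm y)) (range I) y v =
      mfd I 𝓘(ℝ, F) G ((Φ I c).symm y) (chartD I c y v) := by
  have h1 := (mdifferentiableWithinAt_extChartAt_symm hy).hasMFDerivWithinAt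
  have h2 := ((hG ((Φ I c).symm y)).mdifferentiableAt (by simp)).hasMFDerivAt
  have h4 : HasFDerivWithinAt (fun y => G ((Φ I c).symm y))
      ((mfd I 𝓘(ℝ, F) G ((Φ I c).symm y)).comp (chartD I c y)) (range I) y :=
    (HasMFDerivAt.comp_hasMFDerivWithinAt (f := (Φ I c).symm) y h2 h1).hasFDerivWithinAt
  have h5 := h4.fderivWithin (uniqueDiffWithinAt_range hy)
  exact congrArg (fun T : E →L[ℝ] F => T v) h5

theorem contDiffWithinAt_map_comp_symm {G : P → F} (hG : ContMDiff I 𝓘(ℝ, F) ∞ G)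
    (hy : y ∈ (Φ I c).target) : ContDiffWithinAt ℝ ∞ (fun y => G ((Φ I c).symm y)) (range I) y :=
  contDiffWithinAt_coordRep (c' := G ((Φ I c).symm y)) hG hy (by simp)

theorem exists_bilipschitz_chart {G : P → F} (hG : ContMDiff I 𝓘(ℝ, F) ∞ G)
    (himm : ∀ x, Injective (mfd I 𝓘(ℝ, F) G x)) (c : P) :
    ∃ r > 0, ∃ C > 0, Metric.closedBall (Φ I c c) r ∩ range I ⊆ (Φ I c).target ∧
      (∀ ξ ∈ Metric.closedBall (Φ I c c) r ∩ range I,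
        ∀ ξ' ∈ Metric.closedBall (Φ I c c) r ∩ range I,
        ‖ξ - ξ'‖ ≤ C * ‖G ((Φ I c).symm ξ) - G ((Φ I c).symm ξ')‖ ∧
        ‖G ((Φ I c).symm ξ) - G ((Φ I c).symm ξ')‖ ≤ C * ‖ξ - ξ'‖) ∧
      ∀ ξ ∈ Metric.closedBall (Φ I c c) r ∩ range I, ∀ u : E,
        ‖u‖ ≤ C * ‖mfd I 𝓘(ℝ, F) G ((Φ I c).symm ξ) (chartD I c ξ u)‖ ∧
        ‖mfd I 𝓘(ℝ, F) G ((Φ I c).symm ξ) (chartD I c ξ u)‖ ≤ C * ‖u‖ := by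
  set g : E → F := fun y => G ((Φ I c).symm y) with hg
  set ξ₀ := Φ I c c
  have hξ₀ : ξ₀ ∈ (Φ I c).target := mem_extChartAt_target c
  have hr₀ : ξ₀ ∈ range I := target_subset c hξ₀
  set A := fderivWithin ℝ g (range I) ξ₀ with hA
  have hAinj : LinearMap.ker A.toLinearMap = ⊥ := by
    refine LinearMap.ker_eq_bot.2 fun v w h => ?_
    have h' : A v = A w := h
    rw [hA, fderivWithin_comp_symm hG hξ₀, fderivWithin_comp_symm hG hξ₀, chartD_self] at h'
    exact himm _ h'
  obtain ⟨K, hK, hKA⟩ := LinearMap.exists_antilipschitzWith A.toLinearMap hAinj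
  have hKA' : ∀ u, ‖u‖ ≤ K * ‖A u‖ := fun u => by
    have := hKA.le_mul_dist u 0
    simpa using this
  have hK' : (0 : ℝ) < K := hK
  have hcont : ContinuousWithinAt (fderivWithin ℝ g (range I)) (range I) ξ₀ :=
    ((contDiffWithinAt_map_comp_symm hG hξ₀).fderivWithin_right (m := 1) I.uniqueDiffOn
      (WithTop.coe_le_coe.2 le_top) hr₀).continuousWithinAt
  set ε : ℝ := (2 * K)⁻¹ with hε
  have hε0 : 0 < ε := by positivity
  have hev : ∀ᶠ ξ in 𝓝[range I] ξ₀, ξ ∈ (Φ I c).target ∧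
      ‖fderivWithin ℝ g (range I) ξ - A‖ ≤ ε := by
    filter_upwards [extChartAt_target_mem_nhdsWithin c, hcont.eventually (Metric.closedBall_mem_nhds A hε0)] with ξ hξ' hξ
    exact ⟨hξ', by simpa [dist_eq_norm] using hξ⟩
  obtain ⟨r, hr, hball⟩ := (nhdsWithin_hasBasis Metric.nhds_basis_closedBall _).eventually_iff.1 hev
  have hconv : Convex ℝ (Metric.closedBall ξ₀ r ∩ range I) :=
    (convex_closedBall _ _).inter I.convex_range
  have hlin : ∀ ξ ∈ Metric.closedBall ξ₀ r ∩ range I, ∀ ξ' ∈ Metric.closedBall ξ₀ r ∩ range I,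
      ‖g ξ' - g ξ - A (ξ' - ξ)‖ ≤ ε * ‖ξ' - ξ‖ := fun ξ hξ ξ' hξ' =>
    hconv.norm_image_sub_le_of_norm_hasFDerivWithin_le' (f := g)
      (fun z hz => (((contDiffWithinAt_map_comp_symm hG (hball hz).1).differentiableWithinAt
        (by simp)).hasFDerivWithinAt).mono inter_subset_right)
      (fun z hz => (hball hz).2) hξ hξ'
  refine ⟨r, hr, 2 * K + ‖A‖ + ε, by positivity, fun ξ hξ => (hball hξ).1, ?_, ?_⟩
  · intro ξ hξ ξ' hξ'
    have h1 := hlin ξ' hξ' ξ hξ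
    have h2 := hKA' (ξ - ξ')
    have h3 : ‖A (ξ - ξ')‖ ≤ ‖g ξ - g ξ'‖ + ε * ‖ξ - ξ'‖ := by
      calc ‖A (ξ - ξ')‖ = ‖(g ξ - g ξ') - (g ξ - g ξ' - A (ξ - ξ'))‖ := by congr 1; abel
        _ ≤ ‖g ξ - g ξ'‖ + ‖g ξ - g ξ' - A (ξ - ξ')‖ := norm_sub_le _ _
        _ ≤ _ := by gcongr
    have h4 : ‖ξ - ξ'‖ ≤ 2 * K * ‖g ξ - g ξ'‖ := by
      have : ‖ξ - ξ'‖ ≤ K * ‖g ξ - g ξ'‖ + K * ε * ‖ξ - ξ'‖ := by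
        refine h2.trans ((mul_le_mul_of_nonneg_left h3 hK'.le).trans_eq (by ring))
      have h5 : K * ε = 1 / 2 := by rw [hε]; field_simp
      rw [h5] at this
      linarith
    constructor
    · refine h4.trans ?_
      gcongr
      have := norm_nonneg A
      linarith
    · calc ‖g ξ - g ξ'‖ = ‖(g ξ - g ξ' - A (ξ - ξ')) + A (ξ - ξ')‖ := by congr 1; abel
        _ ≤ ε * ‖ξ - ξ'‖ + ‖A‖ * ‖ξ - ξ'‖ :=
          (norm_add_le _ _).trans (add_le_add h1 (A.le_opNorm _))
        _ ≤ _ := by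
          have := norm_nonneg (ξ - ξ')
          nlinarith
  · intro ξ hξ u
    rw [← fderivWithin_comp_symm hG (hball hξ).1]
    have h1 : ‖(fderivWithin ℝ g (range I) ξ - A) u‖ ≤ ε * ‖u‖ :=
      (ContinuousLinearMap.le_opNorm _ _).trans (by gcongr; exact (hball hξ).2)
    rw [sub_apply] at h1
    have h2 := hKA' u
    have h3 : ‖A u‖ ≤ ‖fderivWithin ℝ g (range I) ξ u‖ + ε * ‖u‖ := by
      calc ‖A u‖ = ‖fderivWithin ℝ g (range I) ξ u - (fderivWithin ℝ g (range I) ξ u - A u)‖ := by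
            congr 1; abel
        _ ≤ _ := (norm_sub_le _ _).trans (by gcongr)
    have h4 : ‖u‖ ≤ 2 * K * ‖fderivWithin ℝ g (range I) ξ u‖ := by
      have : ‖u‖ ≤ K * ‖fderivWithin ℝ g (range I) ξ u‖ + K * ε * ‖u‖ :=
        h2.trans ((mul_le_mul_of_nonneg_left h3 hK'.le).trans_eq (by ring))
      have h5 : K * ε = 1 / 2 := by rw [hε]; field_simp
      rw [h5] at this
      linarith
    constructor
    · refine h4.trans ?_
      gcongr
      have := norm_nonneg A
      linarith
    · calc ‖fderivWithin ℝ g (range I) ξ u‖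
          = ‖(fderivWithin ℝ g (range I) ξ u - A u) + A u‖ := by congr 1; abel
        _ ≤ ε * ‖u‖ + ‖A‖ * ‖u‖ := (norm_add_le _ _).trans (add_le_add h1 (A.le_opNorm _))
        _ ≤ _ := by
          have := norm_nonneg u
          nlinarith

end Immersions

/-! ### The measure of a volume form -/

theorem IsAlt.apply_comp_basis (h : IsAlt a) (b : Module.Basis (Fin k) ℝ V) (L : V →ₗ[ℝ] V) :
    a (fun i => L (b i)) = LinearMap.det L * a b := by
  obtain ⟨A, hA⟩ := h
  rw [hA, hA, A.eq_smul_basis_det b]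
  have := b.det_comp L b
  simp only [AlternatingMap.smul_apply, smul_eq_mul, b.det_self, mul_one] at this ⊢
  have h2 : b.det (fun i => L (b i)) = LinearMap.det L := this
  rw [h2, mul_comm]

section VolumeMeasure

variable {d : ℕ} {I : ModelWithCorners ℝ (EuclideanSpace ℝ (Fin d)) H} [IsManifold I ∞ P]
  {vol : PreForm I P d}

theorem measurableSet_target (c : P) : MeasurableSet (Φ I c).target := by
  rw [extChartAt_target]
  exact ((chartAt H c).open_target.preimage I.continuous_symm).measurableSet.inter
    I.isClosed_range.measurableSet

/-- The coefficient of a form of top degree in a chart. -/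
def coeffInChart (vol : PreForm I P d) (c : P) (y : EuclideanSpace ℝ (Fin d)) : ℝ :=
  formInChart vol c y fun a => EuclideanSpace.single a (1 : ℝ)

theorem basisFun_eq_single :
    (⇑(EuclideanSpace.basisFun (Fin d) ℝ).toBasis : Fin d → EuclideanSpace ℝ (Fin d)) =
      fun a => EuclideanSpace.single a (1 : ℝ) := by
  funext a
  simp

theorem coeffInChart_change (hvol : IsAlternatingOn vol U) {c' : P}
    {y : EuclideanSpace ℝ (Fin d)} (hy : y ∈ (Φ I c).target) (hyU : (Φ I c).symm y ∈ U)
    (hy' : (Φ I c).symm y ∈ (Φ I c').source) :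
    coeffInChart vol c y = (fderivWithin ℝ (coordRep I I id c c') (range I) y).det *
      coeffInChart vol c' (coordRep I I id c c' y) := by
  have h1 := formInChart_pullForm (I := I) (I' := I) (f := id) (θ := vol) (c := c) (c' := c')
    mdifferentiableAt_id hy hy' fun a => EuclideanSpace.single a (1 : ℝ)
  rw [pullForm_id] at h1
  have h2 : (Φ I c').symm (coordRep I I id c c' y) ∈ U := by
    change (Φ I c').symm (Φ I c' ((Φ I c).symm y)) ∈ U
    rwa [(Φ I c').left_inv hy']
  have h3 := (isAlt_formInChart hvol h2).apply_comp_basis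
    (EuclideanSpace.basisFun (Fin d) ℝ).toBasis
    (fderivWithin ℝ (coordRep I I id c c') (range I) y).toLinearMap
  rw [basisFun_eq_single] at h3
  exact h1.trans h3

variable [CompactSpace P] [MeasurableSpace P] [BorelSpace P]

theorem aemeasurable_symm (c : P) : AEMeasurable (Φ I c).symm (volume.restrict (Φ I c).target) :=
  (continuousOn_extChartAt_symm c).aemeasurable (measurableSet_target c)

theorem IsVolumeForm.continuousOn_coeffInChart (hvol : IsVolumeForm vol)
    (c : P) : ContinuousOn (coeffInChart vol c) (Φ I c).target := by
  have := (hvol.isFormOn.contDiffOn c fun a => EuclideanSpace.single a (1 : ℝ)).continuousOn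
  rwa [preimage_univ, inter_univ] at this

theorem bijOn_coordRep_id (c c' : P) : coordRep I I id c c' '' ((Φ I c).target ∩
      (Φ I c).symm ⁻¹' (Φ I c').source) = (Φ I c').target ∩ (Φ I c').symm ⁻¹' (Φ I c).source := by
  ext z
  constructor
  · rintro ⟨y, ⟨hy, hy'⟩, rfl⟩
    refine ⟨(Φ I c').map_source hy', ?_⟩
    change (Φ I c').symm (Φ I c' ((Φ I c).symm y)) ∈ (Φ I c).source
    rw [(Φ I c').left_inv hy']
    exact (Φ I c).map_target hy
  · rintro ⟨hz, hz'⟩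
    refine ⟨Φ I c ((Φ I c').symm z), ⟨(Φ I c).map_source hz', ?_⟩, ?_⟩
    · change (Φ I c).symm (Φ I c ((Φ I c').symm z)) ∈ (Φ I c').source
      rw [(Φ I c).left_inv hz']
      exact (Φ I c').map_target hz
    · change Φ I c' ((Φ I c).symm (Φ I c ((Φ I c').symm z))) = z
      rw [(Φ I c).left_inv hz', (Φ I c').right_inv hz]

theorem measurableSet_overlap (c : P) (hU : IsOpen U) :
    MeasurableSet ((Φ I c).target ∩ (Φ I c).symm ⁻¹' U) := by
  obtain ⟨O, hO, hO'⟩ := continuousOn_iff'.1 (continuousOn_extChartAt_symm (I := I) c) U hU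
  rw [inter_comm, hO']
  exact hO.measurableSet.inter (measurableSet_target c)

theorem lintegral_overlap (hvol : IsVolumeForm vol) (c c' : P)
    (g : P → ENNReal) : ∫⁻ y in (Φ I c').target ∩ (Φ I c').symm ⁻¹' (Φ I c).source,
        g ((Φ I c').symm y) * ENNReal.ofReal |coeffInChart vol c' y| =
      ∫⁻ y in (Φ I c).target ∩ (Φ I c).symm ⁻¹' (Φ I c').source,
        g ((Φ I c).symm y) * ENNReal.ofReal |coeffInChart vol c y| := by
  rw [← bijOn_coordRep_id, lintegral_image_eq_lintegral_abs_det_fderiv_mul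
    (f' := fun y => fderivWithin ℝ (coordRep I I id c c') (range I) y) volume
    (measurableSet_overlap c (isOpen_extChartAt_source c'))]
  · refine setLIntegral_congr_fun (measurableSet_overlap c (isOpen_extChartAt_source c')) ?_
    intro y hy
    have h1 : (Φ I c').symm (coordRep I I id c c' y) = (Φ I c).symm y := (Φ I c').left_inv hy.2
    simp only [h1]
    rw [coeffInChart_change hvol.isFormOn.alternating hy.1 (mem_univ _) hy.2, abs_mul,
      ENNReal.ofReal_mul (abs_nonneg _)]
    ring
  · intro y hy
    exact (hasFDerivWithinAt_coordRep mdifferentiableAt_id hy.1 hy.2).differentiableWithinAt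
      |>.hasFDerivWithinAt.mono fun z hz => target_subset c hz.1
  · intro y hy z hz h
    have h1 : (Φ I c').symm (coordRep I I id c c' y) = (Φ I c).symm y := (Φ I c').left_inv hy.2
    have h2 : (Φ I c').symm (coordRep I I id c c' z) = (Φ I c).symm z := (Φ I c').left_inv hz.2
    rw [h, h2] at h1
    rw [← (Φ I c).right_inv hy.1, ← (Φ I c).right_inv hz.1, h1]

open Classical in
/-- The number of chart domains of the cover that contain a point. -/
def chartCount (I : ModelWithCorners ℝ (EuclideanSpace ℝ (Fin d)) H) (x : P) : ℕ :=
  ((chartCover H P).filter fun c' => x ∈ (Φ I c').source).card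

theorem chartCount_pos (x : P) : 0 < chartCount I x := by
  classical
  have h : x ∈ ⋃ c ∈ chartCover H P, (chartAt H c).source := by
    rw [chartCover, Classical.choose_spec (exists_chartCover H P)]
    trivial
  simp only [mem_iUnion] at h
  obtain ⟨c, hc, hx⟩ := h
  refine Finset.card_pos.2 ⟨c, ?_⟩
  simp [hc, hx]

theorem measurable_chartCount : Measurable (chartCount I : P → ℕ) := by
  classical
  have : (chartCount I : P → ℕ) = fun x =>
      ∑ c ∈ chartCover H P, if x ∈ (Φ I c).source then 1 else 0 := by
    funext x
    simp [chartCount]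
  rw [this]
  exact Finset.measurable_fun_sum _ fun c _ =>
    Measurable.ite (isOpen_extChartAt_source c).measurableSet measurable_const measurable_const

theorem lintegral_volumeMeasure (hvol : IsVolumeForm vol) {g : P → ENNReal}
    (hg : Measurable g) :
    ∫⁻ x, g x ∂volumeMeasure vol = ∑ c ∈ chartCover H P, ∫⁻ y in (Φ I c).target,
      g ((Φ I c).symm y) *
        (ENNReal.ofReal |coeffInChart vol c y| * (chartCount I ((Φ I c).symm y) : ENNReal)⁻¹)
      := by
  classical
  unfold volumeMeasure
  rw [lintegral_finsetSum_measure]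
  refine Finset.sum_congr rfl fun c _ => ?_
  have hw : (fun y => ENNReal.ofReal
      (|formInChart vol c y fun a => EuclideanSpace.single a (1 : ℝ)| /
        ((chartCover H P).filter fun c' => (Φ I c).symm y ∈ (chartAt H c').source).card)) = fun y =>
      ENNReal.ofReal |coeffInChart vol c y| * (chartCount I ((Φ I c).symm y) : ENNReal)⁻¹ := by
    funext y
    have h1 : ((chartCover H P).filter fun c' => (Φ I c).symm y ∈ (chartAt H c').source).card =
        chartCount I ((Φ I c).symm y) := by
      simp only [chartCount, extChartAt_source]
    have h0 : (0 : ℝ) < chartCount I ((Φ I c).symm y) := Nat.cast_pos.2 (chartCount_pos _)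
    rw [h1, ENNReal.ofReal_div_of_pos h0, ENNReal.ofReal_natCast, ENNReal.div_eq_inv_mul, mul_comm]
    rfl
  rw [hw]
  have hm : AEMeasurable (fun y => ENNReal.ofReal |coeffInChart vol c y| *
        (chartCount I ((Φ I c).symm y) : ENNReal)⁻¹)
      (volume.restrict (Φ I c).target) := by
    refine AEMeasurable.mul ?_ ?_
    · exact (((hvol.continuousOn_coeffInChart c).aemeasurable
        (measurableSet_target c)).norm).ennreal_ofReal
    · refine AEMeasurable.inv ?_
      exact ((measurable_from_top (f := fun n : ℕ => (n : ENNReal))).comp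
        measurable_chartCount).comp_aemeasurable (aemeasurable_symm c)
  rw [lintegral_map' hg.aemeasurable ((aemeasurable_symm c).mono_ac
    (withDensity_absolutelyContinuous _ _))]
  refine (lintegral_withDensity_eq_lintegral_mul₀ hm
    (hg.comp_aemeasurable (aemeasurable_symm c))).trans ?_
  refine lintegral_congr fun y => ?_
  rw [Pi.mul_apply, mul_comm]
  rfl

theorem setLIntegral_volumeMeasure (hvol : IsVolumeForm vol) (c : P)
    {g : P → ENNReal} (hg : Measurable g) : ∫⁻ x in (Φ I c).source, g x ∂volumeMeasure vol =
      ∫⁻ y in (Φ I c).target, g ((Φ I c).symm y) * ENNReal.ofReal |coeffInChart vol c y| := by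
  classical
  have hs := (isOpen_extChartAt_source (I := I) c).measurableSet
  rw [← lintegral_indicator hs, lintegral_volumeMeasure hvol (hg.indicator hs)]
  have h1 : ∀ c' ∈ chartCover H P, ∫⁻ y in (Φ I c').target,
      (Φ I c).source.indicator g ((Φ I c').symm y) * (ENNReal.ofReal |coeffInChart vol c' y| *
          (chartCount I ((Φ I c').symm y) : ENNReal)⁻¹) =
      ∫⁻ y in (Φ I c).target, (Φ I c').source.indicator
        (fun x => g x * (chartCount I x : ENNReal)⁻¹) ((Φ I c).symm y) *
          ENNReal.ofReal |coeffInChart vol c y| := by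
    intro c' _
    have h2 : ∀ c c' : P, ∀ k : P → ENNReal, ∫⁻ y in (Φ I c').target,
        (Φ I c).source.indicator k ((Φ I c').symm y) * ENNReal.ofReal |coeffInChart vol c' y| =
        ∫⁻ y in (Φ I c').target ∩ (Φ I c').symm ⁻¹' (Φ I c).source,
          k ((Φ I c').symm y) * ENNReal.ofReal |coeffInChart vol c' y| := by
      intro c c' k
      have hm := measurableSet_overlap (I := I) c' (isOpen_extChartAt_source (I := I) c)
      rw [← lintegral_indicator (measurableSet_target c'), ← lintegral_indicator hm]
      refine lintegral_congr fun y => ?_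
      by_cases hy : y ∈ (Φ I c').target <;> by_cases hy' : (Φ I c').symm y ∈ (Φ I c).source <;>
        simp only [indicator, mem_inter_iff, mem_preimage, hy, hy', if_true, if_false, and_true,
          and_false, zero_mul]
    have h3 : ∀ y, (Φ I c).source.indicator g ((Φ I c').symm y) *
        (ENNReal.ofReal |coeffInChart vol c' y| * (chartCount I ((Φ I c').symm y) : ENNReal)⁻¹) =
        (Φ I c).source.indicator (fun x => g x * (chartCount I x : ENNReal)⁻¹)
          ((Φ I c').symm y) * ENNReal.ofReal |coeffInChart vol c' y| := by
      intro y
      by_cases hy' : (Φ I c').symm y ∈ (Φ I c).source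
      · simp only [indicator, hy', if_true]; ring
      · simp only [indicator, hy', if_false, zero_mul]
    simp only [h3]
    rw [h2, h2]
    exact lintegral_overlap hvol c c' fun x => g x * (chartCount I x : ENNReal)⁻¹
  rw [Finset.sum_congr rfl h1, ← lintegral_finsetSum']
  · refine lintegral_congr fun y => ?_
    set x := (Φ I c).symm y
    have h4 : ∑ c' ∈ chartCover H P, (Φ I c').source.indicator
        (fun x => g x * (chartCount I x : ENNReal)⁻¹) x = g x := by
      simp only [indicator]
      rw [← Finset.sum_filter, Finset.sum_const, nsmul_eq_mul]
      change (chartCount I x : ENNReal) * _ = _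
      rw [mul_comm, mul_assoc, ENNReal.inv_mul_cancel, mul_one]
      · exact_mod_cast (chartCount_pos (I := I) x).ne'
      · exact ENNReal.natCast_ne_top _
    rw [← Finset.sum_mul, h4]
  · intro c' _
    refine AEMeasurable.mul ?_ ?_
    · refine Measurable.comp_aemeasurable (g := (Φ I c').source.indicator
        fun x => g x * (chartCount I x : ENNReal)⁻¹) ?_ (aemeasurable_symm c)
      refine Measurable.indicator ?_ (isOpen_extChartAt_source c').measurableSet
      exact hg.mul (Measurable.inv ((measurable_from_top (f := fun n : ℕ => (n : ENNReal))).comp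
        measurable_chartCount))
    · exact (((hvol.continuousOn_coeffInChart c).aemeasurable
        (measurableSet_target c)).norm).ennreal_ofReal

end VolumeMeasure

/-! ### Singular kernels -/

/-- The kernel `|a - b|^{-κ}`, with the value `∞` on the diagonal if `κ > 0`. -/
def invDist {F : Type*} [NormedAddCommGroup F] (κ : ℝ) (a b : F) : ENNReal :=
  (ENNReal.ofReal ‖a - b‖) ^ (-κ)

theorem invDist_comm {F : Type*} [NormedAddCommGroup F] (κ : ℝ) (a b : F) :
    invDist κ a b = invDist κ b a := by
  rw [invDist, invDist, norm_sub_rev]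

theorem rpow_neg_le_of_le_mul {κ : ℝ} (hκ : 0 ≤ κ) {x y D : ENNReal} (hD : D ≠ 0) (hD' : D ≠ ⊤)
    (h : x ≤ D * y) : y ^ (-κ) ≤ D ^ κ * x ^ (-κ) := by
  have h1 : x ^ κ ≤ D ^ κ * y ^ κ := by
    rw [← ENNReal.mul_rpow_of_nonneg _ _ hκ]
    exact ENNReal.rpow_le_rpow h hκ
  have h2 : D ^ κ ≠ 0 := by simp [ENNReal.rpow_eq_zero_iff, hD, hD']
  have h3 : D ^ κ ≠ ⊤ := ENNReal.rpow_ne_top_of_nonneg hκ hD'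
  rw [ENNReal.rpow_neg, ENNReal.rpow_neg]
  calc (y ^ κ)⁻¹ = D ^ κ * (D ^ κ * y ^ κ)⁻¹ := by
        rw [ENNReal.mul_inv (Or.inl h2) (Or.inl h3), ← mul_assoc, ENNReal.mul_inv_cancel h2 h3,
          one_mul]
    _ ≤ D ^ κ * (x ^ κ)⁻¹ := by
        gcongr

theorem lintegral_ball_rpow_neg_lt_top {d : ℕ} [NeZero d] {κ : ℝ} (hκ : κ < d) (R : ℝ) :
    ∫⁻ y in Metric.ball (0 : EuclideanSpace ℝ (Fin d)) R, (ENNReal.ofReal ‖y‖) ^ (-κ) < ⊤ := by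
  have hd : Module.finrank ℝ (EuclideanSpace ℝ (Fin d)) = d := by simp
  have hd1 : 1 ≤ d := Nat.one_le_iff_ne_zero.2 (NeZero.ne d)
  have hnt : Nontrivial (EuclideanSpace ℝ (Fin d)) := by
    apply Module.nontrivial_of_finrank_pos (R := ℝ)
    omega
  have h1 : IntegrableOn (fun y : EuclideanSpace ℝ (Fin d) => (fun s : ℝ => s ^ (-κ)) ‖y‖)
      (Metric.ball 0 R) := by
    rw [integrableOn_fun_norm_addHaar (volume : Measure (EuclideanSpace ℝ (Fin d)))
      (f := fun s : ℝ => s ^ (-κ)), hd]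
    rcases le_or_gt R 0 with hR | hR
    · simp [Ioo_eq_empty_of_le hR]
    have h2 : IntegrableOn (fun s : ℝ => s ^ ((d : ℝ) - 1 - κ)) (Ioo 0 R) :=
      (intervalIntegral.integrableOn_Ioo_rpow_iff hR).2 (by linarith)
    refine h2.congr_fun (fun s hs => ?_) measurableSet_Ioo
    simp only [smul_eq_mul]
    rw [← Real.rpow_natCast, ← Real.rpow_add hs.1, Nat.cast_sub hd1, Nat.cast_one]
    congr 1
  have h3 := h1.2
  refine lt_of_le_of_lt ?_ h3
  refine lintegral_mono_ae ?_
  have h4 : ∀ᵐ y ∂(volume : Measure (EuclideanSpace ℝ (Fin d))).restrict (Metric.ball 0 R),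
      y ≠ 0 := by
    refine ae_restrict_of_ae ?_
    rw [ae_iff]
    simp
  filter_upwards [h4] with y hy
  have hy' : 0 < ‖y‖ := norm_pos_iff.2 hy
  rw [ENNReal.ofReal_rpow_of_pos hy', Real.enorm_eq_ofReal (Real.rpow_nonneg hy'.le _)]

section Regularity

variable {d : ℕ} {I : ModelWithCorners ℝ (EuclideanSpace ℝ (Fin d)) H} [IsManifold I ∞ P]
  [CompactSpace P] [MeasurableSpace P] [BorelSpace P] [MeasurableSpace F] [BorelSpace F]
  {vol : PreForm I P d}

/-- The points of the chart domain at `c` that are mapped to the ball of radius `r`. -/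
def chartBall (I : ModelWithCorners ℝ (EuclideanSpace ℝ (Fin d)) H) (c : P) (r : ℝ) : Set P :=
  (Φ I c).source ∩ Φ I c ⁻¹' Metric.ball (Φ I c c) r

theorem isOpen_chartBall (c : P) (r : ℝ) : IsOpen (chartBall I c r) :=
  (continuousOn_extChartAt c).isOpen_inter_preimage (isOpen_extChartAt_source c) Metric.isOpen_ball

theorem mem_chartBall_self (c : P) {r : ℝ} (hr : 0 < r) : c ∈ chartBall I c r :=
  ⟨mem_extChartAt_source c, Metric.mem_ball_self hr⟩

theorem isCompact_closedBall_inter_range (ξ : EuclideanSpace ℝ (Fin d)) (r : ℝ) :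
    IsCompact (Metric.closedBall ξ r ∩ range I) :=
  (isCompact_closedBall _ _).inter_right I.isClosed_range

theorem setLIntegral_chartBall_le [NeZero d] (hvol : IsVolumeForm vol)
    {G : P → F} (hG : Continuous G) {κ : ℝ} (hκ : 0 ≤ κ) (hκd : κ < d) (c : P) {r C : ℝ}
    (hr : 0 < r) (hC : 0 < C) (hsub : Metric.closedBall (Φ I c c) r ∩ range I ⊆ (Φ I c).target)
    (hG' : ∀ ξ ∈ Metric.closedBall (Φ I c c) r ∩ range I,
        ∀ ξ' ∈ Metric.closedBall (Φ I c c) r ∩ range I,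
        ‖ξ - ξ'‖ ≤ C * ‖G ((Φ I c).symm ξ) - G ((Φ I c).symm ξ')‖) :
    ∃ A : ENNReal, A ≠ ⊤ ∧ ∀ a : F,
      ∫⁻ x in chartBall I c r, invDist κ (G x) a ∂volumeMeasure vol ≤ A := by
  set ξ₀ := Φ I c c with hξ₀
  set K := Metric.closedBall ξ₀ r ∩ range I with hK
  have hKc : IsCompact K := isCompact_closedBall_inter_range _ _
  have hξ₀K : ξ₀ ∈ K := ⟨Metric.mem_closedBall_self hr.le, mem_range_self _⟩
  obtain ⟨V, hV⟩ := hKc.exists_bound_of_continuousOn ((hvol.continuousOn_coeffInChart c).mono hsub)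
  have hV0 : 0 ≤ V := (norm_nonneg _).trans (hV ξ₀ hξ₀K)
  set D : ENNReal := ENNReal.ofReal (2 * C) with hD
  have hD0 : D ≠ 0 := by
    rw [hD]
    exact (ENNReal.ofReal_pos.2 (by positivity)).ne'
  refine ⟨ENNReal.ofReal V * (D ^ κ *
    ∫⁻ y in Metric.ball (0 : EuclideanSpace ℝ (Fin d)) (2 * r + 1),
      (ENNReal.ofReal ‖y‖) ^ (-κ)), ?_, fun a => ?_⟩
  · exact ENNReal.mul_ne_top ENNReal.ofReal_ne_top (ENNReal.mul_ne_top
      (ENNReal.rpow_ne_top_of_nonneg hκ ENNReal.ofReal_ne_top)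
      (lintegral_ball_rpow_neg_lt_top hκd _).ne)
  have hgc : ContinuousOn (fun ξ => ‖G ((Φ I c).symm ξ) - a‖) K :=
    ((hG.comp_continuousOn ((continuousOn_extChartAt_symm c).mono hsub)).sub
      continuousOn_const).norm
  obtain ⟨ξ', hξ'K, hmin⟩ := hKc.exists_isMinOn ⟨ξ₀, hξ₀K⟩ hgc
  have hkey : ∀ ξ ∈ K, invDist κ (G ((Φ I c).symm ξ)) a ≤
      D ^ κ * (ENNReal.ofReal ‖ξ - ξ'‖) ^ (-κ) := by
    intro ξ hξ
    refine rpow_neg_le_of_le_mul hκ hD0 ENNReal.ofReal_ne_top ?_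
    rw [hD, ← ENNReal.ofReal_mul (by positivity)]
    refine ENNReal.ofReal_le_ofReal ?_
    have h1 := hG' ξ hξ ξ' hξ'K
    have h2 : ‖G ((Φ I c).symm ξ') - a‖ ≤ ‖G ((Φ I c).symm ξ) - a‖ := hmin hξ
    have h3 : ‖G ((Φ I c).symm ξ) - G ((Φ I c).symm ξ')‖ ≤ 2 * ‖G ((Φ I c).symm ξ) - a‖ := by
      calc _ = ‖(G ((Φ I c).symm ξ) - a) - (G ((Φ I c).symm ξ') - a)‖ := by
            congr 1; abel
        _ ≤ _ := (norm_sub_le _ _).trans (by linarith)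
    calc ‖ξ - ξ'‖ ≤ _ := h1
      _ ≤ C * (2 * ‖G ((Φ I c).symm ξ) - a‖) := by gcongr
      _ = _ := by ring
  have hms : MeasurableSet (chartBall I c r) := (isOpen_chartBall c r).measurableSet
  have hmeas : Measurable fun x => invDist κ (G x) a :=
    ((hG.measurable.sub_const a).norm.ennreal_ofReal).pow_const _
  have h1 : ∫⁻ x in chartBall I c r, invDist κ (G x) a ∂volumeMeasure vol = ∫⁻ x in (Φ I c).source,
        (chartBall I c r).indicator (fun x => invDist κ (G x) a) x ∂volumeMeasure vol := by
    have hss : chartBall I c r ⊆ (Φ I c).source := inter_subset_left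
    rw [setLIntegral_indicator hms, inter_eq_left.2 hss]
  rw [h1, setLIntegral_volumeMeasure hvol c (hmeas.indicator hms)]
  have hKm : MeasurableSet K := hKc.measurableSet
  calc _ ≤ ∫⁻ y in (Φ I c).target, K.indicator
          (fun ξ => (D ^ κ * (ENNReal.ofReal ‖ξ - ξ'‖) ^ (-κ)) * ENNReal.ofReal V) y := by
        refine setLIntegral_mono' (measurableSet_target c) fun y hy => ?_
        by_cases hyK : (Φ I c).symm y ∈ chartBall I c r
        · have hyK' : y ∈ K := by
            have := hyK.2
            rw [mem_preimage, (Φ I c).right_inv hy] at this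
            exact ⟨Metric.ball_subset_closedBall this, target_subset c hy⟩
          rw [indicator_of_mem hyK, indicator_of_mem hyK']
          gcongr
          · exact hkey y hyK'
          · exact hV y hyK'
        · rw [indicator_of_notMem hyK, zero_mul]
          exact zero_le
    _ ≤ ∫⁻ y, K.indicator
          (fun ξ => (D ^ κ * (ENNReal.ofReal ‖ξ - ξ'‖) ^ (-κ)) * ENNReal.ofReal V) y :=
        setLIntegral_le_lintegral _ _
    _ ≤ ∫⁻ y, (fun z => (Metric.ball 0 (2 * r + 1)).indicator (fun ξ =>
          (D ^ κ * (ENNReal.ofReal ‖ξ‖) ^ (-κ)) * ENNReal.ofReal V) z) (y - ξ') := by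
        refine lintegral_mono fun y => ?_
        by_cases hyK : y ∈ K
        · have hb : y - ξ' ∈ Metric.ball (0 : EuclideanSpace ℝ (Fin d)) (2 * r + 1) := by
            rw [mem_ball_zero_iff, ← dist_eq_norm]
            have := dist_triangle_right y ξ' ξ₀
            have h1 : dist y ξ₀ ≤ r := hyK.1
            have h2 : dist ξ' ξ₀ ≤ r := hξ'K.1
            linarith
          simp only [indicator_of_mem hyK, indicator_of_mem hb, le_refl]
        · rw [indicator_of_notMem hyK]
          exact zero_le
    _ = ∫⁻ z, (Metric.ball 0 (2 * r + 1)).indicator (fun ξ =>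
          (D ^ κ * (ENNReal.ofReal ‖ξ‖) ^ (-κ)) * ENNReal.ofReal V) z :=
        lintegral_sub_right_eq_self _ ξ'
    _ = _ := by
        have hm : Measurable fun ξ : EuclideanSpace ℝ (Fin d) => (ENNReal.ofReal ‖ξ‖) ^ (-κ) :=
          measurable_norm.ennreal_ofReal.pow_const _
        rw [lintegral_indicator measurableSet_ball,
          lintegral_mul_const _ (hm.const_mul _), lintegral_const_mul _ hm, mul_comm]

/-- The measure of a volume form on a compact manifold is upper regular, with respect to the
distance of the ambient space of an immersion. -/
theorem exists_lintegral_invDist_le [NeZero d] (hvol : IsVolumeForm vol)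
    {G : P → F} (hG : ContMDiff I 𝓘(ℝ, F) ∞ G) (himm : ∀ x, Injective (mfd I 𝓘(ℝ, F) G x))
    {κ : ℝ} (hκ : 0 ≤ κ) (hκd : κ < d) :
    ∃ A : ENNReal, A ≠ ⊤ ∧ ∀ a : F, ∫⁻ x, invDist κ (G x) a ∂volumeMeasure vol ≤ A := by
  choose r hr C hC hsub hG' _ using exists_bilipschitz_chart hG himm
  choose A hA hA' using fun c => setLIntegral_chartBall_le hvol hG.continuous hκ hκd c (hr c) (hC c)
    (hsub c) fun ξ hξ ξ' hξ' => (hG' c ξ hξ ξ' hξ').1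
  obtain ⟨s, hs⟩ := isCompact_univ.elim_nhds_subcover (fun c : P => chartBall I c (r c))
    fun c _ => (isOpen_chartBall c _).mem_nhds (mem_chartBall_self c (hr c))
  refine ⟨∑ c ∈ s, A c, ENNReal.sum_ne_top.2 fun c _ => hA c, fun a => ?_⟩
  have hmeas : Measurable fun x => invDist κ (G x) a :=
    ((hG.continuous.measurable.sub_const a).norm.ennreal_ofReal).pow_const _
  calc ∫⁻ x, invDist κ (G x) a ∂volumeMeasure vol
      ≤ ∫⁻ x, ∑ c ∈ s, (chartBall I c (r c)).indicator (fun x => invDist κ (G x) a) x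
          ∂volumeMeasure vol := by
        refine lintegral_mono fun x => ?_
        obtain ⟨c, hc, hx⟩ := mem_iUnion₂.1 (hs.2 (mem_univ x))
        refine le_trans ?_ (Finset.single_le_sum (f := fun c =>
          (chartBall I c (r c)).indicator (fun x => invDist κ (G x) a) x) (fun _ _ => zero_le) hc)
        simp only [indicator_of_mem hx, le_refl]
    _ = ∑ c ∈ s, ∫⁻ x in chartBall I c (r c), invDist κ (G x) a ∂volumeMeasure vol := by
        rw [lintegral_finsetSum _ fun c _ => hmeas.indicator (isOpen_chartBall c _).measurableSet]
        exact Finset.sum_congr rfl fun c _ =>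
          lintegral_indicator (isOpen_chartBall c _).measurableSet _
    _ ≤ _ := Finset.sum_le_sum fun c _ => hA' c a

theorem isFinite_volumeMeasure [NeZero d] [T2Space P]
    (hvol : IsVolumeForm vol) : IsFiniteMeasure (volumeMeasure vol) := by
  obtain ⟨q, G, hG, -, hinj⟩ := exists_embedding_euclidean_of_compact (I := I) (M := P)
  obtain ⟨A, hA, hA'⟩ := exists_lintegral_invDist_le hvol hG hinj le_rfl
    (Nat.cast_pos.2 (NeZero.pos d))
  refine ⟨lt_of_le_of_lt ?_ (lt_top_iff_ne_top.2 hA)⟩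
  simpa [invDist] using hA' 0

end Regularity

/-! ### Integration in charts -/

section TopForms

variable {d : ℕ} {I : ModelWithCorners ℝ (EuclideanSpace ℝ (Fin d)) H} [IsManifold I ∞ P]
  {vol : PreForm I P d}

/-- The quotient of two forms of top degree. -/
def topRatio (vol θ : PreForm I P d) (x : P) : ℝ :=
  coeffInChart θ x (Φ I x x) / coeffInChart vol x (Φ I x x)

theorem topRatio_eq {θ : PreForm I P d} (hvol : IsVolumeForm vol) (hθ : IsAlternatingOn θ U)
    (hx : x ∈ (Φ I c).source) (hxU : x ∈ U) : coeffInChart vol c (Φ I c x) ≠ 0 ∧ topRatio vol θ x =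
      coeffInChart θ c (Φ I c x) / coeffInChart vol c (Φ I c x) := by
  have h1 : coordRep I I id x c (Φ I x x) = Φ I c x := by
    simp only [coordRep, id, extChartAt_to_inv]
  have h2 := coeffInChart_change (c := x) (c' := c) hvol.isFormOn.alternating
    (mem_extChartAt_target x) (mem_univ _) (by rwa [extChartAt_to_inv])
  have h3 := coeffInChart_change (c := x) (c' := c) hθ
    (mem_extChartAt_target x) (by rwa [extChartAt_to_inv]) (by rwa [extChartAt_to_inv])
  have h4 : coeffInChart vol x (Φ I x x) ≠ 0 := by
    have := hvol.ne_zero x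
    rw [coeffInChart, formInChart_self]
    exact this
  rw [h1] at h2 h3
  rw [h2] at h4
  obtain ⟨h5, h6⟩ := mul_ne_zero_iff.1 h4
  refine ⟨h6, ?_⟩
  rw [topRatio, h2, h3, mul_div_mul_left _ _ h5]

theorem continuous_topRatio {θ : PreForm I P d} (hvol : IsVolumeForm vol) (hθ : IsFormOn 0 θ univ) :
    Continuous (topRatio vol θ) := by
  have hco (c : P) {θ : PreForm I P d} (hθ : IsFormOn 0 θ univ) :
      ContinuousOn (coeffInChart θ c) (Φ I c).target := by
    have := (hθ.contDiffOn c fun a => EuclideanSpace.single a (1 : ℝ)).continuousOn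
    rwa [preimage_univ, inter_univ] at this
  refine continuous_iff_continuousAt.2 fun c => ?_
  have h1 : ContinuousOn (fun x => coeffInChart θ c (Φ I c x) /
      coeffInChart vol c (Φ I c x)) (Φ I c).source := by
    refine ContinuousOn.div ?_ ?_ fun x hx => (topRatio_eq hvol hθ.alternating hx (mem_univ _)).1
    · exact (hco c hθ).comp (continuousOn_extChartAt c) fun x hx => (Φ I c).map_source hx
    · exact (hco c (hvol.isFormOn.of_le (by simp))).comp (continuousOn_extChartAt c)
        fun x hx => (Φ I c).map_source hx
  exact (h1.congr fun x hx => (topRatio_eq hvol hθ.alternating hx (mem_univ _)).2).continuousAt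
    (extChartAt_source_mem_nhds c)

variable [CompactSpace P] [MeasurableSpace P] [BorelSpace P]

theorem aemeasurable_density (hvol : IsVolumeForm vol) (c : P) :
    AEMeasurable (fun y => ENNReal.ofReal |coeffInChart vol c y|)
      (volume.restrict (Φ I c).target) :=
  (((hvol.continuousOn_coeffInChart c).aemeasurable (measurableSet_target c)).norm).ennreal_ofReal

theorem restrict_volumeMeasure (hvol : IsVolumeForm vol) (c : P) :
    (volumeMeasure vol).restrict (Φ I c).source =
      Measure.map (Φ I c).symm ((volume.restrict (Φ I c).target).withDensity
        fun y => ENNReal.ofReal |coeffInChart vol c y|) := by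
  refine Measure.ext fun s hs => ?_
  have hm : Measurable (s.indicator (1 : P → ENNReal)) := measurable_one.indicator hs
  rw [← lintegral_indicator_one hs, setLIntegral_volumeMeasure hvol c hm,
    ← lintegral_indicator_one hs, lintegral_map' hm.aemeasurable
      ((aemeasurable_symm c).mono_ac (withDensity_absolutelyContinuous _ _))]
  refine Eq.symm ((lintegral_withDensity_eq_lintegral_mul₀ (aemeasurable_density hvol c)
    (hm.comp_aemeasurable (aemeasurable_symm c))).trans ?_)
  refine lintegral_congr fun y => ?_
  rw [Pi.mul_apply, mul_comm]
  rfl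

theorem setIntegral_volumeMeasure (hvol : IsVolumeForm vol) (c : P)
    {g : P → ℝ} (hg : Measurable g) : ∫ x in (Φ I c).source, g x ∂volumeMeasure vol =
      ∫ y in (Φ I c).target, |coeffInChart vol c y| * g ((Φ I c).symm y) := by
  rw [restrict_volumeMeasure hvol, integral_map
    ((aemeasurable_symm c).mono_ac (withDensity_absolutelyContinuous _ _))
    hg.aestronglyMeasurable, integral_withDensity_eq_integral_toReal_smul₀
    (aemeasurable_density hvol c) (ae_of_all _ fun _ => ENNReal.ofReal_lt_top)]
  refine integral_congr_ae (ae_of_all _ fun y => ?_)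
  simp only [ENNReal.toReal_ofReal (abs_nonneg _), smul_eq_mul]

end TopForms

/-! ### The divergence theorem on a half-space -/

theorem mem_range_halfSpace {y : E3} : y ∈ range ℍ ↔ 0 ≤ y 0 := by
  rw [range_modelWithCornersEuclideanHalfSpace]
  rfl

theorem integral_divergence_halfSpace {u : E3 → E3} (hu : ContDiffOn ℝ 1 u (range ℍ))
    {R : ℝ} (hR : ∀ y, R ≤ ‖y‖ → u y = 0) (h0 : ∀ y, y 0 = 0 → u y 0 = 0) :
    ∫ y in range ℍ, ∑ a : Fin 3, fderivWithin ℝ u (range ℍ) y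
      (EuclideanSpace.single a (1 : ℝ)) a = 0 := by
  set S : Set E3 := range ℍ with hS
  have hSu : UniqueDiffOn ℝ S := (ℍ).uniqueDiffOn
  have hSc : IsClosed S := (ℍ).isClosed_range
  set R' : ℝ := |R| + 1 with hR'
  have hRR : R < R' := by rw [hR']; linarith [le_abs_self R]
  have hR0 : 0 < R' := by positivity
  let T : (Fin 3 → ℝ) ≃L[ℝ] E3 := (EuclideanSpace.equiv (Fin 3) ℝ).symm
  have hT (x : Fin 3 → ℝ) (i : Fin 3) : T x i = x i := rfl
  have hTn (x : Fin 3 → ℝ) (i : Fin 3) : |x i| ≤ ‖T x‖ := by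
    have := EuclideanSpace.norm_eq (T x)
    have h2 := PiLp.norm_apply_le (T x) i
    simpa [hT] using h2
  let f : (Fin 3 → ℝ) → Fin 3 → ℝ := fun x => T.symm (u (T x))
  let f' : (Fin 3 → ℝ) → (Fin 3 → ℝ) →L[ℝ] (Fin 3 → ℝ) := fun x =>
    (T.symm : E3 →L[ℝ] Fin 3 → ℝ).comp ((fderivWithin ℝ u S (T x)).comp (T : (Fin 3 → ℝ) →L[ℝ] E3))
  let D : E3 → ℝ := fun y => ∑ a : Fin 3, fderivWithin ℝ u S y (EuclideanSpace.single a (1 : ℝ)) a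
  have hDf (x : Fin 3 → ℝ) : D (T x) = ∑ i, f' x (Pi.single i 1) i := rfl
  have hDc : ContinuousOn D S := by
    refine continuousOn_finsetSum _ fun a _ => ?_
    have := (hu.continuousOn_fderivWithin hSu le_rfl).clm_apply
      (continuousOn_const (c := (EuclideanSpace.single a (1 : ℝ) : E3)))
    exact (EuclideanSpace.proj (𝕜 := ℝ) a).continuous.comp_continuousOn this
  have hD0 (y : E3) (hy : R' ≤ ‖y‖) : D y = 0 := by
    have h1 : u =ᶠ[𝓝 y] fun _ => 0 := by
      have : ∀ᶠ z in 𝓝 y, R < ‖z‖ :=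
        continuous_norm.continuousAt.eventually (lt_mem_nhds (hRR.trans_le hy))
      filter_upwards [this] with z hz using hR z hz.le
    have h2 : fderivWithin ℝ u S y = 0 := by
      rw [(h1.filter_mono nhdsWithin_le_nhds).fderivWithin_eq h1.self_of_nhds]
      simp
    simp [D, h2]
  let a : Fin 3 → ℝ := fun i => if i = 0 then 0 else -R'
  let b : Fin 3 → ℝ := fun _ => R'
  have ha0 : a 0 = 0 := rfl
  have hab : a ≤ b := fun i => by
    change (if i = 0 then 0 else -R') ≤ R'
    split_ifs <;> linarith
  have hbox : ∀ x ∈ Icc a b, T x ∈ S := fun x hx => mem_range_halfSpace.2 (hx.1 0)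
  have hdiv := integral_divergence_of_hasFDerivAt_off_countable a b hab f f' ∅ countable_empty
    (T.symm.continuous.comp_continuousOn (hu.continuousOn.comp T.continuous.continuousOn hbox))
    (fun x hx => by
      have h1 : S ∈ 𝓝 (T x) := by
        have h2 : {y : E3 | 0 < y 0} ∈ 𝓝 (T x) :=
          (isOpen_lt continuous_const (EuclideanSpace.proj (𝕜 := ℝ) (0 : Fin 3)).continuous).mem_nhds
            (hx.1 0 (mem_univ _)).1
        exact Filter.mem_of_superset h2 fun y hy => mem_range_halfSpace.2 (le_of_lt hy)
      have h3 : HasFDerivAt u (fderivWithin ℝ u S (T x)) (T x) :=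
        ((hu.differentiableOn one_ne_zero _ (mem_of_mem_nhds h1)).hasFDerivWithinAt).hasFDerivAt h1
      exact (T.symm : E3 →L[ℝ] Fin 3 → ℝ).hasFDerivAt.comp x
        (h3.comp x (T : (Fin 3 → ℝ) →L[ℝ] E3).hasFDerivAt))
    (by
      refine ContinuousOn.integrableOn_compact isCompact_Icc ?_
      exact hDc.comp T.continuous.continuousOn hbox)
  have hu0 (x : Fin 3 → ℝ) (i : Fin 3) (h : R' ≤ |x i|) : f x i = 0 := by
    have : u (T x) = 0 := hR _ (hRR.le.trans (h.trans (hTn x i)))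
    change T.symm (u (T x)) i = 0
    rw [this]
    simp
  rw [Finset.sum_eq_zero] at hdiv
  · have hemb : MeasurableEmbedding (T : (Fin 3 → ℝ) → E3) := T.toHomeomorph.measurableEmbedding
    have hpres : MeasurePreserving (T : (Fin 3 → ℝ) → E3) volume volume :=
      PiLp.volume_preserving_toLp (Fin 3)
    have h1 := hpres.setIntegral_preimage_emb hemb D S
    change ∫ y in S, D y = 0
    rw [← h1, ← hdiv]
    refine setIntegral_eq_of_subset_of_forall_sdiff_eq_zero (hSc.measurableSet.preimage hemb.measurable)
      hbox fun x hx => hD0 _ ?_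
    by_contra hlt
    rw [not_le] at hlt
    refine hx.2 ⟨fun i => ?_, fun i => ?_⟩
    · change (if i = 0 then 0 else -R') ≤ x i
      split_ifs with hi
      · subst hi
        exact mem_range_halfSpace.1 hx.1
      · exact (abs_le.1 ((hTn x i).trans hlt.le)).1
    · exact (abs_le.1 ((hTn x i).trans hlt.le)).2
  · intro i _
    have hfront : ∀ x : Fin 2 → ℝ, f (i.insertNth (b i) x) i = 0 := fun x =>
      hu0 _ i (by simp [b, le_abs_self])
    have hback : ∀ x : Fin 2 → ℝ, f (i.insertNth (a i) x) i = 0 := fun x => by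
      by_cases hi : i = 0
      · subst hi
        refine h0 _ ?_
        change (Fin.insertNth 0 (a 0) x : Fin 3 → ℝ) 0 = 0
        rw [Fin.insertNth_apply_same, ha0]
      · refine hu0 _ i ?_
        rw [Fin.insertNth_apply_same]
        simp [a, hi, le_abs_self]
    simp only [hfront, hback, integral_zero, sub_self]

/-! ### Lie derivatives of forms of top degree -/

theorem IsAlt.apply_update_basis (h : IsAlt a) (b : Module.Basis (Fin k) ℝ V) (i : Fin k) (w : V) :
    a (update b i w) = b.repr w i * a b := by
  obtain ⟨A, hA⟩ := h
  rw [hA, hA]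
  conv_lhs => rw [← b.sum_repr w]
  rw [A.map_update_sum, Finset.sum_eq_single i]
  · rw [A.map_update_smul, update_eq_self, smul_eq_mul]
  · intro j _ hj
    rw [A.map_update_smul, A.map_update_self _ hj.symm, smul_zero]
  · simp

theorem locLie_top {d : ℕ} {S : Set (EuclideanSpace ℝ (Fin d))}
    {Z : EuclideanSpace ℝ (Fin d) → EuclideanSpace ℝ (Fin d)}
    {Θ : EuclideanSpace ℝ (Fin d) → (Fin d → EuclideanSpace ℝ (Fin d)) → ℝ}
    {y : EuclideanSpace ℝ (Fin d)} (hS : UniqueDiffWithinAt ℝ S y)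
    (hZ : DifferentiableWithinAt ℝ Z S y) (halt : IsAlt (Θ y))
    (hd : DifferentiableWithinAt ℝ (fun y => Θ y fun a => EuclideanSpace.single a (1 : ℝ)) S y) :
    locLie S Z Θ y (fun a => EuclideanSpace.single a (1 : ℝ)) =
      ∑ a, fderivWithin ℝ (fun y => (Θ y fun a => EuclideanSpace.single a (1 : ℝ)) • Z y) S y
        (EuclideanSpace.single a (1 : ℝ)) a := by
  set e : Fin d → EuclideanSpace ℝ (Fin d) := fun a => EuclideanSpace.single a (1 : ℝ) with he
  rw [fderivWithin_fun_smul hS hd hZ]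
  simp only [add_apply, smul_apply, ContinuousLinearMap.smulRight_apply, PiLp.add_apply,
    PiLp.smul_apply, smul_eq_mul, Finset.sum_add_distrib]
  unfold locLie
  rw [add_comm]
  congr 1
  · refine Finset.sum_congr rfl fun i _ => ?_
    have h1 := halt.apply_update_basis (EuclideanSpace.basisFun (Fin d) ℝ).toBasis i
      (fderivWithin ℝ Z S y (e i))
    rw [basisFun_eq_single] at h1
    rw [h1, mul_comm]
    simp
    rfl
  · have h2 : Z y = ∑ a, Z y a • e a := by
      have := (EuclideanSpace.basisFun (Fin d) ℝ).sum_repr (Z y)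
      simpa using this.symm
    conv_lhs => rw [h2]
    rw [map_sum]
    refine Finset.sum_congr rfl fun a _ => ?_
    rw [map_smul, smul_eq_mul, mul_comm]

/-! ### Linearity and locality of the Lie derivative -/

section LieLinear

variable [FiniteDimensional ℝ E] [IsManifold I ∞ P]

theorem lieDeriv_sum {κ : Type*} [Fintype κ] {θ : κ → PreForm I P k} (hU : IsOpen U)
    (hθ : ∀ i, IsFormOn 1 (θ i) U) (X : VField I P) (hx : x ∈ U) (v : Fin k → E) :
    (lieDeriv X (fun x v => ∑ i, θ i x v)).val x v = ∑ i, (lieDeriv X (θ i)).val x v := by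
  have hy := mem_extChartAt_target (I := I) x
  have hd : ∀ i, DifferentiableWithinAt ℝ (fun y => formInChart (θ i) x y v) (range I)
      (Φ I x x) := fun i =>
    ((hθ i).contDiffWithinAt hU hy (by rwa [extChartAt_to_inv]) v).differentiableWithinAt
      one_ne_zero
  have h1 : formInChart (fun x v => ∑ i, θ i x v) x = fun y v => ∑ i, formInChart (θ i) x y v := rfl
  simp only [lieDeriv_eq_locLie]
  rw [h1]
  unfold locLie
  rw [fderivWithin_fun_sum (uniqueDiffWithinAt_range hy) (fun i _ => hd i)]
  simp only [sum_apply, Finset.sum_add_distrib]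
  rw [Finset.sum_comm]

theorem lieDeriv_eq_zero (X : VField I P) (h : ∀ᶠ x' in 𝓝 x, ∀ v : Fin k → E, θ.val x' v = 0)
    (v : Fin k → E) : (lieDeriv X θ).val x v = 0 := by
  have hy := mem_extChartAt_target (I := I) x
  rw [lieDeriv_eq_locLie, locLie_congr (Z₁ := vectorInChart X x) (Θ₁ := fun _ _ => 0)
    (target_subset x hy) EventuallyEq.rfl]
  · simp [locLie]
  · have h1 : ContinuousWithinAt (Φ I x).symm (range I) (Φ I x x) :=
      (continuousOn_extChartAt_symm x _ hy).mono_of_mem_nhdsWithin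
        (extChartAt_target_mem_nhdsWithin_of_mem hy)
    have h2 := h1.eventually (p := fun x' => ∀ v : Fin k → E, θ.val x' v = 0)
      (by rwa [extChartAt_to_inv])
    filter_upwards [h2] with y hy v using hy _

theorem IsFormOn.isSmoothFamilyOn (h : IsFormOn ∞ θ U) : IsSmoothFamilyOn univ (fun _ => θ) U :=
  ⟨fun _ _ => h.alternating, fun c v => (h.contDiffOn c v).comp contDiff_snd.contDiffOn
    fun _ hz => hz.2⟩

theorem IsFormOn.lieDeriv (hU : IsOpen U) (h : IsFormOn ∞ θ U) (hX : IsChartSmooth X) :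
    IsFormOn ∞ (lieDeriv X θ) U :=
  (h.isSmoothFamilyOn.lieDeriv isOpen_univ hU hX).isFormOn (mem_univ (0 : ℝ))

end LieLinear

/-! ### Stokes' theorem -/

section Stokes

variable [MeasurableSpace M] [BorelSpace M] {volM : PreForm ℍ M 3}

theorem exists_sign_coeffInChart (hvol : IsVolumeForm volM) (c : M) {r : ℝ}
    (hsub : Metric.closedBall (Φ ℍ c c) r ∩ range ℍ ⊆ (Φ ℍ c).target) :
    ∃ σ : ℝ, ∀ y ∈ Metric.ball (Φ ℍ c c) r ∩ range ℍ,
      |coeffInChart volM c y| = σ * coeffInChart volM c y := by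
  set S := Metric.ball (Φ ℍ c c) r ∩ range ℍ
  have hS : IsPreconnected S := ((convex_ball _ _).inter (ℍ).convex_range).isPreconnected
  have hST : S ⊆ (Φ ℍ c).target := fun y hy => hsub ⟨Metric.ball_subset_closedBall hy.1, hy.2⟩
  have hc : ContinuousOn (coeffInChart volM c) S := (hvol.continuousOn_coeffInChart c).mono hST
  have hne : ∀ y ∈ S, coeffInChart volM c y ≠ 0 := fun y hy => by
    have h := (topRatio_eq hvol hvol.isFormOn.alternating
      ((Φ ℍ c).map_target (hST hy)) (mem_univ _)).1
    rwa [(Φ ℍ c).right_inv (hST hy)] at h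
  by_cases h : ∃ y ∈ S, 0 < coeffInChart volM c y
  · obtain ⟨y₁, hy₁, hpos⟩ := h
    refine ⟨1, fun y hy => ?_⟩
    rw [one_mul, abs_of_nonneg]
    by_contra hneg
    obtain ⟨z, hz, hz0⟩ := hS.intermediate_value hy hy₁ hc ⟨(not_le.1 hneg).le, hpos.le⟩
    exact hne z hz hz0
  · refine ⟨-1, fun y hy => ?_⟩
    rw [abs_of_nonpos, neg_one_mul]
    by_contra hneg
    exact h ⟨y, hy, not_le.1 hneg⟩

variable {Y : VField ℍ M} {Y' : VField 𝔹 N}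

theorem integral_topRatio_lieDeriv_of_support (hι : IsBoundaryInclusion ι)
    (hvol : IsVolumeForm volM) (hY : IsChartSmooth Y) (hYY : RestrictsTo ι Y Y') (c : M) {r : ℝ}
    (hsub : Metric.closedBall (Φ ℍ c c) r ∩ range ℍ ⊆ (Φ ℍ c).target)
    {β : PreForm ℍ M 3} (hβ : IsFormOn ∞ β univ) {K : Set M} (hK : IsCompact K)
    (hKr : K ⊆ chartBall ℍ c r) (hβK : ∀ x ∉ K, ∀ v : Fin 3 → E3, β.val x v = 0) :
    ∫ x, topRatio volM (lieDeriv Y β) x ∂volumeMeasure volM = 0 := by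
  have hβ1 : IsFormOn 1 β univ := hβ.of_le (by exact_mod_cast le_top)
  have hL : IsFormOn ∞ (lieDeriv Y β) univ := hβ.lieDeriv isOpen_univ hY
  have hgc := continuous_topRatio hvol (hL.of_le (by simp))
  set e := Φ ℍ c with he
  set S : Set E3 := range ℍ with hS
  have hTS : e.target ⊆ S := target_subset c
  have hLK : ∀ x ∉ K, ∀ v : Fin 3 → E3, (lieDeriv Y β).val x v = 0 := fun x hx v =>
    lieDeriv_eq_zero Y (by
      filter_upwards [hK.isClosed.isOpen_compl.mem_nhds hx] with x' hx' using hβK x' hx') v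
  have hg0 : ∀ x ∉ K, topRatio volM (lieDeriv Y β) x = 0 := fun x hx => by
    rw [topRatio, coeffInChart, formInChart_self, hLK x hx, zero_div]
  have hKs : K ⊆ e.source := fun x hx => (hKr hx).1
  rw [← setIntegral_eq_integral_of_forall_compl_eq_zero (s := e.source)
    fun x hx => hg0 x fun h => hx (hKs h), setIntegral_volumeMeasure hvol c hgc.measurable]
  obtain ⟨σ, hσ⟩ := exists_sign_coeffInChart hvol c hsub
  set b : E3 → ℝ := coeffInChart β c with hb
  set Z : E3 → E3 := vectorInChart Y c with hZ
  have hKc : IsCompact (e '' K) := hK.image_of_continuousOn ((continuousOn_extChartAt c).mono hKs)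
  have hmemK : ∀ y ∈ e.target, y ∉ e '' K → e.symm y ∉ K := fun y hy hyK h =>
    hyK ⟨_, h, e.right_inv hy⟩
  have hb0 : ∀ y ∈ e.target, y ∉ e '' K → b y = 0 := fun y hy hyK => hβK _ (hmemK y hy hyK) _
  set u : E3 → E3 := e.target.indicator fun y => b y • Z y with hu
  have hu0 : ∀ y ∉ e '' K, u y = 0 := fun y hy => by
    by_cases hyt : y ∈ e.target
    · rw [hu, indicator_of_mem hyt, hb0 y hyt hy, zero_smul]
    · rw [hu, indicator_of_notMem hyt]
  have hu_ev : ∀ y ∈ e.target, u =ᶠ[𝓝[S] y] fun y => b y • Z y := fun y hy => by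
    filter_upwards [extChartAt_target_mem_nhdsWithin_of_mem hy] with z hz
    rw [hu, indicator_of_mem hz]
  have hu_ev0 : ∀ y ∉ e '' K, u =ᶠ[𝓝[S] y] fun _ => 0 := fun y hy => by
    filter_upwards [mem_nhdsWithin_of_mem_nhds (hKc.isClosed.isOpen_compl.mem_nhds hy)] with z hz
      using hu0 z hz
  have hbd : ∀ y ∈ e.target, ContDiffWithinAt ℝ ∞ b S y := fun y hy =>
    hβ.contDiffWithinAt isOpen_univ hy (mem_univ _) _
  have hZd : ∀ y ∈ e.target, ContDiffWithinAt ℝ ∞ Z S y := fun y hy => hY.contDiffWithinAt hy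
  have huC : ContDiffOn ℝ 1 u S := by
    intro y hyS
    by_cases hy : y ∈ e.target
    · exact (((hbd y hy).smul (hZd y hy)).of_le (by exact_mod_cast le_top)).congr_of_eventuallyEq
        (hu_ev y hy) ((hu_ev y hy).self_of_nhdsWithin hyS)
    · have hyK : y ∉ e '' K := by
        rintro ⟨x, hx, rfl⟩
        exact hy (e.map_source (hKs hx))
      exact contDiffWithinAt_const.congr_of_eventuallyEq (hu_ev0 y hyK) (hu0 y hyK)
  obtain ⟨R, hR⟩ := hKc.isBounded.exists_norm_le
  have hdiv := integral_divergence_halfSpace huC (R := R + 1)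
    (fun y hy => hu0 y fun h => by linarith [hR y h]) (fun y hy => by
      by_cases hyt : y ∈ e.target
      · rw [hu, indicator_of_mem hyt, PiLp.smul_apply, hYY.vectorInChart_zero hι hyt hy, smul_zero]
      · rw [hu, indicator_of_notMem hyt]
        rfl)
  have hint : ∀ y ∈ e.target, |coeffInChart volM c y| * topRatio volM (lieDeriv Y β) (e.symm y) =
      σ * ∑ a : Fin 3, fderivWithin ℝ u S y (EuclideanSpace.single a (1 : ℝ)) a := by
    intro y hy
    obtain ⟨hne, hr⟩ := topRatio_eq hvol hL.alternating (e.map_target hy) (mem_univ _)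
    rw [← he, e.right_inv hy] at hne hr
    have h1 : coeffInChart (lieDeriv Y β) c y =
        ∑ a : Fin 3, fderivWithin ℝ u S y (EuclideanSpace.single a (1 : ℝ)) a := by
      rw [coeffInChart, formInChart_lieDeriv isOpen_univ hβ1 hY hy (mem_univ _),
        locLie_top (uniqueDiffWithinAt_range hy) ((hZd y hy).differentiableWithinAt (by simp))
          (isAlt_formInChart hβ.alternating (mem_univ _))
          ((hbd y hy).differentiableWithinAt (by simp)),
        (hu_ev y hy).fderivWithin_eq ((hu_ev y hy).self_of_nhdsWithin (hTS hy))]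
      rfl
    by_cases hyK : y ∈ e '' K
    · have hyb : y ∈ Metric.ball (e c) r ∩ S := by
        obtain ⟨x, hx, rfl⟩ := hyK
        exact ⟨(hKr hx).2, hTS hy⟩
      rw [hσ y hyb, hr, ← h1]
      field_simp
    · have h2 : coeffInChart (lieDeriv Y β) c y = 0 := hLK _ (hmemK y hy hyK) _
      rw [hg0 _ (hmemK y hy hyK), ← h1, h2, mul_zero, mul_zero]
  rw [setIntegral_congr_fun (measurableSet_target c) hint, integral_const_mul]
  have hTS' : ∫ y in e.target, ∑ a : Fin 3, fderivWithin ℝ u S y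
      (EuclideanSpace.single a (1 : ℝ)) a = ∫ y in S, ∑ a : Fin 3, fderivWithin ℝ u S y
      (EuclideanSpace.single a (1 : ℝ)) a := by
    refine (setIntegral_eq_of_subset_of_forall_sdiff_eq_zero
      (ℍ).isClosed_range.measurableSet hTS fun y hy => ?_).symm
    have hyK : y ∉ e '' K := by
      rintro ⟨x, hx, rfl⟩
      exact hy.2 (e.map_source (hKs hx))
    rw [(hu_ev0 y hyK).fderivWithin_eq (hu0 y hyK)]
    simp
  rw [hTS', hdiv, mul_zero]

theorem integral_topRatio_lieDeriv (hι : IsBoundaryInclusion ι)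
    (hvol : IsVolumeForm volM) (hY : IsChartSmooth Y) (hYY : RestrictsTo ι Y Y')
    {β : PreForm ℍ M 3} (hβ : IsFormOn ∞ β univ) :
    ∫ x, topRatio volM (lieDeriv Y β) x ∂volumeMeasure volM = 0 := by
  have hr (c : M) : ∃ r > 0, Metric.closedBall (Φ ℍ c c) r ∩ range ℍ ⊆ (Φ ℍ c).target :=
    (nhdsWithin_hasBasis Metric.nhds_basis_closedBall _).mem_iff.1
      (extChartAt_target_mem_nhdsWithin c)
  choose r hr0 hr using hr
  obtain ⟨s, hs⟩ := isCompact_univ.elim_nhds_subcover (fun c : M => chartBall ℍ c (r c))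
    fun c _ => (isOpen_chartBall c _).mem_nhds (mem_chartBall_self c (hr0 c))
  obtain ⟨ρ, hρ⟩ := SmoothPartitionOfUnity.exists_isSubordinate ℍ isClosed_univ
    (fun c : s => chartBall ℍ (c : M) (r c)) (fun c => isOpen_chartBall _ _) (fun x _ => by
      obtain ⟨c, hc, hx⟩ := mem_iUnion₂.1 (hs.2 (mem_univ x))
      exact mem_iUnion.2 ⟨⟨c, hc⟩, hx⟩)
  have hρs (c : s) : ContMDiff ℍ 𝓘(ℝ, ℝ) ∞ (ρ c) := (ρ c).contMDiff
  have hβρ (c : s) : IsFormOn ∞ (smulForm (ρ c) β) univ :=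
    hβ.smulForm le_rfl (hρs c) isOpen_univ fun x hx => absurd (mem_univ x) hx
  have hsum : β = fun x v => ∑ c : s, smulForm (ρ c) β x v := by
    funext x v
    have h1 := ρ.sum_eq_one (mem_univ x)
    rw [finsum_eq_sum_of_fintype] at h1
    simp only [smulForm, ← Finset.sum_mul, h1, one_mul]
  have hL (c : s) : IsFormOn ∞ (lieDeriv Y (smulForm (ρ c) β)) univ :=
    (hβρ c).lieDeriv isOpen_univ hY
  have hLsum (x : M) : topRatio volM (lieDeriv Y β) x =
      ∑ c : s, topRatio volM (lieDeriv Y (smulForm (ρ c) β)) x := by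
    have h1 := lieDeriv_sum isOpen_univ (fun c => (hβρ c).of_le (by exact_mod_cast le_top)) Y
      (mem_univ x) fun a : Fin 3 => EuclideanSpace.single a (1 : ℝ)
    rw [← hsum] at h1
    simp only [topRatio, coeffInChart, formInChart_self]
    rw [h1, Finset.sum_div]
  have hfin : IsFiniteMeasure (volumeMeasure volM) := isFinite_volumeMeasure hvol
  simp only [hLsum]
  rw [integral_finsetSum]
  · refine Finset.sum_eq_zero fun c _ => ?_
    refine integral_topRatio_lieDeriv_of_support hι hvol hY hYY (c : M) (hr c) (hβρ c)
      (isClosed_tsupport (ρ c)).isCompact (hρ c) fun x hx v => ?_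
    change ρ c x * _ = 0
    rw [image_eq_zero_of_notMem_tsupport hx, zero_mul]
  · intro c _
    exact (continuous_topRatio hvol ((hL c).of_le (by simp))).integrable_of_hasCompactSupport
      (HasCompactSupport.of_compactSpace _)

end Stokes

/-! ### Alternating functions with some arguments fixed -/

section Slices

theorem extend_update {p q : ℕ} {V : Type*} {j : Fin p → Fin q} (hj : Injective j)
    (g : Fin p → V) (f : Fin q → V) (i : Fin p) (x : V) :
    extend j (update g i x) f = update (extend j g f) (j i) x := by
  funext b
  by_cases hb : ∃ a, j a = b
  · obtain ⟨a, rfl⟩ := hb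
    rw [hj.extend_apply]
    by_cases h : a = i
    · subst h; simp
    · rw [update_of_ne h, update_of_ne (fun h' => h (hj h')), hj.extend_apply]
  · rw [extend_apply' _ _ _ hb, update_of_ne (fun h => hb ⟨i, h.symm⟩), extend_apply' _ _ _ hb]

theorem IsAlt.extend {p q : ℕ} {V' : Type*} [AddCommGroup V'] [Module ℝ V'] {a : (Fin q → V) → ℝ}
    (h : IsAlt a) {j : Fin p → Fin q} (hj : Injective j) (T : V' →ₗ[ℝ] V) (f : Fin q → V) :
    IsAlt fun u : Fin p → V' => a (extend j (fun b => T (u b)) f) := by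
  obtain ⟨A, hA⟩ := h
  have hupd (u : Fin p → V') (i : Fin p) (x : V') :
      Function.extend j (fun b => T (update u i x b)) f =
        update (Function.extend j (fun b => T (u b)) f) (j i) (T x) := by
    rw [← extend_update hj]
    congr 1
    funext b
    by_cases h : b = i
    · subst h; simp
    · simp [h]
  exact ⟨{
    toFun := fun u => A (Function.extend j (fun b => T (u b)) f)
    map_update_add' := by
      intro inst u i x y
      rw [Subsingleton.elim inst (instDecidableEqFin p)]
      simp only [hupd, map_add, AlternatingMap.map_update_add]
    map_update_smul' := by
      intro inst u i c x
      rw [Subsingleton.elim inst (instDecidableEqFin p)]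
      simp only [hupd, map_smul, AlternatingMap.map_update_smul]
    map_eq_zero_of_eq' := by
      intro u i i' hu hii
      refine A.map_eq_zero_of_eq _ (i := j i) (j := j i') ?_ (hj.ne hii)
      rw [hj.extend_apply, hj.extend_apply, hu] }, fun u => hA _⟩

/-- The local Lie derivative of a form restricts to slices to which the field is tangent, if the
other vectors are preserved by the field. -/
theorem locLie_slice {Es : Type*} [NormedAddCommGroup Es] [NormedSpace ℝ Es] {p q : ℕ} {S : Set E}
    {Ss : Set Es} {Z : E → E} {Zs : Es → Es} {Ψ : E → (Fin q → E) → ℝ} {κ : Es → E} {T : Es →L[ℝ] E}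
    {s₀ : Es} (hu : UniqueDiffWithinAt ℝ Ss s₀) (hκ : HasFDerivAt κ T s₀) (hmaps : MapsTo κ Ss S)
    {j : Fin p → Fin q} (hj : Injective j) {f : Fin q → E} {u : Fin p → Es}
    (hf : ∀ a, f (j a) = T (u a)) (hZ : Z (κ s₀) = T (Zs s₀))
    (hDZ : ∀ a, fderivWithin ℝ Z S (κ s₀) (f (j a)) = T (fderivWithin ℝ Zs Ss s₀ (u a)))
    (hDZ0 : ∀ b ∉ range j, fderivWithin ℝ Z S (κ s₀) (f b) = 0) (halt : IsAlt (Ψ (κ s₀)))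
    (hd : DifferentiableWithinAt ℝ (fun y => Ψ y f) S (κ s₀)) : locLie S Z Ψ (κ s₀) f =
      locLie Ss Zs (fun s u' => Ψ (κ s) (extend j (fun a => T (u' a)) f)) s₀ u := by
  have hext : extend j (fun a => T (u a)) f = f := by
    funext b
    by_cases hb : ∃ a, j a = b
    · obtain ⟨a, rfl⟩ := hb
      rw [hj.extend_apply, hf]
    · rw [extend_apply' _ _ _ hb]
  unfold locLie
  congr 1
  · have h1 := (hd.hasFDerivWithinAt.comp s₀ hκ.hasFDerivWithinAt hmaps).fderivWithin hu
    simp only [hext]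
    have h2 : fderivWithin ℝ (fun s => Ψ (κ s) f) Ss s₀ = _ := h1
    rw [h2, hZ]
    rfl
  · refine (Fintype.sum_of_injective j hj _ _ (fun b hb => ?_) fun a => ?_).symm
    · obtain ⟨A, hA⟩ := halt
      rw [hA, hDZ0 b hb]
      exact A.map_coord_zero b (by simp)
    · have h3 : (fun b => T (update u a (fderivWithin ℝ Zs Ss s₀ (u a)) b)) =
          update (fun b => T (u b)) a (T (fderivWithin ℝ Zs Ss s₀ (u a))) := by
        funext b
        by_cases h : b = a
        · subst h; simp
        · simp [h]
      change Ψ (κ s₀) (extend j (fun b => T (update u a (fderivWithin ℝ Zs Ss s₀ (u a)) b)) f) = _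
      rw [h3, extend_update hj, hext, hDZ]

end Slices

/-! ### Densities along the fibres -/

variable {U : Set (Conf M N m n)} {θ : ConfForm M N m n (m * 3 + k)} {volM : PreForm ℍ M 3}
  {x₀ : Fin m → M} {p : Conf M N m n}

section Fibre

/-- The standard basis of `ℝ³`. -/
def stdBasis3 (a : Fin 3) : E3 := EuclideanSpace.single a (1 : ℝ)

/-- The standard basis of `(ℝ³)^m`, in the order of the factors. -/
def bulkBasis (m : ℕ) (a : Fin (m * 3)) : Fin m → E3 :=
  Pi.single (finProdFinEquiv.symm a).1 (stdBasis3 (finProdFinEquiv.symm a).2)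

/-- Vectors along `M^m` followed by vectors along `N^n`. -/
def appendVec (u : Fin (m * 3) → Fin m → E3) (w : Fin k → Fin n → E2) :
    Fin (m * 3 + k) → EConf m n :=
  Fin.append (fun a => (u a, 0)) (fun b => (0, w b))

theorem appendVec_castAdd (u : Fin (m * 3) → Fin m → E3) (w : Fin k → Fin n → E2)
    (a : Fin (m * 3)) : appendVec u w (Fin.castAdd k a) = (u a, 0) := Fin.append_left _ _ _

theorem appendVec_natAdd (u : Fin (m * 3) → Fin m → E3) (w : Fin k → Fin n → E2)
    (b : Fin k) : appendVec u w (Fin.natAdd (m * 3) b) = (0, w b) := Fin.append_right _ _ _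

theorem appendVec_eq_extend (u u' : Fin (m * 3) → Fin m → E3) (w : Fin k → Fin n → E2) :
    appendVec u w = extend (Fin.castAdd k) (fun a => LinearMap.inl ℝ (Fin m → E3) (Fin n → E2) (u a))
      (appendVec u' w) := by
  funext b
  refine Fin.addCases (fun a => ?_) (fun b => ?_) b
  · rw [(Fin.castAdd_injective (m * 3) k).extend_apply, appendVec_castAdd]
    rfl
  · rw [extend_apply', appendVec_natAdd, appendVec_natAdd]
    rintro ⟨a, ha⟩
    have := congrArg Fin.val ha
    simp at this
    omega

theorem fibreDensity_eq (θ : ConfForm M N m n (m * 3 + k)) (y : Fin n → N)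
    (w : Fin k → Fin n → E2) (x : Fin m → M) : fibreDensity volM θ y w x =
      θ.val (x, y) (appendVec (bulkBasis m) w) / ∏ i, volM.val (x i) stdBasis3 := rfl

theorem IsAlt.appendVec_left {a : (Fin (m * 3 + k) → EConf m n) → ℝ} (ha : IsAlt a)
    (w : Fin k → Fin n → E2) : IsAlt fun u => a (appendVec u w) := by
  have h := ha.extend (Fin.castAdd_injective (m * 3) k)
    (LinearMap.inl ℝ (Fin m → E3) (Fin n → E2)) (appendVec 0 w)
  simp only [← appendVec_eq_extend] at h
  exact h

def bulkBasis' (m : ℕ) : Module.Basis (Fin (m * 3)) ℝ (Fin m → E3) :=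
  (Pi.basis fun _ : Fin m => (EuclideanSpace.basisFun (Fin 3) ℝ).toBasis).reindex
    ((Equiv.sigmaEquivProd (Fin m) (Fin 3)).trans finProdFinEquiv)

theorem coe_bulkBasis' (m : ℕ) : (bulkBasis' m : Fin (m * 3) → Fin m → E3) = bulkBasis m := by
  funext a
  simp [bulkBasis', bulkBasis, stdBasis3, Pi.basis_apply, Equiv.sigmaEquivProd]

theorem IsAlt.apply_appendVec_pi {a : (Fin (m * 3 + k) → EConf m n) → ℝ} (ha : IsAlt a)
    (w : Fin k → Fin n → E2) {L : (Fin m → E3) →ₗ[ℝ] Fin m → E3} {A : Fin m → E3 →ₗ[ℝ] E3}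
    (hL : ∀ v i, L v i = A i (v i)) : a (appendVec (fun b => L (bulkBasis m b)) w) =
      (∏ i, LinearMap.det (A i)) * a (appendVec (bulkBasis m) w) := by
  have h := (ha.appendVec_left w).apply_comp_basis (bulkBasis' m) L
  have hL' : L = LinearMap.pi (fun i ↦ (A i).comp (LinearMap.proj i)) := by
    exact LinearMap.ext fun v => funext fun i => hL v i
  rw [coe_bulkBasis', hL', LinearMap.det_pi, ← hL'] at h
  exact h

theorem coeffInChart_eq_det (hvol : IsVolumeForm volM) {c : M} {ξ : E3} :
    coeffInChart volM c ξ = LinearMap.det (chartD ℍ c ξ).toLinearMap *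
      volM.val ((Φ ℍ c).symm ξ) stdBasis3 := by
  have h := IsAlt.apply_comp_basis (V := E3) (a := volM.val ((Φ ℍ c).symm ξ))
    (hvol.isFormOn.alternating _ (mem_univ _)) (EuclideanSpace.basisFun (Fin 3) ℝ).toBasis
    (chartD ℍ c ξ).toLinearMap
  have hb : (⇑(EuclideanSpace.basisFun (Fin 3) ℝ).toBasis : Fin 3 → E3) = stdBasis3 :=
    basisFun_eq_single
  exact (congrArg (volM.val _) (funext fun a => congrArg (chartD ℍ c ξ)
    (congrFun hb a).symm)).trans (h.trans (congrArg (fun b => LinearMap.det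
      (chartD ℍ c ξ).toLinearMap * volM.val _ b) hb))

/-- The form on `N^n` whose value is the density of `θ` along the fibre at the point `x`. -/
def fibreForm (volM : PreForm ℍ M 3) (θ : ConfForm M N m n (m * 3 + k)) (x : Fin m → M) :
    PreForm (ℬ n) (Fin n → N) k := fun y w => fibreDensity volM θ y w x

theorem chartD_conf {c : Conf M N m n} {y : EConf m n}
    (hy : y ∈ (Φ (ℭ m n) c).target) (v : EConf m n) : chartD (ℭ m n) c y v =
      (chartD (ℳ m) c.1 y.1 v.1, chartD (ℬ n) c.2 y.2 v.2) := by
  exact chartD_prod hy v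

theorem mem_conf_target {c : Conf M N m n} {y : EConf m n} : y ∈ (Φ (ℭ m n) c).target ↔
      y.1 ∈ (Φ (ℳ m) c.1).target ∧ y.2 ∈ (Φ (ℬ n) c.2).target :=
  mem_extChartAt_prod_target

theorem mem_bulk_target {c : Fin m → M} {ξ : Fin m → E3} :
    ξ ∈ (Φ (ℳ m) c).target ↔ ∀ i, ξ i ∈ (Φ ℍ (c i)).target := by
  rw [powChart_target]
  rfl

theorem formInChart_fibreForm (hvol : IsVolumeForm volM) (hθ : IsAlternatingOn θ U) {c : Fin n → N}
    {ξ : Fin m → E3} {z : Fin n → E2} (hξ : ξ ∈ (Φ (ℳ m) x₀).target) (hz : z ∈ (Φ (ℬ n) c).target)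
    (hU : ((Φ (ℳ m) x₀).symm ξ, (Φ (ℬ n) c).symm z) ∈ U) (w : Fin k → Fin n → E2) :
    formInChart (fibreForm volM θ ((Φ (ℳ m) x₀).symm ξ)) c z w =
      formInChart θ (x₀, c) (ξ, z) (appendVec (bulkBasis m) w) /
        ∏ i, coeffInChart volM (x₀ i) (ξ i) := by
  set x := (Φ (ℳ m) x₀).symm ξ with hx
  set y := (Φ (ℬ n) c).symm z with hy
  have hxi (i : Fin m) : (Φ ℍ (x₀ i)).symm (ξ i) = x i := rfl
  have ht : (ξ, z) ∈ (Φ (ℭ m n) (x₀, c)).target := mem_conf_target.2 ⟨hξ, hz⟩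
  have h1 : formInChart (fibreForm volM θ x) c z w =
      θ.val (x, y) (appendVec (bulkBasis m) fun b => chartD (ℬ n) c z (w b)) /
        ∏ i, volM.val (x i) stdBasis3 := rfl
  have h2 : formInChart θ (x₀, c) (ξ, z) (appendVec (bulkBasis m) w) =
      θ.val (x, y) (appendVec (fun a => chartD (ℳ m) x₀ ξ (bulkBasis m a))
        fun b => chartD (ℬ n) c z (w b)) := by
    rw [formInChart_eq]
    have h3 : (Φ (ℭ m n) (x₀, c)).symm (ξ, z) = (x, y) := prodChart_symm _ _
    rw [h3]
    congr 1
    funext b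
    rw [chartD_conf ht]
    refine Fin.addCases (fun a => ?_) (fun b => ?_) b
    · rw [appendVec_castAdd, appendVec_castAdd]
      simp
    · rw [appendVec_natAdd, appendVec_natAdd]
      simp
  have h4 := IsAlt.apply_appendVec_pi (a := θ.val (x, y)) (hθ _ hU)
    (fun b => chartD (ℬ n) c z (w b)) (L := (chartD (ℳ m) x₀ ξ).toLinearMap)
    (A := fun i => (chartD ℍ (x₀ i) (ξ i)).toLinearMap) (fun v i => chartD_pow ℍ i hξ v)
  have h5 : ∏ i, coeffInChart volM (x₀ i) (ξ i) =
      (∏ i, LinearMap.det (chartD ℍ (x₀ i) (ξ i)).toLinearMap) * ∏ i, volM.val (x i) stdBasis3 := by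
    rw [← Finset.prod_mul_distrib]
    exact Finset.prod_congr rfl fun i _ => coeffInChart_eq_det hvol
  have h6 : ∏ i, LinearMap.det (chartD ℍ (x₀ i) (ξ i)).toLinearMap ≠ 0 := by
    refine Finset.prod_ne_zero_iff.2 fun i _ => ?_
    have hi := mem_bulk_target.1 hξ i
    have h7 := (topRatio_eq hvol hvol.isFormOn.alternating
      ((Φ ℍ (x₀ i)).map_target hi) (mem_univ _)).1
    rw [(Φ ℍ (x₀ i)).right_inv hi, coeffInChart_eq_det hvol] at h7
    exact left_ne_zero_of_mul h7
  rw [h1, h2, h5]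
  refine ((congrArg (fun t => t / _) h4).trans ?_).symm
  exact mul_div_mul_left _ _ h6

theorem prod_coeffInChart_ne_zero (hvol : IsVolumeForm volM) {ξ : Fin m → E3}
    (hξ : ξ ∈ (Φ (ℳ m) x₀).target) : ∏ i, coeffInChart volM (x₀ i) (ξ i) ≠ 0 := by
  refine Finset.prod_ne_zero_iff.2 fun i _ => ?_
  have hi := mem_bulk_target.1 hξ i
  have h7 := (topRatio_eq hvol hvol.isFormOn.alternating
    ((Φ ℍ (x₀ i)).map_target hi) (mem_univ _)).1
  rwa [(Φ ℍ (x₀ i)).right_inv hi] at h7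

instance boundaryless_bdryModel : (ℬ n).Boundaryless := ⟨by
  have h : range (ℬ n) = {y | ∀ i, y i ∈ range 𝔹} := range_powModel 𝔹
  rw [h]
  ext y
  simp⟩

end Fibre

/-! ### Additivity of the Lie derivative in the field -/

theorem lieDeriv_sum_field {U : Set P} {θ : PreForm I P k} [FiniteDimensional ℝ E]
    [IsManifold I ∞ P] {κ : Type*} [Fintype κ] {Z : κ → VField I P} (hZ : ∀ o, IsChartSmooth (Z o))
    (hX : ∀ x, fieldVal X x = ∑ o, fieldVal (Z o) x) (hθ : IsAlternatingOn θ U) (hx : x ∈ U)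
    (v : Fin k → E) : (lieDeriv X θ).val x v = ∑ o, (lieDeriv (Z o) θ).val x v := by
  have hy := mem_extChartAt_target (I := I) x
  have hvec : vectorInChart X x = fun y => ∑ o, vectorInChart (Z o) x y := by
    funext y
    have h (X : VField I P) : vectorInChart X x y = mfd I 𝓘(ℝ, E) (Φ I x) ((Φ I x).symm y)
        (fieldVal X ((Φ I x).symm y)) := rfl
    simp only [h, hX, map_sum]
  have hder : fderivWithin ℝ (vectorInChart X x) (range I) (Φ I x x) =
      ∑ o, fderivWithin ℝ (vectorInChart (Z o) x) (range I) (Φ I x x) := by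
    rw [hvec]
    exact fderivWithin_fun_sum (uniqueDiffWithinAt_range hy) fun o _ =>
      ((hZ o).contDiffWithinAt hy).differentiableWithinAt (by simp)
  have halt : IsAlt (formInChart θ x (Φ I x x)) := by
    refine isAlt_formInChart hθ ?_
    rwa [extChartAt_to_inv]
  obtain ⟨A, hA⟩ := halt
  simp only [lieDeriv_eq_locLie]
  unfold locLie
  rw [Finset.sum_add_distrib, hder, hvec, Finset.sum_comm]
  simp only [map_sum, sum_apply, hA, A.map_update_sum]

section Densities

variable [MeasurableSpace M] [BorelSpace M]

/-! ### Regularity of the density along the fibre -/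

theorem eventually_formInChart_fibreForm (hvol : IsVolumeForm volM) (hU : IsOpen U)
    (hθ : IsAlternatingOn θ U) {c y₀ : Fin n → N} (hy : y₀ ∈ (Φ (ℬ n) c).source) (h : (x₀, y₀) ∈ U)
    (w : Fin k → Fin n → E2) :
    ∀ᶠ q : (Fin m → M) × (Fin n → E2) in 𝓝 (x₀, Φ (ℬ n) c y₀),
      formInChart (fibreForm volM θ q.1) c q.2 w =
        formInChart θ (x₀, c) (Φ (ℳ m) x₀ q.1, q.2) (appendVec (bulkBasis m) w) /
          ∏ i, coeffInChart volM (x₀ i) (Φ ℍ (x₀ i) (q.1 i)) := by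
  have h1 : ∀ᶠ q : (Fin m → M) × (Fin n → E2) in 𝓝 (x₀, Φ (ℬ n) c y₀), q.1 ∈ (Φ (ℳ m) x₀).source :=
    continuous_fst.continuousAt (extChartAt_source_mem_nhds (I := ℳ m) x₀)
  have h2 : ∀ᶠ q : (Fin m → M) × (Fin n → E2) in 𝓝 (x₀, Φ (ℬ n) c y₀), q.2 ∈ (Φ (ℬ n) c).target :=
    continuous_snd.continuousAt ((isOpen_extChartAt_target c).mem_nhds ((Φ (ℬ n) c).map_source hy))
  have h3 : ∀ᶠ q : (Fin m → M) × (Fin n → E2) in 𝓝 (x₀, Φ (ℬ n) c y₀),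
      (q.1, (Φ (ℬ n) c).symm q.2) ∈ U := by
    have hc : ContinuousAt (fun q : (Fin m → M) × (Fin n → E2) =>
        (q.1, (Φ (ℬ n) c).symm q.2)) (x₀, Φ (ℬ n) c y₀) :=
      continuous_fst.continuousAt.prodMk
        (ContinuousAt.comp (continuousAt_extChartAt_symm' hy) continuous_snd.continuousAt)
    refine hc (hU.mem_nhds ?_)
    change (x₀, (Φ (ℬ n) c).symm (Φ (ℬ n) c y₀)) ∈ U
    rwa [(Φ (ℬ n) c).left_inv hy]
  filter_upwards [h1, h2, h3] with q hq1 hq2 hq3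
  have hinv := (Φ (ℳ m) x₀).left_inv hq1
  have h4 := formInChart_fibreForm hvol hθ (x₀ := x₀) (c := c) (ξ := Φ (ℳ m) x₀ q.1) (z := q.2)
    ((Φ (ℳ m) x₀).map_source hq1) hq2 (by rwa [hinv]) w
  rw [hinv] at h4
  exact h4

theorem tendsto_chart_range {z₀ : Fin n → E2} :
    Tendsto (fun q : (Fin m → M) × (Fin n → E2) => (Φ (ℳ m) x₀ q.1, q.2))
      (𝓝 (x₀, z₀)) (𝓝[range (ℭ m n)] (Φ (ℳ m) x₀ x₀, z₀)) := by
  refine tendsto_nhdsWithin_iff.2 ⟨?_, ?_⟩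
  · have h : ContinuousAt (fun q : (Fin m → M) × (Fin n → E2) => (Φ (ℳ m) x₀ q.1, q.2)) (x₀, z₀) :=
      (ContinuousAt.comp (continuousAt_extChartAt (I := ℳ m) x₀)
        continuous_fst.continuousAt).prodMk continuous_snd.continuousAt
    exact h
  · have h1 : ∀ᶠ q : (Fin m → M) × (Fin n → E2) in 𝓝 (x₀, z₀), q.1 ∈ (Φ (ℳ m) x₀).source :=
      continuous_fst.continuousAt (extChartAt_source_mem_nhds (I := ℳ m) x₀)
    filter_upwards [h1] with q hq
    have hr : range (ℭ m n) = range (ℳ m) ×ˢ range (ℬ n) := ModelWithCorners.range_prod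
    rw [hr]
    exact ⟨target_subset (I := ℳ m) x₀ ((Φ (ℳ m) x₀).map_source hq), by
        rw [(ℬ n).range_eq_univ]; exact mem_univ _⟩

theorem continuousAt_prod_coeff (hvol : IsVolumeForm volM) (x₀ : Fin m → M) (z₀ : Fin n → E2) :
    ContinuousAt (fun q : (Fin m → M) × (Fin n → E2) =>
      ∏ i, coeffInChart volM (x₀ i) (Φ ℍ (x₀ i) (q.1 i))) (x₀, z₀) := by
  refine tendsto_finsetProd _ fun i _ => ?_
  have h1 : ContinuousAt (fun x => coeffInChart volM (x₀ i) (Φ ℍ (x₀ i) x)) (x₀ i) :=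
    ((hvol.continuousOn_coeffInChart (x₀ i)).comp (continuousOn_extChartAt (x₀ i))
      fun x hx => (Φ ℍ (x₀ i)).map_source hx).continuousAt (extChartAt_source_mem_nhds (x₀ i))
  have h2 : ContinuousAt (fun q : (Fin m → M) × (Fin n → E2) => q.1 i) (x₀, z₀) :=
    ((continuous_apply i).comp continuous_fst).continuousAt
  exact ContinuousAt.comp (g := fun x => coeffInChart volM (x₀ i) (Φ ℍ (x₀ i) x)) h1 h2

theorem continuousAt_formInChart_fibreForm (hvol : IsVolumeForm volM) (hU : IsOpen U)
    (hθ : IsFormOn 0 θ U) {c y₀ : Fin n → N} (hy : y₀ ∈ (Φ (ℬ n) c).source) (h : (x₀, y₀) ∈ U)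
    (w : Fin k → Fin n → E2) :
    ContinuousAt (fun q : (Fin m → M) × (Fin n → E2) => formInChart (fibreForm volM θ q.1) c q.2 w)
      (x₀, Φ (ℬ n) c y₀) := by
  have hev := eventually_formInChart_fibreForm hvol hU hθ.alternating hy h w
  refine ContinuousAt.congr (f := fun q : (Fin m → M) × (Fin n → E2) =>
        formInChart θ (x₀, c) (Φ (ℳ m) x₀ q.1, q.2) (appendVec (bulkBasis m) w) /
          ∏ i, coeffInChart volM (x₀ i) (Φ ℍ (x₀ i) (q.1 i))) ?_
      (hev.mono fun q hq => hq.symm)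
  have ht : (Φ (ℳ m) x₀ x₀, Φ (ℬ n) c y₀) ∈ (Φ (ℭ m n) (x₀, c)).target :=
    mem_conf_target.2 ⟨mem_extChartAt_target (I := ℳ m) x₀, (Φ (ℬ n) c).map_source hy⟩
  have hs : (Φ (ℭ m n) (x₀, c)).symm (Φ (ℳ m) x₀ x₀, Φ (ℬ n) c y₀) = (x₀, y₀) := by
    rw [prodChart_symm]
    exact Prod.ext (extChartAt_to_inv (I := ℳ m) x₀) ((Φ (ℬ n) c).left_inv hy)
  have h1 := (hθ.contDiffWithinAt hU ht (hs ▸ h) (appendVec (bulkBasis m) w)).continuousWithinAt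
  refine ContinuousAt.div (h1.tendsto.comp tendsto_chart_range)
    (continuousAt_prod_coeff hvol x₀ _) ?_
  exact prod_coeffInChart_ne_zero hvol (ξ := fun i => Φ ℍ (x₀ i) (x₀ i))
    (mem_extChartAt_target (I := ℳ m) x₀)

theorem formInChart_fibreForm_self (θ : ConfForm M N m n (m * 3 + k))
    (x : Fin m → M) (y : Fin n → N) (w : Fin k → Fin n → E2) :
    formInChart (fibreForm volM θ x) y (Φ (ℬ n) y y) w =
      fibreDensity volM θ y w x := by
  exact formInChart_self (fibreForm volM θ x) y w

theorem continuousAt_fibreDensity (hvol : IsVolumeForm volM) (hU : IsOpen U) (hθ : IsFormOn 0 θ U)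
    {y : Fin n → N} (h : (x₀, y) ∈ U) (w : Fin k → Fin n → E2) :
    ContinuousAt (fibreDensity volM θ y w) x₀ := by
  have h1 := continuousAt_formInChart_fibreForm hvol hU hθ (mem_extChartAt_source (I := ℬ n) y) h w
  have h2 : ContinuousAt (fun x : Fin m → M => (x, Φ (ℬ n) y y)) x₀ :=
    (Continuous.prodMk_left _).continuousAt
  have h3 := ContinuousAt.comp (f := fun x : Fin m → M => (x, Φ (ℬ n) y y)) h1 h2
  refine h3.congr (Eventually.of_forall fun x => ?_)
  exact formInChart_fibreForm_self θ x y w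

theorem exists_hasFDerivAt_formInChart_fibreForm (hvol : IsVolumeForm volM) (hU : IsOpen U)
    (hθ : IsFormOn 1 θ U) {c y₀ : Fin n → N} (hy : y₀ ∈ (Φ (ℬ n) c).source) (h : (x₀, y₀) ∈ U)
    (w : Fin k → Fin n → E2) :
    (∀ᶠ q : (Fin m → M) × (Fin n → E2) in 𝓝 (x₀, Φ (ℬ n) c y₀),
      DifferentiableAt ℝ (fun z => formInChart (fibreForm volM θ q.1) c z w) q.2) ∧
    ContinuousAt (fun q : (Fin m → M) × (Fin n → E2) =>
      fderiv ℝ (fun z => formInChart (fibreForm volM θ q.1) c z w) q.2) (x₀, Φ (ℬ n) c y₀) := by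
  set e := Φ (ℳ m) x₀ with he
  set z₀ := Φ (ℬ n) c y₀ with hz₀
  set Ψ : EConf m n → ℝ := fun p => formInChart θ (x₀, c) p (appendVec (bulkBasis m) w) with hΨ
  set D : (Fin m → M) × (Fin n → E2) → (Fin n → E2) →L[ℝ] ℝ := fun q =>
    (∏ i, coeffInChart volM (x₀ i) (Φ ℍ (x₀ i) (q.1 i)))⁻¹ •
      (fderivWithin ℝ Ψ (range (ℭ m n)) (e q.1, q.2)).comp
        (ContinuousLinearMap.inr ℝ (Fin m → E3) (Fin n → E2)) with hD
  have ht : (e x₀, z₀) ∈ (Φ (ℭ m n) (x₀, c)).target :=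
    mem_conf_target.2 ⟨mem_extChartAt_target (I := ℳ m) x₀, (Φ (ℬ n) c).map_source hy⟩
  have hs : (Φ (ℭ m n) (x₀, c)).symm (e x₀, z₀) = (x₀, y₀) := by
    rw [prodChart_symm]
    exact Prod.ext (extChartAt_to_inv (I := ℳ m) x₀) ((Φ (ℬ n) c).left_inv hy)
  have hΨ1 : ContDiffWithinAt ℝ 1 Ψ (range (ℭ m n)) (e x₀, z₀) :=
    hθ.contDiffWithinAt hU ht (hs ▸ h) _
  have hrange : range (ℭ m n) = range (ℳ m) ×ˢ univ := by
    rw [← (ℬ n).range_eq_univ]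
    exact ModelWithCorners.range_prod
  have hder : ∀ᶠ q : (Fin m → M) × (Fin n → E2) in 𝓝 (x₀, z₀),
      HasFDerivAt (fun z => formInChart (fibreForm volM θ q.1) c z w) (D q) q.2 := by
    have h1 := (eventually_formInChart_fibreForm hvol hU hθ.alternating hy h w).eventually_nhds
    have h2 : ∀ᶠ p in 𝓝[range (ℭ m n)] (e x₀, z₀), p ∈ range (ℭ m n) ∧
        DifferentiableWithinAt ℝ Ψ (range (ℭ m n)) p := by
      have h3 := (hΨ1.eventually (by simp)).mono fun p hp => hp.differentiableWithinAt (by simp)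
      have h4 : insert (e x₀, z₀) (range (ℭ m n)) = range (ℭ m n) :=
        insert_eq_of_mem (target_subset (I := ℭ m n) (x₀, c) ht)
      rw [h4] at h3
      filter_upwards [self_mem_nhdsWithin, h3] with p hp hp' using ⟨hp, hp'⟩
    filter_upwards [h1, tendsto_chart_range.eventually h2] with q hq1 hq2
    have h5 : HasFDerivWithinAt Ψ (fderivWithin ℝ Ψ (range (ℭ m n)) (e q.1, q.2))
        (range (ℭ m n)) (e q.1, q.2) := hq2.2.hasFDerivWithinAt
    have h6 : HasFDerivAt (fun z : Fin n → E2 => (e q.1, z))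
        (ContinuousLinearMap.inr ℝ (Fin m → E3) (Fin n → E2)) q.2 := hasFDerivAt_prodMk_right _ _
    have h7 : HasFDerivAt (fun z => Ψ (e q.1, z))
        ((fderivWithin ℝ Ψ (range (ℭ m n)) (e q.1, q.2)).comp
          (ContinuousLinearMap.inr ℝ (Fin m → E3) (Fin n → E2))) q.2 := by
      rw [← hasFDerivWithinAt_univ]
      refine h5.comp q.2 h6.hasFDerivWithinAt fun z _ => ?_
      have := hq2.1
      rw [hrange] at this ⊢
      exact ⟨this.1, mem_univ _⟩
    have h8 := h7.const_mul (∏ i, coeffInChart volM (x₀ i) (Φ ℍ (x₀ i) (q.1 i)))⁻¹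
    refine h8.congr_of_eventuallyEq ?_
    have h9 : ∀ᶠ z in 𝓝 q.2, _ := (Continuous.prodMk_right q.1).continuousAt.eventually hq1
    filter_upwards [h9] with z hz
    rw [hz, div_eq_inv_mul]
  refine ⟨hder.mono fun q hq => hq.differentiableAt, ?_⟩
  have hDc : ContinuousAt D (x₀, z₀) := by
    refine ContinuousAt.smul ((continuousAt_prod_coeff hvol x₀ z₀).inv₀
      (prod_coeffInChart_ne_zero hvol (ξ := fun i => Φ ℍ (x₀ i) (x₀ i))
        (mem_extChartAt_target (I := ℳ m) x₀))) ?_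
    have h1 : ContinuousWithinAt (fderivWithin ℝ Ψ (range (ℭ m n))) (range (ℭ m n)) (e x₀, z₀) :=
      (hΨ1.fderivWithin_right (m := 0) (ℭ m n).uniqueDiffOn (by simp)
        (target_subset (I := ℭ m n) (x₀, c) ht)).continuousWithinAt
    have h2 : Tendsto (fun q : (Fin m → M) × (Fin n → E2) =>
        fderivWithin ℝ Ψ (range (ℭ m n)) (e q.1, q.2)) (𝓝 (x₀, z₀))
        (𝓝 (fderivWithin ℝ Ψ (range (ℭ m n)) (e x₀, z₀))) :=
      h1.tendsto.comp tendsto_chart_range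
    exact ((ContinuousLinearMap.compL ℝ (Fin n → E2) (EConf m n) ℝ).flip
      (ContinuousLinearMap.inr ℝ (Fin m → E3) (Fin n → E2))).continuous.continuousAt.tendsto.comp h2
  exact hDc.congr (hder.mono fun q hq => hq.fderiv.symm)

end Densities

theorem locLie_const_mul {S : Set E} {Z : E → E} {Θ : E → (Fin k → E) → ℝ}
    (hS : UniqueDiffWithinAt ℝ S y) (a : ℝ) (v : Fin k → E) :
    locLie S Z (fun y v => a * Θ y v) y v = a * locLie S Z Θ y v := by
  unfold locLie
  have h : fderivWithin ℝ (fun y => a * Θ y v) S y = a • fderivWithin ℝ (fun y => Θ y v) S y :=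
    fderivWithin_const_smul_field a hS
  rw [h, mul_add, Finset.mul_sum]
  rfl

theorem isChartSmooth_zero : IsChartSmooth (fun x : P => (0 : TangentSpace I x)) := by
  intro c
  have h : vectorInChart (fun x : P => (0 : TangentSpace I x)) c = fun _ => 0 := by
    funext y
    exact (mfd I 𝓘(ℝ, E) (Φ I c) ((Φ I c).symm y)).map_zero
  rw [h]
  exact contDiffOn_const

variable {Y : VField ℍ M} {Y' : VField 𝔹 N}

section Slots

theorem mem_range_confModel {p : EConf m n} : p ∈ range (ℭ m n) ↔ ∀ i, p.1 i ∈ range ℍ := by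
  have h1 : range (ℭ m n) = range (ℳ m) ×ˢ range (ℬ n) := ModelWithCorners.range_prod
  have h2 : range (ℳ m) = {y | ∀ i, y i ∈ range ℍ} := range_powModel ℍ
  rw [h1, (ℬ n).range_eq_univ, h2]
  exact ⟨fun h => h.1, fun h => ⟨h, mem_univ _⟩⟩

/-- The vector field `(X₁, …, X_m, X', …, X')` on `M^m × N^n`. -/
def slotField (X : Fin m → VField ℍ M) (X' : VField 𝔹 N)
    (n : ℕ) : ∀ p : Conf M N m n, TangentSpace (ℭ m n) p :=
  fun p => ((fun i => fieldVal (X i) (p.1 i)), (fun j => fieldVal X' (p.2 j)))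

/-- The vector field `(X₁, …, X_m)` on `M^m`. -/
def bulkField (X : Fin m → VField ℍ M) :
    ∀ x : Fin m → M, TangentSpace (ℳ m) x := fun x i => fieldVal (X i) (x i)

variable {X : Fin m → VField ℍ M} {X' : VField 𝔹 N}

theorem isChartSmooth_slotField (hX : ∀ i, IsChartSmooth (X i)) (hX' : IsChartSmooth X') :
    IsChartSmooth (slotField X X' n) :=
  isChartSmooth_prod (X := bulkField X) (X' := bdryField X' n)
    (isChartSmooth_pow ℍ hX fun _ _ => rfl) (isChartSmooth_bdryField hX') fun _ => rfl

theorem vectorInChart_slotField {c : Conf M N m n} {p : EConf m n} (hp : p ∈ (Φ (ℭ m n) c).target) :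
    vectorInChart (slotField X X' n) c p =
      ((fun i => vectorInChart (X i) (c.1 i) (p.1 i)), vectorInChart (bdryField X' n) c.2 p.2) := by
  have h1 := vectorInChart_prod (X := bulkField X) (X' := bdryField X' n) (Z := slotField X X' n)
    (fun _ => rfl) hp
  rw [h1]
  refine Prod.ext (funext fun i => ?_) rfl
  exact vectorInChart_pow ℍ i (X := X i) (Z := bulkField X) (fun _ => rfl) (mem_conf_target.1 hp).1

/-- The positions of the vectors along the `i`-th factor in the list of all vectors. -/
def slotIdx (k : ℕ) (i : Fin m) (a : Fin 3) : Fin (m * 3 + k) :=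
  Fin.castAdd k (finProdFinEquiv (i, a))

theorem slotIdx_injective (i : Fin m) : Injective (slotIdx k i) := fun a b h => by
  have h1 := finProdFinEquiv.injective (Fin.castAdd_injective (m * 3) k h)
  exact congrArg Prod.snd h1

/-- The inclusion of a factor of `(ℝ³)^m × (ℝ²)^n`. -/
def slotIncl (n : ℕ) (i : Fin m) : E3 →L[ℝ] EConf m n :=
  (ContinuousLinearMap.inl ℝ (Fin m → E3) (Fin n → E2)).comp
    (ContinuousLinearMap.single ℝ (fun _ : Fin m => E3) i)

theorem slotIncl_apply (i : Fin m) (u : E3) :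
    slotIncl n i u = ((Pi.single i u : Fin m → E3), (0 : Fin n → E2)) := rfl

theorem appendVec_slotIdx (w : Fin k → Fin n → E2) (i : Fin m) (a : Fin 3) :
    appendVec (bulkBasis m) w (slotIdx k i a) = slotIncl n i (stdBasis3 a) := by
  rw [slotIdx, appendVec_castAdd, slotIncl_apply, bulkBasis, Equiv.symm_apply_apply]

theorem appendVec_notMem_slotIdx (w : Fin k → Fin n → E2) (i : Fin m) {b : Fin (m * 3 + k)}
    (hb : b ∉ range (slotIdx k i)) : (appendVec (bulkBasis m) w b).1 i = 0 := by
  revert hb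
  refine Fin.addCases (fun a ha => ?_) (fun b _ => ?_) b
  · rw [appendVec_castAdd, bulkBasis]
    refine Pi.single_eq_of_ne (fun h => ha ⟨(finProdFinEquiv.symm a).2, ?_⟩) _
    rw [slotIdx, h]
    exact congrArg _ (finProdFinEquiv.apply_symm_apply a)
  · rw [appendVec_natAdd]
    rfl

/-- The form on the `i`-th factor `M` obtained from `θ` by fixing the other points and vectors. -/
def slotForm (θ : ConfForm M N m n (m * 3 + k)) (x : Fin m → M)
    (y : Fin n → N) (w : Fin k → Fin n → E2) (i : Fin m) : PreForm ℍ M 3 :=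
  fun x' (u : Fin 3 → E3) => θ.val (update x i x', y)
    (extend (slotIdx k i) (fun a => slotIncl n i (u a)) (appendVec (bulkBasis m) w))

theorem slotForm_update (θ : ConfForm M N m n (m * 3 + k)) (x : Fin m → M)
    (y : Fin n → N) (w : Fin k → Fin n → E2) (i : Fin m) (x' : M) :
    slotForm θ (update x i x') y w i = slotForm θ x y w i := by
  funext x'' u
  simp only [slotForm, update_idem]

/-- The coordinates of `x` in the chart at `x`. -/
def ownCoord (x : Fin m → M) : Fin m → E3 := fun i => Φ ℍ (x i) (x i)

theorem ownCoord_mem (x : Fin m → M) : ownCoord x ∈ (Φ (ℳ m) x).target :=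
  mem_extChartAt_target (I := ℳ m) x

theorem update_ownCoord_mem {x : Fin m → M} {y : Fin n → N} {i : Fin m} {c : M} {s : E3}
    (hs : s ∈ (Φ ℍ c).target) : (update (ownCoord x) i s, Φ (ℬ n) y y) ∈
      (Φ (ℭ m n) ((update x i c, y) : Conf M N m n)).target := by
  refine mem_conf_target.2 ⟨mem_bulk_target.2 fun l => ?_, mem_extChartAt_target (I := ℬ n) y⟩
  by_cases h : l = i
  · subst h; simpa using hs
  · simp only [update_of_ne h]
    exact mem_extChartAt_target (x l)

theorem formInChart_slotForm (θ : ConfForm M N m n (m * 3 + k))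
    (x : Fin m → M) (y : Fin n → N) (w : Fin k → Fin n → E2) (i : Fin m) {c : M} {s : E3}
    (hs : s ∈ (Φ ℍ c).target) (u : Fin 3 → E3) : formInChart (slotForm θ x y w i) c s u =
      formInChart θ (update x i c, y) (update (ownCoord x) i s, Φ (ℬ n) y y)
        (extend (slotIdx k i) (fun a => slotIncl n i (u a)) (appendVec (bulkBasis m) w)) := by
  have ht := update_ownCoord_mem (x := x) (y := y) (i := i) hs
  have hsymm : (Φ (ℭ m n) ((update x i c, y) : Conf M N m n)).symm
      (update (ownCoord x) i s, Φ (ℬ n) y y) = (update x i ((Φ ℍ c).symm s), y) := by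
    rw [prodChart_symm]
    refine Prod.ext (funext fun l => ?_) (extChartAt_to_inv (I := ℬ n) y)
    refine (extChartAt_pow_symm_apply ℍ _ _ l).trans ?_
    by_cases h : l = i
    · subst h; simp
    · simp only [update_of_ne h]
      exact extChartAt_to_inv (x l)
  rw [formInChart_eq θ, hsymm]
  change θ.val (update x i ((Φ ℍ c).symm s), y)
    (extend (slotIdx k i) (fun a => slotIncl n i (chartD ℍ c s (u a)))
      (appendVec (bulkBasis m) w)) = _
  congr 1
  funext b
  have h1 : (Φ (ℬ n) y y) ∈ (Φ (ℬ n) y).target := mem_extChartAt_target (I := ℬ n) y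
  have hself : chartD (ℬ n) y (Φ (ℬ n) y y) = .id ℝ _ := chartD_self (I := ℬ n) y
  have hl (v : EConf m n) (l : Fin m) : (chartD (ℭ m n) ((update x i c, y) : Conf M N m n)
        (update (ownCoord x) i s, Φ (ℬ n) y y) v).1 l =
        if l = i then chartD ℍ c s (v.1 i) else v.1 l := by
    rw [chartD_conf ht]
    refine (chartD_pow ℍ l (mem_conf_target.1 ht).1 v.1).trans ?_
    by_cases h : l = i
    · subst h; simp
    · simp only [update_of_ne h, h, if_false]
      exact congrArg (fun L : E3 →L[ℝ] E3 => L (v.1 l)) (chartD_self (I := ℍ) (x l))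
  have hl2 (v : EConf m n) : (chartD (ℭ m n) ((update x i c, y) : Conf M N m n)
        (update (ownCoord x) i s, Φ (ℬ n) y y) v).2 = v.2 := by
    rw [chartD_conf ht, hself]
    rfl
  by_cases hb : ∃ a, slotIdx k i a = b
  · obtain ⟨a, rfl⟩ := hb
    rw [(slotIdx_injective i).extend_apply, (slotIdx_injective i).extend_apply]
    refine Prod.ext (funext fun l => ?_) ?_
    · rw [hl, slotIncl_apply, slotIncl_apply]
      by_cases h : l = i
      · subst h; simp
      · simp [h]
    · rw [hl2]; rfl
  · rw [extend_apply' _ _ _ hb, extend_apply' _ _ _ hb]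
    refine Prod.ext (funext fun l => ?_) (hl2 _).symm
    rw [hl]
    by_cases h : l = i
    · subst h
      simp [appendVec_notMem_slotIdx w l hb]
    · simp [h]

theorem isFormOn_slotForm (hθ : IsFormOn ∞ θ univ) (x : Fin m → M) (y : Fin n → N)
    (w : Fin k → Fin n → E2) (i : Fin m) : IsFormOn ∞ (slotForm θ x y w i) univ := by
  refine ⟨fun x' _ => ?_, fun c u s hs => ?_⟩
  · exact IsAlt.extend (V' := E3) (a := θ.val (update x i x', y)) (hθ.alternating _ (mem_univ _))
      (slotIdx_injective i) (slotIncl n i).toLinearMap (appendVec (bulkBasis m) w)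
  · have ht := update_ownCoord_mem (x := x) (y := y) (i := i) hs.1
    have h1 := hθ.contDiffWithinAt isOpen_univ ht (mem_univ _)
      (extend (slotIdx k i) (fun a => slotIncl n i (u a)) (appendVec (bulkBasis m) w))
    have h2 : ContDiff ℝ ∞ fun s : E3 => ((update (ownCoord x) i s, Φ (ℬ n) y y) : EConf m n) :=
      (contDiff_update (𝕜 := ℝ) (F' := fun _ : Fin m => E3) ∞ (ownCoord x) i).prodMk contDiff_const
    have h3 := h1.comp s h2.contDiffWithinAt (s := (Φ ℍ c).target ∩
      (Φ ℍ c).symm ⁻¹' univ) fun s' hs' => target_subset (I := ℭ m n) _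
          (update_ownCoord_mem (x := x) (y := y) (i := i) hs'.1)
    exact h3.congr_of_mem (fun s' hs' => formInChart_slotForm θ x y w i hs'.1 u) hs

theorem lieDeriv_slotField_val (hθ : IsFormOn ∞ θ univ) (hY : IsChartSmooth Y) (x : Fin m → M)
    (y : Fin n → N) (w : Fin k → Fin n → E2) (i : Fin m) :
    (lieDeriv (slotField (update (fun _ _ => 0) i Y) (fun _ => 0) n) θ).val (x, y)
        (appendVec (bulkBasis m) w) =
      (lieDeriv Y (slotForm θ x y w i)).val (x i) stdBasis3 := by
  have hu : update x i (x i) = x := update_eq_self _ _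
  have hξ : update (ownCoord x) i (Φ ℍ (x i) (x i)) = ownCoord x := update_eq_self i (ownCoord x)
  have hx : Φ (ℭ m n) ((x, y) : Conf M N m n) (x, y) =
      (ownCoord x, Φ (ℬ n) y y) := extChartAt_prod_apply _ _
  set Z := vectorInChart (slotField (update (fun _ _ => 0) i Y) (fun _ => 0) n)
    ((x, y) : Conf M N m n) with hZ
  set Zs := vectorInChart Y (x i) with hZs
  set s₀ := Φ ℍ (x i) (x i) with hs₀
  set κ : E3 → EConf m n := fun s => (update (ownCoord x) i s, Φ (ℬ n) y y)
  have hκ₀ : κ s₀ = (ownCoord x, Φ (ℬ n) y y) := by simp only [κ, hξ]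
  have ht : κ s₀ ∈ (Φ (ℭ m n) ((x, y) : Conf M N m n)).target := by
    rw [hκ₀, ← hx]
    exact mem_extChartAt_target (I := ℭ m n) (x, y)
  have hr := target_subset (I := ℭ m n) (x, y) ht
  have hZ1 : ∀ p ∈ (Φ (ℭ m n) ((x, y) : Conf M N m n)).target, Z p = slotIncl n i (Zs (p.1 i)) := by
    intro p hp
    rw [hZ, vectorInChart_slotField hp]
    have h0 (c : M) (s : E3) : vectorInChart (fun x : M => (0 : TangentSpace ℍ x)) c s = 0 :=
      (mfd ℍ 𝓘(ℝ, E3) (Φ ℍ c) ((Φ ℍ c).symm s)).map_zero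
    refine Prod.ext (funext fun l => ?_) ?_
    · rw [slotIncl_apply]
      by_cases h : l = i
      · subst h; simp [hZs]
      · simp [h, h0]
    · exact (mfd (ℬ n) 𝓘(ℝ, Fin n → E2) (Φ (ℬ n) y) ((Φ (ℬ n) y).symm p.2)).map_zero
  have hZd : HasFDerivWithinAt Z ((slotIncl n i).comp ((fderivWithin ℝ Zs (range ℍ) s₀).comp
      ((ContinuousLinearMap.proj i).comp (ContinuousLinearMap.fst ℝ (Fin m → E3) (Fin n → E2)))))
      (range (ℭ m n)) (κ s₀) := by
    have h1 : HasFDerivWithinAt Zs (fderivWithin ℝ Zs (range ℍ) s₀) (range ℍ) ((κ s₀).1 i) := by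
      rw [hκ₀]
      exact ((hY.contDiffWithinAt (mem_extChartAt_target (x i))).differentiableWithinAt
        (by simp)).hasFDerivWithinAt
    have h2 : HasFDerivWithinAt (fun p : EConf m n => p.1 i)
        ((ContinuousLinearMap.proj i).comp (ContinuousLinearMap.fst ℝ (Fin m → E3) (Fin n → E2)))
        (range (ℭ m n)) (κ s₀) :=
      ((ContinuousLinearMap.proj i).comp
        (ContinuousLinearMap.fst ℝ (Fin m → E3) (Fin n → E2))).hasFDerivWithinAt
    have h3 := (slotIncl n i).hasFDerivAt.comp_hasFDerivWithinAt _
      (h1.comp (κ s₀) h2 fun p hp => mem_range_confModel.1 hp i)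
    refine h3.congr_of_eventuallyEq ?_ (hZ1 _ ht)
    have h4 : (Φ (ℭ m n) ((x, y) : Conf M N m n)).target ∈
        𝓝[range (ℭ m n)] (κ s₀) := extChartAt_target_mem_nhdsWithin_of_mem ht
    filter_upwards [h4] with p hp using hZ1 p hp
  have hud : UniqueDiffWithinAt ℝ (range (ℭ m n)) (κ s₀) := (ℭ m n).uniqueDiffOn _ hr
  rw [lieDeriv_eq_locLie, lieDeriv_eq_locLie, hx, ← hκ₀]
  rw [locLie_slice (Ss := range ℍ) (Zs := Zs) (κ := κ) (s₀ := s₀) (T := slotIncl n i)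
    (j := slotIdx k i) (u := stdBasis3)]
  · refine locLie_congr (mem_range_self _) EventuallyEq.rfl ?_ _
    filter_upwards [extChartAt_target_mem_nhdsWithin (I := ℍ) (x i)] with s hs u
    rw [formInChart_slotForm θ x y w i hs u, hu]
  · exact (ℍ).uniqueDiffOn _ (mem_range_self _)
  · have h1 := (hasFDerivAt_update (𝕜 := ℝ) (ownCoord x) (i := i) s₀).prodMk
      (hasFDerivAt_const (Φ (ℬ n) y y) s₀)
    refine h1.congr_fderiv ?_
    ext u : 1
    rw [slotIncl_apply]
    refine Prod.ext (funext fun l => ?_) rfl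
    by_cases h : l = i
    · subst h; simp
    · simp [h]
  · intro s hs
    refine mem_range_confModel.2 fun l => ?_
    by_cases h : l = i
    · subst h; simpa [κ] using hs
    · simp only [κ, update_of_ne h]
      exact mem_range_self _
  · exact slotIdx_injective i
  · exact fun a => appendVec_slotIdx w i a
  · change Z (κ s₀) = _
    rw [hZ1 _ ht, hκ₀]
    rfl
  · intro a
    rw [hZd.fderivWithin hud, appendVec_slotIdx]
    simp [slotIncl_apply]
  · intro b hb
    rw [hZd.fderivWithin hud]
    simp [appendVec_notMem_slotIdx w i hb]
  · refine isAlt_formInChart hθ.alternating (mem_univ _)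
  · exact (hθ.contDiffWithinAt isOpen_univ ht (mem_univ _) _).differentiableWithinAt (by simp)

theorem lieDeriv_slotField_zero_val (hvol : ∀ x, volM.val x stdBasis3 ≠ 0) (hθ : IsFormOn 1 θ univ)
    (hX' : IsChartSmooth X') (x : Fin m → M) (y : Fin n → N) (w : Fin k → Fin n → E2) :
    fibreDensity volM (lieDeriv (slotField (fun _ _ => 0) X' n) θ) y w x =
      (lieDeriv (bdryField X' n) (fibreForm volM θ x)).val y w := by
  have hx : Φ (ℭ m n) ((x, y) : Conf M N m n) (x, y) =
      (ownCoord x, Φ (ℬ n) y y) := extChartAt_prod_apply _ _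
  set s₀ := Φ (ℬ n) y y with hs₀
  set Z := vectorInChart (slotField (fun _ _ => 0) X' n) ((x, y) : Conf M N m n) with hZ
  set Zs := vectorInChart (bdryField X' n) y with hZs
  set κ : (Fin n → E2) → EConf m n := fun z => (ownCoord x, z)
  set T : (Fin n → E2) →L[ℝ] EConf m n := ContinuousLinearMap.inr ℝ (Fin m → E3) (Fin n → E2)
    with hT
  have htz {z : Fin n → E2} (hz : z ∈ (Φ (ℬ n) y).target) :
      κ z ∈ (Φ (ℭ m n) ((x, y) : Conf M N m n)).target :=
    mem_conf_target.2 ⟨ownCoord_mem x, hz⟩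
  have ht : κ s₀ ∈ (Φ (ℭ m n) ((x, y) : Conf M N m n)).target :=
    htz (mem_extChartAt_target (I := ℬ n) y)
  have hr := target_subset (I := ℭ m n) (x, y) ht
  have hZ1 : ∀ p ∈ (Φ (ℭ m n) ((x, y) : Conf M N m n)).target, Z p = T (Zs p.2) := by
    intro p hp
    rw [hZ, vectorInChart_slotField hp]
    refine Prod.ext (funext fun l => ?_) rfl
    exact (mfd ℍ 𝓘(ℝ, E3) (Φ ℍ (x l)) ((Φ ℍ (x l)).symm (p.1 l))).map_zero
  have hZd : HasFDerivWithinAt Z (T.comp ((fderivWithin ℝ Zs (range (ℬ n)) s₀).comp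
      (ContinuousLinearMap.snd ℝ (Fin m → E3) (Fin n → E2)))) (range (ℭ m n)) (κ s₀) := by
    have h1 : HasFDerivWithinAt Zs (fderivWithin ℝ Zs (range (ℬ n)) s₀) (range (ℬ n)) (κ s₀).2 :=
      (((isChartSmooth_bdryField hX').contDiffWithinAt
        (mem_extChartAt_target (I := ℬ n) y)).differentiableWithinAt (by simp)).hasFDerivWithinAt
    have h3 := T.hasFDerivAt.comp_hasFDerivWithinAt _ (h1.comp (s := range (ℭ m n)) (κ s₀)
        (ContinuousLinearMap.snd ℝ (Fin m → E3) (Fin n → E2)).hasFDerivWithinAt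
        fun p _ => by rw [(ℬ n).range_eq_univ]; exact mem_univ _)
    refine h3.congr_of_eventuallyEq ?_ (hZ1 _ ht)
    have h4 : (Φ (ℭ m n) ((x, y) : Conf M N m n)).target ∈
        𝓝[range (ℭ m n)] (κ s₀) := extChartAt_target_mem_nhdsWithin_of_mem ht
    filter_upwards [h4] with p hp using hZ1 p hp
  have hud : UniqueDiffWithinAt ℝ (range (ℭ m n)) (κ s₀) := (ℭ m n).uniqueDiffOn _ hr
  have hj : Injective (Fin.natAdd (m * 3) : Fin k → Fin (m * 3 + k)) := Fin.natAdd_injective k _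
  have hext (u : Fin k → Fin n → E2) :
      extend (Fin.natAdd (m * 3)) (fun a => T (u a)) (appendVec (bulkBasis m) w) =
        appendVec (bulkBasis m) u := by
    funext b
    refine Fin.addCases (fun a => ?_) (fun b => ?_) b
    · rw [extend_apply', appendVec_castAdd, appendVec_castAdd]
      rintro ⟨a', ha⟩
      have := congrArg Fin.val ha
      simp at this
      omega
    · rw [hj.extend_apply, appendVec_natAdd]
      rfl
  have hV : ∏ i, volM.val (x i) stdBasis3 ≠ 0 := Finset.prod_ne_zero_iff.2 fun i _ => hvol _
  rw [fibreDensity_eq, div_eq_iff hV, mul_comm ((lieDeriv _ _).val _ _), lieDeriv_eq_locLie,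
    lieDeriv_eq_locLie, hx, ← locLie_const_mul (y := Φ (ℬ n) y y)
      ((ℬ n).uniqueDiffOn _ (mem_range_self _))]
  change locLie (range (ℭ m n)) Z (formInChart θ (x, y)) (κ s₀) (appendVec (bulkBasis m) w) = _
  rw [locLie_slice (Ss := range (ℬ n)) (Zs := Zs) (κ := κ) (s₀ := s₀) (T := T)
    (j := Fin.natAdd (m * 3)) (u := w)]
  · refine locLie_congr (mem_range_self _) EventuallyEq.rfl ?_ _
    filter_upwards [extChartAt_target_mem_nhdsWithin (I := ℬ n) y] with z hz u
    rw [hext u, formInChart_eq, formInChart_eq]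
    have h1 : (Φ (ℭ m n) ((x, y) : Conf M N m n)).symm (κ z) = (x, (Φ (ℬ n) y).symm z) := by
      rw [prodChart_symm]
      exact Prod.ext (extChartAt_to_inv (I := ℳ m) x) rfl
    have h2 : (fun b => chartD (ℭ m n) ((x, y) : Conf M N m n) (κ z)
        (appendVec (bulkBasis m) u b)) =
          appendVec (bulkBasis m) fun b => chartD (ℬ n) y z (u b) := by
      have hself : chartD (ℳ m) x (ownCoord x) = .id ℝ _ := chartD_self (I := ℳ m) x
      funext b
      rw [chartD_conf (htz hz)]
      refine Fin.addCases (fun a => ?_) (fun b => ?_) b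
      · rw [appendVec_castAdd, appendVec_castAdd]
        simp [κ, hself]
      · rw [appendVec_natAdd, appendVec_natAdd]
        simp [κ]
    rw [h1, h2]
    exact (mul_div_cancel₀ _ hV).symm
  · exact (ℬ n).uniqueDiffOn _ (mem_range_self _)
  · exact hasFDerivAt_prodMk_right _ _
  · intro s _
    exact mem_range_confModel.2 fun l => mem_range_self _
  · exact hj
  · exact fun a => appendVec_natAdd _ _ _
  · exact hZ1 _ ht
  · intro a
    rw [hZd.fderivWithin hud, appendVec_natAdd]
    rfl
  · intro b hb
    rw [hZd.fderivWithin hud]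
    revert hb
    refine Fin.addCases (fun a _ => ?_) (fun b hb => absurd ⟨b, rfl⟩ hb) b
    rw [appendVec_castAdd]
    simp
  · exact isAlt_formInChart hθ.alternating (mem_univ _)
  · exact (hθ.contDiffWithinAt isOpen_univ ht (mem_univ _) _).differentiableWithinAt (by simp)

end Slots

/-! ### Parametric integrals -/

theorem IsAlt.integral {Ω : Type*} [MeasurableSpace Ω] {μ : Measure Ω} {a : Ω → (Fin k → V) → ℝ}
    (ha : ∀ᵐ x ∂μ, IsAlt (a x)) (hint : ∀ v, Integrable (fun x => a x v) μ) :
    IsAlt fun v => ∫ x, a x v ∂μ := by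
  refine ⟨{
    toFun := fun v => ∫ x, a x v ∂μ
    map_update_add' := ?_
    map_update_smul' := ?_
    map_eq_zero_of_eq' := ?_ }, fun v => rfl⟩
  · intro inst v i x y
    rw [← integral_add (hint _) (hint _)]
    refine integral_congr_ae (ha.mono fun p hp => ?_)
    obtain ⟨A, hA⟩ := hp
    simp only [hA, A.map_update_add]
  · intro inst v i c x
    rw [smul_eq_mul, ← integral_const_mul]
    refine integral_congr_ae (ha.mono fun p hp => ?_)
    obtain ⟨A, hA⟩ := hp
    simp only [hA, A.map_update_smul, smul_eq_mul]
  · intro v i j hv hij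
    refine integral_eq_zero_of_ae (ha.mono fun p hp => ?_)
    obtain ⟨A, hA⟩ := hp
    simp only [hA, A.map_eq_zero_of_eq _ hv hij, Pi.zero_apply]

theorem hasFDerivAt_integral_of_compactSpace {K : Type*} [TopologicalSpace K] [CompactSpace K]
    [MeasurableSpace K] [OpensMeasurableSpace K] {μ : Measure K} [IsFiniteMeasure μ]
    [FiniteDimensional ℝ E] {F : K → E → ℝ} {V : Set E} (hV : IsOpen V)
    (hd : ∀ x, ∀ z ∈ V, DifferentiableAt ℝ (F x) z)
    (hF : ∀ x, ∀ z ∈ V, ContinuousAt (fun q : K × E => F q.1 q.2) (x, z))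
    (hF' : ∀ x, ∀ z ∈ V, ContinuousAt (fun q : K × E => fderiv ℝ (F q.1) q.2) (x, z)) {z₀ : E}
    (hz₀ : z₀ ∈ V) : Integrable (fun x => F x z₀) μ ∧ Integrable (fun x => fderiv ℝ (F x) z₀) μ ∧
    HasFDerivAt (fun z => ∫ x, F x z ∂μ) (∫ x, fderiv ℝ (F x) z₀ ∂μ) z₀ ∧
    ContinuousAt (fun z => ∫ x, fderiv ℝ (F x) z ∂μ) z₀ := by
  have hpair (z : E) : Continuous fun x : K => (x, z) := Continuous.prodMk_left z
  have hcF (z : E) (hz : z ∈ V) : Continuous fun x => F x z := continuous_iff_continuousAt.2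
    fun x => ContinuousAt.comp (f := fun x : K => (x, z)) (hF x z hz) (hpair z).continuousAt
  have hcF' (z : E) (hz : z ∈ V) : Continuous fun x => fderiv ℝ (F x) z :=
    continuous_iff_continuousAt.2 fun x => ContinuousAt.comp (f := fun x : K => (x, z))
      (hF' x z hz) (hpair z).continuousAt
  have hsep : SecondCountableTopology (E →L[ℝ] ℝ) := by
    have : ProperSpace (E →L[ℝ] ℝ) := FiniteDimensional.proper_real _
    exact secondCountable_of_proper
  obtain ⟨ε, hε, hball⟩ := Metric.isOpen_iff.1 hV z₀ hz₀
  have hprop : ProperSpace E := FiniteDimensional.proper_real _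
  have hsub : Metric.closedBall z₀ (ε / 2) ⊆ V :=
    (Metric.closedBall_subset_ball (by linarith)).trans hball
  obtain ⟨C, hC⟩ := (isCompact_univ.prod (isCompact_closedBall z₀ (ε / 2))).exists_bound_of_continuousOn
    (f := fun q : K × E => fderiv ℝ (F q.1) q.2)
    fun q hq => (hF' q.1 q.2 (hsub hq.2)).continuousWithinAt
  have hb : ∀ x, ∀ z ∈ Metric.ball z₀ (ε / 2), ‖fderiv ℝ (F x) z‖ ≤ C := fun x z hz =>
    hC (x, z) ⟨mem_univ _, Metric.ball_subset_closedBall hz⟩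
  have hnear : Metric.ball z₀ (ε / 2) ∈ 𝓝 z₀ := Metric.ball_mem_nhds _ (by positivity)
  have hintF : Integrable (fun x => F x z₀) μ := by
    obtain ⟨C', hC'⟩ := isCompact_univ.exists_bound_of_continuousOn (hcF z₀ hz₀).continuousOn
    exact Integrable.of_bound (hcF z₀ hz₀).aestronglyMeasurable C'
      (Eventually.of_forall fun x => hC' x (mem_univ _))
  refine ⟨hintF, Integrable.of_bound (hcF' z₀ hz₀).aestronglyMeasurable C
    (Eventually.of_forall fun x => hb x z₀ (mem_of_mem_nhds hnear)), ?_, ?_⟩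
  · refine hasFDerivAt_integral_of_dominated_of_fderiv_le (bound := fun _ => C) hnear ?_ hintF
      (hcF' z₀ hz₀).aestronglyMeasurable (Eventually.of_forall fun x z hz => hb x z hz)
      (integrable_const _) (Eventually.of_forall fun x z hz =>
        (hd x z (hsub (Metric.ball_subset_closedBall hz))).hasFDerivAt)
    filter_upwards [hV.mem_nhds hz₀] with z hz using (hcF z hz).aestronglyMeasurable
  · refine continuousAt_of_dominated (bound := fun _ => C) ?_ ?_ (integrable_const _)
      (Eventually.of_forall fun x => ?_)
    · filter_upwards [hV.mem_nhds hz₀] with z hz using (hcF' z hz).aestronglyMeasurable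
    · filter_upwards [hnear] with z hz using Eventually.of_forall fun x => hb x z hz
    · exact ContinuousAt.comp (f := fun z : E => (x, z)) (hF' x z₀ hz₀)
        (Continuous.prodMk_right x).continuousAt

/-! ### Fibre integration of smooth forms commutes with Lie derivatives -/

section FibreIntegration

variable [MeasurableSpace M] [BorelSpace M]

theorem secondCountable_of_compact (M : Type*) [TopologicalSpace M] [CompactSpace M]
    [ChartedSpace (EuclideanHalfSpace 3) M] : SecondCountableTopology M :=
  have : SecondCountableTopology (EuclideanHalfSpace 3) := by
    unfold EuclideanHalfSpace
    infer_instance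
  ChartedSpace.secondCountable_of_sigmaCompact (EuclideanHalfSpace 3) M

theorem isFinite_bulkMeasure (hvol : IsVolumeForm volM) (m : ℕ) :
    IsFiniteMeasure (bulkMeasure volM m) := by
  have := isFinite_volumeMeasure hvol
  unfold bulkMeasure
  infer_instance

theorem vol_ne_zero (hvol : IsVolumeForm volM) (x : M) : volM.val x stdBasis3 ≠ 0 := hvol.ne_zero x

theorem integral_fibreDensity_slotField (hι : IsBoundaryInclusion ι) (hvol : IsVolumeForm volM)
    (hY : IsChartSmooth Y) (hYY : RestrictsTo ι Y Y') (hθ : IsFormOn ∞ θ univ) (y : Fin n → N)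
    (w : Fin k → Fin n → E2) (i : Fin m) :
    ∫ x, fibreDensity volM (lieDeriv (slotField (update (fun _ _ => 0) i Y) (fun _ => 0) n) θ) y w x
      ∂bulkMeasure volM m = 0 := by
  have := isFinite_volumeMeasure hvol
  cases m with
  | zero => exact i.elim0
  | succ m' =>
    set f := fibreDensity volM
      (lieDeriv (slotField (update (fun _ _ => 0) i Y) (fun _ => 0) n) θ) y w with hf
    have hfx (x : Fin (m' + 1) → M) : f x = topRatio volM (lieDeriv Y (slotForm θ x y w i)) (x i) /
          ∏ l, volM.val (x (i.succAbove l)) stdBasis3 := by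
      rw [hf, fibreDensity_eq, lieDeriv_slotField_val hθ hY, Fin.prod_univ_succAbove _ i]
      refine (div_mul_eq_div_div (α := ℝ) _ _ _).trans (congrArg (fun r => r / _)
        (congrArg₂ (· / ·) (formInChart_self (I := ℍ) _ (x i) stdBasis3).symm
          (formInChart_self (I := ℍ) _ (x i) stdBasis3).symm))
    have hmp := (measurePreserving_piFinSuccAbove (fun _ : Fin (m' + 1) => volumeMeasure volM) i).symm
    rw [bulkMeasure, ← hmp.integral_comp']
    by_cases hint : Integrable (fun q => f ((MeasurableEquiv.piFinSuccAbove (fun _ => M) i).symm q))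
        ((volumeMeasure volM).prod (Measure.pi fun _ : Fin m' => volumeMeasure volM))
    · rw [integral_prod_symm _ hint]
      refine integral_eq_zero_of_ae (Eventually.of_forall fun x' => ?_)
      have h1 (s : M) : f ((MeasurableEquiv.piFinSuccAbove (fun _ => M) i).symm (s, x')) =
          topRatio volM (lieDeriv Y (slotForm θ (i.insertNth s x') y w i)) s /
            ∏ l, volM.val (x' l) stdBasis3 := by
        have h2 : (MeasurableEquiv.piFinSuccAbove (fun _ => M) i).symm (s, x') =
          i.insertNth s x' := rfl
        rw [h2, hfx]
        simp
      have h3 (s s₀ : M) : slotForm θ (i.insertNth s x') y w i =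
          slotForm θ (i.insertNth s₀ x') y w i := by
        rw [← slotForm_update θ (i.insertNth s₀ x') y w i s]
        congr 1
        simp
      change ∫ s, f ((MeasurableEquiv.piFinSuccAbove (fun _ => M) i).symm (s, x'))
        ∂volumeMeasure volM = 0
      rcases isEmpty_or_nonempty M with hM | ⟨⟨s₀⟩⟩
      · exact integral_eq_zero_of_ae (Eventually.of_forall fun s => hM.elim s)
      · simp only [h1, h3 _ s₀]
        rw [integral_div, integral_topRatio_lieDeriv hι hvol hY hYY (isFormOn_slotForm hθ _ y w i),
          zero_div]
    · exact integral_undef hint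

theorem continuous_fibreDensity (hvol : IsVolumeForm volM) (hθ : IsFormOn 0 θ univ) (y : Fin n → N)
    (w : Fin k → Fin n → E2) : Continuous (fibreDensity volM θ y w) :=
  continuous_iff_continuousAt.2 fun _ =>
    continuousAt_fibreDensity hvol isOpen_univ hθ (mem_univ _) w

theorem integrable_fibreDensity' (hvol : IsVolumeForm volM) (hθ : IsFormOn 0 θ univ)
    (y : Fin n → N) (w : Fin k → Fin n → E2) :
    Integrable (fibreDensity volM θ y w) (bulkMeasure volM m) := by
  have := isFinite_bulkMeasure hvol m
  have := secondCountable_of_compact M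
  have hc := continuous_fibreDensity hvol hθ y w
  obtain ⟨C, hC⟩ := isCompact_univ.exists_bound_of_continuousOn hc.continuousOn
  exact Integrable.of_bound hc.aestronglyMeasurable C
    (Eventually.of_forall fun x => hC x (mem_univ _))

theorem hasFDerivAt_fibreIntegral (hvol : IsVolumeForm volM) (hθ : IsFormOn 1 θ univ)
    {c : Fin n → N} {z : Fin n → E2} (hz : z ∈ (Φ (ℬ n) c).target) (w : Fin k → Fin n → E2) :
    Integrable (fun x => formInChart (fibreForm volM θ x) c z w) (bulkMeasure volM m) ∧
    Integrable (fun x => fderiv ℝ (fun z => formInChart (fibreForm volM θ x) c z w) z)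
      (bulkMeasure volM m) ∧
    HasFDerivAt (fun z => formInChart (fibreIntegral volM θ) c z w)
      (∫ x, fderiv ℝ (fun z => formInChart (fibreForm volM θ x) c z w) z ∂bulkMeasure volM m) z ∧
    ContinuousAt (fun z => ∫ x, fderiv ℝ (fun z => formInChart (fibreForm volM θ x) c z w) z
      ∂bulkMeasure volM m) z := by
  have := isFinite_bulkMeasure hvol m
  have := secondCountable_of_compact M
  have h (x : Fin m → M) {z : Fin n → E2} (hz : z ∈ (Φ (ℬ n) c).target) :
      _ ∧ _ :=
    exists_hasFDerivAt_formInChart_fibreForm hvol isOpen_univ hθ (x₀ := x)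
      ((Φ (ℬ n) c).map_target hz) (mem_univ _) w
  have h0 (x : Fin m → M) {z : Fin n → E2} (hz : z ∈ (Φ (ℬ n) c).target) :=
    continuousAt_formInChart_fibreForm hvol isOpen_univ (hθ.of_le (by simp)) (x₀ := x)
      ((Φ (ℬ n) c).map_target hz) (mem_univ _) w
  refine hasFDerivAt_integral_of_compactSpace (μ := bulkMeasure volM m)
    (F := fun x z => formInChart (fibreForm volM θ x) c z w)
    (isOpen_extChartAt_target (I := ℬ n) c) ?_ ?_ ?_ hz
  · intro x z hz
    have := (h x hz).1.self_of_nhds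
    rwa [(Φ (ℬ n) c).right_inv hz] at this
  · intro x z hz
    have := h0 x hz
    rwa [(Φ (ℬ n) c).right_inv hz] at this
  · intro x z hz
    have := (h x hz).2
    rwa [(Φ (ℬ n) c).right_inv hz] at this

theorem isAlt_fibreForm (hθ : IsAlternatingOn θ U) {x : Fin m → M} {y : Fin n → N}
    (h : (x, y) ∈ U) : IsAlt ((fibreForm volM θ x).val y) := by
  have h1 := IsAlt.extend (V' := Fin n → E2) (a := θ.val (x, y)) (hθ _ h)
    (j := Fin.natAdd (m * 3)) (Fin.natAdd_injective k _)
    (LinearMap.inr ℝ (Fin m → E3) (Fin n → E2)) (appendVec (bulkBasis m) 0)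
  have h2 : (fibreForm volM θ x).val y = fun w => (∏ i, volM.val (x i) stdBasis3)⁻¹ *
      θ.val (x, y) (extend (Fin.natAdd (m * 3))
        (fun b => LinearMap.inr ℝ (Fin m → E3) (Fin n → E2) (w b)) (appendVec (bulkBasis m) 0)) := by
    funext w
    have h3 : extend (Fin.natAdd (m * 3)) (fun b => LinearMap.inr ℝ (Fin m → E3) (Fin n → E2) (w b))
        (appendVec (bulkBasis m) 0) = appendVec (bulkBasis m) w := by
      funext b
      refine Fin.addCases (fun a => ?_) (fun b => ?_) b
      · rw [extend_apply', appendVec_castAdd, appendVec_castAdd]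
        rintro ⟨a', ha⟩
        have := congrArg Fin.val ha
        simp at this
        omega
      · rw [(Fin.natAdd_injective k _).extend_apply, appendVec_natAdd]
        rfl
    rw [h3, ← div_eq_inv_mul]
    rfl
  rw [h2]
  exact h1.smul _

theorem isFormOn_fibreIntegral (hvol : IsVolumeForm volM) (hθ : IsFormOn 1 θ univ) :
    IsFormOn 1 (fibreIntegral volM θ) univ := by
  refine ⟨fun y _ => ?_, fun c w z hz => ?_⟩
  · exact IsAlt.integral (a := fun x => (fibreForm volM θ x).val y) (μ := bulkMeasure volM m)
      (Eventually.of_forall fun x => isAlt_fibreForm hθ.alternating (mem_univ _))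
      (integrable_fibreDensity' hvol (hθ.of_le (by simp)) y)
  · have hopen := isOpen_extChartAt_target (I := ℬ n) c
    refine ContDiffAt.contDiffWithinAt (contDiffAt_one_iff.2 ⟨_, _, hopen.mem_nhds hz.1,
      fun z hz => (hasFDerivAt_fibreIntegral hvol hθ hz w).2.2.2.continuousWithinAt,
      fun z hz => (hasFDerivAt_fibreIntegral hvol hθ hz w).2.2.1⟩)

theorem lieDeriv_fibreIntegral (hι : IsBoundaryInclusion ι) (hvol : IsVolumeForm volM)
    (hY : IsChartSmooth Y) (hYY : RestrictsTo ι Y Y') (hθ : IsFormOn ∞ θ univ) (y : Fin n → N)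
    (w : Fin k → Fin n → E2) : (lieDeriv (bdryField Y' n) (fibreIntegral volM θ)).val y w =
      (fibreIntegral volM (lieDeriv (confField Y Y' m n) θ)).val y w := by
  have hY' : IsChartSmooth Y' := RestrictsTo.isChartSmooth hι hY hYY
  have h1 : (1 : ℕ∞ω) ≤ ∞ := by exact_mod_cast le_top
  have hθ1 : IsFormOn 1 θ univ := hθ.of_le h1
  set Z : Option (Fin m) → ∀ p : Conf M N m n, TangentSpace (ℭ m n) p := fun o =>
    o.elim (slotField (fun _ _ => 0) Y' n)
      fun i => slotField (update (fun _ _ => 0) i Y) (fun _ => 0) n with hZdef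
  have hZ : ∀ o, IsChartSmooth (Z o) := by
    rintro (_ | i)
    · exact isChartSmooth_slotField (fun _ => isChartSmooth_zero (I := ℍ) (P := M)) hY'
    · refine isChartSmooth_slotField (fun l => ?_) (isChartSmooth_zero (I := 𝔹) (P := N))
      by_cases h : l = i
      · rw [h, update_self]
        exact hY
      · rw [update_of_ne h]
        exact isChartSmooth_zero (I := ℍ) (P := M)
  have hsum (p : Conf M N m n) : fieldVal (confField Y Y' m n) p = ∑ o, fieldVal (Z o) p := by
    rw [Fintype.sum_option]
    refine Prod.ext (funext fun l => ?_) (funext fun j => ?_)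
    · rw [Prod.fst_add, Prod.fst_sum, Pi.add_apply, Finset.sum_apply]
      have h2 (i : Fin m) : (fieldVal (Z (some i)) p).1 l = if l = i then fieldVal Y (p.1 l) else 0 := by
        change fieldVal (I := ℍ) (update (fun _ _ => 0) i Y l) (p.1 l) = _
        by_cases h : l = i
        · subst h
          rw [if_pos rfl]
          exact congrArg (fun V : (VField ℍ M) => fieldVal V (p.1 l)) (update_self _ _ _)
        · rw [if_neg h]
          exact congrArg (fun V : (VField ℍ M) => fieldVal V (p.1 l))
            (update_of_ne h Y (fun (_ : Fin m) (_ : M) => (0 : E3)))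
      have h3 : (fieldVal (Z none) p).1 l = 0 := rfl
      simp only [h2, h3, Finset.sum_ite_eq, Finset.mem_univ, if_true, zero_add]
      rfl
    · rw [Prod.snd_add, Prod.snd_sum, Pi.add_apply, Finset.sum_apply]
      have h2 (i : Fin m) : (fieldVal (Z (some i)) p).2 j = 0 := rfl
      simp only [h2, Finset.sum_const_zero, add_zero]
      rfl
  have hdens (x : Fin m → M) : fibreDensity volM (lieDeriv (confField Y Y' m n) θ) y w x =
      ∑ o, fibreDensity volM (lieDeriv (Z o) θ) y w x := by
    simp only [fibreDensity_eq]
    rw [lieDeriv_sum_field hZ hsum hθ.alternating (mem_univ _), Finset.sum_div]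
  have hR : (fibreIntegral volM (lieDeriv (confField Y Y' m n) θ)).val y w =
      ∫ x, (lieDeriv (bdryField Y' n) (fibreForm volM θ x)).val y w ∂bulkMeasure volM m := by
    change ∫ x, fibreDensity volM (lieDeriv (confField Y Y' m n) θ) y w x ∂bulkMeasure volM m = _
    simp only [hdens]
    rw [integral_finsetSum _ fun o _ => integrable_fibreDensity' hvol
      ((IsFormOn.lieDeriv isOpen_univ hθ (hZ o)).of_le (by simp)) y w, Fintype.sum_option]
    refine (congrArg (fun r => _ + r) (Finset.sum_eq_zero fun i _ =>
      integral_fibreDensity_slotField hι hvol hY hYY hθ y w i)).trans ?_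
    rw [add_zero]
    exact integral_congr_ae (Eventually.of_forall fun x =>
      lieDeriv_slotField_zero_val (vol_ne_zero hvol) hθ1 hY' x y w)
  rw [hR]
  set z₀ := Φ (ℬ n) y y with hz₀
  have hz : z₀ ∈ (Φ (ℬ n) y).target := mem_extChartAt_target (I := ℬ n) y
  have hloc (Ξ : PreForm (ℬ n) (Fin n → N) k) : (lieDeriv (bdryField Y' n) Ξ).val y w =
        fderiv ℝ (fun z => formInChart Ξ y z w) z₀ (vectorInChart (bdryField Y' n) y z₀) +
        ∑ i, formInChart Ξ y z₀ (update w i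
          (fderiv ℝ (vectorInChart (bdryField Y' n) y) z₀ (w i))) := by
    rw [lieDeriv_eq_locLie]
    unfold locLie
    rw [(ℬ n).range_eq_univ, fderivWithin_univ, fderivWithin_univ]
  have hD := hasFDerivAt_fibreIntegral hvol hθ1 hz w
  simp only [hloc]
  rw [integral_add, hD.2.2.1.fderiv, ContinuousLinearMap.integral_apply hD.2.1, integral_finsetSum]
  · rfl
  · exact fun i _ => (hasFDerivAt_fibreIntegral hvol hθ1 hz _).1
  · exact ContinuousLinearMap.integrable_comp (ContinuousLinearMap.apply ℝ ℝ
      (vectorInChart (bdryField Y' n) y z₀)) hD.2.1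
  · exact integrable_finsetSum _ fun i _ => (hasFDerivAt_fibreIntegral hvol hθ1 hz _).1

end FibreIntegration

/-! ### Orientations of forests -/

section Forests

variable {V E : Type*}

/-- The graph whose edges are the elements of `S`, with ends given by `a` and `b`. -/
def edgeGraph (a b : E → V) (S : Finset E) : SimpleGraph V :=
  SimpleGraph.fromRel fun u u' => ∃ e ∈ S, a e = u ∧ b e = u'

theorem edgeGraph_adj {a b : E → V} {S : Finset E} {u v : V} : (edgeGraph a b S).Adj u v ↔
      u ≠ v ∧ ∃ e ∈ S, (a e = u ∧ b e = v) ∨ (a e = v ∧ b e = u) := by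
  rw [edgeGraph, SimpleGraph.fromRel_adj, ← exists_or]
  simp only [← and_or_left]

/-- Every vertex that is not a root is joined to a vertex that is closer to the root. -/
theorem exists_edge_towards_root {a b : E → V} {S : Finset E} {ρ : V → V}
    (hρ : ∀ v, (edgeGraph a b S).Reachable v (ρ v))
    (hadj : ∀ u v, (edgeGraph a b S).Adj u v → ρ u = ρ v) {v : V} (hv : ρ v ≠ v) :
    ∃ e ∈ S, ∃ u, (edgeGraph a b S).dist u (ρ u) < (edgeGraph a b S).dist v (ρ v) ∧
      ((a e = v ∧ b e = u) ∨ (a e = u ∧ b e = v)) := by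
  obtain ⟨p, hp⟩ := (hρ v).exists_walk_length_eq_dist
  generalize hr : ρ v = r at p hp hv
  cases p with
  | nil => exact absurd rfl hv
  | @cons _ u _ h p =>
    obtain ⟨-, e, he, h'⟩ := edgeGraph_adj.1 h
    refine ⟨e, he, u, ?_, h'⟩
    rw [← hadj v u h, hr, ← hp, SimpleGraph.Walk.length_cons]
    exact Nat.lt_succ_of_le (SimpleGraph.dist_le p)

theorem exists_injective_edge {a b : E → V} {S : Finset E} {ρ : V → V}
    (hρ : ∀ v, (edgeGraph a b S).Reachable v (ρ v))
    (hadj : ∀ u v, (edgeGraph a b S).Adj u v → ρ u = ρ v) :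
    ∃ f : {v // ρ v ≠ v} → {e // e ∈ S}, Injective f ∧ ∀ v : {v // ρ v ≠ v}, ∃ u,
      (edgeGraph a b S).dist u (ρ u) < (edgeGraph a b S).dist v (ρ v) ∧
      ((a (f v) = v ∧ b (f v) = u) ∨ (a (f v) = u ∧ b (f v) = v)) := by
  choose f hf g hg using fun v : {v // ρ v ≠ v} => exists_edge_towards_root hρ hadj v.2
  refine ⟨fun v => ⟨f v, hf v⟩, fun v v' h => ?_, fun v => ⟨g v, hg v⟩⟩
  have h' : f v = f v' := congrArg Subtype.val h
  by_contra hne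
  have hne' : (v : V) ≠ v' := fun h => hne (Subtype.ext h)
  obtain ⟨h1, h2⟩ := hg v
  obtain ⟨h3, h4⟩ := hg v'
  rw [h'] at h2
  rcases h2 with ⟨h5, h6⟩ | ⟨h5, h6⟩ <;> rcases h4 with ⟨h7, h8⟩ | ⟨h7, h8⟩
  · exact hne' (h5.symm.trans h7)
  · rw [h6.symm.trans h8] at h1
    rw [h7.symm.trans h5] at h3
    omega
  · rw [h5.symm.trans h7] at h1
    rw [h8.symm.trans h6] at h3
    omega
  · exact hne' (h6.symm.trans h8)

/-- If there are enough vertices besides the roots, every edge leads from a vertex towards the root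
of this vertex. -/
theorem exists_orientation [Fintype V] [DecidableEq V] {a b : E → V} {S : Finset E} {ρ : V → V}
    (hρ : ∀ v, (edgeGraph a b S).Reachable v (ρ v))
    (hadj : ∀ u v, (edgeGraph a b S).Adj u v → ρ u = ρ v)
    (hcard : S.card ≤ (Finset.univ.filter fun v => ρ v ≠ v).card) :
    ∃ (rank : V → ℕ) (child parent : E → V), InjOn child S ∧ ∀ e ∈ S, ρ (child e) ≠ child e ∧
      rank (parent e) < rank (child e) ∧
      ((a e = child e ∧ b e = parent e) ∨ (a e = parent e ∧ b e = child e)) := by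
  classical
  obtain ⟨f, hf, hfe⟩ := exists_injective_edge hρ hadj
  have hbij : Bijective f := by
    refine (Fintype.bijective_iff_injective_and_card f).2 ⟨hf, le_antisymm
      (Fintype.card_le_of_injective f hf) ?_⟩
    rw [Fintype.card_coe, Fintype.card_subtype]
    exact hcard
  choose g hg using hfe
  set φ := Equiv.ofBijective f hbij with hφ
  refine ⟨fun v => (edgeGraph a b S).dist v (ρ v),
    fun e => if h : e ∈ S then φ.symm ⟨e, h⟩ else a e,
    fun e => if h : e ∈ S then g (φ.symm ⟨e, h⟩) else a e, ?_, ?_⟩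
  · intro e he e' he' h
    simp only [Finset.mem_coe.1 he, Finset.mem_coe.1 he', dif_pos] at h
    have := φ.symm.injective (Subtype.ext h)
    exact congrArg Subtype.val this
  · intro e he
    simp only [he, dif_pos]
    have h1 : f (φ.symm ⟨e, he⟩) = ⟨e, he⟩ := φ.apply_symm_apply _
    have h2 := hg (φ.symm ⟨e, he⟩)
    rw [h1] at h2
    exact ⟨(φ.symm ⟨e, he⟩).2, h2.1, h2.2⟩

theorem reachable_map_edgeGraph {Q : Type*} {a b : E → V} {A L : Finset E} (π : V → Q)
    (h : ∀ e ∈ A, e ∉ L → π (a e) = π (b e)) {u v : V} (huv : (edgeGraph a b A).Reachable u v) :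
    (edgeGraph (π ∘ a) (π ∘ b) L).Reachable (π u) (π v) := by
  obtain ⟨p⟩ := huv
  induction p with
  | nil => exact SimpleGraph.Reachable.refl _
  | @cons u u' v hadj p ih =>
    refine SimpleGraph.Reachable.trans ?_ ih
    obtain ⟨-, e, he, h'⟩ := edgeGraph_adj.1 hadj
    by_cases hq : π u = π u'
    · rw [hq]
    · refine SimpleGraph.Adj.reachable (edgeGraph_adj.2 ⟨hq, e, ?_, ?_⟩)
      · by_contra heL
        have h1 := h e he heL
        rcases h' with ⟨h2, h3⟩ | ⟨h2, h3⟩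
        · rw [h2, h3] at h1; exact hq h1
        · rw [h2, h3] at h1; exact hq h1.symm
      · rcases h' with ⟨h2, h3⟩ | ⟨h2, h3⟩
        · exact Or.inl ⟨congrArg π h2, congrArg π h3⟩
        · exact Or.inr ⟨congrArg π h2, congrArg π h3⟩

variable [Fintype V] [DecidableEq V] {a b : E → V} {A : Finset E}

theorem exists_orientation_root (hconn : (edgeGraph a b A).Connected)
    (hcard : A.card + 1 = Fintype.card V) (r : V) :
    ∃ (rank : V → ℕ) (child parent : E → V), InjOn child A ∧ ∀ e ∈ A, child e ≠ r ∧
      rank (parent e) < rank (child e) ∧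
      ((a e = child e ∧ b e = parent e) ∨ (a e = parent e ∧ b e = child e)) := by
  have h := exists_orientation (a := a) (b := b) (S := A) (ρ := fun _ => r)
    (fun v => hconn.preconnected v r) (fun _ _ _ => rfl) (by
      have h1 : (Finset.univ.filter fun v => r ≠ v) = Finset.univ.erase r := by
        ext v; simp [eq_comm]
      rw [h1, Finset.card_erase_of_mem (Finset.mem_univ r), Finset.card_univ]
      omega)
  obtain ⟨rank, child, parent, h1, h2⟩ := h
  exact ⟨rank, child, parent, h1, fun e he => ⟨(h2 e he).1.symm, (h2 e he).2⟩⟩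

/-- A forest contained in a tree can be oriented towards given vertices, at most one in each
component. -/
theorem exists_orientation_forest (hconn : (edgeGraph a b A).Connected)
    (hcard : A.card + 1 = Fintype.card V) {S : Finset E} (hS : S ⊆ A) {β : Set V}
    (hβ : ∀ u ∈ β, ∀ v ∈ β, (edgeGraph a b S).Reachable u v → u = v) :
    ∃ (rank : V → ℕ) (child parent : E → V), InjOn child S ∧ ∀ e ∈ S, child e ∉ β ∧
      rank (parent e) < rank (child e) ∧
      ((a e = child e ∧ b e = parent e) ∨ (a e = parent e ∧ b e = child e)) := by
  classical
  set Gr := edgeGraph a b S with hGr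
  have hroot (q : Gr.ConnectedComponent) : ∃ v, Gr.connectedComponentMk v = q ∧
      ∀ u ∈ β, Gr.connectedComponentMk u = q → u = v := by
    by_cases h : ∃ u ∈ β, Gr.connectedComponentMk u = q
    · obtain ⟨u, hu, huq⟩ := h
      refine ⟨u, huq, fun u' hu' huq' => hβ u' hu' u hu ?_⟩
      exact SimpleGraph.ConnectedComponent.exact (huq'.trans huq.symm)
    · obtain ⟨v, hv⟩ := q.exists_rep
      exact ⟨v, hv, fun u hu huq => absurd ⟨u, hu, huq⟩ h⟩
  choose root hroot1 hroot2 using hroot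
  set ρ : V → V := fun v => root (Gr.connectedComponentMk v) with hρ
  have hmk : ∀ u v, Gr.Adj u v → Gr.connectedComponentMk u = Gr.connectedComponentMk v :=
    fun u v h => SimpleGraph.ConnectedComponent.sound h.reachable
  have hreach : ∀ v, Gr.Reachable v (ρ v) := fun v =>
    SimpleGraph.ConnectedComponent.exact (hroot1 _).symm
  -- the number of components
  have hfix : (Finset.univ.filter fun v => ρ v = v).card ≤ Fintype.card Gr.ConnectedComponent := by
    refine (Finset.card_le_card_of_injOn (fun v => Gr.connectedComponentMk v)
      (fun _ _ => Finset.mem_univ _) fun u hu v hv h => ?_).trans_eq Finset.card_univ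
    have hu' : ρ u = u := (Finset.mem_filter.1 hu).2
    have hv' : ρ v = v := (Finset.mem_filter.1 hv).2
    rw [← hu', ← hv']
    exact congrArg root h
  have hcomp : Fintype.card Gr.ConnectedComponent ≤ (A \ S).card + 1 := by
    obtain ⟨v₀⟩ := hconn.nonempty
    set q₀ := Gr.connectedComponentMk v₀
    obtain ⟨f, hf, -⟩ := exists_injective_edge (a := Gr.connectedComponentMk ∘ a)
      (b := Gr.connectedComponentMk ∘ b) (S := A \ S) (ρ := fun _ => q₀) (fun q => by
        obtain ⟨v, rfl⟩ := q.exists_rep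
        refine reachable_map_edgeGraph (A := A) _ (fun e he heL => ?_) (hconn.preconnected v v₀)
        have heS : e ∈ S := by
          by_contra h
          exact heL (Finset.mem_sdiff.2 ⟨he, h⟩)
        by_cases hab : a e = b e
        · rw [hab]
        · exact hmk _ _ (edgeGraph_adj.2 ⟨hab, e, heS, Or.inl ⟨rfl, rfl⟩⟩))
      (fun _ _ _ => rfl)
    have h1 := Fintype.card_le_of_injective f hf
    rw [Fintype.card_coe, Fintype.card_subtype] at h1
    have h2 : (Finset.univ.filter fun q => q₀ ≠ q) = Finset.univ.erase q₀ := by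
      ext v; simp [eq_comm]
    rw [h2, Finset.card_erase_of_mem (Finset.mem_univ q₀), Finset.card_univ] at h1
    omega
  have hsd := Finset.card_sdiff_add_card_eq_card hS
  have htot := Finset.card_filter_add_card_filter_not (s := (Finset.univ : Finset V))
    (fun v => ρ v = v)
  rw [Finset.card_univ] at htot
  obtain ⟨rank, child, parent, h1, h2⟩ := exists_orientation (a := a) (b := b) (S := S) (ρ := ρ)
    hreach (fun u v h => congrArg root (hmk u v h)) (by
      change S.card ≤ (Finset.univ.filter fun v => ¬ ρ v = v).card
      omega)
  refine ⟨rank, child, parent, h1, fun e he => ⟨fun hb => (h2 e he).1 ?_, (h2 e he).2⟩⟩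
  exact (hroot2 _ _ hb rfl).symm

/-- Points connected by `|V|` short edges are close. -/
theorem norm_sub_le_of_reachable {F : Type*} [NormedAddCommGroup F] {S : Finset E} {p : V → F}
    {r : ℝ} (hr : 0 ≤ r) (hp : ∀ e ∈ S, ‖p (a e) - p (b e)‖ ≤ r) {u v : V}
    (huv : (edgeGraph a b S).Reachable u v) : ‖p u - p v‖ ≤ (Fintype.card V - 1 : ℕ) * r := by
  classical
  obtain ⟨w, hw⟩ := huv.exists_isPath
  have hlen (u v : V) (w : (edgeGraph a b S).Walk u v) : ‖p u - p v‖ ≤ w.length * r := by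
    induction w with
    | nil => simp
    | @cons u u' v h w ih =>
      obtain ⟨-, e, he, h'⟩ := edgeGraph_adj.1 h
      have h1 : ‖p u - p u'‖ ≤ r := by
        rcases h' with ⟨h2, h3⟩ | ⟨h2, h3⟩
        · rw [← h2, ← h3]; exact hp e he
        · rw [← h2, ← h3, norm_sub_rev]; exact hp e he
      rw [SimpleGraph.Walk.length_cons]
      push_cast
      linarith [norm_sub_le_norm_sub_add_norm_sub (p u) (p u') (p v)]
  refine (hlen u v w).trans (mul_le_mul_of_nonneg_right ?_ hr)
  have := hw.length_lt
  exact_mod_cast (by omega : w.length ≤ Fintype.card V - 1)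

end Forests

/-! ### Integrals of products along forests -/

section Marginals

variable {δ : Type*} [DecidableEq δ] {Ω : δ → Type*} [∀ i, MeasurableSpace (Ω i)]
  {μ : ∀ i, Measure (Ω i)} [∀ i, SigmaFinite (μ i)]

theorem lmarginal_mul_const (s : Finset δ) {f : (∀ i, Ω i) → ENNReal} (hf : Measurable f)
    (c : ENNReal) (x : ∀ i, Ω i) : (∫⋯∫⁻_s, (fun x => f x * c) ∂μ) x = (∫⋯∫⁻_s, f ∂μ) x * c := by
  unfold lmarginal
  exact lintegral_mul_const c (hf.comp measurable_updateFinset)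

theorem lmarginal_prod_le {E : Type*} [DecidableEq E] {k : E → (∀ i, Ω i) → ENNReal}
    (hk : ∀ e, Measurable (k e)) {rank : δ → ℕ} {child : E → δ} {C : ENNReal}
    (hC : ∀ i, μ i univ ≤ C) (s : Finset δ) : ∀ (F : Finset E), InjOn child F →
    (∀ e ∈ F, ∀ v, v ≠ child e → rank (child e) ≤ rank v → ∀ x z, k e (update x v z) = k e x) →
    (∀ e ∈ F, ∀ x, ∫⁻ z, k e (update x (child e) z) ∂μ (child e) ≤ C) →
    (∀ e ∈ F, child e ∈ s) → ∀ x, (∫⋯∫⁻_s, (fun x => ∏ e ∈ F, k e x) ∂μ) x ≤ C ^ s.card := by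
  induction hn : s.card generalizing s with
  | zero =>
    intro F _ _ _ hF x
    rw [Finset.card_eq_zero] at hn
    subst hn
    have : F = ∅ := Finset.eq_empty_of_forall_notMem fun e he => Finset.notMem_empty _ (hF e he)
    subst this
    simp
  | succ n ih =>
    intro F hinj hdep hbound hF x
    obtain ⟨v, hv, hmax⟩ := s.exists_max_image rank (Finset.card_pos.1 (by omega))
    have hcard : (s.erase v).card = n := by rw [Finset.card_erase_of_mem hv]; omega
    have hmeas (F : Finset E) : Measurable fun x => ∏ e ∈ F, k e x :=
      Finset.measurable_fun_prod _ fun e _ => hk e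
    -- the remaining edges do not depend on the position of `v`
    have key : ∃ F' ⊆ F, (∀ e ∈ F', child e ≠ v) ∧
        ∀ x, ∫⁻ z, ∏ e ∈ F, k e (update x v z) ∂μ v ≤ (∏ e ∈ F', k e x) * C := by
      have hconst : ∀ F' ⊆ F, (∀ e ∈ F', child e ≠ v) → ∀ x z,
          ∏ e ∈ F', k e (update x v z) = ∏ e ∈ F', k e x := fun F' hF' hne x z =>
        Finset.prod_congr rfl fun e he =>
          hdep e (hF' he) v (hne e he).symm (hmax _ (hF e (hF' he))) x z
      by_cases h : ∃ e₀ ∈ F, child e₀ = v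
      · obtain ⟨e₀, he₀, rfl⟩ := h
        have hne : ∀ e ∈ F.erase e₀, child e ≠ child e₀ := fun e he h =>
          (Finset.mem_erase.1 he).1 (hinj (Finset.mem_of_mem_erase he) he₀ h)
        refine ⟨F.erase e₀, Finset.erase_subset _ _, hne, fun x => ?_⟩
        have h1 (z) : ∏ e ∈ F, k e (update x (child e₀) z) =
            (∏ e ∈ F.erase e₀, k e x) * k e₀ (update x (child e₀) z) := by
          rw [← Finset.prod_erase_mul _ _ he₀, hconst _ (Finset.erase_subset _ _) hne]
        simp only [h1]
        refine (lintegral_const_mul _ ((hk e₀).comp (measurable_update x))).trans_le ?_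
        exact mul_le_mul_right (hbound e₀ he₀ x) _
      · push Not at h
        refine ⟨F, subset_rfl, h, fun x => ?_⟩
        simp only [hconst F subset_rfl h]
        rw [lintegral_const]
        exact mul_le_mul_right (hC v) _
    obtain ⟨F', hF', hne, hle⟩ := key
    rw [lmarginal_erase' _ (hmeas F) hv]
    refine (lmarginal_mono (μ := μ) (s := s.erase v) hle x).trans ?_
    rw [lmarginal_mul_const _ (hmeas F'), pow_succ]
    refine mul_le_mul_left (ih (s.erase v) hcard F' (hinj.mono hF')
      (fun e he => hdep e (hF' he)) (fun e he => hbound e (hF' he))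
      (fun e he => Finset.mem_erase.2 ⟨hne e he, hF e (hF' he)⟩) x) _

theorem lintegral_prod_le [Fintype δ] {E : Type*} [DecidableEq E] {k : E → (∀ i, Ω i) → ENNReal}
    (hk : ∀ e, Measurable (k e)) {rank : δ → ℕ} {child : E → δ} {C : ENNReal}
    (hC : ∀ i, μ i univ ≤ C) (F : Finset E) (hinj : InjOn child F)
    (hdep : ∀ e ∈ F, ∀ v, v ≠ child e → rank (child e) ≤ rank v → ∀ x z, k e (update x v z) = k e x)
    (hbound : ∀ e ∈ F, ∀ x, ∫⁻ z, k e (update x (child e) z) ∂μ (child e) ≤ C) :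
    ∫⁻ x, ∏ e ∈ F, k e x ∂Measure.pi μ ≤ C ^ Fintype.card δ := by
  rcases isEmpty_or_nonempty (∀ i, Ω i) with h | ⟨⟨x⟩⟩
  · simp
  · have h := lmarginal_prod_le hk hC Finset.univ F hinj hdep hbound
      (fun e _ => Finset.mem_univ _) x
    rwa [lmarginal_univ, Finset.card_univ] at h

end Marginals

/-! ### Integrals of products of inverse distances along trees -/

section TreeIntegrals

variable {F : Type*} [NormedAddCommGroup F]

theorem invDist_add {κ κ' : ℝ} (hκ : 0 ≤ κ) (hκ' : 0 ≤ κ') (a b : F) :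
    invDist (κ + κ') a b = invDist κ a b * invDist κ' a b := by
  unfold invDist
  rw [ENNReal.rpow_neg, ENNReal.rpow_neg, ENNReal.rpow_neg, ← ENNReal.inv_rpow, ← ENNReal.inv_rpow,
    ← ENNReal.inv_rpow, ENNReal.rpow_add_of_nonneg _ _ hκ hκ']

theorem invDist_le_of_le {κ : ℝ} (hκ : 0 ≤ κ) {a b a' b' : F} (h : ‖a - b‖ ≤ ‖a' - b'‖) :
    invDist κ a' b' ≤ invDist κ a b := by
  unfold invDist
  rw [ENNReal.rpow_neg, ENNReal.rpow_neg, ENNReal.inv_le_inv]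
  exact ENNReal.rpow_le_rpow (ENNReal.ofReal_le_ofReal h) hκ

theorem invDist_pow {κ : ℝ} (a b : F) (l : ℕ) : invDist κ a b ^ l = invDist (l * κ) a b := by
  unfold invDist
  rw [← ENNReal.rpow_natCast, ← ENNReal.rpow_mul]
  congr 1
  ring

theorem measurable_invDist [MeasurableSpace F] [BorelSpace F] [SecondCountableTopology F]
    {Ω : Type*} [MeasurableSpace Ω] {κ : ℝ} {f g : Ω → F} (hf : Measurable f) (hg : Measurable g) :
    Measurable fun x => invDist κ (f x) (g x) :=
  ((hf.sub hg).norm.ennreal_ofReal).pow_const _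

variable [MeasurableSpace F] [BorelSpace F] [SecondCountableTopology F]
  {Z : Type*} [MeasurableSpace Z] {G : Z → F} {E : Type*} [DecidableEq E]

/-- Integrals of products of inverse distances along a tree over its movable vertices, if the other
vertices are separated from each other. -/
theorem exists_lintegral_prod_invDist_le (hG : Measurable G) {μ : Measure Z} [IsFiniteMeasure μ]
    {a b : E → Fin m ⊕ Fin n} {A : Finset E} (hconn : (edgeGraph a b A).Connected)
    (hcard : A.card + 1 = Fintype.card (Fin m ⊕ Fin n)) {κ : ℝ} (hκ : 0 ≤ κ) {A₀ : ENNReal}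
    (hA₀ : A₀ ≠ ⊤) (hker : ∀ p : F, ∫⁻ x, invDist κ (G x) p ∂μ ≤ A₀) {c₀ : ℝ} (hc₀ : 0 < c₀) :
    ∃ C : ENNReal, C ≠ ⊤ ∧ ∀ q : Fin n → F, (∀ j j', j ≠ j' → c₀ ≤ ‖q j - q j'‖) →
      ∫⁻ x : Fin m → Z, ∏ e ∈ A, invDist κ (Sum.elim (fun i => G (x i)) q (a e))
        (Sum.elim (fun i => G (x i)) q (b e)) ∂Measure.pi (fun _ => μ) ≤ C := by
  classical
  set c₁ : ℝ := c₀ / Fintype.card (Fin m ⊕ Fin n) with hc₁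
  have hV : 0 < Fintype.card (Fin m ⊕ Fin n) := by omega
  have hc₁0 : 0 < c₁ := div_pos hc₀ (by exact_mod_cast hV)
  set D : ENNReal := (ENNReal.ofReal c₁) ^ (-κ) with hD
  have hDtop : D ≠ ⊤ := by
    rw [hD, ENNReal.rpow_neg]
    exact ENNReal.inv_ne_top.2 (by
      rw [ne_eq, ENNReal.rpow_eq_zero_iff]
      simp [hc₁0])
  set C₁ : ENNReal := A₀ + μ univ with hC₁
  have hC₁top : C₁ ≠ ⊤ := ENNReal.add_ne_top.2 ⟨hA₀, measure_ne_top _ _⟩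
  set valid : Finset E → Prop := fun S => ∀ j j' : Fin n,
    (edgeGraph a b S).Reachable (Sum.inr j) (Sum.inr j') → j = j' with hvalid
  refine ⟨∑ S ∈ A.powerset, D ^ (A \ S).card * C₁ ^ m, ?_, fun q hq => ?_⟩
  · exact ENNReal.sum_ne_top.2 fun S _ => ENNReal.mul_ne_top (ENNReal.pow_ne_top hDtop)
      (ENNReal.pow_ne_top hC₁top)
  set p : (Fin m → Z) → Fin m ⊕ Fin n → F := fun x => Sum.elim (fun i => G (x i)) q with hp
  set k : E → (Fin m → Z) → ENNReal := fun e x => invDist κ (p x (a e)) (p x (b e)) with hk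
  have hpm (v : Fin m ⊕ Fin n) : Measurable fun x => p x v := by
    rcases v with i | j
    · exact hG.comp (measurable_pi_apply i)
    · exact measurable_const
  have hkm (e : E) : Measurable (k e) := measurable_invDist (hpm _) (hpm _)
  -- split according to the set of short edges
  have hpoint (x : Fin m → Z) : ∏ e ∈ A, k e x ≤
      ∑ S ∈ A.powerset, if valid S then D ^ (A \ S).card * ∏ e ∈ S, k e x else 0 := by
    set S := A.filter fun e => ‖p x (a e) - p x (b e)‖ < c₁ with hS
    have hSA : S ⊆ A := Finset.filter_subset _ _
    have hval : valid S := by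
      intro j j' h
      by_contra hne
      have h1 := norm_sub_le_of_reachable (p := p x) hc₁0.le
        (fun e he => (Finset.mem_filter.1 he).2.le) h
      have h2 := hq j j' hne
      have h3 : c₁ * Fintype.card (Fin m ⊕ Fin n) = c₀ := by
        rw [hc₁]
        field_simp
      have h4 : ((Fintype.card (Fin m ⊕ Fin n) - 1 : ℕ) : ℝ) <
          (Fintype.card (Fin m ⊕ Fin n) : ℝ) := by
        exact_mod_cast Nat.sub_lt hV one_pos
      have h5 : ‖p x (Sum.inr j) - p x (Sum.inr j')‖ = ‖q j - q j'‖ := rfl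
      nlinarith
    refine le_trans ?_ (Finset.single_le_sum (f := fun S => if valid S then
      D ^ (A \ S).card * ∏ e ∈ S, k e x else 0) (fun _ _ => zero_le)
      (Finset.mem_powerset.2 hSA))
    rw [if_pos hval, ← Finset.prod_sdiff hSA]
    refine mul_le_mul_left ?_ _
    refine (Finset.prod_le_pow_card _ _ D fun e he => ?_)
    obtain ⟨he, heS⟩ := Finset.mem_sdiff.1 he
    have h1 : c₁ ≤ ‖p x (a e) - p x (b e)‖ := by
      by_contra h
      exact heS (Finset.mem_filter.2 ⟨he, not_le.1 h⟩)
    simp only [hk, invDist, hD]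
    rw [ENNReal.rpow_neg, ENNReal.rpow_neg, ENNReal.inv_le_inv]
    exact ENNReal.rpow_le_rpow (ENNReal.ofReal_le_ofReal h1) hκ
  refine (lintegral_mono hpoint).trans ?_
  rw [lintegral_finsetSum]
  swap
  · intro S _
    split_ifs
    · exact (Finset.measurable_fun_prod _ fun e _ => hkm e).const_mul _
    · exact measurable_const
  refine Finset.sum_le_sum fun S hS => ?_
  by_cases hval : valid S
  swap
  · simp [hval]
  simp only [if_pos hval]
  rw [lintegral_const_mul _ (Finset.measurable_fun_prod _ fun e _ => hkm e)]
  refine mul_le_mul_right ?_ _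
  obtain ⟨rank, child, parent, hinj, hor⟩ := exists_orientation_forest hconn hcard
    (Finset.mem_powerset.1 hS) (β := range Sum.inr) (by
      rintro _ ⟨j, rfl⟩ _ ⟨j', rfl⟩ h
      rw [hval j j' h])
  have hch (e : E) (he : e ∈ S) : ∃ i, child e = Sum.inl i := by
    rcases h : child e with i | j
    · exact ⟨i, rfl⟩
    · exact absurd ⟨j, h.symm⟩ (hor e he).1
  rcases Nat.eq_zero_or_pos m with hm | hm
  · subst hm
    have hSe : S = ∅ := Finset.eq_empty_of_forall_notMem fun e he => (hch e he).choose.elim0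
    subst hSe
    simp
  have : Nonempty (Fin m) := ⟨⟨0, hm⟩⟩
  set ch : E → Fin m := fun e => Sum.elim id (fun _ => Classical.arbitrary _) (child e) with hchdef
  have hch' (e : E) (he : e ∈ S) : child e = Sum.inl (ch e) := by
    obtain ⟨i, hi⟩ := hch e he
    rw [hchdef, hi]
    simp [hi]
  have hpu (x : Fin m → Z) (i : Fin m) (z : Z) (v : Fin m ⊕ Fin n) (hv : v ≠ Sum.inl i) :
      p (update x i z) v = p x v := by
    rcases v with l | j
    · have : l ≠ i := fun h => hv (by rw [h])
      simp [hp, this]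
    · rfl
  refine (lintegral_prod_le (rank := fun i => rank (Sum.inl i)) (child := ch) (C := C₁) hkm
    (fun _ => le_add_self) S ?_ ?_ ?_).trans_eq (by rw [Fintype.card_fin])
  · intro e he e' he' h
    exact hinj he he' (by rw [hch' e he, hch' e' he', h])
  · intro e he i hi hrank x z
    have h1 := hor e he
    rw [hch' e he] at h1
    have h2 : (Sum.inl (ch e) : Fin m ⊕ Fin n) ≠ Sum.inl i := fun h => hi (Sum.inl.inj h).symm
    have h3 : parent e ≠ Sum.inl i := fun h => by
      rw [h] at h1
      exact absurd h1.2.1 (not_lt.2 hrank)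
    simp only [hk]
    rcases h1.2.2 with ⟨h4, h5⟩ | ⟨h4, h5⟩
    · rw [h4, h5, hpu _ _ _ _ h2, hpu _ _ _ _ h3]
    · rw [h4, h5, hpu _ _ _ _ h2, hpu _ _ _ _ h3]
  · intro e he x
    have h1 := hor e he
    rw [hch' e he] at h1
    have h3 : parent e ≠ Sum.inl (ch e) := fun h => by
      rw [h] at h1
      exact absurd h1.2.1 (lt_irrefl _)
    have h6 (z : Z) : p (update x (ch e) z) (Sum.inl (ch e)) = G z := by simp [hp]
    refine le_trans ?_ ((hker (p x (parent e))).trans le_self_add)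
    refine (lintegral_congr fun z => ?_).le
    simp only [hk]
    rcases h1.2.2 with ⟨h4, h5⟩ | ⟨h4, h5⟩
    · rw [h4, h5, h6, hpu _ _ _ _ h3]
    · rw [h4, h5, h6, hpu _ _ _ _ h3, invDist_comm]

/-- The integral of the product of the inverse squares of the distances along a tree over all its
vertices.  At the vertices `v` with `¬ bulk v`, the inverse squares themselves are not integrable. -/
theorem lintegral_prod_invDist_lt_top {V : Type*} [Fintype V] [DecidableEq V] (hG : Measurable G)
    {μ : V → Measure Z} [∀ v, IsFiniteMeasure (μ v)] {a b : E → V} {A : Finset E}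
    (hconn : (edgeGraph a b A).Connected) (hcard : A.card + 1 = Fintype.card V)
    {bulk : V → Prop} (ha : ∀ e ∈ A, bulk (a e)) (hbulk : ∀ v, bulk v → ∀ κ : ℝ, 0 ≤ κ → κ < 3 →
      ∃ A₀ : ENNReal, A₀ ≠ ⊤ ∧ ∀ p : F, ∫⁻ x, invDist κ (G x) p ∂μ v ≤ A₀)
    (hall : ∀ v, ∀ κ : ℝ, 0 ≤ κ → κ < 2 →
      ∃ A₀ : ENNReal, A₀ ≠ ⊤ ∧ ∀ p : F, ∫⁻ x, invDist κ (G x) p ∂μ v ≤ A₀) :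
    ∫⁻ x : V → Z, ∏ e ∈ A, invDist 2 (G (x (a e))) (G (x (b e))) ∂Measure.pi μ < ⊤ := by
  classical
  rcases A.eq_empty_or_nonempty with rfl | hne
  · simp [measure_lt_top]
  set δ : ℝ := 1 / (2 * A.card) with hδ
  have hA : (0 : ℝ) < A.card := by exact_mod_cast Finset.card_pos.2 hne
  have hA1 : (1 : ℝ) ≤ A.card := by exact_mod_cast Finset.card_pos.2 hne
  have hδ0 : 0 < δ := by positivity
  have hδA : A.card * δ = 1 / 2 := by rw [hδ]; field_simp
  have hδ2 : δ ≤ 1 / 2 := by nlinarith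
  set l : ℕ := A.card - 1 with hl
  have hlA : (l : ℝ) ≤ A.card := by exact_mod_cast Nat.sub_le _ _
  set κ₁ : ℝ := 2 + l * δ with hκ₁
  have hκ₁0 : 0 ≤ κ₁ := by positivity
  have hκ₁3 : κ₁ < 3 := by nlinarith
  have hκ₂0 : 0 ≤ 2 - δ := by linarith
  set d : E → (V → Z) → ℝ := fun e x => ‖G (x (a e)) - G (x (b e))‖ with hd
  set k : E → E → (V → Z) → ENNReal := fun e₀ e x =>
    invDist (if e = e₀ then κ₁ else 2 - δ) (G (x (a e))) (G (x (b e))) with hk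
  have hκ (e₀ e : E) : 0 ≤ (if e = e₀ then κ₁ else 2 - δ) := by split_ifs <;> assumption
  have hpm (v : V) : Measurable fun x : V → Z => G (x v) := hG.comp (measurable_pi_apply v)
  have hkm (e₀ e : E) : Measurable (k e₀ e) := measurable_invDist (hpm _) (hpm _)
  have hpoint (x : V → Z) : ∏ e ∈ A, invDist 2 (G (x (a e))) (G (x (b e))) ≤
      ∑ e₀ ∈ A, ∏ e ∈ A, k e₀ e x := by
    obtain ⟨e₀, he₀, hmin⟩ := A.exists_min_image (fun e => d e x) hne
    refine le_trans ?_ (Finset.single_le_sum (f := fun e₀ => ∏ e ∈ A, k e₀ e x)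
      (fun _ _ => zero_le) he₀)
    rw [← Finset.mul_prod_erase _ _ he₀, ← Finset.mul_prod_erase _ _ he₀]
    have h1 : k e₀ e₀ x = invDist 2 (G (x (a e₀))) (G (x (b e₀))) *
        invDist δ (G (x (a e₀))) (G (x (b e₀))) ^ (A.erase e₀).card := by
      rw [invDist_pow, ← invDist_add (by norm_num) (by positivity)]
      simp only [hk, if_true]
      rw [Finset.card_erase_of_mem he₀]
    rw [h1, mul_assoc]
    refine mul_le_mul_right ?_ _
    rw [← Finset.prod_const, ← Finset.prod_mul_distrib]
    refine Finset.prod_le_prod' fun e he => ?_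
    obtain ⟨hne, heA⟩ := Finset.mem_erase.1 he
    simp only [hk, if_neg hne]
    have h2 : invDist 2 (G (x (a e))) (G (x (b e))) = invDist δ (G (x (a e))) (G (x (b e))) *
        invDist (2 - δ) (G (x (a e))) (G (x (b e))) := by
      rw [← invDist_add hδ0.le hκ₂0]
      congr 1
      ring
    rw [h2]
    exact mul_le_mul_left (invDist_le_of_le hδ0.le (hmin e heA)) _
  refine (lintegral_mono hpoint).trans_lt ?_
  rw [lintegral_finsetSum _ fun e₀ _ => Finset.measurable_fun_prod _ fun e _ => hkm e₀ e]
  refine ENNReal.sum_lt_top.2 fun e₀ he₀ => ?_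
  obtain ⟨rank, child, parent, hinj, hor⟩ := exists_orientation_root hconn hcard (b e₀)
  have hconst (v : V) : ∃ A₀ : ENNReal, A₀ ≠ ⊤ ∧ (∀ p : F, ∫⁻ x, invDist (2 - δ) (G x) p ∂μ v ≤ A₀) ∧
      (bulk v → ∀ p : F, ∫⁻ x, invDist κ₁ (G x) p ∂μ v ≤ A₀) := by
    obtain ⟨A₁, h1, h2⟩ := hall v (2 - δ) hκ₂0 (by linarith)
    by_cases hv : bulk v
    · obtain ⟨A₂, h3, h4⟩ := hbulk v hv κ₁ hκ₁0 hκ₁3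
      exact ⟨A₁ + A₂, ENNReal.add_ne_top.2 ⟨h1, h3⟩, fun p => (h2 p).trans le_self_add,
        fun _ p => (h4 p).trans le_add_self⟩
    · exact ⟨A₁, h1, h2, fun h => absurd h hv⟩
  choose A₀ hA₀ hker₂ hker₁ using hconst
  set C : ENNReal := ∑ v, (A₀ v + μ v univ) with hC
  have hCtop : C ≠ ⊤ := ENNReal.sum_ne_top.2 fun v _ =>
    ENNReal.add_ne_top.2 ⟨hA₀ v, measure_ne_top _ _⟩
  have hCv (v : V) : A₀ v + μ v univ ≤ C :=
    Finset.single_le_sum (f := fun v => A₀ v + μ v univ) (fun _ _ => zero_le) (Finset.mem_univ v)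
  refine (lintegral_prod_le (k := k e₀) (rank := rank) (child := child) (C := C) (hkm e₀)
    (fun v => le_add_self.trans (hCv v)) A hinj ?_ ?_).trans_lt (ENNReal.pow_lt_top hCtop.lt_top)
  · intro e he v hv hrank x z
    have h1 := hor e he
    have h3 : parent e ≠ v := fun h => by
      rw [h] at h1
      exact absurd h1.2.1 (not_lt.2 hrank)
    simp only [hk]
    rcases h1.2.2 with ⟨h4, h5⟩ | ⟨h4, h5⟩
    · rw [h4, h5, update_of_ne hv.symm, update_of_ne h3]
    · rw [h4, h5, update_of_ne hv.symm, update_of_ne h3]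
  · intro e he x
    have h1 := hor e he
    have h3 : parent e ≠ child e := fun h => by
      rw [h] at h1
      exact absurd h1.2.1 (lt_irrefl _)
    have h6 : ∫⁻ z, k e₀ e (update x (child e) z) ∂μ (child e) =
        ∫⁻ z, invDist (if e = e₀ then κ₁ else 2 - δ) (G z) (G (x (parent e))) ∂μ (child e) := by
      refine lintegral_congr fun z => ?_
      simp only [hk]
      rcases h1.2.2 with ⟨h4, h5⟩ | ⟨h4, h5⟩
      · rw [h4, h5, update_self, update_of_ne h3]
      · rw [h4, h5, update_self, update_of_ne h3, invDist_comm]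
    rw [h6]
    refine le_trans ?_ (le_self_add.trans (hCv (child e)))
    split_ifs with he0
    · refine hker₁ _ ?_ _
      subst he0
      rcases h1.2.2 with ⟨h4, h5⟩ | ⟨h4, h5⟩
      · rw [← h4]; exact ha e he
      · exact absurd h5.symm h1.1
    · exact hker₂ _ _

end TreeIntegrals

/-! ### Bounds for forms in terms of an immersion -/

section LocalBounds

variable [FiniteDimensional ℝ E]

variable (E) in
theorem exists_isAlt_bound (k : ℕ) : ∃ (K : ℝ) (s : Finset (Fin k → E)), 0 ≤ K ∧
    ∀ a : (Fin k → E) → ℝ, IsAlt a → ∀ v, |a v| ≤ K * (∑ u ∈ s, |a u|) * ∏ i, ‖v i‖ := by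
  classical
  set b := Module.finBasis ℝ E
  set L : E →L[ℝ] (Fin (Module.finrank ℝ E) → ℝ) := LinearMap.toContinuousLinearMap b.equivFun.toLinearMap
  have hL (v : E) (j) : |b.repr v j| ≤ ‖L‖ * ‖v‖ := by
    have h1 : b.repr v j = L v j := rfl
    rw [h1]
    exact (norm_le_pi_norm (L v) j).trans (L.le_opNorm v)
  set s : Finset (Fin k → E) := Finset.univ.image fun (r : Fin k → Fin (Module.finrank ℝ E)) i => b (r i)
  refine ⟨Fintype.card (Fin k → Fin (Module.finrank ℝ E)) * ‖L‖ ^ k, s, by positivity, fun a ha v => ?_⟩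
  rw [ha.apply_eq_sum v]
  have hterm (r : Fin k → Fin (Module.finrank ℝ E)) :
      |(∏ i, b.repr (v i) (r i)) * a fun i => b (r i)| ≤
        ‖L‖ ^ k * (∑ u ∈ s, |a u|) * ∏ i, ‖v i‖ := by
    rw [abs_mul, Finset.abs_prod]
    have h1 : ∏ i, |b.repr (v i) (r i)| ≤ ‖L‖ ^ k * ∏ i, ‖v i‖ := by
      have h2 : ∏ i : Fin k, (‖L‖ * ‖v i‖) = ‖L‖ ^ k * ∏ i, ‖v i‖ := by
        rw [Finset.prod_mul_distrib, Finset.prod_const, Finset.card_univ, Fintype.card_fin]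
      rw [← h2]
      exact Finset.prod_le_prod (fun _ _ => abs_nonneg _) fun i _ => hL _ _
    have h3 : |a fun i => b (r i)| ≤ ∑ u ∈ s, |a u| :=
      Finset.single_le_sum (f := fun u => |a u|) (fun _ _ => abs_nonneg _)
        (Finset.mem_image_of_mem _ (Finset.mem_univ r))
    calc _ ≤ (‖L‖ ^ k * ∏ i, ‖v i‖) * ∑ u ∈ s, |a u| :=
          mul_le_mul h1 h3 (abs_nonneg _) (by positivity)
      _ = _ := by ring
  refine (Finset.abs_sum_le_sum_abs _ _).trans ((Finset.sum_le_sum fun r _ => hterm r).trans ?_)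
  rw [Finset.sum_const, Finset.card_univ, nsmul_eq_mul]
  exact le_of_eq (by ring)

variable [IsManifold I ∞ P]

theorem val_eq_formInChart (θ : PreForm I P k) (hx : x ∈ (Φ I c).source) (v : Fin k → E) :
    θ.val x v = formInChart θ c (Φ I c x) fun i => mfd I 𝓘(ℝ, E) (Φ I c) x (v i) := by
  have hy := (Φ I c).map_source hx
  rw [formInChart_eq, (Φ I c).left_inv hx]
  congr 1
  funext i
  have h := chartD_mfderiv hy (v i)
  rw [(Φ I c).left_inv hx] at h
  exact h.symm

theorem IsSmoothFamilyOn.exists_local_bound {θ : ℝ → PreForm I P k} {U : Set P} (hU : IsOpen U)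
    (hθ : IsSmoothFamilyOn J θ U) {G : P → F} (hG : ContMDiff I 𝓘(ℝ, F) ∞ G)
    (himm : ∀ x, Injective (mfd I 𝓘(ℝ, F) G x)) {T : Set ℝ} (hT : IsCompact T) (hTJ : T ⊆ J)
    (hc : c ∈ U) : ∃ C, 0 ≤ C ∧ ∀ᶠ x in 𝓝 c, ∀ t ∈ T, ∀ v : Fin k → E,
      |(θ t).val x v| ≤ C * ∏ i, ‖mfd I 𝓘(ℝ, F) G x (v i)‖ := by
  have : ProperSpace E := FiniteDimensional.proper_real _
  obtain ⟨r, hr, C, hC, -, -, hGD⟩ := exists_bilipschitz_chart hG himm c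
  obtain ⟨K, s, hK, hs⟩ := exists_isAlt_bound E k
  have hmem := eventually_mem_target (I := I) hU (mem_extChartAt_target c)
    (by rwa [extChartAt_to_inv])
  obtain ⟨r', hr', hsub⟩ := Metric.mem_nhdsWithin_iff.1 hmem
  set ρ := min r (r' / 2)
  have hρ : 0 < ρ := lt_min hr (by positivity)
  set Q := Metric.closedBall (Φ I c c) ρ ∩ range I with hQ
  have hQc : IsCompact Q := (isCompact_closedBall _ _).inter_right I.isClosed_range
  have hQsub : Q ⊆ (Φ I c).target ∩ (Φ I c).symm ⁻¹' U := fun y hy =>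
    hsub ⟨Metric.closedBall_subset_ball ((min_le_right _ _).trans_lt (by linarith)) hy.1, hy.2⟩
  have hbound (u : Fin k → E) : ∃ B : ℝ, ∀ z ∈ T ×ˢ Q, ‖formInChart (θ z.1) c z.2 u‖ ≤ B :=
    (hT.prod hQc).exists_bound_of_continuousOn
      ((hθ.contDiffOn c u).continuousOn.mono (prod_mono hTJ hQsub))
  choose B hB using hbound
  refine ⟨K * (∑ u ∈ s, |B u|) * C ^ k, by positivity, ?_⟩
  have hn1 : ∀ᶠ x in 𝓝 c, x ∈ (Φ I c).source := extChartAt_source_mem_nhds c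
  have hn2 : ∀ᶠ x in 𝓝 c, Φ I c x ∈ Metric.closedBall (Φ I c c) ρ :=
    (continuousAt_extChartAt c) (Metric.closedBall_mem_nhds _ hρ)
  filter_upwards [hn1, hn2] with x hx hxρ t ht v
  have hxQ : Φ I c x ∈ Q := ⟨hxρ, target_subset c ((Φ I c).map_source hx)⟩
  rw [val_eq_formInChart (θ t) hx]
  set u : Fin k → E := fun i => mfd I 𝓘(ℝ, E) (Φ I c) x (v i)
  have h1 := hs _ (isAlt_formInChart (hθ.alternating t (hTJ ht)) (hQsub hxQ).2) u
  refine h1.trans ?_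
  have h2 : ∑ w ∈ s, |formInChart (θ t) c (Φ I c x) w| ≤ ∑ w ∈ s, |B w| :=
    Finset.sum_le_sum fun w _ => (hB w (t, _) ⟨ht, hxQ⟩).trans (le_abs_self _)
  have h3 (i : Fin k) : ‖u i‖ ≤ C * ‖mfd I 𝓘(ℝ, F) G x (v i)‖ := by
    have h4 := (hGD (Φ I c x)
      ⟨Metric.closedBall_subset_closedBall (min_le_left _ _) hxρ, hxQ.2⟩ (u i)).1
    have h5 := chartD_mfderiv ((Φ I c).map_source hx) (v i)
    rw [(Φ I c).left_inv hx] at h5 h4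
    rwa [h5] at h4
  calc _ ≤ K * (∑ u ∈ s, |B u|) * ∏ i, (C * ‖mfd I 𝓘(ℝ, F) G x (v i)‖) := by
        refine mul_le_mul (mul_le_mul_of_nonneg_left h2 hK)
          (Finset.prod_le_prod (fun _ _ => norm_nonneg _) fun i _ => h3 i) ?_ (by positivity)
        exact Finset.prod_nonneg fun _ _ => norm_nonneg _
    _ = _ := by
        rw [Finset.prod_mul_distrib, Finset.prod_const, Finset.card_univ, Fintype.card_fin]
        ring

theorem IsSmoothFamilyOn.exists_bound [CompactSpace P] {θ : ℝ → PreForm I P k}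
    (hθ : IsSmoothFamilyOn J θ univ) {G : P → F} (hG : ContMDiff I 𝓘(ℝ, F) ∞ G)
    (himm : ∀ x, Injective (mfd I 𝓘(ℝ, F) G x)) {T : Set ℝ} (hT : IsCompact T) (hTJ : T ⊆ J) :
    ∃ C, 0 ≤ C ∧ ∀ t ∈ T, ∀ x, ∀ v : Fin k → E,
      |(θ t).val x v| ≤ C * ∏ i, ‖mfd I 𝓘(ℝ, F) G x (v i)‖ := by
  choose C hC hCx using fun c : P => hθ.exists_local_bound isOpen_univ hG himm hT hTJ (mem_univ c)
  obtain ⟨s, -, hs⟩ := isCompact_univ.elim_nhds_subcover _ fun c _ => hCx c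
  refine ⟨∑ c ∈ s, C c, Finset.sum_nonneg fun c _ => hC c, fun t ht x v => ?_⟩
  obtain ⟨c, hc, hxc⟩ := mem_iUnion₂.1 (hs (mem_univ x))
  refine (hxc t ht v).trans (mul_le_mul_of_nonneg_right ?_
    (Finset.prod_nonneg fun _ _ => norm_nonneg _))
  exact Finset.single_le_sum (f := C) (fun c _ => hC c) hc

end LocalBounds

section PairBounds

variable {G : M → F}

theorem mfd_pairMap (hG : ContMDiff ℍ 𝓘(ℝ, F) ∞ G) (p : M × M) (v : E3 × E3) :
    mfd pairModel 𝓘(ℝ, F × F) (fun p : M × M => (G p.1, G p.2)) p v =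
      (mfd ℍ 𝓘(ℝ, F) G p.1 v.1, mfd ℍ 𝓘(ℝ, F) G p.2 v.2) := by
  have h1 : MDifferentiableAt pairModel 𝓘(ℝ, F) (fun p : M × M => G p.1) p :=
    (hG.comp contMDiff_fst p).mdifferentiableAt (by simp)
  have h2 : MDifferentiableAt pairModel 𝓘(ℝ, F) (fun p : M × M => G p.2) p :=
    (hG.comp contMDiff_snd p).mdifferentiableAt (by simp)
  have h3 := mfd_prodMk (I := pairModel) (I' := 𝓘(ℝ, F)) (I'' := 𝓘(ℝ, F)) h1 h2
  have h4 := mfd_comp (I := pairModel) (I' := ℍ) (I'' := 𝓘(ℝ, F)) (g := G) (f := Prod.fst)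
    (x := p) ((hG p.1).mdifferentiableAt (by simp)) mdifferentiableAt_fst
  have h5 := mfd_comp (I := pairModel) (I' := ℍ) (I'' := 𝓘(ℝ, F)) (g := G) (f := Prod.snd)
    (x := p) ((hG p.2).mdifferentiableAt (by simp)) mdifferentiableAt_snd
  have h6 : mfd pairModel 𝓘(ℝ, F × F) (fun p : M × M => (G p.1, G p.2)) p =
      mfd pairModel (𝓘(ℝ, F).prod 𝓘(ℝ, F)) (fun p : M × M => (G p.1, G p.2)) p := by
    rw [← modelWithCornersSelf_prod, ← chartedSpaceSelf_prod]
  have h7 : mfd pairModel ℍ Prod.fst p = ContinuousLinearMap.fst ℝ E3 E3 := mfderiv_fst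
  have h8 : mfd pairModel ℍ Prod.snd p = ContinuousLinearMap.snd ℝ E3 E3 := mfderiv_snd
  rw [h6, h3, h4, h5, h7, h8]
  rfl

theorem IsSmoothFamilyOn.exists_pair_bound {η : ℝ → PreForm pairModel (M × M) 2}
    (hη : IsSmoothFamilyOn J η (pairSpace M)) (hdiag : HasDiagonalBound J η)
    (hG : ContMDiff ℍ 𝓘(ℝ, F) ∞ G) (hinj : Injective G) (himm : ∀ x, Injective (mfd ℍ 𝓘(ℝ, F) G x))
    {T : Set ℝ} (hT : IsCompact T) (hTJ : T ⊆ J) :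
    ∃ C, 0 ≤ C ∧ ∀ t ∈ T, ∀ p ∈ pairSpace M, ∀ v : Fin 2 → E3 × E3,
      |(η t).val p v| ≤ C * (‖G p.1 - G p.2‖ ^ 2)⁻¹ *
        ∏ a, (‖mfd ℍ 𝓘(ℝ, F) G p.1 (v a).1‖ + ‖mfd ℍ 𝓘(ℝ, F) G p.2 (v a).2‖) := by
  set S : M × M → (Fin 2 → E3 × E3) → ℝ := fun p v =>
    ∏ a, (‖mfd ℍ 𝓘(ℝ, F) G p.1 (v a).1‖ + ‖mfd ℍ 𝓘(ℝ, F) G p.2 (v a).2‖) with hS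
  have hS0 (p v) : 0 ≤ S p v := Finset.prod_nonneg fun _ _ => by positivity
  have hloc (c : M × M) : ∃ C, 0 ≤ C ∧ ∀ᶠ p in 𝓝 c, p ∈ pairSpace M → ∀ t ∈ T, ∀ v,
      |(η t).val p v| ≤ C * (‖G p.1 - G p.2‖ ^ 2)⁻¹ * S p v := by
    by_cases hc : c ∈ pairSpace M
    · -- away from the diagonal
      have hG2 : ContMDiff pairModel 𝓘(ℝ, F × F) ∞ (fun p : M × M => (G p.1, G p.2)) :=
        (hG.comp contMDiff_fst).prodMk_space (hG.comp contMDiff_snd)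
      have himm2 (p : M × M) : Injective
          (mfd pairModel 𝓘(ℝ, F × F) (fun p : M × M => (G p.1, G p.2)) p) := by
        intro v v' h
        rw [mfd_pairMap hG, mfd_pairMap hG] at h
        exact Prod.ext (himm _ (congrArg Prod.fst h)) (himm _ (congrArg Prod.snd h))
      obtain ⟨C, hC, hev⟩ := hη.exists_local_bound isOpen_pairSpace hG2 himm2 hT hTJ hc
      have hd : ContinuousAt (fun p : M × M => ‖G p.1 - G p.2‖ ^ 2) c := by
        have := hG.continuous
        fun_prop
      have hd2 : ∀ᶠ p in 𝓝 c, ‖G p.1 - G p.2‖ ^ 2 ≤ ‖G c.1 - G c.2‖ ^ 2 + 1 :=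
        hd.eventually (eventually_le_nhds (lt_add_one _))
      refine ⟨C * (‖G c.1 - G c.2‖ ^ 2 + 1), by positivity, ?_⟩
      filter_upwards [hev, hd2] with p hp hp2 hpp t ht v
      have hpos : 0 < ‖G p.1 - G p.2‖ ^ 2 := by
        have : G p.1 - G p.2 ≠ 0 := sub_ne_zero.2 fun h => hpp (hinj h)
        positivity
      have h1 : (1 : ℝ) ≤ (‖G c.1 - G c.2‖ ^ 2 + 1) * (‖G p.1 - G p.2‖ ^ 2)⁻¹ := by
        rw [← div_eq_mul_inv, le_div_iff₀ hpos, one_mul]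
        exact hp2
      refine (hp t ht v).trans ?_
      have h2 : ∏ i, ‖mfd pairModel 𝓘(ℝ, F × F) (fun p : M × M => (G p.1, G p.2)) p (v i)‖ ≤
          S p v := by
        refine Finset.prod_le_prod (fun _ _ => norm_nonneg _) fun a _ => ?_
        rw [mfd_pairMap hG]
        refine max_le ?_ ?_
        · exact le_add_of_nonneg_right (norm_nonneg _)
        · exact le_add_of_nonneg_left (norm_nonneg _)
      calc C * _ ≤ C * S p v := mul_le_mul_of_nonneg_left h2 hC
        _ ≤ (C * S p v) * ((‖G c.1 - G c.2‖ ^ 2 + 1) * (‖G p.1 - G p.2‖ ^ 2)⁻¹) :=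
            le_mul_of_one_le_right (mul_nonneg hC (hS0 _ _)) h1
        _ = _ := by ring
    · -- near the diagonal
      obtain ⟨c, c'⟩ := c
      have hcc : c = c' := not_not.1 hc
      subst hcc
      obtain ⟨r, hr, D, hD, hsub, hGbi, hGD⟩ := exists_bilipschitz_chart hG himm c
      set Q := Metric.closedBall (Φ ℍ c c) r ∩ range ℍ with hQ
      have hQc : IsCompact Q := (isCompact_closedBall _ _).inter_right (ℍ).isClosed_range
      obtain ⟨C, hC⟩ := hdiag c T Q hT hTJ hQc hsub
      refine ⟨|C| * D ^ 2 * D ^ 2, by positivity, ?_⟩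
      have hn : ∀ᶠ x in 𝓝 c, x ∈ (Φ ℍ c).source ∧ Φ ℍ c x ∈ Metric.closedBall (Φ ℍ c c) r := by
        have h1 : ∀ᶠ x in 𝓝 c, x ∈ (Φ ℍ c).source := extChartAt_source_mem_nhds c
        have h2 : ∀ᶠ x in 𝓝 c, Φ ℍ c x ∈ Metric.closedBall (Φ ℍ c c) r :=
          (continuousAt_extChartAt c) (Metric.closedBall_mem_nhds _ hr)
        filter_upwards [h1, h2] with x h h' using ⟨h, h'⟩
      have hn2 : ∀ᶠ p : M × M in 𝓝 (c, c), _ ∧ _ := (continuous_fst.tendsto (c, c)).eventually hn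
      have hn3 : ∀ᶠ p : M × M in 𝓝 (c, c), _ ∧ _ := (continuous_snd.tendsto (c, c)).eventually hn
      filter_upwards [hn2, hn3] with p hp1 hp2 hpp t ht v
      set y := Φ ℍ c p.1
      set y' := Φ ℍ c p.2
      have hy : y ∈ Q := ⟨hp1.2, target_subset c ((Φ ℍ c).map_source hp1.1)⟩
      have hy' : y' ∈ Q := ⟨hp2.2, target_subset c ((Φ ℍ c).map_source hp2.1)⟩
      have hinv : (Φ ℍ c).symm y = p.1 := (Φ ℍ c).left_inv hp1.1
      have hinv' : (Φ ℍ c).symm y' = p.2 := (Φ ℍ c).left_inv hp2.1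
      have hyy : y ≠ y' := fun h => hpp (by rw [← hinv, ← hinv', h])
      set u : Fin 2 → E3 × E3 := fun a => (mfd ℍ 𝓘(ℝ, E3) (Φ ℍ c) p.1 (v a).1,
          mfd ℍ 𝓘(ℝ, E3) (Φ ℍ c) p.2 (v a).2) with hu
      have ht2 : ((y, y') : E3 × E3) ∈ (Φ pairModel ((c, c) : M × M)).target :=
        mem_extChartAt_prod_target.2 ⟨hsub hy, hsub hy'⟩
      have hv1 (a) : chartD ℍ c y (u a).1 = (v a).1 := by
        have h := chartD_mfderiv (hsub hy) (v a).1
        rwa [hinv] at h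
      have hv2 (a) : chartD ℍ c y' (u a).2 = (v a).2 := by
        have h := chartD_mfderiv (hsub hy') (v a).2
        rwa [hinv'] at h
      have hval : (η t).val p v = formInChart (η t) (c, c) (y, y') u := by
        rw [formInChart_eq]
        have h1 : (Φ pairModel ((c, c) : M × M)).symm (y, y') = p := by
          rw [prodChart_symm]
          exact Prod.ext hinv hinv'
        rw [h1]
        congr 1
        funext a
        rw [chartD_prod ht2]
        exact Prod.ext (hv1 a).symm (hv2 a).symm
      have hua (a) : ‖u a‖ ≤ D * (‖mfd ℍ 𝓘(ℝ, F) G p.1 (v a).1‖ +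
          ‖mfd ℍ 𝓘(ℝ, F) G p.2 (v a).2‖) := by
        have h1 := (hGD y hy (u a).1).1
        have h2 := (hGD y' hy' (u a).2).1
        rw [hv1, hinv] at h1
        rw [hv2, hinv'] at h2
        refine max_le (h1.trans ?_) (h2.trans ?_)
        · exact mul_le_mul_of_nonneg_left (le_add_of_nonneg_right (norm_nonneg _)) hD.le
        · exact mul_le_mul_of_nonneg_left (le_add_of_nonneg_left (norm_nonneg _)) hD.le
      have hdist := (hGbi y hy y' hy').2
      rw [hinv, hinv'] at hdist
      have hpos : 0 < ‖G p.1 - G p.2‖ := norm_pos_iff.2 (sub_ne_zero.2 fun h => hpp (hinj h))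
      have hpos' : 0 < ‖y - y'‖ := norm_pos_iff.2 (sub_ne_zero.2 hyy)
      have h3 : (‖y - y'‖ ^ 2)⁻¹ ≤ D ^ 2 * (‖G p.1 - G p.2‖ ^ 2)⁻¹ := by
        rw [← div_eq_mul_inv, inv_le_comm₀ (by positivity) (by positivity), inv_div,
          div_le_iff₀ (by positivity), mul_comm, ← mul_pow]
        exact pow_le_pow_left₀ hpos.le hdist 2
      rw [hval]
      refine (hC t ht y hy y' hy' hyy u).trans ?_
      have h4 : ‖u 0‖ * ‖u 1‖ ≤ D ^ 2 * S p v := by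
        have h5 : D ^ 2 * S p v = ∏ a, (D * (‖mfd ℍ 𝓘(ℝ, F) G p.1 (v a).1‖ +
          ‖mfd ℍ 𝓘(ℝ, F) G p.2 (v a).2‖)) := by
          rw [Finset.prod_mul_distrib, Finset.prod_const, Finset.card_univ, Fintype.card_fin]
        rw [h5, Fin.prod_univ_two]
        exact mul_le_mul (hua 0) (hua 1) (norm_nonneg _) (by positivity)
      calc C * (‖y - y'‖ ^ 2)⁻¹ * (‖u 0‖ * ‖u 1‖)
          ≤ |C| * (‖y - y'‖ ^ 2)⁻¹ * (‖u 0‖ * ‖u 1‖) := by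
            gcongr
            exact le_abs_self C
        _ ≤ |C| * (D ^ 2 * (‖G p.1 - G p.2‖ ^ 2)⁻¹) * (D ^ 2 * S p v) := by
            gcongr
        _ = _ := by ring
  choose C hC hCx using hloc
  obtain ⟨s, -, hs⟩ := isCompact_univ.elim_nhds_subcover _ fun c _ => hCx c
  refine ⟨∑ c ∈ s, C c, Finset.sum_nonneg fun c _ => hC c, fun t ht p hp v => ?_⟩
  obtain ⟨c, hc, hxc⟩ := mem_iUnion₂.1 (hs (mem_univ p))
  refine (hxc hp t ht v).trans (mul_le_mul_of_nonneg_right (mul_le_mul_of_nonneg_right ?_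
    (by positivity)) (hS0 p v))
  exact Finset.single_le_sum (f := C) (fun c _ => hC c) hc

end PairBounds

/-! ### Bounds for the integrands of Feynman trees -/

/-- A smooth injective immersion into a vector space. -/
structure IsInjImmersion (G : M → F) : Prop where
  smooth : ContMDiff ℍ 𝓘(ℝ, F) ∞ G
  injective : Injective G
  immersive : ∀ x, Injective (mfd ℍ 𝓘(ℝ, F) G x)

variable {G : M → F} {r : ℕ∞ω} {s K : ℕ} {φ : Fin s → Factor B m n} {T : Set ℝ}
  {η : ℝ → PreForm pairModel (M × M) 2} {X : VField ℍ M} {X' : VField 𝔹 N}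

section TreeBounds

variable {F : Type*} [NormedAddCommGroup F] [InnerProductSpace ℝ F] {G : M → F} {dχ : B → ℕ}

variable (ι G) in
/-- The squared distance between the ends of an arrow. -/
def sqDist : Factor B m n → Conf M N m n → ℝ
  | .leaf _ _, _ => 1
  | .arrow i w, p => ‖G (p.1 i) - G (pos ι p w)‖ ^ 2

variable (ι G) in
/-- The product of the squared lengths of the arrows. -/
def treeDist (φ : Fin s → Factor B m n) (p : Conf M N m n) : ℝ := ∏ f, sqDist ι G (φ f) p

variable (ι G) in
/-- The sum of the norms of the velocities of the vertices. -/
def tanSize (p : Conf M N m n) (v : EConf m n) : ℝ :=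
  ∑ w, ‖mfd ℍ 𝓘(ℝ, F) G (pos ι p w) (vel ι p w v)‖

variable (ι G) in
/-- The form `θ` is `O(1 / D)`. -/
def KernelBound (D : Conf M N m n → ℝ) (C : ℝ) (θ : ConfForm M N m n k) :
    Prop :=
  ∀ p, D p ≠ 0 → ∀ v : Fin k → EConf m n,
    |θ.val p v| ≤ C * (D p)⁻¹ * ∏ a, tanSize ι G p (v a)

theorem sqDist_nonneg (f : Factor B m n) (p : Conf M N m n) : 0 ≤ sqDist ι G f p := by
  cases f with
  | leaf => exact zero_le_one
  | arrow i w => exact sq_nonneg _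

theorem treeDist_nonneg (φ : Fin s → Factor B m n) (p : Conf M N m n) : 0 ≤ treeDist ι G φ p :=
  Finset.prod_nonneg fun _ _ => sqDist_nonneg _ _

theorem le_tanSize (p : Conf M N m n) (v : EConf m n) (w : Fin m ⊕ Fin n) :
    ‖mfd ℍ 𝓘(ℝ, F) G (pos ι p w) (vel ι p w v)‖ ≤ tanSize ι G p v :=
  Finset.single_le_sum (f := fun w => ‖mfd ℍ 𝓘(ℝ, F) G (pos ι p w) (vel ι p w v)‖)
    (fun _ _ => norm_nonneg _) (Finset.mem_univ w)

theorem tanSize_nonneg (p : Conf M N m n) (v : EConf m n) : 0 ≤ tanSize ι G p v :=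
  Finset.sum_nonneg fun _ _ => norm_nonneg _

theorem prod_tanSize_nonneg (p : Conf M N m n) (v : Fin k → EConf m n) :
    0 ≤ ∏ a, tanSize ι G p (v a) := Finset.prod_nonneg fun _ _ => tanSize_nonneg _ _

theorem mem_facSet_iff (hG : Injective G) {f : Factor B m n} :
    p ∈ facSet ι f ↔ sqDist ι G f p ≠ 0 := by
  cases f with
  | leaf => simp [facSet, sqDist]
  | arrow i w =>
    simp only [facSet, sqDist, ne_eq, pow_eq_zero_iff, norm_eq_zero, sub_eq_zero, OfNat.ofNat_ne_zero,
      not_false_eq_true]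
    exact not_congr hG.eq_iff.symm

variable (ι G) in
/-- The configurations without collisions along the arrows. -/
def treeSet (φ : Fin s → Factor B m n) : Set (Conf M N m n) := {p | treeDist ι G φ p ≠ 0}

theorem mem_treeSet_iff :
    p ∈ treeSet ι G φ ↔ ∀ f, sqDist ι G (φ f) p ≠ 0 := by
  simp [treeSet, treeDist, Finset.prod_ne_zero_iff]

/-- Families of background fields and propagators. -/
structure IsFieldFamily (ι : N → M) (J : Set ℝ) (χ : ℝ → ∀ b, PreForm ℍ M (dχ b))
    (η : ℝ → PreForm pairModel (M × M) 2) : Prop where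
  smooth_leaf : ∀ b, IsSmoothFamilyOn J (fun t => χ t b) univ
  smooth_arrow : IsSmoothFamilyOn J η (pairSpace M)
  bound : HasDiagonalBound J η

theorem IsFieldFamily.exists_factor_bound {χ : ℝ → ∀ b, PreForm ℍ M (dχ b)}
    (h : IsFieldFamily ι J χ η) (hG : IsInjImmersion G) (hT : IsCompact T) (hTJ : T ⊆ J)
    (f : Factor B m n) :
    ∃ C, 0 ≤ C ∧ ∀ t ∈ T, KernelBound ι G (sqDist ι G f) C (factorForm ι (χ t) (η t) f) := by
  cases f with
  | leaf w b =>
    obtain ⟨C, hC, hb⟩ := (h.smooth_leaf b).exists_bound hG.smooth hG.immersive hT hTJ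
    refine ⟨C, hC, fun t ht p _ v => (hb t ht (pos ι p w) fun a => vel ι p w (v a)).trans ?_⟩
    simp only [sqDist, inv_one, mul_one]
    exact mul_le_mul_of_nonneg_left
      (Finset.prod_le_prod (fun _ _ => norm_nonneg _) fun a _ => le_tanSize p (v a) w) hC
  | arrow i w =>
    obtain ⟨C, hC, hb⟩ := h.smooth_arrow.exists_pair_bound h.bound hG.smooth hG.injective
      hG.immersive hT hTJ
    refine ⟨C * 2 ^ 2, by positivity, fun t ht p hp v => ?_⟩
    have hp' : posPair ι i w p ∈ pairSpace M :=
      (mem_facSet_iff (f := Factor.arrow (B := B) i w) hG.injective).2 hp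
    refine (hb t ht _ hp' fun a => (vel ι p (Sum.inl i) (v a), vel ι p w (v a))).trans ?_
    have h2 (a : Fin 2) := add_le_add (le_tanSize (ι := ι) (G := G) p (v a) (Sum.inl i))
      (le_tanSize (ι := ι) (G := G) p (v a) w)
    have h3 := Finset.prod_le_prod (s := Finset.univ) (fun a _ => by positivity) fun a _ => h2 a
    refine (mul_le_mul_of_nonneg_left h3 (by positivity)).trans (le_of_eq ?_)
    simp only [← two_mul, Finset.prod_mul_distrib, Finset.prod_const, Finset.card_univ,
      Fintype.card_fin]
    change C * (sqDist ι G (Factor.arrow (B := B) i w) p)⁻¹ *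
      (2 ^ 2 * ∏ a : Fin 2, tanSize ι G p (v a)) = C * 2 ^ 2 * (sqDist ι G (.arrow i w) p)⁻¹ *
        ∏ a : Fin 2, tanSize ι G p (v a)
    ring

theorem IsFieldFamily.lieDeriv (hJ : IsOpen J) {χ : ℝ → ∀ b, PreForm ℍ M (dχ b)}
    (h : IsFieldFamily ι J χ η) (hY : IsChartSmooth Y)
    (hb : HasDiagonalBound J fun t => lieDeriv (pairField Y) (η t)) :
    IsFieldFamily ι J (fun t b => lieDeriv Y (χ t b)) fun t => lieDeriv (pairField Y) (η t) :=
  ⟨fun b => (h.smooth_leaf b).lieDeriv hJ isOpen_univ hY,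
    h.smooth_arrow.lieDeriv hJ isOpen_pairSpace (isChartSmooth_pairField hY), hb⟩

theorem isOpen_treeSet (hι : Continuous ι) (hG : Continuous G) (φ : Fin s → Factor B m n) :
    IsOpen (treeSet ι G φ) := by
  refine isOpen_ne_fun (continuous_finsetProd _ fun f _ => ?_) continuous_const
  cases φ f with
  | leaf => exact continuous_const
  | arrow i w =>
    rcases w with i' | j
    · change Continuous fun p : Conf M N m n => ‖G (p.1 i) - G (p.1 i')‖ ^ 2
      fun_prop
    · change Continuous fun p : Conf M N m n => ‖G (p.1 i) - G (ι (p.2 j))‖ ^ 2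
      fun_prop

theorem KernelBound.wedgeForm {d : Fin s → ℕ} (hK : ∑ f, d f = K) {α : ∀ f, ConfForm M N m n (d f)}
    {C : Fin s → ℝ} (hα : ∀ f, KernelBound ι G (sqDist ι G (φ f)) (C f) (α f)) :
    KernelBound ι G (treeDist ι G φ) (K.factorial * ∏ f, C f) (wedgeForm hK α) := by
  intro p hp v
  have hp' := mem_treeSet_iff.1 hp
  refine (abs_wedgeFam_le hK (α := fun f => (α f).val p)
    (C := fun f => C f * (sqDist ι G (φ f) p)⁻¹) (fun f u => hα f p (hp' f) u) v).trans
    (le_of_eq ?_)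
  rw [treeDist, Finset.prod_mul_distrib, Finset.prod_inv_distrib]
  ring

theorem IsFieldFamily.exists_tree_bound (hJ : IsOpen J) {χ : ℝ → ∀ b, PreForm ℍ M (dχ b)}
    (h : IsFieldFamily ι J χ η) (hι : IsBoundaryInclusion ι) (hG : IsInjImmersion G)
    (hY : IsChartSmooth Y) (hYY : RestrictsTo ι Y Y')
    (hb : HasDiagonalBound J fun t => ChangeOfData.lieDeriv (pairField Y) (η t)) (Γ : FeynmanTree B)
    (hK : ∑ f, (Γ.factor f).deg dχ = K) (hT : IsCompact T) (hTJ : T ⊆ J) :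
    ∃ C, 0 ≤ C ∧ ∀ t ∈ T, KernelBound ι G (treeDist ι G Γ.factor) C (gammaHat ι (χ t) (η t) Γ hK) ∧
      KernelBound ι G (treeDist ι G Γ.factor) C
        (ChangeOfData.lieDeriv (confField Y Y' Γ.m Γ.n) (gammaHat ι (χ t) (η t) Γ hK)) := by
  choose C hC hCb using fun f => h.exists_factor_bound hG hT hTJ (Γ.factor f)
  choose C' hC' hCb' using fun f => (h.lieDeriv hJ hY hb).exists_factor_bound hG hT hTJ (Γ.factor f)
  set A : Fin Γ.s → ℝ := fun f => C f + C' f with hA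
  have hA0 (f) : 0 ≤ A f := add_nonneg (hC f) (hC' f)
  have hmono {D : Conf M N Γ.m Γ.n → ℝ} {c c' : ℝ} (hcc : c ≤ c') (hD : ∀ p, 0 ≤ D p) {k : ℕ}
      {θ : ConfForm M N Γ.m Γ.n k} (hθ : KernelBound ι G D c θ) :
      KernelBound ι G D c' θ := fun p hp v => (hθ p hp v).trans
        (mul_le_mul_of_nonneg_right (mul_le_mul_of_nonneg_right hcc (inv_nonneg.2 (hD p)))
          (prod_tanSize_nonneg p v))
  set α : ℝ → ∀ f, ConfForm M N Γ.m Γ.n ((Γ.factor f).deg dχ) :=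
    fun t f => factorForm ι (χ t) (η t) (Γ.factor f) with hα
  have h1 (t) (ht : t ∈ T) (f) : KernelBound ι G (sqDist ι G (Γ.factor f)) (A f) (α t f) :=
    hmono (le_add_of_nonneg_right (hC' f)) (fun p => sqDist_nonneg _ p) (hCb f t ht)
  have hform (t) (ht : t ∈ T) (f) : IsFormOn 1 (α t f) (facSet ι (Γ.factor f)) :=
    isFormOn_factorForm (by exact_mod_cast le_top) hι.contMDiff
      (fun b => ((h.smooth_leaf b).isFormOn (hTJ ht)).of_le (by exact_mod_cast le_top))
      ((h.smooth_arrow.isFormOn (hTJ ht)).of_le (by exact_mod_cast le_top)) _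
  have h2 (t) (ht : t ∈ T) (f) : KernelBound ι G (sqDist ι G (Γ.factor f)) (A f)
      (ChangeOfData.lieDeriv (confField Y Y' Γ.m Γ.n) (α t f)) := by
    refine hmono (le_add_of_nonneg_left (hC f)) (fun p => sqDist_nonneg _ p) fun p hp v => ?_
    have h3 := lieDeriv_factorForm hι.contMDiff
      (fun b => ((h.smooth_leaf b).isFormOn (hTJ ht)).of_le (by exact_mod_cast le_top))
      ((h.smooth_arrow.isFormOn (hTJ ht)).of_le (by exact_mod_cast le_top)) hY
      (hYY.isChartSmooth hι hY) hYY (Γ.factor f) ((mem_facSet_iff hG.injective).2 hp) v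
    rw [h3]
    exact hCb' f t ht p hp v
  set c : ℝ := K.factorial * ∏ f, A f with hc
  have hc0 : 0 ≤ c := mul_nonneg (by positivity) (Finset.prod_nonneg fun f _ => hA0 f)
  refine ⟨c + Γ.s * c, by positivity, fun t ht => ⟨?_, fun p hp v => ?_⟩⟩
  · exact hmono (le_add_of_nonneg_right (by positivity)) (fun p => treeDist_nonneg _ p)
      (KernelBound.wedgeForm hK (h1 t ht))
  · have hU : IsOpen (⋂ f, facSet ι (Γ.factor f) : Set (Conf M N Γ.m Γ.n)) :=
      isOpen_iInter_of_finite fun f => isOpen_facSet hι.contMDiff _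
    have hpU : p ∈ ⋂ f, facSet ι (Γ.factor f) :=
      mem_iInter.2 fun f => (mem_facSet_iff hG.injective).2 (mem_treeSet_iff.1 hp f)
    have h3 := lieDeriv_wedgeForm hK hU (fun f => (hform t ht f).mono (iInter_subset _ f))
      (confField Y Y' Γ.m Γ.n) hpU v
    refine (congrArg _ h3).le.trans ((Finset.abs_sum_le_sum_abs _ _).trans ?_)
    have h4 (f₀) := KernelBound.wedgeForm hK (C := A) (φ := Γ.factor)
      (α := update (α t) f₀ (ChangeOfData.lieDeriv (confField Y Y' Γ.m Γ.n) (α t f₀))) (fun f => by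
        by_cases hf : f = f₀
        · subst hf
          rw [update_self]
          exact h2 t ht f
        · rw [update_of_ne hf]
          exact h1 t ht f) p hp v
    refine (Finset.sum_le_sum fun f₀ _ => h4 f₀).trans ?_
    rw [Finset.sum_const, Finset.card_univ, Fintype.card_fin, nsmul_eq_mul, ← hc]
    have h5 : 0 ≤ (treeDist ι G Γ.factor p)⁻¹ * ∏ a, tanSize ι G p (v a) :=
      mul_nonneg (inv_nonneg.2 (treeDist_nonneg _ p)) (prod_tanSize_nonneg p v)
    nlinarith [mul_nonneg hc0 h5]

end TreeBounds

/-! ### Densities in good charts -/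

/-- A compact manifold is covered by charts in which a volume form and an immersion are bounded. -/
theorem exists_good_charts {d : ℕ} {I : ModelWithCorners ℝ (EuclideanSpace ℝ (Fin d)) H}
    [IsManifold I ∞ P] [CompactSpace P] [MeasurableSpace P] [BorelSpace P] {vol : PreForm I P d}
    (hvol : IsVolumeForm vol) {G : P → F} (hG : ContMDiff I 𝓘(ℝ, F) ∞ G)
    (himm : ∀ x, Injective (mfd I 𝓘(ℝ, F) G x)) : ∃ C, 0 ≤ C ∧ ∀ x, ∃ c, x ∈ (Φ I c).source ∧
      |coeffInChart vol c (Φ I c x)|⁻¹ ≤ C ∧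
      ∀ u, ‖mfd I 𝓘(ℝ, F) G x (chartD I c (Φ I c x) u)‖ ≤ C * ‖u‖ := by
  have hloc (c : P) : ∃ C, 0 ≤ C ∧ ∀ᶠ x in 𝓝 c, x ∈ (Φ I c).source ∧
      |coeffInChart vol c (Φ I c x)|⁻¹ ≤ C ∧
      ∀ u, ‖mfd I 𝓘(ℝ, F) G x (chartD I c (Φ I c x) u)‖ ≤ C * ‖u‖ := by
    obtain ⟨r, hr, C, hC, -, -, hD⟩ := exists_bilipschitz_chart hG himm c
    have h0 := (topRatio_eq hvol hvol.isFormOn.alternating (mem_extChartAt_source c) (mem_univ _)).1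
    have hcont : ContinuousAt (fun x => |coeffInChart vol c (Φ I c x)|⁻¹) c := by
      have h1 : ContinuousAt (fun x => coeffInChart vol c (Φ I c x)) c :=
        ((hvol.continuousOn_coeffInChart c).comp (continuousOn_extChartAt c)
          (Φ I c).mapsTo).continuousAt (extChartAt_source_mem_nhds c)
      exact h1.abs.inv₀ (abs_ne_zero.2 h0)
    have hn1 : ∀ᶠ x in 𝓝 c, x ∈ (Φ I c).source := extChartAt_source_mem_nhds c
    have hn2 : ∀ᶠ x in 𝓝 c, Φ I c x ∈ Metric.closedBall (Φ I c c) r :=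
      (continuousAt_extChartAt c) (Metric.closedBall_mem_nhds _ hr)
    have hn3 := hcont.eventually (eventually_le_nhds (lt_add_one _))
    refine ⟨C + (|coeffInChart vol c (Φ I c c)|⁻¹ + 1), by positivity, ?_⟩
    filter_upwards [hn1, hn2, hn3] with x h1 h2 h3
    refine ⟨h1, h3.trans (le_add_of_nonneg_left hC.le), fun u => ?_⟩
    have h4 := (hD _ ⟨h2, target_subset c ((Φ I c).map_source h1)⟩ u).2
    rw [(Φ I c).left_inv h1] at h4
    exact h4.trans (mul_le_mul_of_nonneg_right (le_add_of_nonneg_right (by positivity))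
      (norm_nonneg _))
  choose C hC hCx using hloc
  obtain ⟨s, -, hs⟩ := isCompact_univ.elim_nhds_subcover _ fun c _ => hCx c
  refine ⟨∑ c ∈ s, C c, Finset.sum_nonneg fun c _ => hC c, fun x => ?_⟩
  obtain ⟨c, hc, hxc⟩ := mem_iUnion₂.1 (hs (mem_univ x))
  have hle := Finset.single_le_sum (f := C) (fun c _ => hC c) hc
  exact ⟨c, hxc.1, hxc.2.1.trans hle, fun u => (hxc.2.2 u).trans
    (mul_le_mul_of_nonneg_right hle (norm_nonneg _))⟩

section DensityBounds

variable [MeasurableSpace M] [BorelSpace M] {F : Type*} [NormedAddCommGroup F]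
  [InnerProductSpace ℝ F] {G : M → F} {volN : PreForm 𝔹 N 2}

variable (ι G) in
/-- The sum of the norms of the velocities of the boundary vertices. -/
def bdrySize (y : Fin n → N) (w : Fin n → E2) : ℝ :=
  ∑ j, ‖mfd ℍ 𝓘(ℝ, F) G (ι (y j)) (mfd 𝔹 ℍ ι (y j) (w j))‖

theorem bdrySize_nonneg (y : Fin n → N) (w : Fin n → E2) : 0 ≤ bdrySize ι G y w :=
  Finset.sum_nonneg fun _ _ => norm_nonneg _

theorem tanSize_eq (p : Conf M N m n) (v : EConf m n) :
    tanSize ι G p v = ∑ i, ‖mfd ℍ 𝓘(ℝ, F) G (p.1 i) (v.1 i)‖ + bdrySize ι G p.2 v.2 :=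
  Fintype.sum_sum_type _

theorem norm_single_apply_le {κ E : Type*} [DecidableEq κ] [NormedAddCommGroup E] (i i' : κ)
    {e : E} (he : ‖e‖ ≤ 1) : ‖(Pi.single i e : κ → E) i'‖ ≤ 1 := by
  by_cases h : i' = i
  · subst h; simpa using he
  · simp [h]

theorem exists_fibreDensity_bound (hvol : IsVolumeForm volM) (hG : IsInjImmersion G) (m n k : ℕ) :
    ∃ C, 0 ≤ C ∧ ∀ (θ : ConfForm M N m n (m * 3 + k)) (p : Conf M N m n)
      (b : ℝ), 0 ≤ b → IsAlt (θ.val p) → (∀ v, |θ.val p v| ≤ b * ∏ a, tanSize ι G p (v a)) →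
      ∀ w : Fin k → Fin n → E2, |fibreDensity volM θ p.2 w p.1| ≤ C * b * ∏ a, bdrySize ι G p.2 (w a) := by
  obtain ⟨C, hC, hgood⟩ := exists_good_charts hvol hG.smooth hG.immersive
  choose c hc hcoef hD using hgood
  refine ⟨(m * C) ^ (m * 3) * C ^ m, by positivity, fun θ p b hb halt hbd w => ?_⟩
  set x₀ : Fin m → M := fun i => c (p.1 i)
  set ξ := Φ (ℳ m) x₀ p.1
  set z := Φ (ℬ n) p.2 p.2
  have hsrc : p.1 ∈ (Φ (ℳ m) x₀).source := by
    have h := powChart_source (I := ℍ) x₀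
    exact h.symm ▸ fun i => hc (p.1 i)
  have hξ := (Φ (ℳ m) x₀).map_source hsrc
  have hz := mem_extChartAt_target (I := ℬ n) p.2
  have hξx := (Φ (ℳ m) x₀).left_inv hsrc
  have hzy := extChartAt_to_inv (I := ℬ n) p.2
  have hp : ((Φ (ℳ m) x₀).symm ξ, (Φ (ℬ n) p.2).symm z) = p := Prod.ext hξx hzy
  have h1 := formInChart_fibreForm hvol (θ := θ) (U := {p})
    (fun q hq => by rw [mem_singleton_iff.1 hq]; exact halt) hξ hz hp w
  rw [hξx] at h1
  rw [(formInChart_fibreForm_self θ p.1 p.2 w).symm.trans h1, abs_div, Finset.abs_prod]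
  have hprod : (∏ i, |coeffInChart volM (x₀ i) (ξ i)|)⁻¹ ≤ C ^ m := by
    rw [← Finset.prod_inv_distrib]
    refine (Finset.prod_le_prod (fun _ _ => by positivity) fun i _ => hcoef (p.1 i)).trans ?_
    simp
  have ht : (ξ, z) ∈ (Φ (ℭ m n) (x₀, p.2)).target := mem_conf_target.2 ⟨hξ, hz⟩
  have hnum : |formInChart θ (x₀, p.2) (ξ, z) (appendVec (bulkBasis m) w)| ≤
      b * ((m * C) ^ (m * 3) * ∏ a, bdrySize ι G p.2 (w a)) := by
    have h3 : (Φ (ℭ m n) (x₀, p.2)).symm (ξ, z) = p := (prodChart_symm _ _).trans hp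
    rw [formInChart_eq, h3]
    refine (hbd _).trans (mul_le_mul_of_nonneg_left ?_ hb)
    rw [Fin.prod_univ_add]
    refine mul_le_mul ?_ (Finset.prod_le_prod (fun _ _ => tanSize_nonneg _ _) fun a _ => ?_)
      (Finset.prod_nonneg fun _ _ => tanSize_nonneg _ _) (by positivity)
    · refine (Finset.prod_le_prod (fun _ _ => tanSize_nonneg _ _) fun a _ => ?_).trans
        (b := ∏ _a : Fin (m * 3), (m * C)) (by simp)
      rw [chartD_conf ht, tanSize_eq, appendVec_castAdd]
      have h4 : bdrySize ι G p.2 (chartD (ℬ n) p.2 z 0) = 0 := by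
        rw [map_zero]
        refine Finset.sum_eq_zero fun j _ => ?_
        rw [Pi.zero_apply, map_zero, map_zero, norm_zero]
      refine (add_le_of_nonpos_right h4.le).trans
        ((Finset.sum_le_sum (g := fun _ => C) fun i _ => ?_).trans (by simp))
      have h5 := hD (p.1 i) (bulkBasis m a i)
      have h6 : chartD (ℳ m) x₀ ξ (bulkBasis m a) i =
          chartD ℍ (x₀ i) (ξ i) (bulkBasis m a i) := chartD_pow ℍ i hξ _
      refine (congrArg (fun u => ‖mfd ℍ 𝓘(ℝ, F) G (p.1 i) u‖) h6).le.trans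
        (h5.trans (mul_le_of_le_one_right hC ?_))
      exact norm_single_apply_le _ _ (by simp [stdBasis3])
    · rw [chartD_conf ht, tanSize_eq, appendVec_natAdd]
      have h4 : ∑ i, ‖mfd ℍ 𝓘(ℝ, F) G (p.1 i) (chartD (ℳ m) x₀ ξ 0 i)‖ = 0 := by
        rw [map_zero]
        refine Finset.sum_eq_zero fun j _ => ?_
        rw [Pi.zero_apply, map_zero, norm_zero]
      refine (add_le_of_nonpos_left h4.le).trans (le_of_eq ?_)
      have h5 : chartD (ℬ n) p.2 z = ContinuousLinearMap.id ℝ _ := chartD_self p.2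
      change bdrySize ι G p.2 (chartD (ℬ n) p.2 z (w a)) = _
      rw [h5]
      rfl
  rw [div_eq_mul_inv]
  refine (mul_le_mul hnum hprod (by positivity) (mul_nonneg hb (mul_nonneg (by positivity)
      (Finset.prod_nonneg fun _ _ => bdrySize_nonneg _ _)))).trans (le_of_eq (by ring))

/-! ### Densities on the boundary -/

/-- The standard basis of `(ℝ²)^n`, in the order of the factors. -/
def bdryBasis (n : ℕ) (a : Fin (n * 2)) : Fin n → E2 :=
  Pi.single (finProdFinEquiv.symm a).1 (EuclideanSpace.single (finProdFinEquiv.symm a).2 (1 : ℝ))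

theorem bdryDensity_eq (hvol : IsVolumeForm volN)
    {θ : PreForm (ℬ n) (Fin n → N) (n * 2)} {c y : Fin n → N}
    (hy : y ∈ (Φ (ℬ n) c).source) (halt : IsAlt (θ.val y)) :
    (∏ j, coeffInChart volN (c j) (Φ 𝔹 (c j) (y j)) ≠ 0) ∧
    bdryDensity volN θ y = formInChart θ c (Φ (ℬ n) c y) (bdryBasis n) /
      ∏ j, coeffInChart volN (c j) (Φ 𝔹 (c j) (y j)) := by
  have hyj (j) : y j ∈ (Φ 𝔹 (c j)).source := by
    have h := powChart_source (I := 𝔹) c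
    exact (h ▸ hy : y ∈ {x | ∀ i, x i ∈ (Φ 𝔹 (c i)).source}) j
  have hz := (Φ (ℬ n) c).map_source hy
  set z := Φ (ℬ n) c y with hzdef
  set A : Fin n → E2 →ₗ[ℝ] E2 := fun j => (chartD 𝔹 (c j) (z j)).toLinearMap with hA
  have hcoef (j) : coeffInChart volN (c j) (Φ 𝔹 (c j) (y j)) =
      LinearMap.det (A j) * volN.val (y j) fun a => EuclideanSpace.single a (1 : ℝ) := by
    have h := IsAlt.apply_comp_basis (V := E2) (a := volN.val (y j))
      (hvol.isFormOn.alternating _ (mem_univ _)) (EuclideanSpace.basisFun (Fin 2) ℝ).toBasis (A j)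
    have hb : (⇑(EuclideanSpace.basisFun (Fin 2) ℝ).toBasis : Fin 2 → E2) =
        fun a => EuclideanSpace.single a (1 : ℝ) := basisFun_eq_single
    refine Eq.trans ?_ (h.trans (congrArg (fun b => LinearMap.det (A j) * volN.val (y j) b) hb))
    change volN.val ((Φ 𝔹 (c j)).symm (Φ 𝔹 (c j) (y j))) _ = _
    rw [(Φ 𝔹 (c j)).left_inv (hyj j)]
    exact congrArg (volN.val (y j)) (funext fun a => congrArg (A j) (congrFun hb a).symm)
  have hne : ∏ j, coeffInChart volN (c j) (Φ 𝔹 (c j) (y j)) ≠ 0 :=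
    Finset.prod_ne_zero_iff.2 fun j _ =>
      (topRatio_eq hvol hvol.isFormOn.alternating (hyj j) (mem_univ _)).1
  refine ⟨hne, ?_⟩
  set b : Module.Basis (Fin (n * 2)) ℝ (Fin n → E2) :=
    (Pi.basis fun _ : Fin n => (EuclideanSpace.basisFun (Fin 2) ℝ).toBasis).reindex
      ((Equiv.sigmaEquivProd (Fin n) (Fin 2)).trans finProdFinEquiv) with hbdef
  have hb : (b : Fin (n * 2) → Fin n → E2) = bdryBasis n := by
    funext a
    simp [hbdef, bdryBasis, Pi.basis_apply, Equiv.sigmaEquivProd]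
  have h1 := halt.apply_comp_basis b (LinearMap.pi fun j => (A j).comp (LinearMap.proj j))
  rw [LinearMap.det_pi, hb] at h1
  have h2 : formInChart θ c z (bdryBasis n) =
      (∏ j, LinearMap.det (A j)) * θ.val y (bdryBasis n) := by
    rw [← h1, formInChart_eq, hzdef, (Φ (ℬ n) c).left_inv hy]
    congr 1
    funext a
    exact funext fun j => chartD_pow 𝔹 j hz _
  simp_rw [hcoef, Finset.prod_mul_distrib] at hne ⊢
  rw [h2, mul_div_mul_left _ _ (left_ne_zero_of_mul hne)]
  rfl

theorem exists_bdryDensity_bound [CompactSpace N] [MeasurableSpace N] [BorelSpace N]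
    (hvol : IsVolumeForm volN) (hι : IsBoundaryInclusion ι) (hG : IsInjImmersion G) (n : ℕ) :
    ∃ C, 0 ≤ C ∧ ∀ (θ : PreForm (ℬ n) (Fin n → N) (n * 2)) (y : Fin n → N)
      (b : ℝ), 0 ≤ b → IsAlt (θ.val y) → (∀ v, |θ.val y v| ≤ b * ∏ a, bdrySize ι G y (v a)) →
      |bdryDensity volN θ y| ≤ C * b := by
  have hcomp (y : N) : mfd 𝔹 𝓘(ℝ, F) (fun y => G (ι y)) y =
      (mfd ℍ 𝓘(ℝ, F) G (ι y)).comp (mfd 𝔹 ℍ ι y) :=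
    mfd_comp ((hG.smooth _).mdifferentiableAt (by simp))
      ((hι.contMDiff y).mdifferentiableAt (by simp))
  obtain ⟨C, hC, hgood⟩ := exists_good_charts hvol (hG.smooth.comp hι.contMDiff) fun y => by
    have h : Injective ((mfd ℍ 𝓘(ℝ, F) G (ι y)).comp (mfd 𝔹 ℍ ι y)) :=
      (hG.immersive (ι y)).comp (hι.immersive y)
    rw [← hcomp] at h
    exact h
  choose c hc hcoef hD using hgood
  refine ⟨(n * C) ^ (n * 2) * C ^ n, by positivity, fun θ y b hb halt hbd => ?_⟩
  set x₀ : Fin n → N := fun i => c (y i)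
  have hsrc : y ∈ (Φ (ℬ n) x₀).source := by
    have h := powChart_source (I := 𝔹) x₀
    exact h.symm ▸ fun i => hc (y i)
  have hz := (Φ (ℬ n) x₀).map_source hsrc
  rw [(bdryDensity_eq hvol hsrc halt).2, abs_div, Finset.abs_prod, div_eq_mul_inv,
    ← Finset.prod_inv_distrib]
  have hprod : (∏ i, |coeffInChart volN (x₀ i) (Φ 𝔹 (x₀ i) (y i))|⁻¹) ≤ C ^ n := by
    refine (Finset.prod_le_prod (fun _ _ => by positivity) fun i _ => hcoef (y i)).trans ?_
    simp
  have hnum : |formInChart θ x₀ (Φ (ℬ n) x₀ y) (bdryBasis n)| ≤ b * (n * C) ^ (n * 2) := by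
    rw [formInChart_eq, (Φ (ℬ n) x₀).left_inv hsrc]
    refine (hbd _).trans (mul_le_mul_of_nonneg_left ?_ hb)
    refine (Finset.prod_le_prod (fun _ _ => bdrySize_nonneg _ _) fun a _ => ?_).trans
        (b := ∏ _a : Fin (n * 2), (n * C)) (by simp)
    refine (Finset.sum_le_sum (g := fun _ => C) fun i _ => ?_).trans (by simp)
    have h6 : chartD (ℬ n) x₀ (Φ (ℬ n) x₀ y) (bdryBasis n a) i =
      chartD 𝔹 (x₀ i) (Φ 𝔹 (x₀ i) (y i)) (bdryBasis n a i) := chartD_pow 𝔹 i hz _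
    have h5 := hD (y i) (bdryBasis n a i)
    refine le_trans (le_of_eq ?_) (h5.trans (mul_le_of_le_one_right hC
      (norm_single_apply_le _ _ (by simp))))
    rw [h6]
    exact congrArg norm (congrArg (fun L => L (chartD 𝔹 (x₀ i)
      (Φ 𝔹 (x₀ i) (y i)) (bdryBasis n a i))) (hcomp (y i))).symm
  exact (mul_le_mul hnum hprod (Finset.prod_nonneg fun _ _ => by positivity)
    (by positivity)).trans (le_of_eq (by ring))

end DensityBounds

/-! ### Cutoff functions -/

section Cutoff

variable {F : Type*} [NormedAddCommGroup F] [InnerProductSpace ℝ F] {G : M → F}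

theorem exists_norm_sub_le (hG : IsInjImmersion G) {f : M → F} (hf : ContMDiff ℍ 𝓘(ℝ, F) ∞ f) :
    ∃ L, 0 ≤ L ∧ ∀ x x', ‖f x - f x'‖ ≤ L * ‖G x - G x'‖ := by
  have hloc (c : M × M) : ∃ L, 0 ≤ L ∧ ∀ᶠ p in 𝓝 c, ‖f p.1 - f p.2‖ ≤ L * ‖G p.1 - G p.2‖ := by
    by_cases hc : c.1 = c.2
    · obtain ⟨c, c'⟩ := c
      obtain rfl : c = c' := hc
      obtain ⟨r, hr, C, hC, -, hb, -⟩ := exists_bilipschitz_chart hG.smooth hG.immersive c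
      obtain ⟨L, t, ht, hL⟩ := ((contDiffWithinAt_map_comp_symm hf
        (mem_extChartAt_target c)).of_le (m := 1)
          (by exact_mod_cast le_top)).exists_lipschitzOnWith (ℍ).convex_range
      have hn : ∀ᶠ x in 𝓝 c, x ∈ (Φ ℍ c).source ∧ Φ ℍ c x ∈
          t ∩ (Metric.closedBall (Φ ℍ c c) r ∩ range ℍ) := by
        have h1 : ∀ᶠ x in 𝓝 c, x ∈ (Φ ℍ c).source := extChartAt_source_mem_nhds c
        have h2 := tendsto_nhdsWithin_iff.2 ⟨continuousAt_extChartAt (I := ℍ) c,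
          h1.mono fun x hx => target_subset c ((Φ ℍ c).map_source hx)⟩
        filter_upwards [h1, h2 (inter_mem ht (inter_mem (mem_nhdsWithin_of_mem_nhds (Metric.closedBall_mem_nhds _ hr)) self_mem_nhdsWithin))] with x h h'
          using ⟨h, h'⟩
      have hn1 : ∀ᶠ p : M × M in 𝓝 (c, c), _ ∧ _ := (continuous_fst.tendsto (c, c)).eventually hn
      have hn2 : ∀ᶠ p : M × M in 𝓝 (c, c), _ ∧ _ := (continuous_snd.tendsto (c, c)).eventually hn
      refine ⟨L * C, by positivity, ?_⟩
      filter_upwards [hn1, hn2] with p h1 h2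
      have h3 := hL.norm_sub_le h1.2.1 h2.2.1
      have h4 := (hb _ h1.2.2 _ h2.2.2).1
      simp only [(Φ ℍ c).left_inv h1.1, (Φ ℍ c).left_inv h2.1] at h3 h4
      exact h3.trans ((mul_le_mul_of_nonneg_left h4 L.2).trans_eq (mul_assoc _ _ _).symm)
    · have h0 : ‖G c.1 - G c.2‖ ≠ 0 := norm_ne_zero_iff.2 (sub_ne_zero.2 fun h => hc (hG.injective h))
      have hf' := hf.continuous
      have hG' := hG.smooth.continuous
      have h1 : ContinuousAt (fun p : M × M => ‖f p.1 - f p.2‖ / ‖G p.1 - G p.2‖) c :=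
        ContinuousAt.div (by fun_prop) (by fun_prop) h0
      have h2 : ContinuousAt (fun p : M × M => ‖G p.1 - G p.2‖) c := by fun_prop
      refine ⟨‖f c.1 - f c.2‖ / ‖G c.1 - G c.2‖ + 1, by positivity, ?_⟩
      filter_upwards [h1.eventually (eventually_le_nhds (lt_add_one _)), h2.eventually_ne h0]
        with p hp hp0
      exact (div_le_iff₀ (lt_of_le_of_ne (norm_nonneg _) (Ne.symm hp0))).1 hp
  choose L hL hLp using hloc
  obtain ⟨s, -, hs⟩ := isCompact_univ.elim_nhds_subcover _ fun c _ => hLp c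
  refine ⟨∑ c ∈ s, L c, Finset.sum_nonneg fun c _ => hL c, fun x x' => ?_⟩
  obtain ⟨c, hc, hxc⟩ := mem_iUnion₂.1 (hs (mem_univ (x, x')))
  exact LE.le.trans hxc (mul_le_mul_of_nonneg_right
    (Finset.single_le_sum (f := L) (fun c _ => hL c) hc) (norm_nonneg _))

theorem contMDiff_mfd_field (hG : ContMDiff ℍ 𝓘(ℝ, F) ∞ G) (hY : IsSmoothVectorField ℍ Y) :
    ContMDiff ℍ 𝓘(ℝ, F) ∞ fun x => mfd ℍ 𝓘(ℝ, F) G x (fieldVal Y x) :=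
  (contMDiff_snd_tangentBundle_modelSpace F 𝓘(ℝ, F)).comp
    ((hG.contMDiff_tangentMap (m := ∞) (by simp)).comp hY)

/-- A nonnegative function whose derivative along `Z` is bounded by a multiple of the function. -/
structure IsLogLipschitz (Z : ∀ p : Conf M N m n, TangentSpace (ℭ m n) p)
    (g : Conf M N m n → ℝ) : Prop where
  smooth : ContMDiff (ℭ m n) 𝓘(ℝ, ℝ) ∞ g
  bound : ∃ L, 0 ≤ L ∧ ∀ p, 0 ≤ g p ∧
    |mfd (ℭ m n) 𝓘(ℝ, ℝ) g p (fieldVal Z p)| ≤ L * g p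

theorem IsLogLipschitz.mul {Z : ∀ p : Conf M N m n, TangentSpace (ℭ m n) p}
    {g g' : Conf M N m n → ℝ} (h : IsLogLipschitz Z g) (h' : IsLogLipschitz Z g') :
    IsLogLipschitz Z (g * g') := by
  obtain ⟨L, hL, hb⟩ := h.bound
  obtain ⟨L', hL', hb'⟩ := h'.bound
  refine ⟨h.smooth.mul h'.smooth, L + L', by positivity, fun p => ⟨mul_nonneg (hb p).1 (hb' p).1, ?_⟩⟩
  have h1 : mfd (ℭ m n) 𝓘(ℝ, ℝ) (g * g') p =
      g p • mfd (ℭ m n) 𝓘(ℝ, ℝ) g' p + g' p • mfd (ℭ m n) 𝓘(ℝ, ℝ) g p :=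
    (((h.smooth p).mdifferentiableAt (by simp)).hasMFDerivAt.mul
      ((h'.smooth p).mdifferentiableAt (by simp)).hasMFDerivAt).mfderiv
  rw [h1]
  refine (abs_add_le _ _).trans ?_
  change |g p * _| + |g' p * _| ≤ _ * (g p * g' p)
  rw [abs_mul, abs_mul, abs_of_nonneg (hb p).1, abs_of_nonneg (hb' p).1]
  exact (add_le_add (mul_le_mul_of_nonneg_left (hb' p).2 (hb p).1)
    (mul_le_mul_of_nonneg_left (hb p).2 (hb' p).1)).trans (le_of_eq (by ring))

theorem isLogLipschitz_one {Z : ∀ p : Conf M N m n, TangentSpace (ℭ m n) p} :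
    IsLogLipschitz Z 1 := by
  refine ⟨contMDiff_const, 0, le_rfl, fun p => ⟨zero_le_one, ?_⟩⟩
  have h : mfd (ℭ m n) 𝓘(ℝ, ℝ) (1 : Conf M N m n → ℝ) p = 0 := mfderiv_const
  rw [h]
  simp

theorem isLogLipschitz_sqDist (hι : ContMDiff 𝔹 ℍ ∞ ι) (hG : IsInjImmersion G)
    (hY : IsSmoothVectorField ℍ Y) (hYY : RestrictsTo ι Y Y') (f : Factor B m n) :
    IsLogLipschitz (confField Y Y' m n) (sqDist ι G f) := by
  cases f with
  | leaf => exact isLogLipschitz_one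
  | arrow i w =>
    obtain ⟨L, hL, hLb⟩ := exists_norm_sub_le hG (contMDiff_mfd_field hG.smooth hY)
    have hpos (w : Fin m ⊕ Fin n) : ContMDiff (ℭ m n) 𝓘(ℝ, F) ∞
        fun p : Conf M N m n => G (pos ι p w) := hG.smooth.comp (contMDiff_pos hι w)
    set u : Conf M N m n → F := fun p => G (pos ι p (Sum.inl i)) - G (pos ι p w) with hu
    have husm : ContMDiff (ℭ m n) 𝓘(ℝ, F) ∞ u := (hpos _).sub (hpos _)
    refine ⟨(contDiff_norm_sq ℝ (E := F)).contMDiff.comp husm, 2 * L, by positivity,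
      fun p => ⟨sqDist_nonneg (ι := ι) (G := G) (.arrow (B := B) i w) p, ?_⟩⟩
    have h1 (w : Fin m ⊕ Fin n) : mfd (ℭ m n) 𝓘(ℝ, F) (fun p => G (pos ι p w)) p
        (fieldVal (confField Y Y' m n) p) =
        mfd ℍ 𝓘(ℝ, F) G (pos ι p w) (fieldVal Y (pos ι p w)) := by
      rw [mfd_comp ((hG.smooth _).mdifferentiableAt (by simp))
        ((contMDiff_pos hι w p).mdifferentiableAt (by simp))]
      exact congrArg (mfd ℍ 𝓘(ℝ, F) G (pos ι p w))
        ((mfd_pos hι w p _).trans (vel_confField hYY p w))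
    have h2 : mfd (ℭ m n) 𝓘(ℝ, F) u p = mfd (ℭ m n) 𝓘(ℝ, F)
        (fun p => G (pos ι p (Sum.inl i))) p - mfd (ℭ m n) 𝓘(ℝ, F) (fun p => G (pos ι p w)) p :=
      mfderiv_sub ((hpos _ p).mdifferentiableAt (by simp)) ((hpos _ p).mdifferentiableAt (by simp))
    have h3 : mfd (ℭ m n) 𝓘(ℝ, ℝ) (fun p => ‖u p‖ ^ 2) p =
        (fderiv ℝ (fun v : F => ‖v‖ ^ 2) (u p)).comp (mfd (ℭ m n) 𝓘(ℝ, F) u p) := by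
      rw [← mfderiv_eq_fderiv]
      exact mfd_comp (g := fun v : F => ‖v‖ ^ 2)
        (((contDiff_norm_sq ℝ (n := ∞)).contMDiff _).mdifferentiableAt (by simp))
        ((husm p).mdifferentiableAt (by simp))
    change |mfd (ℭ m n) 𝓘(ℝ, ℝ) (fun p => ‖u p‖ ^ 2) p _| ≤ 2 * L * ‖u p‖ ^ 2
    rw [h3, fderiv_norm_sq, h2]
    change |2 • inner ℝ (u p) (mfd (ℭ m n) 𝓘(ℝ, F) _ p _ - mfd (ℭ m n) 𝓘(ℝ, F) _ p _)| ≤ _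
    rw [h1, h1, two_nsmul, ← two_mul, abs_mul, abs_two]
    have h4 := (abs_real_inner_le_norm (u p) _).trans (mul_le_mul_of_nonneg_left
      (hLb (pos ι p (Sum.inl i)) (pos ι p w)) (norm_nonneg (u p)))
    change _ ≤ ‖u p‖ * (L * ‖u p‖) at h4
    nlinarith

theorem isLogLipschitz_treeDist (hι : ContMDiff 𝔹 ℍ ∞ ι) (hG : IsInjImmersion G)
    (hY : IsSmoothVectorField ℍ Y) (hYY : RestrictsTo ι Y Y') (φ : Fin s → Factor B m n) :
    IsLogLipschitz (confField Y Y' m n) (treeDist ι G φ) := by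
  have h (S : Finset (Fin s)) : IsLogLipschitz (confField Y Y' m n)
      (∏ f ∈ S, sqDist ι G (φ f)) := by
    induction S using Finset.cons_induction with
    | empty => exact isLogLipschitz_one
    | cons f S hf ih =>
      rw [Finset.prod_cons]
      exact (isLogLipschitz_sqDist hι hG hY hYY _).mul ih
  convert h Finset.univ
  ext p
  rw [Finset.prod_apply]
  rfl

variable (ι G) in
/-- A function that vanishes near the collisions along arrows. -/
def cutoff (φ : Fin s → Factor B m n) (ε : ℝ) (p : Conf M N m n) : ℝ :=
  Real.smoothTransition (2 * (ε⁻¹ * treeDist ι G φ p) - 1)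

theorem cutoff_eventually_zero {ε : ℝ} (hε : 0 < ε) (hp : p ∉ treeSet ι G φ)
    (hcont : Continuous (treeDist ι G φ : Conf M N m n → ℝ)) :
    ∀ᶠ p' in 𝓝 p, cutoff ι G φ ε p' = 0 := by
  have h0 : treeDist ι G φ p = 0 := not_not.1 hp
  have h1 : treeDist ι G φ p < ε / 2 := by rw [h0]; positivity
  filter_upwards [hcont.continuousAt.eventually_lt_const h1] with p' hp'
  refine Real.smoothTransition.zero_of_nonpos ?_
  have : ε⁻¹ * treeDist ι G φ p' ≤ ε⁻¹ * (ε / 2) := by gcongr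
  have h3 : ε⁻¹ * (ε / 2) = 1 / 2 := by field_simp
  linarith

/-- The cutoff function differs from `1`, and its derivative from `0`, near collisions only. -/
theorem exists_cutoff_bound (hι : ContMDiff 𝔹 ℍ ∞ ι) (hG : IsInjImmersion G)
    (hY : IsSmoothVectorField ℍ Y) (hYY : RestrictsTo ι Y Y') (φ : Fin s → Factor B m n) :
    ∃ L, 0 ≤ L ∧ ∀ ε > 0, ContMDiff (ℭ m n) 𝓘(ℝ, ℝ) ∞
        (cutoff ι G φ ε : Conf M N m n → ℝ) ∧ ∀ p : Conf M N m n, p ∈ treeSet ι G φ →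
      |cutoff ι G φ ε p - 1| ≤ L * (ε * (treeDist ι G φ p)⁻¹) ^ (1 / 4 : ℝ) ∧
      |mfd (ℭ m n) 𝓘(ℝ, ℝ) (cutoff ι G φ ε) p (fieldVal (confField Y Y' m n) p)| ≤
        L * (ε * (treeDist ι G φ p)⁻¹) ^ (1 / 4 : ℝ) := by
  obtain ⟨hsm, L, hL, hb⟩ := isLogLipschitz_treeDist hι hG hY hYY φ
  set h : ℝ → ℝ := fun r => Real.smoothTransition (2 * r - 1) with hh
  have hhs : ContDiff ℝ ∞ h := Real.smoothTransition.contDiff.comp (by fun_prop)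
  have hdc : Continuous (deriv h) := hhs.continuous_deriv (by simp)
  obtain ⟨A, hA⟩ := (isCompact_Icc (a := (0 : ℝ)) (b := 1)).exists_bound_of_continuousOn
    hdc.continuousOn
  have hA0 : 0 ≤ A := (norm_nonneg _).trans (hA 0 ⟨le_rfl, zero_le_one⟩)
  refine ⟨1 + A * L, by positivity, fun ε hε => ?_⟩
  have hscale : ContMDiff (ℭ m n) 𝓘(ℝ, ℝ) ∞
      (fun p : Conf M N m n => ε⁻¹ * treeDist ι G φ p) := contMDiff_const.mul hsm
  refine ⟨hhs.contMDiff.comp hscale, fun p hp => ?_⟩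
  have hpos : 0 < treeDist ι G φ p := lt_of_le_of_ne (hb p).1 (Ne.symm hp)
  set r := ε⁻¹ * treeDist ι G φ p with hr
  have hr0 : 0 < r := by positivity
  have hq : ε * (treeDist ι G φ p)⁻¹ = r⁻¹ := by rw [hr, mul_inv, inv_inv]
  have hder : mfd (ℭ m n) 𝓘(ℝ, ℝ) (cutoff ι G φ ε) p (fieldVal (confField Y Y' m n) p) =
      deriv h r * (ε⁻¹ * mfd (ℭ m n) 𝓘(ℝ, ℝ) (treeDist ι G φ) p
        (fieldVal (confField Y Y' m n) p)) := by
    have h1 : HasMFDerivAt (ℭ m n) 𝓘(ℝ, ℝ) (cutoff ι G φ ε) p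
        ((fderiv ℝ (fun d => h (ε⁻¹ * d)) (treeDist ι G φ p)).comp
          (mfd (ℭ m n) 𝓘(ℝ, ℝ) (treeDist ι G φ) p)) :=
      HasMFDerivAt.comp (g := fun d => h (ε⁻¹ * d)) p
        ((hhs.comp (contDiff_const.mul contDiff_id)).differentiable (by simp) _).hasFDerivAt.hasMFDerivAt
        ((hsm p).mdifferentiableAt (by simp)).hasMFDerivAt
    have h2 : HasDerivAt (fun d => h (ε⁻¹ * d)) (deriv h r * ε⁻¹) (treeDist ι G φ p) := by
      exact (HasDerivAt.comp (h₂ := h) _ (hhs.differentiable (by simp) r).hasDerivAt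
        ((hasDerivAt_id' _).const_mul ε⁻¹)).congr_deriv (by rw [mul_one])
    have h3 : mfd (ℭ m n) 𝓘(ℝ, ℝ) (cutoff ι G φ ε) p = _ := h1.mfderiv
    rw [h3, h2.hasFDerivAt.fderiv]
    change mfd (ℭ m n) 𝓘(ℝ, ℝ) (treeDist ι G φ) p _ * (deriv h r * ε⁻¹) = _
    ring
  rw [hder, hq]
  rcases le_or_gt r 1 with hr1 | hr1
  · have h1 : (1 : ℝ) ≤ r⁻¹ ^ (1 / 4 : ℝ) :=
      Real.one_le_rpow ((one_le_inv₀ hr0).2 hr1) (by norm_num)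
    have hle : (1 + A * L) * 1 ≤ (1 + A * L) * r⁻¹ ^ (1 / 4 : ℝ) :=
      mul_le_mul_of_nonneg_left h1 (by positivity)
    constructor
    · refine le_trans ?_ hle
      have h2 : 0 ≤ cutoff ι G φ ε p := Real.smoothTransition.nonneg _
      have h3 : cutoff ι G φ ε p ≤ 1 := Real.smoothTransition.le_one _
      rw [abs_le]
      constructor <;> nlinarith [mul_nonneg hA0 hL]
    · refine le_trans ?_ hle
      rw [abs_mul, abs_mul, abs_of_pos (inv_pos.2 hε)]
      have h2 : ε⁻¹ * |mfd (ℭ m n) 𝓘(ℝ, ℝ) (treeDist ι G φ) p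
          (fieldVal (confField Y Y' m n) p)| ≤ L := by
        refine (mul_le_mul_of_nonneg_left (hb p).2 (by positivity)).trans ?_
        calc ε⁻¹ * (L * treeDist ι G φ p) = L * r := by rw [hr]; ring
          _ ≤ L := mul_le_of_le_one_right hL hr1
      have h3 := mul_le_mul (hA r ⟨hr0.le, hr1⟩) h2 (by positivity) hA0
      rw [Real.norm_eq_abs] at h3
      linarith
  · have h1 : cutoff ι G φ ε p = 1 := Real.smoothTransition.one_of_one_le (by linarith)
    have h2 : deriv h r = 0 := by
      have : h =ᶠ[𝓝 r] fun _ => 1 := by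
        filter_upwards [lt_mem_nhds hr1] with r' hr'
        exact Real.smoothTransition.one_of_one_le (by linarith)
      rw [this.deriv_eq, deriv_const]
    rw [h1, h2]
    simp only [sub_self, abs_zero, zero_mul]
    exact ⟨by positivity, by positivity⟩

end Cutoff

/-! ### Limits of differentiable functions -/

/-- A pointwise limit of functions whose derivatives along a frame of vector fields converge
uniformly. -/
theorem contDiffAt_of_frame [FiniteDimensional ℝ E] {κ : Type*} [Fintype κ] {lam : κ → E →L[ℝ] ℝ}
    {Z : κ → E → E} {z₀ : E} {V : Set E} (hV : V ∈ 𝓝 z₀) (hZ : ∀ a, ContinuousAt (Z a) z₀)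
    (hZ' : ∀ v, ∑ a, lam a v • Z a z₀ = 0 → v = 0) {f : E → ℝ} {fn : ℕ → E → ℝ}
    (hfn : ∀ n, ∀ z ∈ V, ContDiffAt ℝ 1 (fn n) z) {g : κ → E → ℝ} {b : ℕ → ℝ}
    (hb : Tendsto b atTop (𝓝 0)) (hg : ∀ n a, ∀ z ∈ V, |fderiv ℝ (fn n) z (Z a z) - g a z| ≤ b n)
    (hf : ∀ z ∈ V, Tendsto (fun n => fn n z) atTop (𝓝 (f z))) :
    ContDiffAt ℝ 1 f z₀ ∧ Tendsto (fun n => fderiv ℝ (fn n) z₀) atTop (𝓝 (fderiv ℝ f z₀)) := by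
  set L : E → E →L[ℝ] E := fun z => ∑ a, (lam a).smulRight (Z a z) with hL
  have hLv (z v) : L z v = ∑ a, lam a v • Z a z := by simp [hL, _root_.sum_apply]
  have hLc : ContinuousAt L z₀ := by
    have h : ∀ a, ContinuousAt (fun z => (lam a).smulRight (Z a z)) z₀ := fun a =>
      ((ContinuousLinearMap.smulRightL ℝ E E (lam a)).continuous.continuousAt).comp (hZ a)
    exact tendsto_finsetSum _ fun a _ => h a
  have hinj : Injective (L z₀).toLinearMap := by
    refine (injective_iff_map_eq_zero (L z₀).toLinearMap).2 fun v hv => hZ' v ?_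
    rw [← hLv]
    exact hv
  set e : E ≃L[ℝ] E := (LinearEquiv.ofInjectiveEndo _ hinj).toContinuousLinearEquiv
  have he : (e : E →L[ℝ] E) = L z₀ := by ext v; rfl
  have hequiv : ∀ᶠ z in 𝓝 z₀, L z ∈ range ((↑) : (E ≃L[ℝ] E) → E →L[ℝ] E) := hLc (he ▸ e.nhds)
  have hinvc : ContinuousAt (fun z => ‖(L z).inverse‖) z₀ := by
    have h : ContinuousAt ContinuousLinearMap.inverse (L z₀) := by
      rw [← he]
      exact (contDiffAt_map_inverse (𝕜 := ℝ) (n := 0) e).continuousAt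
    exact (ContinuousAt.comp h hLc).norm
  have hev : ∀ᶠ z in 𝓝 z₀, z ∈ V ∧ L z ∈ range ((↑) : (E ≃L[ℝ] E) → E →L[ℝ] E) ∧
      ‖(L z).inverse‖ ≤ ‖(L z₀).inverse‖ + 1 := by
    filter_upwards [hV, hequiv, hinvc.eventually (eventually_le_nhds (lt_add_one _))] with z h1 h2 h3
      using ⟨h1, h2, h3⟩
  obtain ⟨W, hWsub, hWo, hzW⟩ := eventually_nhds_iff.1 hev
  set R : E → E →L[ℝ] ℝ := fun z => (∑ a, g a z • lam a).comp (L z).inverse with hR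
  set K : ℝ := (∑ a, ‖lam a‖) * (‖(L z₀).inverse‖ + 1) with hK
  have hdiff (n) (z) (hz : z ∈ W) : ‖fderiv ℝ (fn n) z - R z‖ ≤ b n * K := by
    obtain ⟨hzV, ⟨e', he'⟩, hzi⟩ := hWsub z hz
    have hbn : 0 ≤ b n ∨ IsEmpty κ := by
      rcases isEmpty_or_nonempty κ with h | ⟨⟨a⟩⟩
      · exact Or.inr h
      · exact Or.inl ((abs_nonneg _).trans (hg n a z hzV))
    have h1 : fderiv ℝ (fn n) z - R z =
        (∑ a, (fderiv ℝ (fn n) z (Z a z) - g a z) • lam a).comp (L z).inverse := by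
      ext v
      have h2 : L z ((L z).inverse v) = v := by
        rw [← he', ContinuousLinearMap.inverse_equiv]
        exact e'.apply_symm_apply v
      have h3 : fderiv ℝ (fn n) z v = ∑ a, lam a ((L z).inverse v) * fderiv ℝ (fn n) z (Z a z) := by
        conv_lhs => rw [← h2, hLv, map_sum]
        simp
      simp only [hR, ContinuousLinearMap.comp_apply, _root_.sub_apply, _root_.sum_apply,
        _root_.smul_apply, smul_eq_mul, h3, sub_mul, Finset.sum_sub_distrib]
      simp only [mul_comm]
    rw [h1, hK, ← mul_assoc, Finset.mul_sum]
    refine (ContinuousLinearMap.opNorm_comp_le _ _).trans (mul_le_mul ?_ hzi (norm_nonneg _) ?_)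
    · refine (norm_sum_le _ _).trans (Finset.sum_le_sum fun a _ => ?_)
      rw [norm_smul]
      exact mul_le_mul_of_nonneg_right (hg n a z hzV) (norm_nonneg _)
    · rcases hbn with h | h
      · exact Finset.sum_nonneg fun a _ => mul_nonneg h (norm_nonneg _)
      · simp
  have hunif : TendstoUniformlyOn (fun n z => fderiv ℝ (fn n) z) R atTop W := by
    rw [Metric.tendstoUniformlyOn_iff]
    intro ε hε
    have hbK : Tendsto (fun n => b n * K) atTop (𝓝 0) := by simpa using hb.mul_const K
    filter_upwards [hbK.eventually (gt_mem_nhds hε)] with n hn z hz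
    rw [dist_comm, dist_eq_norm]
    exact (hdiff n z hz).trans_lt hn
  have hder (z) (hz : z ∈ W) : HasFDerivAt f (R z) z := hasFDerivAt_of_tendstoUniformlyOn hWo hunif
      (fun n z hz => ((hfn n z (hWsub z hz).1).differentiableAt (by simp)).hasFDerivAt)
      (fun z hz => hf z (hWsub z hz).1) hz
  have hRc : ContinuousOn R W := hunif.continuousOn (Frequently.of_forall fun n z hz =>
    (((hfn n z (hWsub z hz).1).fderiv_right (m := 0) (by simp)).continuousAt).continuousWithinAt)
  refine ⟨contDiffAt_one_iff.2 ⟨R, W, hWo.mem_nhds hzW, hRc, hder⟩, ?_⟩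
  rw [(hder z₀ hzW).fderiv]
  exact hunif.tendsto_at hzW

theorem isOpen_confSpace [T2Space N] : IsOpen (confSpace N n) := by
  have h : confSpace N n = ⋂ (j) (j') (_ : j ≠ j'), {y | y j ≠ y j'} := by
    ext y
    simp only [confSpace, Injective, mem_ofPred_eq, mem_iInter]
    exact forall₂_congr fun _ _ => not_imp_not.symm
  rw [h]
  exact isOpen_iInter_of_finite fun j => isOpen_iInter_of_finite fun j' =>
    isOpen_iInter_of_finite fun _ => isOpen_ne_fun (continuous_apply j) (continuous_apply j')

/-! ### Vector fields tangent to the boundary -/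

section TangentFields

theorem IsBoundaryInclusion.exists_mfd_eq (hι : IsBoundaryInclusion ι) {c : M} {y : N}
    (hy : ι y ∈ (Φ ℍ c).source) {v : E3} (hv : mfd ℍ 𝓘(ℝ, E3) (Φ ℍ c) (ι y) v 0 = 0) :
    ∃ u, mfd 𝔹 ℍ ι y u = v := by
  set D := mfd ℍ 𝓘(ℝ, E3) (Φ ℍ c) (ι y)
  set A : E2 →ₗ[ℝ] E3 := (D.comp (mfd 𝔹 ℍ ι y)).toLinearMap with hA
  have hD : Injective D := mfd_extChartAt_injective hy
  have hAinj : Injective A := hD.comp (hι.immersive y)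
  set p : E3 →ₗ[ℝ] ℝ := (EuclideanSpace.proj (𝕜 := ℝ) (0 : Fin 3)).toLinearMap
  have hle : LinearMap.range A ≤ LinearMap.ker p := by
    rintro _ ⟨u, rfl⟩
    have hX : RestrictsTo ι (extend ι (fun y => mfd 𝔹 ℍ ι y u) (0 : M → E3))
        (fun _ => u) := fun y =>
      (hι.isEmbedding.injective.extend_apply (fun y => mfd 𝔹 ℍ ι y u) (0 : M → E3) y).symm
    have hb : (Φ ℍ c (ι y)) 0 = 0 := (mem_boundary_iff hy).1 (hι.range_eq ▸ mem_range_self y)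
    have h := hX.vectorInChart_zero hι ((Φ ℍ c).map_source hy) hb
    change mfd ℍ 𝓘(ℝ, E3) (Φ ℍ c) ((Φ ℍ c).symm
      (Φ ℍ c (ι y))) (extend ι (fun y => mfd 𝔹 ℍ ι y u) (0 : M → E3)
      ((Φ ℍ c).symm (Φ ℍ c (ι y)))) 0 = 0 at h
    rw [(Φ ℍ c).left_inv hy, hι.isEmbedding.injective.extend_apply] at h
    exact h
  have heq : LinearMap.range A = LinearMap.ker p := by
    refine Submodule.eq_of_le_of_finrank_eq hle ?_
    have h1 := LinearMap.finrank_range_of_inj hAinj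
    have h2 := p.finrank_range_add_finrank_ker
    have h3 : LinearMap.range p = ⊤ := LinearMap.range_eq_top.2 fun r =>
      ⟨EuclideanSpace.single 0 r, by simp [p]⟩
    rw [h3, finrank_top] at h2
    simp only [Module.finrank_self, finrank_euclideanSpace, Fintype.card_fin] at h1 h2
    omega
  obtain ⟨u, hu⟩ : D v ∈ LinearMap.range A := heq ▸ hv
  exact ⟨u, hD hu⟩

/-- A tangent field with prescribed tangential value at a point and support near that point. -/
theorem IsBoundaryInclusion.exists_tangent_field (hι : IsBoundaryInclusion ι) (x₀ : M) {b : Fin 3}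
    (hb : b ≠ 0) {U : Set M} (hU : U ∈ 𝓝 x₀) : ∃ (Y : VField ℍ M) (Y' : VField 𝔹 N),
      IsSmoothVectorField ℍ Y ∧ RestrictsTo ι Y Y' ∧
      fieldVal Y x₀ = EuclideanSpace.single b (1 : ℝ) ∧ ∀ x ∉ U, fieldVal Y x = 0 := by
  obtain ⟨f, -, hf⟩ := (SmoothBumpFunction.nhds_basis_tsupport (I := ℍ) x₀).mem_iff.1 hU
  set S : VField ℍ M := fun x =>
    (chartD ℍ x₀ (Φ ℍ x₀ x) (EuclideanSpace.single b (1 : ℝ)) : E3) with hS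
  have hSsm : ContMDiffOn ℍ (ℍ).tangent ∞
      (fun x => (⟨x, S x⟩ : TangentBundle ℍ M)) (chartAt (EuclideanHalfSpace 3) x₀).source := by
    refine ((trivializationAt E3 (TangentSpace ℍ) x₀).contMDiffOn_localFrame_baseSet
      (I := ℍ) (n := ∞) (EuclideanSpace.basisFun (Fin 3) ℝ).toBasis b).congr fun x hx => ?_
    have hx' : x ∈ (trivializationAt E3 (TangentSpace ℍ) x₀).baseSet := hx
    congr 1
    rw [Bundle.Trivialization.localFrame_apply_of_mem_baseSet _ _ hx']
    have h1 := congrArg (fun L : E3 →L[ℝ] E3 => L (EuclideanSpace.single b (1 : ℝ)))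
      (TangentBundle.symmL_trivializationAt (I := ℍ) (𝕜 := ℝ) hx)
    refine h1.symm.trans ?_
    have hbs : (EuclideanSpace.basisFun (Fin 3) ℝ).toBasis b = EuclideanSpace.single b (1 : ℝ) :=
      congrFun (basisFun_eq_single (d := 3)) b
    rw [Bundle.Trivialization.basisAt, Module.Basis.map_apply, hbs]
    exact Bundle.Trivialization.symmₗ_apply (R := ℝ) (trivializationAt E3 (TangentSpace ℍ) x₀) hx' _
  set Y : VField ℍ M := (f : M → ℝ) • S with hY
  have hval (x : M) : fieldVal Y x =
      f x • chartD ℍ x₀ (Φ ℍ x₀ x) (EuclideanSpace.single b (1 : ℝ)) := rfl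
  have htan (y : N) : ∃ u, mfd 𝔹 ℍ ι y u = fieldVal Y (ι y) := by
    by_cases hy : ι y ∈ (Φ ℍ x₀).source
    · refine hι.exists_mfd_eq hy ?_
      have h := mfderiv_chartD ((Φ ℍ x₀).map_source hy) (EuclideanSpace.single b (1 : ℝ))
      rw [(Φ ℍ x₀).left_inv hy] at h
      rw [hval, map_smul, h]
      simp [Ne.symm hb]
    · refine ⟨0, ?_⟩
      rw [extChartAt_source] at hy
      rw [map_zero, hval, image_eq_zero_of_notMem_tsupport
        fun h => hy (f.tsupport_subset_chartAt_source h), zero_smul]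
  choose Y' hY' using htan
  refine ⟨Y, Y', ContMDiffOn.smul_section_of_tsupport f.contMDiff.contMDiffOn
    (chartAt (EuclideanHalfSpace 3) x₀).open_source f.tsupport_subset_chartAt_source hSsm,
    hY', ?_, fun x hx => ?_⟩
  · rw [hval, f.eq_one, chartD_self, one_smul]
    rfl
  · rw [hval, image_eq_zero_of_notMem_tsupport fun h => hx (hf h), zero_smul]

/-- Boundary fields that extend to tangent fields span the tangent spaces of the configuration
space. -/
theorem IsBoundaryInclusion.exists_frame (hι : IsBoundaryInclusion ι) {y : Fin n → N}
    (hy : y ∈ confSpace N n) : ∃ (Y : Fin n → Fin 2 → VField ℍ M) (Y' : Fin n → Fin 2 → VField 𝔹 N),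
      (∀ j b, IsSmoothVectorField ℍ (Y j b) ∧ RestrictsTo ι (Y j b) (Y' j b)) ∧
      ∀ a : Fin n → E2, ∑ j, ∑ b, a j b • (fieldVal (bdryField (Y' j b) n) y : Fin n → E2) = 0 →
        a = 0 := by
  have hinj : Injective fun j => ι (y j) := hι.isEmbedding.injective.comp hy
  have hU (j : Fin n) : (⋂ j' : {j' // j' ≠ j}, {ι (y j')}ᶜ : Set M) ∈ 𝓝 (ι (y j)) :=
    iInter_mem.2 fun j' => isOpen_compl_singleton.mem_nhds fun h =>
      j'.2 (hinj (mem_singleton_iff.1 h)).symm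
  choose Y Y' hYs hYY hY1 hY0 using fun (j : Fin n) (b : Fin 2) =>
    hι.exists_tangent_field (ι (y j)) (Fin.succ_ne_zero b) (hU j)
  refine ⟨Y, Y', fun j b => ⟨hYs j b, hYY j b⟩, fun a ha => ?_⟩
  funext j
  have h1 := congrFun ha j
  have h2 (j' : Fin n) (b : Fin 2) : mfd 𝔹 ℍ ι (y j) (fieldVal (Y' j' b) (y j)) =
      if j' = j then EuclideanSpace.single b.succ (1 : ℝ) else 0 := by
    refine (hYY j' b (y j)).trans ?_
    split_ifs with h
    · subst h
      exact hY1 j' b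
    · refine hY0 j' b _ fun hm => ?_
      exact mem_iInter.1 hm ⟨j, fun h' => h h'.symm⟩ rfl
  have h3 : ∑ j', ∑ b, a j' b • (fieldVal (Y' j' b) (y j) : E2) = 0 := by
    simp only [Finset.sum_apply, Pi.smul_apply] at h1
    exact h1
  have h4 := congrArg (mfd 𝔹 ℍ ι (y j)) h3
  simp only [map_sum, map_smul, map_zero] at h4
  simp only [h2, smul_ite, smul_zero, Finset.sum_ite_irrel, Finset.sum_const_zero,
    Finset.sum_ite_eq', Finset.mem_univ, if_true] at h4
  ext b
  have h5 := congrArg (fun v : E3 => v b.succ) h4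
  fin_cases b <;> simpa [Pi.single_apply] using h5

end TangentFields

/-! ### Wedge products of two factors -/

/-- The family with two members. -/
def pairFam {T : ℕ → Type*} {p q : ℕ} (α : T p) (β : T q) : ∀ i : Fin 2, T (![p, q] i)
  | 0 => α
  | 1 => β

theorem wedge_eq_wedgeFam {V : Type*} {p q : ℕ} (h : p + q = K) (α : (Fin p → V) → ℝ)
    (β : (Fin q → V) → ℝ) : wedge h α β = wedgeFam ((Fin.sum_univ_two ![p, q]).trans h)
      (pairFam (T := fun p => (Fin p → V) → ℝ) α β) := by
  funext v
  rw [wedge, wedgeFam, Fin.prod_univ_two]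
  refine congrArg _ (Finset.sum_congr rfl fun σ _ => ?_)
  rw [Fin.prod_univ_two]
  refine congrArg _ (congrArg₂ (· * ·) (congrArg α (funext fun a => congrArg (fun i => v (σ i)) ?_))
    (congrArg β (funext fun b => congrArg (fun i => v (σ i)) ?_)))
  · ext
    simp [finSigmaFinEquiv_apply]
  · ext
    simp [finSigmaFinEquiv_apply]

theorem wedge_cons {p q : ℕ} (h : p + 1 + q = K + 1) {α : (Fin (p + 1) → V) → ℝ} (hα : IsAlt α)
    {β : (Fin q → V) → ℝ} {x : V} (hβ : ∀ u b, u b = x → β u = 0) (w : Fin K → V) :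
    wedge h α β (Fin.cons x w) = wedge (by omega : p + q = K) (fun u => α (Fin.cons x u)) β w := by
  obtain ⟨A, hA⟩ := hα
  set i₁ : Fin (p + 1) → Fin (K + 1) := fun a => Fin.cast h (Fin.castAdd q a)
  set i₂ : Fin q → Fin (K + 1) := fun b => Fin.cast h (Fin.natAdd (p + 1) b)
  have hi₁ : Injective i₁ := (finCongr h).injective.comp (Fin.castAdd_injective _ _)
  have hi₁0 : i₁ 0 = 0 := Fin.ext (by simp [i₁])
  have hi₁₂ (a b) : i₁ a ≠ i₂ b := fun hab => by
    have := congrArg Fin.val hab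
    simp only [i₁, i₂, Fin.val_cast, Fin.val_castAdd, Fin.val_natAdd] at this
    omega
  set s : Equiv.Perm (Fin K) → Equiv.Perm (Fin (K + 1)) := fun e =>
    Equiv.Perm.decomposeFin.symm (0, e)
  have hs0 (e) : s e 0 = 0 := Equiv.Perm.decomposeFin_symm_apply_zero 0 e
  have hss (e) (j : Fin K) : s e j.succ = (e j).succ := by simp [s]
  have hsinv (e) : (s e)⁻¹ = s e⁻¹ := inv_eq_of_mul_eq_one_right (Equiv.ext fun j => by
    refine Fin.cases ?_ (fun j => ?_) j <;> simp [Equiv.Perm.mul_apply, hs0, hss])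
  have hdec (r e) : Equiv.Perm.decomposeFin.symm (r, e) = Equiv.swap 0 r * s e :=
    Equiv.ext fun j => by
      refine Fin.cases ?_ (fun j => ?_) j <;> simp [Equiv.Perm.mul_apply, hs0, hss]
  set v : Fin (K + 1) → V := Fin.cons x w
  set f : Equiv.Perm (Fin (K + 1)) → ℝ := fun σ => ((Equiv.Perm.sign σ : ℤ) : ℝ) *
    (α (fun a => v (σ (i₁ a))) * β (fun b => v (σ (i₂ b))))
  have h1 (e) (a₀ : Fin (p + 1)) : f (s e * Equiv.swap 0 (i₁ a₀)) = f (s e) := by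
    have hsw (a) : Equiv.swap 0 (i₁ a₀) (i₁ a) = i₁ (Equiv.swap 0 a₀ a) := by
      rw [← hi₁0]
      exact (hi₁.map_swap _ _ _).symm
    have hfix (b) : Equiv.swap 0 (i₁ a₀) (i₂ b) = i₂ b :=
      Equiv.swap_apply_of_ne_of_ne (hi₁0 ▸ (hi₁₂ 0 b).symm) (hi₁₂ a₀ b).symm
    have hsgn : Equiv.Perm.sign (Equiv.swap 0 (i₁ a₀)) = Equiv.Perm.sign (Equiv.swap 0 a₀) := by
      rw [Equiv.Perm.sign_swap', Equiv.Perm.sign_swap', ← hi₁0]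
      simp only [hi₁.eq_iff]
    have hperm := A.map_perm (fun a => v (s e (i₁ a))) (Equiv.swap 0 a₀)
    simp only [f, Equiv.Perm.mul_apply, hsw, hfix, Equiv.Perm.sign_mul, hsgn, hA]
    change _ * (A ((fun a => v (s e (i₁ a))) ∘ Equiv.swap 0 a₀) * _) = _
    rw [hperm, Units.smul_def]
    rcases Int.units_eq_one_or (Equiv.Perm.sign (Equiv.swap 0 a₀)) with h | h <;> simp [h]
  have h2 (e) (b₀ : Fin q) : f (s e * Equiv.swap 0 (i₂ b₀)) = 0 := by
    simp only [f]
    rw [hβ _ b₀, mul_zero, mul_zero]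
    rw [Equiv.Perm.mul_apply, Equiv.swap_apply_right, hs0]
    rfl
  have h3 : ∑ σ, f σ = (p + 1 : ℕ) * ∑ e, f (s e) := by
    rw [← Equiv.sum_comp (Equiv.inv _), ← Equiv.sum_comp Equiv.Perm.decomposeFin.symm,
      Fintype.sum_prod_type_right, Finset.mul_sum, ← Equiv.sum_comp (Equiv.inv _)]
    refine Finset.sum_congr rfl fun e _ => ?_
    rw [← Equiv.sum_comp (finCongr h), Fin.sum_univ_add]
    have h4 (r) : f (Equiv.inv _ (Equiv.Perm.decomposeFin.symm (r, Equiv.inv _ e))) =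
        f (s e * Equiv.swap 0 r) := by
      simp [hdec, hsinv]
    simp only [h4]
    refine (congrArg₂ (· + ·) (Finset.sum_congr rfl fun a _ => h1 e a)
      (Finset.sum_congr rfl fun b _ => h2 e b)).trans ?_
    simp
  have h5 (e) : f (s e) = ((Equiv.Perm.sign e : ℤ) : ℝ) *
      (α (Fin.cons x fun a => w (e (Fin.cast (by omega) (Fin.castAdd q a)))) *
        β fun b => w (e (Fin.cast (by omega) (Fin.natAdd p b)))) := by
    have h6 : Equiv.Perm.sign (s e) = Equiv.Perm.sign e := by simp [s]
    have h7 : (fun a => v (s e (i₁ a))) =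
        Fin.cons x fun a => w (e (Fin.cast (by omega) (Fin.castAdd q a))) := by
      funext a
      refine Fin.cases ?_ (fun a => ?_) a
      · rw [hi₁0, hs0]
        rfl
      · rw [show i₁ a.succ = (Fin.cast (by omega) (Fin.castAdd q a)).succ from Fin.ext (by simp [i₁]),
          hss]
        rfl
    have h8 (b) : v (s e (i₂ b)) = w (e (Fin.cast (by omega) (Fin.natAdd p b))) := by
      rw [show i₂ b = (Fin.cast (by omega) (Fin.natAdd p b)).succ from
        Fin.ext (by simp [i₂]; omega), hss]
      rfl
    simp only [f, h6, h7, h8]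
  change _ * ∑ σ, f σ = _
  rw [h3, Finset.sum_congr rfl fun e _ => h5 e, wedge, ← mul_assoc, Nat.factorial_succ]
  congr 1
  have := p.factorial_ne_zero
  have := q.factorial_ne_zero
  push_cast
  field_simp

/-- If `β` kills the vectors `e`, then contraction with `e` passes through the wedge product with
`β`. -/
theorem wedge_append {a q K' : ℕ} (h' : k + q = K') {β : (Fin q → V) → ℝ} (w : Fin K' → V)
    (e : Fin a → V) (hβ : ∀ i u b, u b = e i → β u = 0) :
    ∀ {P K : ℕ} (hP : P = a + k) (hK : K = a + K') (h : P + q = K) {α : (Fin P → V) → ℝ}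
      (_ : IsAlt α), wedge h α β (fun i => Fin.append e w (i.cast hK)) =
        wedge h' (fun u => α fun i => Fin.append e u (i.cast hP)) β w := by
  have happ {a k P : ℕ} (e : Fin (a + 1) → V) (u : Fin k → V) (hP : P + 1 = a + 1 + k) :
      (fun i : Fin (P + 1) => Fin.append e u (i.cast hP)) =
        Fin.cons (e 0) fun i => Fin.append (Fin.tail e) u (i.cast (by omega)) := by
    funext i
    refine Fin.cases ?_ (fun i => ?_) i
    · simp [Fin.append, Fin.addCases]
      rfl
    · by_cases hi : (i : ℕ) < a <;> simp [Fin.append, Fin.addCases, Fin.tail, hi]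
      · rfl
      · exact congrArg u (Fin.ext (by simp))
  induction a with
  | zero =>
    intro P K hP hK h α _
    obtain rfl : P = k := by omega
    obtain rfl : K = K' := by omega
    have h0 {k : ℕ} (u : Fin k → V) (hP : k = 0 + k) :
        (fun i : Fin k => Fin.append e u (i.cast hP)) = u := by
      funext i
      simp [Fin.append, Fin.addCases]
    simp only [h0]
  | succ a ih =>
    intro P K hP hK h α hα
    obtain ⟨P, rfl⟩ : ∃ P', P = P' + 1 := ⟨a + k, by omega⟩
    obtain ⟨K, rfl⟩ : ∃ K₁, K = K₁ + 1 := ⟨a + K', by omega⟩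
    simp only [happ]
    rw [wedge_cons h hα (hβ 0)]
    obtain ⟨A, hA⟩ := hα
    exact ih (Fin.tail e) (fun i => hβ i.succ) (by omega) (by omega) (by omega)
      ⟨A.curryLeft (e 0), fun u => hA _⟩

theorem hasDerivAt_wedgeFam {V : Type*} {d : Fin s → ℕ} (h : ∑ i, d i = K)
    {α : ℝ → ∀ i, (Fin (d i) → V) → ℝ} {α' : ∀ i, (Fin (d i) → V) → ℝ} {t : ℝ}
    (hα : ∀ i u, HasDerivAt (fun t => α t i u) (α' i u) t) (v : Fin K → V) :
    HasDerivAt (fun t => wedgeFam h (α t) v) (∑ f, wedgeFam h (update (α t) f (α' f)) v) t := by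
  simp only [wedgeFam_update]
  simp only [wedgeFam_eq]
  rw [← Finset.mul_sum, Finset.sum_comm]
  simp only [← Finset.mul_sum]
  refine HasDerivAt.const_mul _ (HasDerivAt.fun_sum fun σ _ => HasDerivAt.const_mul _ ?_)
  refine (HasDerivAt.fun_finsetProd fun f _ => hα f _).congr_deriv ?_
  exact Finset.sum_congr rfl fun f _ => by rw [smul_eq_mul, mul_comm]

/-! ### Integrability of tree kernels -/

namespace Factor

/-- The first vertex of a factor. -/
def src : Factor B m n → Fin m ⊕ Fin n
  | leaf w _ => w
  | arrow i _ => Sum.inl i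

/-- The last vertex of a factor. -/
def tgt : Factor B m n → Fin m ⊕ Fin n
  | leaf w _ => w
  | arrow _ w => w

end Factor

def FeynmanTree.arrows (Γ : FeynmanTree B) : Finset (Fin Γ.s) :=
  Finset.univ.filter fun f => (Γ.factor f).arrowCount = 1

theorem FeynmanTree.card_arrows (Γ : FeynmanTree B) :
    Γ.arrows.card + 1 = Fintype.card (Fin Γ.m ⊕ Fin Γ.n) := by
  rw [Fintype.card_sum, Fintype.card_fin, Fintype.card_fin, ← Γ.tree, arrows, Finset.card_filter]
  congr 1
  refine Finset.sum_congr rfl fun f _ => ?_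
  cases Γ.factor f <;> simp [Factor.arrowCount]

theorem FeynmanTree.connected_edgeGraph (Γ : FeynmanTree B) :
    (edgeGraph (fun f => (Γ.factor f).src) (fun f => (Γ.factor f).tgt) Γ.arrows).Connected := by
  have h : (fun u u' => ∃ f, (Γ.factor f).Joins u u') = fun u u' => ∃ f ∈ Γ.arrows,
      (Γ.factor f).src = u ∧ (Γ.factor f).tgt = u' := by
    funext u u'
    refine propext (exists_congr fun f => ?_)
    rw [arrows, Finset.mem_filter]
    cases Γ.factor f <;> simp [Factor.arrowCount, Factor.Joins, Factor.src, Factor.tgt]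
  have h1 := Γ.connected
  rw [h] at h1
  exact h1

section Integrability

variable [MeasurableSpace M] [BorelSpace M] [CompactSpace N] [MeasurableSpace N] [BorelSpace N]
  {F : Type*} [NormedAddCommGroup F] [InnerProductSpace ℝ F] [MeasurableSpace F] [BorelSpace F]
  [SecondCountableTopology F] {G : M → F} {volN : PreForm 𝔹 N 2} {Γ : FeynmanTree B}

theorem IsBoundaryInclusion.t2Space (hι : IsBoundaryInclusion ι) : T2Space N := hι.isEmbedding.t2Space

theorem IsBoundaryInclusion.secondCountable (hι : IsBoundaryInclusion ι) :
    SecondCountableTopology N :=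
  have := secondCountable_of_compact M
  hι.isEmbedding.secondCountableTopology

theorem IsInjImmersion.immersive_comp (hι : IsBoundaryInclusion ι) (hG : IsInjImmersion G) (y : N) :
    Injective (mfd 𝔹 𝓘(ℝ, F) (fun y => G (ι y)) y) := by
  have h := mfd_comp ((hG.smooth (ι y)).mdifferentiableAt (by simp))
    ((hι.contMDiff y).mdifferentiableAt (by simp))
  have h' : Injective ((mfd ℍ 𝓘(ℝ, F) G (ι y)).comp (mfd 𝔹 ℍ ι y)) :=
    (hG.immersive (ι y)).comp (hι.immersive y)
  rw [← h] at h'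
  exact h'

theorem continuous_treeDist (hι : Continuous ι) (hG : Continuous G) (φ : Fin s → Factor B m n) :
    Continuous (treeDist ι G φ : Conf M N m n → ℝ) := by
  refine continuous_finsetProd _ fun f _ => ?_
  cases φ f with
  | leaf => exact continuous_const
  | arrow i w =>
    rcases w with i' | j
    · change Continuous fun p : Conf M N m n => ‖G (p.1 i) - G (p.1 i')‖ ^ 2
      fun_prop
    · change Continuous fun p : Conf M N m n => ‖G (p.1 i) - G (ι (p.2 j))‖ ^ 2
      fun_prop

theorem treeDist_rpow (Γ : FeynmanTree B) (κ : ℝ) (p : Conf M N Γ.m Γ.n) :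
    ENNReal.ofReal (treeDist ι G Γ.factor p) ^ (-(κ / 2)) = ∏ f ∈ Γ.arrows,
      invDist κ (G (pos ι p (Γ.factor f).src)) (G (pos ι p (Γ.factor f).tgt)) := by
  rw [treeDist, ENNReal.ofReal_prod_of_nonneg fun f _ => sqDist_nonneg _ p,
    ← ENNReal.prod_rpow_of_ne_top fun _ _ => ENNReal.ofReal_ne_top, FeynmanTree.arrows,
    Finset.prod_filter]
  refine Finset.prod_congr rfl fun f _ => ?_
  cases Γ.factor f with
  | leaf => simp [sqDist, Factor.arrowCount]
  | arrow i w =>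
    rw [if_pos (show (Factor.arrow i w : Factor B Γ.m Γ.n).arrowCount = 1 from rfl)]
    change ENNReal.ofReal (‖G (p.1 i) - G (pos ι p w)‖ ^ 2) ^ _ =
      ENNReal.ofReal ‖G (p.1 i) - G (pos ι p w)‖ ^ (-κ)
    rw [ENNReal.ofReal_pow (norm_nonneg _), ← ENNReal.rpow_natCast, ← ENNReal.rpow_mul]
    congr 1
    push_cast
    ring

theorem exists_lintegral_treeDist_le (hvolM : IsVolumeForm volM) (hι : IsBoundaryInclusion ι)
    (hG : IsInjImmersion G) (Γ : FeynmanTree B) {y₀ : Fin Γ.n → N} (hy₀ : y₀ ∈ confSpace N Γ.n) :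
    ∃ A : ENNReal, A ≠ ⊤ ∧ ∀ᶠ y in 𝓝 y₀, ∫⁻ x : Fin Γ.m → M,
      ENNReal.ofReal (treeDist ι G Γ.factor (x, y)) ^ (-((5 / 2) / 2) : ℝ) ∂bulkMeasure volM Γ.m ≤ A := by
  have := isFinite_volumeMeasure hvolM
  obtain ⟨A₀, hA₀, hker⟩ := exists_lintegral_invDist_le hvolM hG.smooth hG.immersive
    (κ := 5 / 2) (by norm_num) (by norm_num)
  have hpos (j j' : Fin Γ.n) (h : j ≠ j') : 0 < ‖G (ι (y₀ j)) - G (ι (y₀ j'))‖ :=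
    norm_pos_iff.2 (sub_ne_zero.2 fun h' => h (hy₀ (hι.isEmbedding.injective (hG.injective h'))))
  have hc : ∀ᶠ c : ℝ in 𝓝[>] 0, ∀ j j' : Fin Γ.n, j ≠ j' → c < ‖G (ι (y₀ j)) - G (ι (y₀ j'))‖ := by
    refine nhdsWithin_le_nhds (eventually_all.2 fun j => eventually_all.2 fun j' => ?_)
    by_cases h : j = j'
    · exact Eventually.of_forall fun c h' => absurd h h'
    · filter_upwards [gt_mem_nhds (hpos j j' h)] with c hc _ using hc
  obtain ⟨c₀, hc₀, hc₀'⟩ := (hc.and self_mem_nhdsWithin).exists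
  obtain ⟨C, hC, hCq⟩ := exists_lintegral_prod_invDist_le hG.smooth.continuous.measurable
    (μ := volumeMeasure volM) Γ.connected_edgeGraph Γ.card_arrows (by norm_num) hA₀ hker hc₀'
  refine ⟨C, hC, ?_⟩
  have hev : ∀ᶠ y in 𝓝 y₀, ∀ j j', j ≠ j' → c₀ ≤ ‖G (ι (y j)) - G (ι (y j'))‖ := by
    refine eventually_all.2 fun j => eventually_all.2 fun j' => ?_
    by_cases h : j = j'
    · exact Eventually.of_forall fun c h' => absurd h h'
    · have h1 : ContinuousAt (fun y : Fin Γ.n → N => ‖G (ι (y j)) - G (ι (y j'))‖) y₀ := by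
        have := hG.smooth.continuous
        have := hι.contMDiff.continuous
        fun_prop
      filter_upwards [h1.eventually (lt_mem_nhds (hc₀ j j' h))] with y hy _ using hy.le
  filter_upwards [hev] with y hy
  refine le_trans (le_of_eq (lintegral_congr fun x => ?_)) (hCq (fun j => G (ι (y j))) hy)
  have hpe (w) : G (pos ι ((x, y) : Conf M N Γ.m Γ.n) w) =
      Sum.elim (fun i => G (x i)) (fun j => G (ι (y j))) w := by cases w <;> rfl
  rw [treeDist_rpow]
  simp only [hpe]

theorem lintegral_treeDist_lt_top (hvolM : IsVolumeForm volM) (hvolN : IsVolumeForm volN)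
    (hι : IsBoundaryInclusion ι) (hG : IsInjImmersion G) (Γ : FeynmanTree B) :
    ∫⁻ p, ENNReal.ofReal (treeDist ι G Γ.factor p) ^ (-1 : ℝ)
      ∂confMeasure volM volN Γ.m Γ.n < ⊤ := by
  have := hι.t2Space
  have := secondCountable_of_compact M
  have := isFinite_volumeMeasure hvolM
  have := isFinite_volumeMeasure hvolN
  have := isFinite_bulkMeasure hvolM Γ.m
  have : IsFiniteMeasure (bdryMeasure volN Γ.n) :=
    inferInstanceAs (IsFiniteMeasure (Measure.pi fun _ => volumeMeasure volN))
  have hGm := hG.smooth.continuous.measurable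
  have hιm := hι.contMDiff.continuous.measurable
  set μ : Fin Γ.m ⊕ Fin Γ.n → Measure M :=
    Sum.elim (fun _ => volumeMeasure volM) fun _ => Measure.map ι (volumeMeasure volN) with hμ
  have hfin (v) : IsFiniteMeasure (μ v) := by
    rcases v with i | j
    · exact inferInstanceAs (IsFiniteMeasure (volumeMeasure volM))
    · exact inferInstanceAs (IsFiniteMeasure (Measure.map ι (volumeMeasure volN)))
  have hbulk (i : Fin Γ.m) (κ : ℝ) (h0 : 0 ≤ κ) (h3 : κ < 3) :
      ∃ A₀ : ENNReal, A₀ ≠ ⊤ ∧ ∀ p : F, ∫⁻ x, invDist κ (G x) p ∂μ (.inl i) ≤ A₀ :=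
    exists_lintegral_invDist_le hvolM hG.smooth hG.immersive h0 (by exact_mod_cast h3)
  have key := lintegral_prod_invDist_lt_top hGm (μ := μ) Γ.connected_edgeGraph Γ.card_arrows
    (bulk := fun v => v.isLeft) (fun e he => by
      have he' := (Finset.mem_filter.1 he).2
      revert he'
      cases Γ.factor e <;> simp [Factor.src, Factor.arrowCount])
    (fun v hv κ h0 h3 => by
      rcases v with i | j
      · exact hbulk i κ h0 h3
      · simp at hv)
    (fun v κ h0 h2 => by
      rcases v with i | j
      · exact hbulk i κ h0 (h2.trans (by norm_num))
      · obtain ⟨A₀, hA₀, h⟩ := exists_lintegral_invDist_le hvolN (hG.smooth.comp hι.contMDiff)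
          (IsInjImmersion.immersive_comp (ι := ι) (G := G) hι hG) h0 (by exact_mod_cast h2)
        refine ⟨A₀, hA₀, fun p => le_trans (le_of_eq ?_) (h p)⟩
        exact lintegral_map (measurable_invDist hGm measurable_const) hιm)
  refine lt_of_eq_of_lt ?_ key
  have h1 : MeasurePreserving (fun y : Fin Γ.n → N => fun j => ι (y j)) (bdryMeasure volN Γ.n)
      (Measure.pi fun _ => Measure.map ι (volumeMeasure volN)) :=
    measurePreserving_pi _ _ fun _ => ⟨hιm, rfl⟩
  have h2 := (MeasurePreserving.id (bulkMeasure volM Γ.m)).prod h1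
  have h3 := (measurePreserving_sumPiEquivProdPi_symm μ).comp h2
  have hmeas : Measurable fun x : Fin Γ.m ⊕ Fin Γ.n → M => ∏ f ∈ Γ.arrows,
      invDist 2 (G (x (Γ.factor f).src)) (G (x (Γ.factor f).tgt)) :=
    Finset.measurable_fun_prod _ fun f _ => measurable_invDist
      (hGm.comp (measurable_pi_apply _)) (hGm.comp (measurable_pi_apply _))
  rw [← h3.lintegral_comp hmeas]
  refine lintegral_congr fun p => ?_
  have h4 := treeDist_rpow (ι := ι) (G := G) Γ 2 p
  rw [show (-((2 : ℝ) / 2)) = -1 by norm_num] at h4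
  rw [h4]
  have hpe (w) : pos ι p w = (MeasurableEquiv.sumPiEquivProdPi fun _ : Fin Γ.m ⊕ Fin Γ.n => M).symm
      (p.1, fun j => ι (p.2 j)) w := by cases w <;> rfl
  simp only [hpe]
  rfl

theorem ae_mem_treeSet_of_lintegral (hι : IsBoundaryInclusion ι) (hG : IsInjImmersion G)
    (Γ : FeynmanTree B) {κ : ℝ} (hκ : κ < 0) {Ω : Type*} [MeasurableSpace Ω] {μ : Measure Ω}
    {g : Ω → Conf M N Γ.m Γ.n} (hg : Measurable g)
    (h : ∫⁻ z, ENNReal.ofReal (treeDist ι G Γ.factor (g z)) ^ κ ∂μ ≠ ⊤) :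
    ∀ᵐ z ∂μ, g z ∈ treeSet ι G Γ.factor := by
  have := secondCountable_of_compact M
  have := hι.secondCountable
  have hm : Measurable (treeDist ι G Γ.factor : Conf M N Γ.m Γ.n → ℝ) :=
    (continuous_treeDist hι.contMDiff.continuous hG.smooth.continuous _).measurable
  filter_upwards [ae_lt_top ((hm.comp hg).ennreal_ofReal.pow_const κ) h] with z hz h0
  rw [comp_apply, h0, ENNReal.ofReal_zero, ENNReal.zero_rpow_of_neg hκ] at hz
  exact lt_irrefl _ hz

theorem ae_mem_treeSet (hvolM : IsVolumeForm volM) (hι : IsBoundaryInclusion ι)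
    (hG : IsInjImmersion G) (Γ : FeynmanTree B) {y : Fin Γ.n → N} (hy : y ∈ confSpace N Γ.n) :
    ∀ᵐ x ∂bulkMeasure volM Γ.m, (x, y) ∈ treeSet ι G Γ.factor := by
  obtain ⟨A, hA, h⟩ := exists_lintegral_treeDist_le hvolM hι hG Γ hy
  exact ae_mem_treeSet_of_lintegral hι hG Γ (by norm_num) measurable_prodMk_right
    (h.self_of_nhds.trans_lt hA.lt_top).ne

theorem ae_mem_confSpace (hvolN : IsVolumeForm volN) (hι : IsBoundaryInclusion ι)
    (hG : IsInjImmersion G) (n : ℕ) : ∀ᵐ y ∂bdryMeasure volN n, y ∈ confSpace N n := by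
  have := hι.t2Space
  have := isFinite_volumeMeasure hvolN
  have hGι : Measurable fun y => G (ι y) :=
    hG.smooth.continuous.measurable.comp hι.contMDiff.continuous.measurable
  obtain ⟨A, hA, hker⟩ := exists_lintegral_invDist_le hvolN (hG.smooth.comp hι.contMDiff)
    (IsInjImmersion.immersive_comp (ι := ι) (G := G) hι hG) zero_le_one (by norm_num)
  have h (j j' : Fin n) : ∀ᵐ y ∂bdryMeasure volN n, y j = y j' → j = j' := by
    by_cases hjj : j = j'
    · exact Eventually.of_forall fun _ _ => hjj
    have hm : Measurable fun y : Fin n → N => invDist 1 (G (ι (y j))) (G (ι (y j'))) :=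
      measurable_invDist (hGι.comp (measurable_pi_apply _)) (hGι.comp (measurable_pi_apply _))
    have h1 := lintegral_prod_le (μ := fun _ : Fin n => volumeMeasure volN) (E := Unit)
      (k := fun _ y => invDist 1 (G (ι (y j))) (G (ι (y j')))) (fun _ => hm)
      (rank := fun v => if v = j then 1 else 0) (child := fun _ => j)
      (C := max A (volumeMeasure volN univ)) (fun _ => le_max_right _ _) {()}
      (by simp) (fun _ _ v hv hr => by simp [hv] at hr) (fun _ _ y => by
        simp only [update_self, update_of_ne (Ne.symm hjj)]
        exact (hker _).trans (le_max_left _ _))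
    simp only [Finset.prod_singleton] at h1
    have h2 := ae_lt_top hm (h1.trans_lt (ENNReal.pow_lt_top
      (max_lt hA.lt_top (measure_lt_top _ _)))).ne
    filter_upwards [h2] with y hy h0
    rw [h0, invDist, sub_self, norm_zero, ENNReal.ofReal_zero,
      ENNReal.zero_rpow_of_neg (by norm_num)] at hy
    exact absurd hy (lt_irrefl _)
  filter_upwards [ae_all_iff.2 fun j => ae_all_iff.2 fun j' => h j j'] with y hy j j' hjj
    using hy j j' hjj

theorem exists_integral_treeDist_le (hvolM : IsVolumeForm volM) (hι : IsBoundaryInclusion ι)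
    (hG : IsInjImmersion G) (Γ : FeynmanTree B) {y₀ : Fin Γ.n → N} (hy₀ : y₀ ∈ confSpace N Γ.n) :
    ∃ A, 0 ≤ A ∧ ∀ᶠ y in 𝓝 y₀,
      Integrable (fun x : Fin Γ.m → M => (treeDist ι G Γ.factor (x, y))⁻¹ ^ (5 / 4 : ℝ))
        (bulkMeasure volM Γ.m) ∧
      ∫ x : Fin Γ.m → M, (treeDist ι G Γ.factor (x, y))⁻¹ ^ (5 / 4 : ℝ) ∂bulkMeasure volM Γ.m ≤ A := by
  have := secondCountable_of_compact M
  obtain ⟨A, hA, hev⟩ := exists_lintegral_treeDist_le hvolM hι hG Γ hy₀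
  refine ⟨A.toReal, ENNReal.toReal_nonneg, ?_⟩
  filter_upwards [hev] with y hy
  have hnn (x : Fin Γ.m → M) : 0 ≤ (treeDist ι G Γ.factor (x, y))⁻¹ ^ (5 / 4 : ℝ) :=
    Real.rpow_nonneg (inv_nonneg.2 (treeDist_nonneg _ _)) _
  have hle : ∫⁻ x : Fin Γ.m → M, ENNReal.ofReal ((treeDist ι G Γ.factor (x, y))⁻¹ ^ (5 / 4 : ℝ))
      ∂bulkMeasure volM Γ.m ≤ A := by
    refine (lintegral_mono fun x => ?_).trans hy
    rcases (treeDist_nonneg (ι := ι) (G := G) Γ.factor (x, y)).eq_or_lt with h | h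
    · rw [← h, inv_zero, Real.zero_rpow (by norm_num), ENNReal.ofReal_zero]
      exact zero_le
    · rw [ENNReal.ofReal_rpow_of_pos h, Real.inv_rpow h.le, ← Real.rpow_neg h.le]
      norm_num
  have hm : Measurable fun x : Fin Γ.m → M => (treeDist ι G Γ.factor (x, y))⁻¹ ^ (5 / 4 : ℝ) :=
    (((continuous_treeDist hι.contMDiff.continuous hG.smooth.continuous Γ.factor).comp
      (Continuous.prodMk_left y)).measurable.inv.pow_const _)
  refine ⟨⟨hm.aestronglyMeasurable, ?_⟩, ?_⟩
  · rw [hasFiniteIntegral_iff_ofReal (Eventually.of_forall hnn)]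
    exact hle.trans_lt hA.lt_top
  · rw [integral_eq_lintegral_of_nonneg_ae (Eventually.of_forall hnn) hm.aestronglyMeasurable]
    exact ENNReal.toReal_mono hA hle

theorem aestronglyMeasurable_fibreDensity (hvolM : IsVolumeForm volM) (hι : IsBoundaryInclusion ι)
    (hG : IsInjImmersion G) {θ : ConfForm M N Γ.m Γ.n (Γ.m * 3 + k)}
    (hθ : IsFormOn 0 θ (treeSet ι G Γ.factor)) {y : Fin Γ.n → N} (hy : y ∈ confSpace N Γ.n)
    (w : Fin k → Fin Γ.n → E2) :
    AEStronglyMeasurable (fibreDensity volM θ y w) (bulkMeasure volM Γ.m) := by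
  have := secondCountable_of_compact M
  have hU := isOpen_treeSet hι.contMDiff.continuous hG.smooth.continuous Γ.factor
  have hUy : IsOpen {x : Fin Γ.m → M | (x, y) ∈ treeSet ι G Γ.factor} :=
    hU.preimage (Continuous.prodMk_left y)
  have h := (ContinuousOn.aestronglyMeasurable (μ := bulkMeasure volM Γ.m)
    (f := fibreDensity volM θ y w)
    (fun x hx => (continuousAt_fibreDensity hvolM hU hθ hx w).continuousWithinAt) hUy.measurableSet)
  rwa [Measure.restrict_eq_self_of_ae_mem (ae_mem_treeSet hvolM hι hG Γ hy)] at h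

theorem exists_fibreDensity_le (hvolM : IsVolumeForm volM) (hι : IsBoundaryInclusion ι)
    (hG : IsInjImmersion G) (Γ : FeynmanTree B) {C : ℝ} (hC : 0 ≤ C) {y : Fin Γ.n → N}
    (hy : y ∈ confSpace N Γ.n) (w : Fin k → Fin Γ.n → E2) :
    ∃ g : (Fin Γ.m → M) → ℝ, Integrable g (bulkMeasure volM Γ.m) ∧
      ∀ᵐ x ∂bulkMeasure volM Γ.m, (x, y) ∈ treeSet ι G Γ.factor ∧
      ∀ θ : ConfForm M N Γ.m Γ.n (Γ.m * 3 + k), IsAlternatingOn θ (treeSet ι G Γ.factor) →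
        KernelBound ι G (treeDist ι G Γ.factor) C θ → ‖fibreDensity volM θ y w x‖ ≤ g x := by
  have := isFinite_bulkMeasure hvolM Γ.m
  obtain ⟨A, -, hA⟩ := exists_integral_treeDist_le hvolM hι hG Γ hy
  obtain ⟨C', hC', hC'b⟩ := exists_fibreDensity_bound (N := N) (ι := ι) hvolM hG Γ.m Γ.n k
  have hS : 0 ≤ ∏ a, bdrySize ι G y (w a) := Finset.prod_nonneg fun _ _ => bdrySize_nonneg _ _
  refine ⟨_, ((integrable_const 1).add hA.self_of_nhds.1).const_mul
    (C' * C * ∏ a, bdrySize ι G y (w a)), ?_⟩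
  filter_upwards [ae_mem_treeSet hvolM hι hG Γ hy] with x hx
  refine ⟨hx, fun θ halt hb => ?_⟩
  have hd : 0 < treeDist ι G Γ.factor (x, y) := lt_of_le_of_ne (treeDist_nonneg _ _) (Ne.symm hx)
  refine (hC'b θ (x, y) _ (mul_nonneg hC (inv_nonneg.2 hd.le)) (halt _ hx) (hb _ hx) w).trans ?_
  have h1 : (treeDist ι G Γ.factor (x, y))⁻¹ ≤
      1 + (treeDist ι G Γ.factor (x, y))⁻¹ ^ (5 / 4 : ℝ) := by
    rcases le_total ((treeDist ι G Γ.factor (x, y))⁻¹) 1 with h | h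
    · exact h.trans (le_add_of_nonneg_right (by positivity))
    · exact (Real.self_le_rpow_of_one_le h (by norm_num)).trans (le_add_of_nonneg_left zero_le_one)
  calc _ = C' * C * (∏ a, bdrySize ι G y (w a)) * (treeDist ι G Γ.factor (x, y))⁻¹ := by ring
    _ ≤ _ := mul_le_mul_of_nonneg_left h1 (by positivity)

theorem integrable_fibreDensity (hvolM : IsVolumeForm volM) (hι : IsBoundaryInclusion ι)
    (hG : IsInjImmersion G) {θ : ConfForm M N Γ.m Γ.n (Γ.m * 3 + k)}
    (hθ : IsFormOn 0 θ (treeSet ι G Γ.factor)) {C : ℝ} (hC : 0 ≤ C)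
    (hb : KernelBound ι G (treeDist ι G Γ.factor) C θ) {y : Fin Γ.n → N}
    (hy : y ∈ confSpace N Γ.n) (w : Fin k → Fin Γ.n → E2) :
    Integrable (fibreDensity volM θ y w) (bulkMeasure volM Γ.m) := by
  obtain ⟨g, hg, hgb⟩ := exists_fibreDensity_le hvolM hι hG Γ hC hy w
  exact hg.mono' (aestronglyMeasurable_fibreDensity hvolM hι hG hθ hy w)
    (hgb.mono fun x hx => hx.2 θ hθ.alternating hb)

theorem exists_fibreIntegral_sub_le (hvolM : IsVolumeForm volM) (hι : IsBoundaryInclusion ι)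
    (hG : IsInjImmersion G) (k : ℕ) {c : Fin Γ.n → N} {z₀ : Fin Γ.n → E2}
    (hz₀ : z₀ ∈ (Φ (ℬ Γ.n) c).target) (hy₀ : (Φ (ℬ Γ.n) c).symm z₀ ∈ confSpace N Γ.n) :
    ∃ A, 0 ≤ A ∧ ∀ᶠ z in 𝓝 z₀, ∀ (θ θ' : ConfForm M N Γ.m Γ.n (Γ.m * 3 + k)) (b : ℝ), 0 ≤ b →
      IsAlternatingOn θ (treeSet ι G Γ.factor) → IsAlternatingOn θ' (treeSet ι G Γ.factor) →
      (∀ y ∈ confSpace N Γ.n, ∀ w, Integrable (fibreDensity volM θ y w) (bulkMeasure volM Γ.m)) →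
      (∀ y ∈ confSpace N Γ.n, ∀ w, Integrable (fibreDensity volM θ' y w) (bulkMeasure volM Γ.m)) →
      (∀ p ∈ treeSet ι G Γ.factor, ∀ v, |θ.val p v - θ'.val p v| ≤
        b * (treeDist ι G Γ.factor p)⁻¹ ^ (5 / 4 : ℝ) * ∏ a, tanSize ι G p (v a)) →
      ∀ w, |formInChart (fibreIntegral volM θ) c z w - formInChart (fibreIntegral volM θ') c z w| ≤
        A * b * ∏ a, ‖w a‖ := by
  obtain ⟨A, hA0, hA⟩ := exists_integral_treeDist_le hvolM hι hG Γ hy₀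
  obtain ⟨C, hC, hCb⟩ := exists_fibreDensity_bound (N := N) (ι := ι) hvolM hG Γ.m Γ.n k
  set g : Fin Γ.n → E2 → F := fun j z => G (ι ((Φ 𝔹 (c j)).symm z)) with hg
  have htj {z : Fin Γ.n → E2} (hz : z ∈ (Φ (ℬ Γ.n) c).target) (j) : z j ∈ (Φ 𝔹 (c j)).target := by
    have h := powChart_target (I := 𝔹) c
    exact (h ▸ hz : z ∈ {y | ∀ i, y i ∈ (Φ 𝔹 (c i)).target}) j
  have hGι := hG.smooth.comp hι.contMDiff
  have hgc (j) : ContinuousAt (fun z : Fin Γ.n → E2 => ‖fderiv ℝ (g j) (z j)‖) z₀ := by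
    have h := contDiffWithinAt_map_comp_symm hGι (htj hz₀ j)
    rw [ModelWithCorners.Boundaryless.range_eq_univ, contDiffWithinAt_univ] at h
    exact (ContinuousAt.comp (f := fun z : Fin Γ.n → E2 => z j)
      (h.fderiv_right (m := 0) (by simp)).continuousAt (continuous_apply j).continuousAt).norm
  set D : ℝ := ∑ j, (‖fderiv ℝ (g j) (z₀ j)‖ + 1) with hD
  have hD0 : 0 ≤ D := Finset.sum_nonneg fun j _ => by positivity
  have htgt : ∀ᶠ z in 𝓝 z₀, z ∈ (Φ (ℬ Γ.n) c).target := (isOpen_extChartAt_target c).mem_nhds hz₀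
  have hsymm : ContinuousAt (Φ (ℬ Γ.n) c).symm z₀ := continuousAt_extChartAt_symm'' hz₀
  have := hι.t2Space
  have hinj := hsymm.eventually (isOpen_confSpace.mem_nhds hy₀)
  refine ⟨C * A * D ^ k, by positivity, ?_⟩
  filter_upwards [htgt, hinj, hsymm.eventually hA, eventually_all.2 fun j =>
    (hgc j).eventually (eventually_le_nhds (lt_add_one _))] with z hz hy hAz hgz
  intro θ θ' b hb ha ha' hi hi' hbd w
  set y := (Φ (ℬ Γ.n) c).symm z with hydef
  set u : Fin k → Fin Γ.n → E2 := fun a => chartD (ℬ Γ.n) c z (w a) with hu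
  have hsize (a : Fin k) : bdrySize ι G y (u a) ≤ D * ‖w a‖ := by
    rw [hD, Finset.sum_mul]
    refine Finset.sum_le_sum fun j _ => ?_
    have h1 : u a j = chartD 𝔹 (c j) (z j) (w a j) := chartD_pow 𝔹 j hz _
    have h2 := fderivWithin_comp_symm hGι (htj hz j) (w a j)
    rw [ModelWithCorners.Boundaryless.range_eq_univ, fderivWithin_univ] at h2
    have h3 : mfd 𝔹 𝓘(ℝ, F) (G ∘ ι) (y j) = (mfd ℍ 𝓘(ℝ, F) G (ι (y j))).comp
        (mfd 𝔹 ℍ ι (y j)) := mfd_comp ((hG.smooth _).mdifferentiableAt (by simp))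
          ((hι.contMDiff _).mdifferentiableAt (by simp))
    have h4 : mfd ℍ 𝓘(ℝ, F) G (ι (y j)) (mfd 𝔹 ℍ ι (y j) (u a j)) =
        fderiv ℝ (g j) (z j) (w a j) := by
      rw [h1]
      exact (h2.trans (congrArg (fun L => L (chartD 𝔹 (c j) (z j) (w a j))) h3)).symm
    rw [h4]
    exact (ContinuousLinearMap.le_opNorm _ _).trans
      (mul_le_mul (hgz j) (norm_le_pi_norm (w a) j) (norm_nonneg _) (by positivity))
  have h1 : formInChart (fibreIntegral volM θ) c z w - formInChart (fibreIntegral volM θ') c z w =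
      ∫ x, (fibreDensity volM θ y u x - fibreDensity volM θ' y u x) ∂bulkMeasure volM Γ.m :=
    (integral_sub (hi y hy u) (hi' y hy u)).symm
  have hpt : ∀ᵐ x ∂bulkMeasure volM Γ.m, ‖fibreDensity volM θ y u x - fibreDensity volM θ' y u x‖ ≤
        C * b * (∏ a, bdrySize ι G y (u a)) * (treeDist ι G Γ.factor (x, y))⁻¹ ^ (5 / 4 : ℝ) := by
    filter_upwards [ae_mem_treeSet hvolM hι hG Γ hy] with x hx
    set θs : ConfForm M N Γ.m Γ.n (Γ.m * 3 + k) := fun p v => θ.val p v - θ'.val p v with hθs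
    have h2 : fibreDensity volM θ y u x - fibreDensity volM θ' y u x =
        fibreDensity volM θs y u x := (sub_div _ _ _).symm
    have h3 : IsAlt (θs.val (x, y)) := by
      obtain ⟨a₁, h₁⟩ := ha _ hx
      obtain ⟨a₂, h₂⟩ := ha' _ hx
      exact ⟨a₁ - a₂, fun v => congrArg₂ (· - ·) (h₁ v) (h₂ v)⟩
    rw [h2]
    have hnn : 0 ≤ (treeDist ι G Γ.factor (x, y))⁻¹ ^ (5 / 4 : ℝ) :=
      Real.rpow_nonneg (inv_nonneg.2 (treeDist_nonneg _ _)) _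
    exact (hCb θs (x, y) _ (mul_nonneg hb hnn) h3 (hbd _ hx) u).trans (le_of_eq (by ring))
  rw [h1, ← Real.norm_eq_abs]
  refine (norm_integral_le_of_norm_le (hAz.1.const_mul _) hpt).trans ?_
  rw [integral_const_mul]
  have h5 : ∏ a, bdrySize ι G y (u a) ≤ D ^ k * ∏ a, ‖w a‖ := by
    refine (Finset.prod_le_prod (fun _ _ => bdrySize_nonneg _ _) fun a _ => hsize a).trans
      (le_of_eq ?_)
    rw [Finset.prod_mul_distrib, Finset.prod_const, Finset.card_univ, Fintype.card_fin]
  calc _ ≤ C * b * (D ^ k * ∏ a, ‖w a‖) * A := by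
        refine mul_le_mul (mul_le_mul_of_nonneg_left h5 (by positivity)) hAz.2 ?_ ?_
        · exact integral_nonneg fun x => Real.rpow_nonneg (inv_nonneg.2 (treeDist_nonneg _ _)) _
        · exact mul_nonneg (by positivity) (mul_nonneg (by positivity)
            (Finset.prod_nonneg fun _ _ => norm_nonneg _))
    _ = _ := by ring

/-- Forms on the configurations without collisions along the arrows of a tree that, with their Lie
derivatives, are as singular as the integrand of the tree. -/
structure IsTreeForm (ι : N → M) (G : M → F) (Γ : FeynmanTree B)
    (θ : ConfForm M N Γ.m Γ.n k) : Prop where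
  isFormOn : IsFormOn ∞ θ (treeSet ι G Γ.factor)
  bound : ∃ C, 0 ≤ C ∧ KernelBound ι G (treeDist ι G Γ.factor) C θ
  bound_lieDeriv : ∀ {Y : VField ℍ M} {Y' : VField 𝔹 N},
    IsSmoothVectorField ℍ Y → RestrictsTo ι Y Y' → ∃ C, 0 ≤ C ∧
      KernelBound ι G (treeDist ι G Γ.factor) C (lieDeriv (confField Y Y' Γ.m Γ.n) θ)

variable (ι G Γ) in
/-- Smooth forms that approximate a tree form. -/
def truncForm (θ : ConfForm M N Γ.m Γ.n k) (n : ℕ) :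
    ConfForm M N Γ.m Γ.n k :=
  smulForm (cutoff ι G Γ.factor ((n : ℝ) + 1)⁻¹) θ

/-- The speed of the approximation by smooth forms. -/
def truncRate (n : ℕ) : ℝ := ((n : ℝ) + 1)⁻¹ ^ (1 / 4 : ℝ)

theorem truncRate_nonneg (n : ℕ) : 0 ≤ truncRate n := by unfold truncRate; positivity

theorem tendsto_truncRate : Tendsto truncRate atTop (𝓝 0) := by
  have h := (tendsto_one_div_add_atTop_nhds_zero_nat (𝕜 := ℝ)).rpow_const (p := 1 / 4)
    (Or.inr (by norm_num))
  rw [Real.zero_rpow (by norm_num)] at h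
  exact h.congr fun n => by rw [truncRate, one_div]

theorem IsTreeForm.exists_truncForm_bound {θ : ConfForm M N Γ.m Γ.n k} (h : IsTreeForm ι G Γ θ)
    (hι : IsBoundaryInclusion ι) (hG : IsInjImmersion G) (hY : IsSmoothVectorField ℍ Y)
    (hYY : RestrictsTo ι Y Y') : ∃ Q, 0 ≤ Q ∧ ∀ n, IsFormOn ∞ (truncForm ι G Γ θ n) univ ∧
      ∀ p ∈ treeSet ι G Γ.factor, ∀ v,
        |(truncForm ι G Γ θ n).val p v - θ.val p v| ≤ Q * truncRate n *
          (treeDist ι G Γ.factor p)⁻¹ ^ (5 / 4 : ℝ) * ∏ a, tanSize ι G p (v a) ∧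
        |(lieDeriv (confField Y Y' Γ.m Γ.n) (truncForm ι G Γ θ n)).val p v -
            (lieDeriv (confField Y Y' Γ.m Γ.n) θ).val p v| ≤ Q * truncRate n *
          (treeDist ι G Γ.factor p)⁻¹ ^ (5 / 4 : ℝ) * ∏ a, tanSize ι G p (v a) := by
  obtain ⟨C, hC, hb⟩ := h.bound
  obtain ⟨C', hC', hb'⟩ := h.bound_lieDeriv hY hYY
  obtain ⟨L, hL, hcut⟩ := exists_cutoff_bound hι.contMDiff hG hY hYY Γ.factor
  have hcont := continuous_treeDist hι.contMDiff.continuous hG.smooth.continuous Γ.factor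
  have hU := isOpen_treeSet hι.contMDiff.continuous hG.smooth.continuous Γ.factor
  refine ⟨L * (C + C'), by positivity, fun n => ?_⟩
  have hε : 0 < ((n : ℝ) + 1)⁻¹ := by positivity
  obtain ⟨hsm, hcb⟩ := hcut _ hε
  refine ⟨h.isFormOn.smulForm le_rfl hsm hU fun p hp => cutoff_eventually_zero hε hp hcont,
    fun p hp v => ?_⟩
  obtain ⟨h1, h2⟩ := hcb p hp
  have hd : 0 < treeDist ι G Γ.factor p := lt_of_le_of_ne (treeDist_nonneg _ _) (Ne.symm hp)
  set d := treeDist ι G Γ.factor p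
  set P := ∏ a, tanSize ι G p (v a)
  have hP : 0 ≤ P := prod_tanSize_nonneg p v
  set r := (((n : ℝ) + 1)⁻¹ * d⁻¹) ^ (1 / 4 : ℝ)
  have hr : r * d⁻¹ = truncRate n * d⁻¹ ^ (5 / 4 : ℝ) := by
    have h3 : d⁻¹ ^ (5 / 4 : ℝ) = d⁻¹ ^ (1 / 4 : ℝ) * d⁻¹ := by
      rw [show (5 / 4 : ℝ) = 1 / 4 + 1 by norm_num, Real.rpow_add_one (by positivity)]
    rw [h3, truncRate, ← mul_assoc, ← Real.mul_rpow hε.le (by positivity)]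
  have hr0 : 0 ≤ r := by positivity
  have hfin (K : ℝ) (hK : K ≤ C + C') {x : ℝ} (hx : x ≤ L * r * (K * d⁻¹ * P)) :
      x ≤ L * (C + C') * truncRate n * d⁻¹ ^ (5 / 4 : ℝ) * P := by
    refine hx.trans ?_
    rw [mul_assoc _ (truncRate n), ← hr]
    calc _ = L * r * d⁻¹ * P * K := by ring
      _ ≤ L * r * d⁻¹ * P * (C + C') := mul_le_mul_of_nonneg_left hK (by positivity)
      _ = _ := by ring
  constructor
  · refine hfin C (le_add_of_nonneg_right hC') ?_
    have h4 : (truncForm ι G Γ θ n).val p v - θ.val p v =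
      (cutoff ι G Γ.factor ((n : ℝ) + 1)⁻¹ p - 1) * θ.val p v := (sub_one_mul _ _).symm
    rw [h4, abs_mul]
    exact mul_le_mul h1 (hb p hp v) (abs_nonneg _) (by positivity)
  · refine hfin (C + C') le_rfl ?_
    have h4 := lieDeriv_smulForm hsm hU (h.isFormOn.of_le (by exact_mod_cast le_top))
      (confField Y Y' Γ.m Γ.n) hp v
    change |(lieDeriv (confField Y Y' Γ.m Γ.n) (smulForm _ θ)).val p v - _| ≤ _
    rw [h4, add_sub_assoc, ← sub_one_mul]
    refine (abs_add_le _ _).trans ?_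
    rw [abs_mul, abs_mul, add_mul, add_mul, mul_add]
    exact add_le_add (mul_le_mul h2 (hb p hp v) (abs_nonneg _) (by positivity))
      (mul_le_mul h1 (hb' p hp v) (abs_nonneg _) (by positivity))

theorem IsTreeForm.exists_fderiv_sub_le (hvolM : IsVolumeForm volM)
    {θ : ConfForm M N Γ.m Γ.n (Γ.m * 3 + k)} (h : IsTreeForm ι G Γ θ) (hι : IsBoundaryInclusion ι)
    (hG : IsInjImmersion G) (hY : IsSmoothVectorField ℍ Y) (hYY : RestrictsTo ι Y Y')
    {c : Fin Γ.n → N} {z₀ : Fin Γ.n → E2} (hz₀ : z₀ ∈ (Φ (ℬ Γ.n) c).target)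
    (hy₀ : (Φ (ℬ Γ.n) c).symm z₀ ∈ confSpace N Γ.n) (w : Fin k → Fin Γ.n → E2) :
    ∃ Q, 0 ≤ Q ∧ ∀ᶠ z in 𝓝 z₀, ∀ n, ContDiffAt ℝ 1
        (fun z => formInChart (fibreIntegral volM (truncForm ι G Γ θ n)) c z w) z ∧
      |formInChart (fibreIntegral volM (truncForm ι G Γ θ n)) c z w -
        formInChart (fibreIntegral volM θ) c z w| ≤ Q * truncRate n ∧
      |fderiv ℝ (fun z => formInChart (fibreIntegral volM (truncForm ι G Γ θ n)) c z w) z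
          (vectorInChart (bdryField Y' Γ.n) c z) -
        (formInChart (fibreIntegral volM (lieDeriv (confField Y Y' Γ.m Γ.n) θ)) c z w -
          ∑ i, formInChart (fibreIntegral volM θ) c z
            (update w i (fderiv ℝ (vectorInChart (bdryField Y' Γ.n) c) z (w i))))| ≤
        Q * truncRate n := by
  have hYc := hY.isChartSmooth
  have hYc' := hYY.isChartSmooth hι hYc
  have hcf := isChartSmooth_confField (m := Γ.m) (n := Γ.n) hYc hYc'
  have hU := isOpen_treeSet hι.contMDiff.continuous hG.smooth.continuous Γ.factor
  obtain ⟨C, hC, hb⟩ := h.bound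
  obtain ⟨C', hC', hb'⟩ := h.bound_lieDeriv hY hYY
  obtain ⟨Q, hQ, hQn⟩ := h.exists_truncForm_bound hι hG hY hYY
  obtain ⟨A, hA, hAz⟩ := exists_fibreIntegral_sub_le hvolM hι hG k hz₀ hy₀
  set Z := vectorInChart (bdryField Y' Γ.n) c
  set S : (Fin Γ.n → E2) → ℝ := fun z =>
    (∏ a, ‖w a‖) + ∑ i, ∏ a, ‖update w i (fderiv ℝ Z z (w i)) a‖ with hS
  have htgt := (isOpen_extChartAt_target (I := ℬ Γ.n) c).mem_nhds hz₀
  have hZ : ContDiffAt ℝ ∞ Z z₀ := (isChartSmooth_bdryField hYc' c).contDiffAt htgt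
  have hSc : ContinuousAt S z₀ := by
    refine continuousAt_const.add (tendsto_finsetSum _ fun i _ => tendsto_finsetProd _ fun a _ => ?_)
    have h1 : ContinuousAt (fun z => fderiv ℝ Z z (w i)) z₀ :=
      ((hZ.fderiv_right (m := 0) (by simp)).continuousAt).clm_apply continuousAt_const
    exact ((continuous_apply a).continuousAt.comp (continuousAt_const.update i h1)).norm
  have hform := h.isFormOn.of_le (r' := 0) (by simp)
  have hlie := (h.isFormOn.lieDeriv hU hcf).of_le (r' := 0) (by simp)
  have hi (n) := fun y (_ : y ∈ confSpace N Γ.n) w =>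
    integrable_fibreDensity' hvolM ((hQn n).1.of_le (r' := 0) (by simp)) y w
  have hi' (n) := fun y (_ : y ∈ confSpace N Γ.n) w => integrable_fibreDensity' hvolM
    (((hQn n).1.lieDeriv isOpen_univ hcf).of_le (r' := 0) (by simp)) y w
  refine ⟨A * Q * (S z₀ + 1), by positivity, ?_⟩
  filter_upwards [htgt, hAz, hSc.eventually (eventually_le_nhds (lt_add_one _))] with z hz hAz hSz n
  have hγ := isFormOn_fibreIntegral hvolM ((hQn n).1.of_le (r' := 1) (by exact_mod_cast le_top))
  have hd := hAz _ θ (Q * truncRate n) (mul_nonneg hQ (truncRate_nonneg n))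
    (fun p _ => (hQn n).1.alternating p (mem_univ _)) h.isFormOn.alternating (hi n)
    (fun y hy w => integrable_fibreDensity hvolM hι hG hform hC hb hy w)
    fun p hp v => ((hQn n).2 p hp v).1
  have hd' := hAz _ _ (Q * truncRate n) (mul_nonneg hQ (truncRate_nonneg n))
    (fun p _ => ((hQn n).1.lieDeriv isOpen_univ hcf).alternating p (mem_univ _)) hlie.alternating
    (hi' n) (fun y hy w => integrable_fibreDensity hvolM hι hG hlie hC' hb' hy w)
    fun p hp v => ((hQn n).2 p hp v).2
  set γ := fibreIntegral volM (truncForm ι G Γ θ n)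
  have hle {x : ℝ} (s : ℝ) (hs : s ≤ S z) (hx : x ≤ A * (Q * truncRate n) * s) :
      x ≤ A * Q * (S z₀ + 1) * truncRate n := by
    have := truncRate_nonneg n
    calc x ≤ _ := hx
      _ ≤ A * (Q * truncRate n) * (S z₀ + 1) :=
        mul_le_mul_of_nonneg_left (hs.trans hSz) (by positivity)
      _ = _ := by ring
  refine ⟨?_, hle _ (le_add_of_nonneg_right (by positivity)) (hd w), ?_⟩
  · refine (hγ.contDiffOn c w).contDiffAt ?_
    rw [preimage_univ, inter_univ]
    exact (isOpen_extChartAt_target c).mem_nhds hz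
  · have h1 := formInChart_lieDeriv isOpen_univ hγ (isChartSmooth_bdryField hYc') hz (mem_univ _) w
    have h2 : formInChart (lieDeriv (bdryField Y' Γ.n) γ) c z w = formInChart (fibreIntegral volM
        (lieDeriv (confField Y Y' Γ.m Γ.n) (truncForm ι G Γ θ n))) c z w :=
      lieDeriv_fibreIntegral hι hvolM hYc hYY (hQn n).1 _ _
    rw [locLie, ModelWithCorners.Boundaryless.range_eq_univ, fderivWithin_univ,
      fderivWithin_univ, h2] at h1
    rw [← sub_eq_iff_eq_add.2 h1, sub_sub_sub_comm, ← Finset.sum_sub_distrib]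
    refine hle _ le_rfl ((abs_sub _ _).trans ?_)
    rw [hS, mul_add, Finset.mul_sum]
    exact add_le_add (hd' w) ((Finset.abs_sum_le_sum_abs _ _).trans
      (Finset.sum_le_sum fun i _ => hd _))

/-- Integration of a tree form over the bulk vertices. -/
theorem IsTreeForm.isFormOn_fibreIntegral (hvolM : IsVolumeForm volM)
    {θ : ConfForm M N Γ.m Γ.n (Γ.m * 3 + k)} (h : IsTreeForm ι G Γ θ)
    (hι : IsBoundaryInclusion ι) (hG : IsInjImmersion G) :
    IsFormOn 1 (fibreIntegral volM θ) (confSpace N Γ.n) ∧ ∀ (Y : VField ℍ M) (Y' : VField 𝔹 N),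
      IsSmoothVectorField ℍ Y → RestrictsTo ι Y Y' → ∀ y ∈ confSpace N Γ.n,
      ∀ w : Fin k → Fin Γ.n → E2, (lieDeriv (bdryField Y' Γ.n) (fibreIntegral volM θ)).val y w =
        (fibreIntegral volM (lieDeriv (confField Y Y' Γ.m Γ.n) θ)).val y w := by
  have hlim (Q : ℝ) : Tendsto (fun n => Q * truncRate n) atTop (𝓝 0) := by
    simpa using tendsto_truncRate.const_mul Q
  have hmain {c : Fin Γ.n → N} {z₀ : Fin Γ.n → E2} (hz₀ : z₀ ∈ (Φ (ℬ Γ.n) c).target)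
      (hy₀ : (Φ (ℬ Γ.n) c).symm z₀ ∈ confSpace N Γ.n) (w : Fin k → Fin Γ.n → E2) :
      ContDiffAt ℝ 1 (fun z => formInChart (fibreIntegral volM θ) c z w) z₀ ∧
      Tendsto (fun n => fderiv ℝ (fun z => formInChart
        (fibreIntegral volM (truncForm ι G Γ θ n)) c z w) z₀) atTop
        (𝓝 (fderiv ℝ (fun z => formInChart (fibreIntegral volM θ) c z w) z₀)) := by
    obtain ⟨Y, Y', hYs, hfr⟩ := hι.exists_frame hy₀
    choose Q hQ hev using fun a : Fin Γ.n × Fin 2 => h.exists_fderiv_sub_le hvolM hι hG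
      (hYs a.1 a.2).1 (hYs a.1 a.2).2 hz₀ hy₀ w
    have hQs (a) (n) : Q a * truncRate n ≤ (∑ a, Q a) * truncRate n := mul_le_mul_of_nonneg_right
      (Finset.single_le_sum (fun a _ => hQ a) (Finset.mem_univ a)) (truncRate_nonneg n)
    obtain ⟨Q₀, -, hev₀⟩ := h.exists_fderiv_sub_le hvolM hι hG (Y := 0) (Y' := 0)
      (Bundle.contMDiff_zeroSection ℝ _) (fun y => map_zero _) hz₀ hy₀ w
    refine contDiffAt_of_frame (inter_mem (eventually_all.2 hev) hev₀)
      (lam := fun a => (EuclideanSpace.proj (𝕜 := ℝ) a.2).comp (ContinuousLinearMap.proj a.1))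
      (Z := fun a => vectorInChart (bdryField (Y' a.1 a.2) Γ.n) c)
      (fun a => (((isChartSmooth_bdryField ((hYs a.1 a.2).2.isChartSmooth hι
        (hYs a.1 a.2).1.isChartSmooth)) c).contDiffAt
        ((isOpen_extChartAt_target c).mem_nhds hz₀)).continuousAt) (fun v hv => ?_)
      (fun n z hz => (hz.2 n).1) (hlim (∑ a, Q a))
      (fun n a z hz => ((hz.1 a n).2.2).trans (hQs a n)) fun z hz => ?_
    · refine hfr v ?_
      have h1 := congrArg (chartD (ℬ Γ.n) c z₀) hv
      rw [map_sum, map_zero] at h1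
      rw [← Fintype.sum_prod_type', ← h1]
      refine Finset.sum_congr rfl fun a _ => ?_
      rw [map_smul, chartD_vectorInChart _ hz₀]
      rfl
    · exact tendsto_iff_norm_sub_tendsto_zero.2 (squeeze_zero (fun _ => norm_nonneg _)
        (fun n => (hz.2 n).2.1) (hlim Q₀))
  have := hι.t2Space
  obtain ⟨C, hC, hb⟩ := h.bound
  have hform : IsFormOn 1 (fibreIntegral volM θ) (confSpace N Γ.n) := ⟨fun y hy => IsAlt.integral
      ((ae_mem_treeSet hvolM hι hG Γ hy).mono fun x hx => isAlt_fibreForm h.isFormOn.alternating hx)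
      (integrable_fibreDensity hvolM hι hG (h.isFormOn.of_le (by simp)) hC hb hy),
    fun c v z hz => (hmain hz.1 hz.2 v).1.contDiffWithinAt⟩
  refine ⟨hform, fun Y Y' hY hYY y hy w => ?_⟩
  have hys := mem_extChartAt_source (I := ℬ Γ.n) y
  have hz₀ := mem_extChartAt_target (I := ℬ Γ.n) y
  have hy₀ : (Φ (ℬ Γ.n) y).symm (Φ (ℬ Γ.n) y y) ∈
      confSpace N Γ.n := by rwa [extChartAt_to_inv]
  rw [val_eq_formInChart _ hys, val_eq_formInChart _ hys]
  set u : Fin k → Fin Γ.n → E2 := fun i => mfd (ℬ Γ.n) 𝓘(ℝ, Fin Γ.n → E2) (Φ (ℬ Γ.n) y) y (w i)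
  refine (formInChart_lieDeriv isOpen_confSpace hform
    (isChartSmooth_bdryField (hYY.isChartSmooth hι hY.isChartSmooth)) hz₀ hy₀ u).trans ?_
  obtain ⟨Q, -, hev⟩ := h.exists_fderiv_sub_le hvolM hι hG hY hYY hz₀ hy₀ u
  rw [locLie, ModelWithCorners.Boundaryless.range_eq_univ, fderivWithin_univ, fderivWithin_univ,
    ← eq_sub_iff_add_eq]
  refine tendsto_nhds_unique (((ContinuousLinearMap.apply ℝ ℝ _).continuous.tendsto _).comp
    (hmain hz₀ hy₀ u).2) ?_
  exact tendsto_iff_norm_sub_tendsto_zero.2 (squeeze_zero (fun _ => norm_nonneg _)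
    (fun n => (hev.self_of_nhds n).2.2) (hlim Q))

/-! ### Time derivatives -/

variable {dχ : B → ℕ} {χ : ℝ → ∀ b, PreForm ℍ M (dχ b)}

/-- Background fields and propagators that are transported by the flow of a vector field. -/
structure IsDeformation (ι : N → M) (J : Set ℝ) (X : VField ℍ M) (X' : VField 𝔹 N)
    (χ : ℝ → ∀ b, PreForm ℍ M (dχ b)) (η : ℝ → PreForm pairModel (M × M) 2) : Prop where
  isOpen : IsOpen J
  inclusion : IsBoundaryInclusion ι
  smooth : IsSmoothVectorField ℍ X
  restricts : RestrictsTo ι X X'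
  leaf : ∀ b, IsSmoothFamilyOn J (fun t => χ t b) univ
  arrow : HasPropagatorRegularity ι J η
  deriv_leaf : ∀ t ∈ J, ∀ b x v, HasDerivAt (fun s => χ s b x v) (lieDeriv X (χ t b) x v) t
  deriv_arrow : ∀ t ∈ J, ∀ q ∈ pairSpace M, ∀ v,
    HasDerivAt (fun s => η s q v) (lieDeriv (pairField X) (η t) q v) t

variable {t : ℝ}

theorem IsDeformation.isTreeForm (h : IsDeformation ι J X X' χ η) (hG : IsInjImmersion G)
    (ht : t ∈ J) (hK : ∑ f, (Γ.factor f).deg dχ = K) :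
    IsTreeForm ι G Γ (gammaHat ι (χ t) (η t) Γ hK) := by
  have hι := h.inclusion
  have hχ := h.leaf
  have hη := h.arrow
  have hb {Y : VField ℍ M} {Y' : VField 𝔹 N}
      (hY : IsSmoothVectorField ℍ Y) (hYY : RestrictsTo ι Y Y') :=
    IsFieldFamily.exists_tree_bound h.isOpen ⟨hχ, hη.smooth, hη.bound⟩ hι hG hY.isChartSmooth hYY
      (hη.bound_lieDeriv Y Y' hY hYY) Γ hK isCompact_singleton (singleton_subset_iff.2 ht)
  refine ⟨IsFormOn.wedgeForm hK fun f => (isFormOn_factorForm le_rfl hι.contMDiff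
    (fun b => (hχ b).isFormOn ht) (hη.smooth.isFormOn ht) (Γ.factor f)).mono
      fun p hp => (mem_facSet_iff hG.injective).2 (mem_treeSet_iff.1 hp f), ?_, fun hY hYY => ?_⟩
  · obtain ⟨C, hC, h⟩ := hb (Y := 0) (Y' := 0) (Bundle.contMDiff_zeroSection ℝ _)
      fun y => map_zero _
    exact ⟨C, hC, (h t rfl).1⟩
  · obtain ⟨C, hC, h⟩ := hb hY hYY
    exact ⟨C, hC, (h t rfl).2⟩

theorem IsDeformation.hasDerivAt (h : IsDeformation ι J X X' χ η) (hG : IsInjImmersion G)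
    (hK : ∑ f, (Γ.factor f).deg dχ = K) (ht : t ∈ J) {p : Conf M N Γ.m Γ.n}
    (hp : p ∈ treeSet ι G Γ.factor) (v : Fin K → EConf Γ.m Γ.n) :
    HasDerivAt (fun s => (gammaHat ι (χ s) (η s) Γ hK).val p v)
      ((lieDeriv (confField X X' Γ.m Γ.n) (gammaHat ι (χ t) (η t) Γ hK)).val p v) t := by
  have hι := h.inclusion
  have hX := h.smooth
  have hpf (f) : p ∈ facSet ι (Γ.factor f) :=
    (mem_facSet_iff hG.injective).2 (mem_treeSet_iff.1 hp f)
  have hχ1 (b) : IsFormOn 1 (χ t b) univ := ((h.leaf b).isFormOn ht).of_le (by exact_mod_cast le_top)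
  have hη1 := (h.arrow.smooth.isFormOn ht).of_le (r' := 1) (by exact_mod_cast le_top)
  have h1 := lieDeriv_wedgeForm hK (isOpen_iInter_of_finite fun f => isOpen_facSet hι.contMDiff _)
    (fun f => (isFormOn_factorForm (by exact_mod_cast le_top) hι.contMDiff hχ1 hη1
      (Γ.factor f)).mono (iInter_subset _ f)) (confField X X' Γ.m Γ.n) (mem_iInter.2 hpf) v
  refine (hasDerivAt_wedgeFam hK (α := fun s f => (factorForm ι (χ s) (η s) (Γ.factor f)).val p)
    (α' := fun f => (lieDeriv (confField X X' Γ.m Γ.n)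
      (factorForm ι (χ t) (η t) (Γ.factor f))).val p) (fun f u => ?_) v).congr_deriv
    (Eq.trans (Finset.sum_congr rfl fun f₀ _ => ?_) h1.symm)
  · have h2 := lieDeriv_factorForm hι.contMDiff hχ1 hη1 hX.isChartSmooth
      (h.restricts.isChartSmooth hι hX.isChartSmooth) h.restricts (Γ.factor f) (hpf f) u
    refine HasDerivAt.congr_deriv ?_ h2.symm
    have hpf := hpf f
    revert u hpf
    cases Γ.factor f with
    | leaf w b => exact fun u _ _ => h.deriv_leaf t ht b _ _
    | arrow i w => exact fun u _ hpf => h.deriv_arrow t ht _ hpf _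
  · refine congrArg (fun α => wedgeFam (V := EConf Γ.m Γ.n) hK α v) (funext fun f => ?_)
    by_cases hf : f = f₀
    · subst hf
      rw [update_self, update_self]
      rfl
    · rw [update_of_ne hf, update_of_ne hf]
      rfl

theorem IsDeformation.exists_bound (h : IsDeformation ι J X X' χ η) (hG : IsInjImmersion G)
    (hK : ∑ f, (Γ.factor f).deg dχ = K) (ht : t ∈ J) :
    ∃ T ∈ 𝓝 t, T ⊆ J ∧ ∃ C, 0 ≤ C ∧ ∀ s ∈ T,
      (IsFormOn 0 (gammaHat ι (χ s) (η s) Γ hK) (treeSet ι G Γ.factor) ∧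
        KernelBound ι G (treeDist ι G Γ.factor) C (gammaHat ι (χ s) (η s) Γ hK)) ∧
      IsFormOn 0 (lieDeriv (confField X X' Γ.m Γ.n) (gammaHat ι (χ s) (η s) Γ hK))
        (treeSet ι G Γ.factor) ∧
      KernelBound ι G (treeDist ι G Γ.factor) C
        (lieDeriv (confField X X' Γ.m Γ.n) (gammaHat ι (χ s) (η s) Γ hK)) := by
  obtain ⟨T, hT, htT, hTJ⟩ := exists_compact_subset h.isOpen ht
  have hι := h.inclusion
  have hX := h.smooth.isChartSmooth
  obtain ⟨C, hC, hb⟩ := IsFieldFamily.exists_tree_bound h.isOpen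
    ⟨h.leaf, h.arrow.smooth, h.arrow.bound⟩ hι hG hX h.restricts
    (h.arrow.bound_lieDeriv X X' h.smooth h.restricts) Γ hK hT hTJ
  refine ⟨T, mem_interior_iff_mem_nhds.1 htT, hTJ, C, hC, fun s hs => ?_⟩
  have hf := (h.isTreeForm hG (hTJ hs) hK).isFormOn
  exact ⟨⟨hf.of_le (by simp), (hb s hs).1⟩, (hf.lieDeriv
    (isOpen_treeSet hι.contMDiff.continuous hG.smooth.continuous Γ.factor) (isChartSmooth_confField
      hX (h.restricts.isChartSmooth hι hX))).of_le (by simp), (hb s hs).2⟩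

theorem IsDeformation.hasDerivAt_fibreIntegral (h : IsDeformation ι J X X' χ η)
    (hG : IsInjImmersion G) (hvolM : IsVolumeForm volM)
    (hK : ∑ f, (Γ.factor f).deg dχ = Γ.m * 3 + k) (ht : t ∈ J) {y : Fin Γ.n → N}
    (hy : y ∈ confSpace N Γ.n) (w : Fin k → Fin Γ.n → E2) :
    HasDerivAt (fun s => (fibreIntegral volM (gammaHat ι (χ s) (η s) Γ hK)).val y w)
      ((fibreIntegral volM
        (lieDeriv (confField X X' Γ.m Γ.n) (gammaHat ι (χ t) (η t) Γ hK))).val y w) t := by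
  obtain ⟨T, htn, hTJ, C, hC, hb⟩ := h.exists_bound hG hK ht
  have hι := h.inclusion
  obtain ⟨g, hg, hgb⟩ := exists_fibreDensity_le hvolM hι hG Γ hC hy w
  have htT := hb t (mem_of_mem_nhds htn)
  refine (hasDerivAt_integral_of_dominated_loc_of_deriv_le (μ := bulkMeasure volM Γ.m)
    (F := fun s => fibreDensity volM (gammaHat ι (χ s) (η s) Γ hK) y w)
    (F' := fun s => fibreDensity volM
      (lieDeriv (confField X X' Γ.m Γ.n) (gammaHat ι (χ s) (η s) Γ hK)) y w) htn
    (eventually_of_mem htn fun s hs =>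
      aestronglyMeasurable_fibreDensity hvolM hι hG (hb s hs).1.1 hy w)
    (integrable_fibreDensity hvolM hι hG htT.1.1 hC htT.1.2 hy w)
    (aestronglyMeasurable_fibreDensity hvolM hι hG htT.2.1 hy w)
    (hgb.mono fun x hx s hs => hx.2 _ (hb s hs).2.1.alternating (hb s hs).2.2) hg
    (hgb.mono fun x hx s hs => ?_)).2
  exact (h.hasDerivAt hG hK (hTJ hs) hx.1 _).div_const _

/-! ### Integrals over all vertices -/

variable {p : Fin n → ℕ} {A : ∀ j, PreForm 𝔹 N (p j)}

variable (M m) in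
/-- The boundary fields as a form on the configuration space of all vertices. -/
def liftFields (A : ∀ j, PreForm 𝔹 N (p j)) : ConfForm M N m n (∑ j, p j) :=
  fun x u => bdryFields A x.2 fun a => (u a : EConf m n).2

theorem isFormOn_liftFields (hA : ∀ j, IsFormOn ∞ (A j) univ) :
    IsFormOn ∞ (liftFields M m A) univ := by
  have hev (j : Fin n) : ContMDiff (ℭ m n) 𝔹 ∞ fun x : Conf M N m n => x.2 j :=
    (contMDiff_eval 𝔹 j).comp contMDiff_snd
  have h : liftFields M m A =
      wedgeForm rfl fun j => pullForm (ℭ m n) 𝔹 (fun x : Conf M N m n => x.2 j) (A j) := by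
    funext x u
    refine congrArg (fun α => wedgeFam (V := EConf m n) rfl α u)
      (a₁ := fun j v => (A j).val (x.2 j) fun a => (v a).2 j)
      (funext fun j => funext fun v => congrArg ((A j).val (x.2 j)) (funext fun a => ?_))
    have h1 := mfd_comp (I := ℭ m n) (I' := ℬ n) (I'' := 𝔹)
      (g := fun y : Fin n → N => y j) (f := (Prod.snd : Conf M N m n → _)) (x := x)
      ((contMDiff_eval 𝔹 (n := ∞) j _).mdifferentiableAt (by simp)) mdifferentiableAt_snd
    have h2 := congrArg (fun L : EConf m n →L[ℝ] E2 => L (v a)) h1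
    rw [mfd_eval, mfd_snd] at h2
    exact h2.symm
  rw [h]
  exact IsFormOn.wedgeForm rfl fun j => (hA j).pullForm le_rfl (hev j) isOpen_univ

theorem exists_liftFields_bound (hι : IsBoundaryInclusion ι) (hG : IsInjImmersion G)
    (hA : ∀ j, IsFormOn ∞ (A j) univ) :
    ∃ C, 0 ≤ C ∧ ∀ (x : Conf M N m n) (u : Fin (∑ j, p j) → EConf m n),
      |(liftFields M m A).val x u| ≤ C * ∏ a, tanSize ι G x (u a) := by
  have := hι.t2Space
  have hb (j : Fin n) : ∃ C, 0 ≤ C ∧ ∀ x, ∀ v : Fin (p j) → E2, |(A j).val x v| ≤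
      C * ∏ a, ‖mfd 𝔹 𝓘(ℝ, F) (fun y => G (ι y)) x (v a)‖ := by
    have hfam : IsSmoothFamilyOn univ (fun _ : ℝ => A j) univ :=
      ⟨fun _ _ => (hA j).alternating, fun c v => ((hA j).contDiffOn c v).comp contDiffOn_snd
        fun z hz => hz.2⟩
    obtain ⟨C, hC, h⟩ := hfam.exists_bound (hG.smooth.comp hι.contMDiff)
      (IsInjImmersion.immersive_comp (ι := ι) (G := G) hι hG) isCompact_singleton (subset_univ {0})
    exact ⟨C, hC, h 0 rfl⟩
  choose C hC hb using hb
  refine ⟨(∑ j, p j).factorial * ∏ j, C j,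
    mul_nonneg (Nat.cast_nonneg _) (Finset.prod_nonneg fun j _ => hC j), fun x u => ?_⟩
  rw [mul_assoc]
  refine abs_wedgeFam_le (V := EConf m n) rfl (α := fun j v => (A j).val (x.2 j) fun a => (v a).2 j)
    (fun j v => (hb j _ _).trans (mul_le_mul_of_nonneg_left
      (Finset.prod_le_prod (fun _ _ => norm_nonneg _) fun a _ => ?_) (hC j))) u
  have h1 := mfd_comp ((hG.smooth (ι (x.2 j))).mdifferentiableAt (by simp))
    ((hι.contMDiff (x.2 j)).mdifferentiableAt (by simp))
  refine (le_of_eq ?_).trans (le_tanSize (ι := ι) (G := G) x (v a) (Sum.inr j))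
  exact congrArg norm (congrArg (fun L => L ((v a).2 j)) h1)

theorem confIntegrand_eq (h : k + ∑ j, p j = n * 2) (θ : ConfForm M N m n (m * 3 + k)) :
    confIntegrand h θ A = wedgeForm ((Fin.sum_univ_two ![m * 3 + k, ∑ j, p j]).trans
      (show m * 3 + k + ∑ j, p j = m * 3 + n * 2 by omega))
      (pairFam (T := ConfForm M N m n) θ (liftFields M m A)) := by
  funext x u
  refine (congrFun (wedge_eq_wedgeFam (V := EConf m n) (show m * 3 + k + ∑ j, p j = m * 3 + n * 2 by
    omega) (θ.val x) ((liftFields M m A).val x)) u).trans ?_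
  refine congrArg (fun α => wedgeFam (V := EConf m n) _ α u) (funext fun i => ?_)
  fin_cases i <;> rfl

theorem isFormOn_confIntegrand (h : k + ∑ j, p j = n * 2) (hA : ∀ j, IsFormOn ∞ (A j) univ)
    (hθ : IsFormOn 0 θ U) : IsFormOn 0 (confIntegrand h θ A) U := by
  rw [confIntegrand_eq]
  exact IsFormOn.wedgeForm _ (Fin.forall_fin_two.2
    ⟨hθ, ((isFormOn_liftFields hA).of_le (by simp)).mono (subset_univ U)⟩)

theorem confDensity_eq {ψ : ConfForm M N m n (m * 3 + n * 2)} (x : Conf M N m n) :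
    confDensity volM volN ψ x = bdryDensity volN (fibreForm volM ψ x.1) x.2 :=
  (div_div _ _ _).symm

theorem continuousAt_confDensity (hvolM : IsVolumeForm volM) (hvolN : IsVolumeForm volN)
    (hU : IsOpen U) {ψ : ConfForm M N m n (m * 3 + n * 2)} (hψ : IsFormOn 0 ψ U) {x : Conf M N m n}
    (hx : x ∈ U) : ContinuousAt (confDensity volM volN ψ) x := by
  obtain ⟨x, y⟩ := x
  have hys := extChartAt_source_mem_nhds (I := ℬ n) y
  have h1 : ∀ᶠ q in 𝓝 ((x, y) : Conf M N m n), q ∈ U ∧ q.2 ∈ (Φ (ℬ n) y).source :=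
    (hU.eventually_mem hx).and (continuous_snd.continuousAt.eventually hys)
  have heq (q : Conf M N m n) (hq : q ∈ U ∧ q.2 ∈ (Φ (ℬ n) y).source) :=
    bdryDensity_eq hvolN hq.2 (isAlt_fibreForm (volM := volM) hψ.alternating hq.1)
  refine ContinuousAt.congr (ContinuousAt.div ?_ (tendsto_finsetProd _ fun j _ => ?_)
    (heq _ h1.self_of_nhds).1) (h1.mono fun q hq => ((confDensity_eq q).trans (heq q hq).2).symm)
  · exact ContinuousAt.comp (x := ((x, y) : Conf M N m n))
      (f := fun q : Conf M N m n => (q.1, Φ (ℬ n) y q.2))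
      (continuousAt_formInChart_fibreForm hvolM hU hψ (mem_extChartAt_source y) hx (bdryBasis n))
      (continuousAt_fst.prodMk (ContinuousAt.comp (x := ((x, y) : Conf M N m n)) (f := Prod.snd)
        (continuousAt_extChartAt y) continuousAt_snd))
  · have h2 := ((hvolN.continuousOn_coeffInChart (y j)).comp (continuousOn_extChartAt (y j))
      (Φ 𝔹 (y j)).mapsTo).continuousAt (extChartAt_source_mem_nhds (y j))
    exact ContinuousAt.comp (x := ((x, y) : Conf M N m n)) (f := fun q : Conf M N m n => q.2 j) h2
      ((continuous_apply j).comp continuous_snd).continuousAt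

variable {p : Fin Γ.n → ℕ} {A : ∀ j, PreForm 𝔹 N (p j)}

theorem exists_confDensity_le (hvolM : IsVolumeForm volM) (hvolN : IsVolumeForm volN)
    (hι : IsBoundaryInclusion ι) (hG : IsInjImmersion G) (h : k + ∑ j, p j = Γ.n * 2)
    (hA : ∀ j, IsFormOn ∞ (A j) univ) {C : ℝ} (hC : 0 ≤ C) :
    ∃ g : Conf M N Γ.m Γ.n → ℝ, Integrable g (confMeasure volM volN Γ.m Γ.n) ∧
      ∀ᵐ x ∂confMeasure volM volN Γ.m Γ.n, x ∈ treeSet ι G Γ.factor ∧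
      ∀ θ : ConfForm M N Γ.m Γ.n (Γ.m * 3 + k), IsFormOn 0 θ (treeSet ι G Γ.factor) →
        KernelBound ι G (treeDist ι G Γ.factor) C θ →
        ‖confDensity volM volN (confIntegrand h θ A) x‖ ≤ g x := by
  have := hι.t2Space
  have := secondCountable_of_compact M
  have := hι.secondCountable
  obtain ⟨C₁, hC₁, hb₁⟩ := exists_liftFields_bound (m := Γ.m) hι hG hA
  obtain ⟨C₂, hC₂, hb₂⟩ := exists_fibreDensity_bound (N := N) (ι := ι) hvolM hG Γ.m Γ.n (Γ.n * 2)
  obtain ⟨C₃, hC₃, hb₃⟩ := exists_bdryDensity_bound hvolN hι hG Γ.n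
  have hfin := (lintegral_treeDist_lt_top hvolM hvolN hι hG Γ).ne
  have hm : Measurable (treeDist ι G Γ.factor : Conf M N Γ.m Γ.n → ℝ) :=
    (continuous_treeDist hι.contMDiff.continuous hG.smooth.continuous Γ.factor).measurable
  have hint : Integrable (fun x => (treeDist ι G Γ.factor x)⁻¹) (confMeasure volM volN Γ.m Γ.n) := by
    refine ⟨hm.inv.aestronglyMeasurable, ?_⟩
    rw [hasFiniteIntegral_iff_ofReal (Eventually.of_forall fun x =>
      inv_nonneg.2 (treeDist_nonneg _ x))]
    refine (lintegral_mono fun x => ?_).trans_lt hfin.lt_top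
    rw [ENNReal.rpow_neg_one]
    exact ENNReal.ofReal_inv_le
  refine ⟨_, hint.const_mul (C₃ * (C₂ * ((Γ.m * 3 + Γ.n * 2).factorial * (C * C₁)))), ?_⟩
  filter_upwards [ae_mem_treeSet_of_lintegral hι hG Γ (by norm_num) measurable_id hfin] with x hx
  refine ⟨hx, fun θ hθ hb => ?_⟩
  have hd : 0 ≤ (treeDist ι G Γ.factor x)⁻¹ := inv_nonneg.2 (treeDist_nonneg _ x)
  have halt := (isFormOn_confIntegrand h hA hθ).alternating
  rw [confDensity_eq]
  refine (hb₃ _ _ (C₂ * ((Γ.m * 3 + Γ.n * 2).factorial * (C * C₁) * (treeDist ι G Γ.factor x)⁻¹))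
    (by positivity) (isAlt_fibreForm halt hx) fun v => ?_).trans (le_of_eq (by ring))
  refine hb₂ (confIntegrand h θ A) x _ (by positivity) (halt x hx) (fun u => ?_) v
  rw [confIntegrand_eq]
  refine (abs_wedgeFam_le (V := EConf Γ.m Γ.n) _
    (α := pairFam (T := fun k => (Fin k → EConf Γ.m Γ.n) → ℝ) (θ.val x) ((liftFields M Γ.m A).val x))
    (C := ![C * (treeDist ι G Γ.factor x)⁻¹, C₁]) (ν := tanSize ι G x)
    (Fin.forall_fin_two.2 ⟨hb x hx, hb₁ x⟩) u).trans (le_of_eq ?_)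
  simp only [Fin.prod_univ_two, Matrix.cons_val_zero, Matrix.cons_val_one]
  ring

theorem integrable_confDensity (hvolM : IsVolumeForm volM) (hvolN : IsVolumeForm volN)
    (hι : IsBoundaryInclusion ι) (hG : IsInjImmersion G) (h : k + ∑ j, p j = Γ.n * 2)
    (hA : ∀ j, IsFormOn ∞ (A j) univ) {θ : ConfForm M N Γ.m Γ.n (Γ.m * 3 + k)}
    (hθ : IsFormOn 0 θ (treeSet ι G Γ.factor)) {C : ℝ} (hC : 0 ≤ C)
    (hb : KernelBound ι G (treeDist ι G Γ.factor) C θ) :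
    Integrable (confDensity volM volN (confIntegrand h θ A)) (confMeasure volM volN Γ.m Γ.n) := by
  have := hι.t2Space
  have := secondCountable_of_compact M
  have := hι.secondCountable
  have hU := isOpen_treeSet hι.contMDiff.continuous hG.smooth.continuous Γ.factor
  obtain ⟨g, hg, hgb⟩ := exists_confDensity_le hvolM hvolN hι hG h hA hC
  have hm := ContinuousOn.aestronglyMeasurable (μ := confMeasure volM volN Γ.m Γ.n)
    (fun x hx => (continuousAt_confDensity hvolM hvolN hU
      (isFormOn_confIntegrand h hA hθ) hx).continuousWithinAt) hU.measurableSet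
  rw [Measure.restrict_eq_self_of_ae_mem (hgb.mono fun x hx => hx.1)] at hm
  exact hg.mono' hm (hgb.mono fun x hx => hx.2 θ hθ hb)

/-- The integral over all vertices is the integral over the boundary vertices of the integral over
the bulk vertices. -/
theorem confIntegral_eq (hvolM : IsVolumeForm volM) (hvolN : IsVolumeForm volN)
    (hι : IsBoundaryInclusion ι) (hG : IsInjImmersion G) (h : k + ∑ j, p j = Γ.n * 2)
    (hA : ∀ j, IsFormOn ∞ (A j) univ) {θ : ConfForm M N Γ.m Γ.n (Γ.m * 3 + k)}
    (hθ : IsFormOn 0 θ (treeSet ι G Γ.factor)) {C : ℝ} (hC : 0 ≤ C)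
    (hb : KernelBound ι G (treeDist ι G Γ.factor) C θ) {γ : PreForm (ℬ Γ.n) (Fin Γ.n → N) k}
    (hγ : ∀ y ∈ confSpace N Γ.n, ∀ w : Fin k → Fin Γ.n → E2,
      γ.val y w = (fibreIntegral volM θ).val y w) :
    Integrable (bdryDensity volN (bdryIntegrand h γ A)) (bdryMeasure volN Γ.n) ∧
    confIntegral volM volN (confIntegrand h θ A) = bdryIntegral volN (bdryIntegrand h γ A) := by
  have := hι.t2Space
  have := isFinite_volumeMeasure hvolN
  have := isFinite_bulkMeasure hvolM Γ.m
  have : IsFiniteMeasure (bdryMeasure volN Γ.n) :=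
    inferInstanceAs (IsFiniteMeasure (Measure.pi fun _ => volumeMeasure volN))
  have hint := integrable_confDensity hvolM hvolN hι hG h hA hθ hC hb
  have hae : (fun y => ∫ x, confDensity volM volN (confIntegrand h θ A) (x, y)
      ∂bulkMeasure volM Γ.m) =ᵐ[bdryMeasure volN Γ.n] bdryDensity volN (bdryIntegrand h γ A) := by
    filter_upwards [ae_mem_confSpace hvolN hι hG Γ.n] with y hy
    set w : Fin (Γ.n * 2) → Fin Γ.n → E2 := bdryFrame y
    set β : (Fin (∑ j, p j) → Fin Γ.n → E2) → ℝ := (bdryFields A).val y with hβ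
    have hβ0 (u : Fin (∑ j, p j) → Fin Γ.n → E2) (b) (hub : u b = 0) : β u = 0 := by
      obtain ⟨a, ha⟩ := isAlt_wedgeFam (V := Fin Γ.n → E2) (h := (rfl : ∑ j, p j = _))
        (α := fun j u => (A j).val (y j) fun a => u a j) fun j =>
          IsAlt.comp_linearMap (V := E2) (a := (A j).val (y j)) ((hA j).alternating _ (mem_univ _))
            (LinearMap.proj (φ := fun _ => E2) j)
      exact (ha u).trans (a.map_coord_zero b hub)
    have h1 : ∀ᵐ x ∂bulkMeasure volM Γ.m, confDensity volM volN (confIntegrand h θ A) (x, y) =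
        wedge h ((fibreForm volM θ x).val y) β w / bdryVol volN y := by
      filter_upwards [ae_mem_treeSet hvolM hι hG Γ hy] with x hx
      have h2 := wedge_append (V := EConf Γ.m Γ.n) h (β := fun u => β fun a => (u a).2)
        (fun a => (0, w a)) (fun a => ((bulkFrame x a : Fin Γ.m → E3), (0 : Fin Γ.n → E2)))
        (fun i u b hub => hβ0 _ b (congrArg Prod.snd hub)) rfl rfl
        (show Γ.m * 3 + k + ∑ j, p j = Γ.m * 3 + Γ.n * 2 by omega) (α := θ.val (x, y))
        (hθ.alternating _ hx)
      refine (congrArg (· / (bulkVol volM x * bdryVol volN y)) h2).trans ?_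
      rw [← div_div]
      refine congrArg (· / bdryVol volN y) ?_
      rw [wedge, wedge, mul_div_assoc, Finset.sum_div]
      refine congrArg _ (Finset.sum_congr rfl fun σ _ => ?_)
      rw [mul_div_assoc, mul_div_right_comm]
      rfl
    refine (integral_congr_ae h1).trans ?_
    rw [integral_div]
    refine congrArg (· / bdryVol volN y) ?_
    have h3 (u : Fin k → Fin Γ.n → E2) := integrable_fibreDensity hvolM hι hG hθ hC hb hy u
    change ∫ x, (_ * ∑ σ : Equiv.Perm (Fin (Γ.n * 2)), _ * (fibreDensity volM θ y _ x * _))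
      ∂bulkMeasure volM Γ.m = _
    rw [integral_const_mul, integral_finsetSum _ fun σ _ => ((h3 _).mul_const _).const_mul _]
    refine congrArg _ (Finset.sum_congr rfl fun σ _ => ?_)
    rw [integral_const_mul, integral_mul_const]
    exact congrArg (fun r => _ * (r * _)) (hγ y hy _).symm
  exact ⟨hint.integral_prod_right.congr hae,
    (integral_prod_symm _ hint).trans (integral_congr_ae hae)⟩

theorem IsDeformation.hasDerivAt_confIntegral (hd : IsDeformation ι J X X' χ η)
    (hG : IsInjImmersion G) (hvolM : IsVolumeForm volM) (hvolN : IsVolumeForm volN)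
    (hK : ∑ f, (Γ.factor f).deg dχ = Γ.m * 3 + k) (h : k + ∑ j, p j = Γ.n * 2)
    (hA : ∀ j, IsFormOn ∞ (A j) univ) (ht : t ∈ J) :
    HasDerivAt (fun s => confIntegral volM volN (confIntegrand h (gammaHat ι (χ s) (η s) Γ hK) A))
      (confIntegral volM volN (confIntegrand h
        (lieDeriv (confField X X' Γ.m Γ.n) (gammaHat ι (χ t) (η t) Γ hK)) A)) t := by
  obtain ⟨T, htn, hTJ, C, hC, hb⟩ := hd.exists_bound hG hK ht
  have hι := hd.inclusion
  obtain ⟨g, hg, hgb⟩ := exists_confDensity_le hvolM hvolN hι hG h hA hC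
  have htT := hb t (mem_of_mem_nhds htn)
  have hi {θ} := integrable_confDensity (θ := θ) hvolM hvolN hι hG h hA
  refine (hasDerivAt_integral_of_dominated_loc_of_deriv_le (μ := confMeasure volM volN Γ.m Γ.n)
    (F := fun s => confDensity volM volN (confIntegrand h (gammaHat ι (χ s) (η s) Γ hK) A))
    (F' := fun s => confDensity volM volN (confIntegrand h
      (lieDeriv (confField X X' Γ.m Γ.n) (gammaHat ι (χ s) (η s) Γ hK)) A)) htn
    (eventually_of_mem htn fun s hs => (hi (hb s hs).1.1 hC (hb s hs).1.2).aestronglyMeasurable)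
    (hi htT.1.1 hC htT.1.2) (hi htT.2.1 hC htT.2.2).aestronglyMeasurable
    (hgb.mono fun x hx s hs => hx.2 _ (hb s hs).2.1 (hb s hs).2.2) hg
    (hgb.mono fun x hx s hs => ?_)).2
  exact ((HasDerivAt.fun_sum fun σ _ => ((hd.hasDerivAt hG hK (hTJ hs)
    hx.1 _).mul_const _).const_mul _).const_mul _).div_const _

end Integrability

end ChangeOfData

end

open ChangeOfData in
theorem mainTheorem5
    -- a compact oriented `3`-manifold `M` with boundary `ι : N → M`, with `N` oriented
    {M : Type*} [TopologicalSpace M] [T2Space M] [CompactSpace M]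
    [ChartedSpace (EuclideanHalfSpace 3) M] [IsManifold (𝓡∂ 3) ∞ M]
    [MeasurableSpace M] [BorelSpace M]
    {N : Type*} [TopologicalSpace N] [CompactSpace N]
    [ChartedSpace (EuclideanSpace ℝ (Fin 2)) N] [IsManifold (𝓡 2) ∞ N]
    [MeasurableSpace N] [BorelSpace N]
    (ι : N → M) (hι : IsBoundaryInclusion ι)
    (volM : PreForm (𝓡∂ 3) M 3) (hvolM : IsVolumeForm volM)
    (volN : PreForm (𝓡 2) N 2) (hvolN : IsVolumeForm volN)
    -- a vector field `X` on `M` with restriction `X'` to the boundary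
    (X : ∀ x : M, TangentSpace (𝓡∂ 3) x) (hX : IsSmoothVectorField (𝓡∂ 3) X)
    (X' : ∀ y : N, TangentSpace (𝓡 2) y) (hX' : RestrictsTo ι X X')
    -- the cohomology representatives (the `χ_i` and the `χ^i` together) and the propagator
    (J : Set ℝ) (hJ : IsOpen J)
    {B : Type*} (dχ : B → ℕ) (χ : ℝ → ∀ b, PreForm (𝓡∂ 3) M (dχ b))
    (hχ : ∀ b, IsSmoothFamilyOn J (fun t => χ t b) Set.univ)
    (η : ℝ → PreForm pairModel (M × M) 2) (hη : HasPropagatorRegularity ι J η)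
    -- their deformation by the Lie derivative
    (hχ' : ∀ t ∈ J, ∀ b x v, HasDerivAt (fun s => χ s b x v) (lieDeriv X (χ t b) x v) t)
    (hη' : ∀ t ∈ J, ∀ q ∈ pairSpace M, ∀ v,
      HasDerivAt (fun s => η s q v) (lieDeriv (pairField X) (η t) q v) t)
    -- the terms of the effective action
    {W : Type*} [NormedAddCommGroup W] [NormedSpace ℝ W] {T : Type*} [Fintype T]
    (τ : T → ActionTerm B dχ N W) :
    -- the integrals over the bulk vertices are forms `γ` on `C_n(∂M)`, and the Lie derivative passes
    -- through these integrals
    (∀ t ∈ J, ∀ i,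
      IsFormOn 1 ((τ i).form ι (χ t) (η t) volM) (confSpace N (τ i).n) ∧
      ∀ y ∈ confSpace N (τ i).n, ∀ w,
        Integrable (fibreDensity volM ((τ i).hatForm ι (χ t) (η t)) y w)
          (bulkMeasure volM (τ i).m) ∧
        Integrable (fibreDensity volM
            (lieDeriv (confField X X' _ _) ((τ i).hatForm ι (χ t) (η t))) y w)
          (bulkMeasure volM (τ i).m) ∧
        lieDeriv (bdryField X' _) ((τ i).form ι (χ t) (η t) volM) y w =
          fibreIntegral volM (lieDeriv (confField X X' _ _) ((τ i).hatForm ι (χ t) (η t))) y w ∧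
        HasDerivAt (fun s => (τ i).form ι (χ s) (η s) volM y w)
          (lieDeriv (bdryField X' _) ((τ i).form ι (χ t) (η t) volM) y w) t) ∧
    -- the effective action is the sum of the terms `∫_{C_n(∂M)} γ 𝔸 … 𝔸`
    (∀ t ∈ J,
      (∀ i, Integrable (confDensity volM volN
          (confIntegrand (τ i).top_degree ((τ i).hatForm ι (χ t) (η t)) (τ i).A))
          (confMeasure volM volN (τ i).m (τ i).n) ∧
        Integrable (bdryDensity volN
          (bdryIntegrand (τ i).top_degree ((τ i).form ι (χ t) (η t) volM) (τ i).A))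
          (bdryMeasure volN (τ i).n)) ∧
      effectiveAction volM volN τ ι (χ t) (η t) =
        ∑ i, bdryIntegral volN (bdryIntegrand (τ i).top_degree
          ((τ i).form ι (χ t) (η t) volM) (τ i).A) • (τ i).coeff) ∧
    -- its time derivative is the sum of the terms `∫_{C_n(∂M)} (L_{X'} γ) 𝔸 … 𝔸`, term by term
    ∀ t ∈ J,
      (∀ i, Integrable (bdryDensity volN (bdryIntegrand (τ i).top_degree
          (lieDeriv (bdryField X' _) ((τ i).form ι (χ t) (η t) volM)) (τ i).A))
          (bdryMeasure volN (τ i).n) ∧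
        HasDerivAt (fun s => bdryIntegral volN (bdryIntegrand (τ i).top_degree
            ((τ i).form ι (χ s) (η s) volM) (τ i).A))
          (bdryIntegral volN (bdryIntegrand (τ i).top_degree
            (lieDeriv (bdryField X' _) ((τ i).form ι (χ t) (η t) volM)) (τ i).A)) t) ∧
      HasDerivAt (fun s => effectiveAction volM volN τ ι (χ s) (η s))
        (∑ i, bdryIntegral volN (bdryIntegrand (τ i).top_degree
          (lieDeriv (bdryField X' _) ((τ i).form ι (χ t) (η t) volM)) (τ i).A) • (τ i).coeff) t := by
  obtain ⟨d, G, hGs, hGe, hGi⟩ := exists_embedding_euclidean_of_compact (I := ℍ) (M := M)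
  have hG : IsInjImmersion G := ⟨hGs, hGe.injective, hGi⟩
  have hd : IsDeformation ι J X X' χ η := ⟨hJ, hι, hX, hX', hχ, hη, hχ', hη'⟩
  have hform {t} (ht : t ∈ J) (i) :
      IsTreeForm ι G (τ i).toFeynmanTree ((τ i).hatForm ι (χ t) (η t)) :=
    hd.isTreeForm hG ht (τ i).deg_eq
  have hL {t} (ht : t ∈ J) (i) := ((hform ht i).isFormOn.lieDeriv
    (isOpen_treeSet hι.contMDiff.continuous hGs.continuous _) (isChartSmooth_confField
      hX.isChartSmooth (hX'.isChartSmooth hι hX.isChartSmooth))).of_le (r' := 0) (by simp)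
  have h0 {t} (ht : t ∈ J) (i) := (hform ht i).isFormOn.of_le (r' := 0) (by simp)
  have hlie {t} (ht : t ∈ J) (i) (y) (hy : y ∈ confSpace N (τ i).n)
      (w : Fin (τ i).k → Fin (τ i).n → E2) :
      (lieDeriv (bdryField X' _) ((τ i).form ι (χ t) (η t) volM)).val y w =
        (fibreIntegral volM (lieDeriv (confField X X' _ _)
          ((τ i).hatForm ι (χ t) (η t)))).val y w :=
    ((hform ht i).isFormOn_fibreIntegral hvolM hι hG).2 X X' hX hX' y hy w
  have hb {t} (ht : t ∈ J) (i) := (hform ht i).bound.choose_spec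
  have hbL {t} (ht : t ∈ J) (i) := ((hform ht i).bound_lieDeriv hX hX').choose_spec
  have hconf {t} (ht : t ∈ J) (i) := confIntegral_eq hvolM hvolN hι hG (τ i).top_degree
    (τ i).smooth (h0 ht i) (hb ht i).1 (hb ht i).2 (γ := (τ i).form ι (χ t) (η t) volM)
    fun _ _ _ => rfl
  have hconfL {t} (ht : t ∈ J) (i) := confIntegral_eq hvolM hvolN hι hG (τ i).top_degree
    (τ i).smooth (hL ht i) (hbL ht i).1 (hbL ht i).2 (hlie ht i)
  have hderiv {t} (ht : t ∈ J) (i) : HasDerivAt (fun s => confIntegral volM volN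
      (confIntegrand (τ i).top_degree ((τ i).hatForm ι (χ s) (η s)) (τ i).A))
      (bdryIntegral volN (bdryIntegrand (τ i).top_degree
        (lieDeriv (bdryField X' _) ((τ i).form ι (χ t) (η t) volM)) (τ i).A)) t :=
    (hd.hasDerivAt_confIntegral hG hvolM hvolN (τ i).deg_eq (τ i).top_degree (τ i).smooth ht).congr_deriv (hconfL ht i).2
  refine ⟨fun t ht i => ⟨((hform ht i).isFormOn_fibreIntegral hvolM hι hG).1, fun y hy w =>
    ⟨integrable_fibreDensity hvolM hι hG (h0 ht i) (hb ht i).1 (hb ht i).2 hy w,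
      integrable_fibreDensity hvolM hι hG (hL ht i) (hbL ht i).1 (hbL ht i).2 hy w,
      hlie ht i y hy w, (hd.hasDerivAt_fibreIntegral hG hvolM (τ i).deg_eq ht hy w).congr_deriv (hlie ht i y hy w).symm⟩⟩,
    fun t ht => ⟨fun i => ⟨integrable_confDensity hvolM hvolN hι hG (τ i).top_degree (τ i).smooth
        (h0 ht i) (hb ht i).1 (hb ht i).2, (hconf ht i).1⟩,
      Finset.sum_congr rfl fun i _ => congrArg (· • (τ i).coeff) (hconf ht i).2⟩,
    fun t ht => ⟨fun i => ⟨(hconfL ht i).1, (hderiv ht i).congr_of_eventuallyEq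
      (Filter.eventually_of_mem (hJ.mem_nhds ht) fun s hs => (hconf hs i).2.symm)⟩,
      HasDerivAt.fun_sum fun i _ => (hderiv ht i).smul_const (τ i).coeff⟩⟩
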